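/- **Setting.** Let $|a|<M$, $r_\pm=M\pm\sqrt{M^2-a^2}$, $\Delta_r=(r-r_+)(r-r_-)$, $\epsilon>0$ with $r_-<r_+-\epsilon$, $s\in\frac12\mathbb Z$, $q\in\mathbb R$, $X=(r_+-\epsilon,\infty)_r\times\mathbb S^2_{\theta,\phi_*}$, $x=1/r$, $\mathrm dvol=r^2\sin\theta\,\mathrm dr\,\mathrm d\theta\,\mathrm d\phi_*$. Let $\mathcal B_s\to\mathbb S^2$ be the line bundle of spin-weight $s$ functions: it has trivializations over the sphere minus the south pole and minus the north pole, with transition function $e^{-2is\phi}$ from the first to the second; in the intermediate trivialization (component $u_m=e^{-is\phi}u_S$, where $u_S$ is the component in the first one) put $$\Delta^{[s]}=-\tfrac1{\sin\theta}\partial_\theta\sin\theta\,\partial_\theta-\tfrac1{\sin^2\theta}\partial_{\phi_*}^2-\tfrac{2is\cos\theta}{\sin^2\theta}\partial_{\phi_*}+s^2\cot^2\theta ,$$ $$\hat T_s(0)=-\Delta_r\partial_r^2+2\big((r-M)(s-1)-a\partial_{\phi_*}\big)\partial_r+\Delta^{[s]}+s .$$ For $l\in|s|+\mathbb N$ and $m\in\{-l,-l+1,\dots,l\}$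 let $f_{l,m}$ be a normalized spin-weighted spherical harmonic: a smooth section of $\mathcal B_s$ with $\|f_{l,m}\|_{L^2}=1$, $\Delta^{[s]}f_{l,m}=((l+s)(l-s)+l)f_{l,m}$, $\partial_{\phi_*}f_{l,m}=imf_{l,m}$ (these exist; any choice of phases is allowed). Let $H_b^{k}$ ($k\in\mathbb R$) be the b-Sobolev space of sections of $\mathcal B_s$ over $[0,\infty]_x\times\mathbb S^2$ based on $L^2(\frac{\mathrm dx}{x}\sin\theta\,\mathrm d\theta\,\mathrm d\phi_*)$ (regularity with respect to $x\partial_x$ and the sphere), and $H_b^{k,w}=x^wH_b^k$. $\overline H^{k,q}_{(b)}$ is the space of restrictions to $X$ of elements of $H_b^{k,q+3/2}$ with support in some $\{x<C\}$, and $\dot H^{k,q}_{(b)}$ is the space of elements of $H_b^{k,q+3/2}$ with support in $\{r\ge r_+-\epsilon\}$. By the pairing $w\mapsto\int w\,\overline v\,\mathrm dvol$ one regards elements of $\dot H_{(b)}^{k,-q}\,\mathrm dvol$ as linear forms $\Phi$ on test sections $w$ of $\mathcal B_s$, and $\ker \hat T_s(0)^*$ is the set of those $\Phi$ with $\Phi(\hat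 T_s(0)w)=0$ for all $w$. Let $\mathbf F(a',b',c,z)=\sum_{k\ge0}\frac{(a')_k(b')_k}{\Gamma(c+k)}\frac{z^k}{k!}$ for $|z|<1$ (with $1/\Gamma=0$ at the poles of $\Gamma$), continued analytically to $\mathbb C\setminus[1,\infty)$, and put $d=r_+-r_-$, $z=\frac{r_+-r}{d}$, $\kappa=\frac{2iam}{d}$. **Proposition.** $$\ker\hat T_s(0)\cap\overline H^{s+\frac12,q}_{(b)}=\bigoplus_{\substack{|s|\le l<-\frac32-s-q\\ |m|\le l}}\mathbb C\,u_{l,m},$$ and for every $\delta>0$ (so also for the intersection over all $\delta>0$) $$\ker\hat T_s(0)^*\cap\dot H^{-s+\frac12-\delta,-q}_{(b)}\,\mathrm dvol=\bigoplus_{\substack{|s|\le l<\frac12+s+q\\ |m|\le l}}\mathbb C\,\overline{u^*_{l,m}},$$ where $l\in|s|+\mathbb N$, $m\in l+\mathbb Z$ and the sums are direct, with $u_{l,m}=U(r)f_{l,m}$ and $u^*_{l,m}=U^*(r)f_{l,m}\,\mathrm dr\,\sin\theta\,\mathrm d\theta\,\mathrm d\phi_*$ given as follows. 1. If $s\notin\mathbb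 Z$ or $am\ne0$: $U=\mathbf F(-l-s,1+l-s,1-s+\kappa,z)$ and $U^*=d^{\,s+\kappa}\,(r-r_+)_+^{-s-\kappa}\,\mathbf F(-l-\kappa,1+l-\kappa,1-s-\kappa,z)$, where $(r-r_+)_+^{\alpha}$ is the homogeneous distribution supported in $r\ge r_+$. 2. If $am=0$ and $s\in-1-\mathbb N$: $U=\mathbf F(-l-s,1+l-s,1-s,z)$ and $U^*=\mathbb 1_{(r_+,\infty)}\big(\tfrac{r-r_+}{d}\big)^{-s}\big(\tfrac{r-r_-}{d}\big)^{-s}\mathbf F(-l-s,1+l-s,1-s,z)$. 3. If $am=0$ and $s\in\mathbb N$: $U=\big(\tfrac{r-r_+}{d}\big)^{s}\big(\tfrac{r-r_-}{d}\big)^{s}\mathbf F(-l+s,1+l+s,1+s,z)$ and $$U^*=\frac{(l+s)!}{(l-s)!}d^{-s}\,\mathbb 1_{(r_+,\infty)}\mathbf F(-l+s,1+l+s,1+s,z)+\sum_{j=0}^{s-1}\frac{(l+s-1-j)!}{(l-s+1+j)!\,(s-1-j)!}\,d^{-s+1+j}\,\delta_{r_+}^{(j)} .$$ -/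

import Mathlib

open scoped ENNReal NNReal ContDiff ComplexConjugate

noncomputable section

namespace KerrTeukolsky

/-! ## Kerr parameters -/

/-- The outer root `r₊ = M + √(M² - a²)` of `Δ_r = r² - 2 M r + a²`. -/
def rPlus (M a : ℝ) : ℝ := M + √(M ^ 2 - a ^ 2)

/-- The inner root `r₋ = M - √(M² - a²)`. -/
def rMinus (M a : ℝ) : ℝ := M - √(M ^ 2 - a ^ 2)

/-- The gap `r₊ - r₋`. -/
def gap (M a : ℝ) : ℝ := rPlus M a - rMinus M a

/-- The spin `s = n / 2`; half-integers are encoded by the integer `n = 2 s`. -/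
def spin (n : ℤ) : ℝ := (n : ℝ) / 2

/-! ## The line bundle `𝓑_s` over the sphere

With `ζ = tan(θ/2) e^{iφ}` the sphere minus the south pole is `ℂ`, and with `1/ζ` the sphere minus
the north pole is `ℂ`. A section of `𝓑_s` is the pair of its components in the trivialisations over
these two sets. The transition function is `e^{-2isφ} = (ζ/|ζ|)^{-n}`. The components `u₁`, `u₂` are
related to the component `u_m` in the third trivialisation (the one in which the Teukolsky operator
is usually written) by `u₁ = e^{isφ} u_m`, `u₂ = e^{-isφ} u_m`. Fibrewise multiplication of the
components identifies the dual bundle of `𝓑_s` with `𝓑_{-s}`, and complex conjugation of the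
components is an antilinear isomorphism from `𝓑_s` to `𝓑_{-s}`. -/

/-- Pairs of components (north-pole chart, south-pole chart) of sections over the sphere. -/
abbrev SpherePair : Type := (ℂ → ℂ) × (ℂ → ℂ)

/-- Pairs of components of sections over (a part of) `ℝ_r × 𝕊²`. -/
abbrev SpacePair : Type := (ℝ × ℂ → ℂ) × (ℝ × ℂ → ℂ)

/-- The transition function `e^{-2isφ}` of `𝓑_s`, `s = n / 2`, at `ζ ≠ 0`. -/
def transition (n : ℤ) (ζ : ℂ) : ℂ := (ζ / (‖ζ‖ : ℂ)) ^ (-n)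

/-- Smooth sections of `𝓑_s` over the sphere. -/
structure IsSmoothSection (n : ℤ) (f : SpherePair) : Prop where
  smooth_fst : ContDiff ℝ ∞ f.1
  smooth_snd : ContDiff ℝ ∞ f.2
  glue : ∀ ζ : ℂ, ζ ≠ 0 → f.2 ζ⁻¹ = transition n ζ * f.1 ζ

/-- `Γ_c((J ∩ (0,∞)) × 𝓑_s)`: smooth sections with compact support, extended by zero to all `r`. -/
def testSections (n : ℤ) (J : Set ℝ) : Submodule ℂ SpacePair where
  carrier := {w | ContDiff ℝ ∞ w.1 ∧ ContDiff ℝ ∞ w.2 ∧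
    (∀ (r : ℝ) (ζ : ℂ), ζ ≠ 0 → w.2 (r, ζ⁻¹) = transition n ζ * w.1 (r, ζ)) ∧
    ∃ K : Set ℝ, IsCompact K ∧ K ⊆ J ∩ Set.Ioi 0 ∧
      ∀ r, r ∉ K → ∀ ζ, w.1 (r, ζ) = 0 ∧ w.2 (r, ζ) = 0}
  add_mem' := by
    rintro v w ⟨hv1, hv2, hvg, K, hK, hKJ, hv⟩ ⟨hw1, hw2, hwg, L, hL, hLJ, hw⟩
    refine ⟨hv1.add hw1, hv2.add hw2, fun r ζ hζ => ?_, K ∪ L, hK.union hL,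
      Set.union_subset hKJ hLJ, fun r hr ζ => ?_⟩
    · simp only [Prod.fst_add, Prod.snd_add, Pi.add_apply, hvg r ζ hζ, hwg r ζ hζ]; ring
    · simp only [Set.mem_union, not_or] at hr
      simp [hv r hr.1 ζ, hw r hr.2 ζ]
  zero_mem' :=
    ⟨contDiff_const, contDiff_const, fun _ _ _ => by simp, ∅, isCompact_empty, by simp,
      fun _ _ _ => by simp⟩
  smul_mem' := by
    rintro c v ⟨hv1, hv2, hvg, K, hK, hKJ, hv⟩
    refine ⟨contDiff_const.smul hv1, contDiff_const.smul hv2, fun r ζ hζ => ?_, K, hK, hKJ,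
      fun r hr ζ => ?_⟩
    · simp only [Prod.smul_fst, Prod.smul_snd, Pi.smul_apply, smul_eq_mul, hvg r ζ hζ]; ring
    · simp [hv r hr ζ]

/-- Forms on test sections of `𝓑_s` over `J × 𝕊²`. A distributional density `u dvol` with values in
the dual bundle `𝓑_s' = 𝓑_{-s}` is such a form `w ↦ ∫ u w dvol` (linear and bounded; both are part
of the function spaces below). Here `dvol = r² sin θ dr dθ dφ`. Through this, a distributional
section of `𝓑_s` is a form on test sections of `𝓑_{-s}`. -/
abbrev TestForm (n : ℤ) (J : Set ℝ) : Type := testSections n J → ℂ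

/-! ## Integration over the sphere -/

/-- `∫ g sin θ dθ dφ` for a function `g` of `ζ = tan(θ/2) e^{iφ}`. -/
def areaIntegral (g : ℂ → ℂ) : ℂ := ∫ ζ : ℂ, g ζ * ((4 / (1 + ‖ζ‖ ^ 2) ^ 2 : ℝ) : ℂ)

/-! ## Differential operators in the two charts -/

/-- `x ∂_y - y ∂_x`, the derivative in the direction `i ζ`. -/
def rot (g : ℂ → ℂ) (ζ : ℂ) : ℂ := fderiv ℝ g ζ (Complex.I * ζ)

/-- The operator `∂_φ` (in the third trivialisation), seen on the component of a section of `𝓑_s` in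
the north-pole chart (`σ = 1`) or in the south-pole chart (`σ = -1`). -/
def phiDeriv (σ : ℂ) (n : ℤ) (g : ℂ → ℂ) (ζ : ℂ) : ℂ :=
  σ * (rot g ζ - Complex.I * (spin n : ℂ) * g ζ)

/-- The non-negative spin-weighted Laplacian
`Δ^{[s]} = -(1/sin θ) ∂_θ sin θ ∂_θ - (1/sin² θ) ∂_φ² - (2is cos θ / sin² θ) ∂_φ + s² cot² θ`,
seen on the component of a section of `𝓑_s` in either chart (the expression is the same). -/
def spinLaplacian (n : ℤ) (g : ℂ → ℂ) (ζ : ℂ) : ℂ :=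
  -(((1 + ‖ζ‖ ^ 2) ^ 2 / 4 : ℝ) : ℂ) * Laplacian.laplacian g ζ
    + Complex.I * (spin n : ℂ) * ((1 + ‖ζ‖ ^ 2 : ℝ) : ℂ) * rot g ζ
    + ((spin n ^ 2 * ‖ζ‖ ^ 2 : ℝ) : ℂ) * g ζ

/-- `∂_r`. -/
def radialDeriv (w : ℝ × ℂ → ℂ) (p : ℝ × ℂ) : ℂ := deriv (fun r : ℝ => w (r, p.2)) p.1

/-- The operator
`T̂_s(0) = -Δ_r ∂_r² + 2 ((r - M)(s - 1) - a ∂_{φ_*}) ∂_r + Δ^{[s]} + s`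
in the coordinates `(r, θ, φ_*)`, on the component in the north (`σ = 1`) or south (`σ = -1`)
chart. -/
def teukolskyChart (M a : ℝ) (n : ℤ) (σ : ℂ) (w : ℝ × ℂ → ℂ) (p : ℝ × ℂ) : ℂ :=
  -((p.1 ^ 2 - 2 * M * p.1 + a ^ 2 : ℝ) : ℂ) * radialDeriv (radialDeriv w) p
    + ((2 * (p.1 - M) * (spin n - 1) : ℝ) : ℂ) * radialDeriv w p
    - 2 * (a : ℂ) * phiDeriv σ n (fun ζ => radialDeriv w (p.1, ζ)) p.2
    + spinLaplacian n (fun ζ => w (p.1, ζ)) p.2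
    + (spin n : ℂ) * w p

/-- `T̂_s(0)` on sections of `𝓑_s`, `s = n / 2`. -/
def teukolsky (M a : ℝ) (n : ℤ) (w : SpacePair) : SpacePair :=
  (teukolskyChart M a n 1 w.1, teukolskyChart M a n (-1) w.2)

/-- Multiplication by `r²`. -/
def rSq (w : SpacePair) : SpacePair :=
  (fun p => (p.1 : ℂ) ^ 2 * w.1 p, fun p => (p.1 : ℂ) ^ 2 * w.2 p)

/-! ## Spin-weighted spherical harmonics -/

/-- The indices `l ∈ |s| + ℕ` and `m ∈ {-l, -l + 1, …, l}`. -/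
def IsMode (n : ℤ) (l m : ℝ) : Prop :=
  ∃ j i : ℕ, l = |spin n| + j ∧ (i : ℝ) ≤ 2 * l ∧ m = -l + i

/-- The eigenvalue `(l + s)(l - s) + l` of `Δ^{[s]}`. -/
def eigenvalue (n : ℤ) (l : ℝ) : ℝ := (l + spin n) * (l - spin n) + l

/-- `f` is an `L²`-normalised spin-weighted spherical harmonic with indices `l`, `m`, that is
`Δ^{[s]} f = ((l + s)(l - s) + l) f` and `∂_φ f = i m f`. It is unique up to a phase. -/
structure IsSpinHarmonic (n : ℤ) (l m : ℝ) (f : SpherePair) : Prop where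
  isSmoothSection : IsSmoothSection n f
  eigen_fst : ∀ ζ, spinLaplacian n f.1 ζ = (eigenvalue n l : ℂ) * f.1 ζ
  eigen_snd : ∀ ζ, spinLaplacian n f.2 ζ = (eigenvalue n l : ℂ) * f.2 ζ
  phi_fst : ∀ ζ, phiDeriv 1 n f.1 ζ = Complex.I * (m : ℂ) * f.1 ζ
  phi_snd : ∀ ζ, phiDeriv (-1) n f.2 ζ = Complex.I * (m : ℂ) * f.2 ζ
  normalized : areaIntegral (fun ζ => f.1 ζ * conj (f.1 ζ)) = 1

/-! ## b-Sobolev spaces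

With `x = 1/r`, the space `H_b^k` on `[0,∞]_x × 𝓑_s` is the Hilbert scale of the operator
`1 + (x D_x)² + Δ^{[s]}` on `L²(dx/x sin θ dθ dφ)`, diagonalised by the Mellin transform
`∫ x^{-iλ} (·) dx/x` and the spin-weighted harmonics. The weighted space is `H_b^{k,l} = x^l H_b^k`.
For `k` a natural number this is the space of sections in `L²_b` whose derivatives of order at most
`k` along b-vector fields are in `L²_b`; the other orders follow by interpolation and duality. -/

/-- Mellin transform at `λ` of the component along `f` of the test section `r^p w`. -/
def mellinCoeff (p : ℝ) (w : SpacePair) (f : SpherePair) (lam : ℝ) : ℂ :=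
  ∫ r : ℝ in Set.Ioi 0, (r : ℂ) ^ ((p : ℂ) + (lam : ℂ) * Complex.I - 1) *
    areaIntegral (fun ζ => w.1 (r, ζ) * conj (f.1 ζ))

/-- The square of the norm of the test section `r^p w` of `𝓑_s` in `H_b^k`. The supremum over the
harmonics with indices `(l, m)` has the same value at each of them: they differ by phases. -/
def hbNormSq (n : ℤ) (k p : ℝ) (w : SpacePair) : ℝ≥0∞ :=
  ∑' lm : {lm : ℝ × ℝ // IsMode n lm.1 lm.2},
    ⨆ (f : SpherePair) (_ : IsSpinHarmonic n lm.1.1 lm.1.2 f),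
      ∫⁻ lam : ℝ, ENNReal.ofReal
        ((1 + lam ^ 2 + eigenvalue n lm.1.1) ^ k * ‖mellinCoeff p w f lam‖ ^ 2)

/-- For a form `Φ(w) = ∫ u w dvol` on test sections of `𝓑_s` over `(0,∞) × 𝕊²`: the distributional
section `u` of the dual bundle `𝓑_{-s}` is in `H_b^{k,l}`. As `dvol = r³ (dr/r) sin θ dθ dφ` and
`H_b^{k,l} = x^l H_b^k`, this says that `|Φ(w)| ≤ C ‖r^{3 - l} w‖` in the norm of `H_b^{-k}`, the
space dual to `H_b^k`. -/
def MemHb (n : ℤ) (k l : ℝ) (Φ : TestForm n (Set.Ioi 0)) : Prop :=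
  IsLinearMap ℂ Φ ∧ ∃ C : ℝ≥0, ∀ w : testSections n (Set.Ioi 0),
    ENNReal.ofReal (‖Φ w‖ ^ 2) ≤ C * hbNormSq n (-k) (3 - l) w

/-- The distribution `Φ` vanishes on `J`. -/
def VanishesOn (n : ℤ) (J : Set ℝ) (Φ : TestForm n (Set.Ioi 0)) : Prop :=
  ∀ w : testSections n (Set.Ioi 0), (w : SpacePair) ∈ testSections n J → Φ w = 0

/-- The extendible space with the scattering-type weight convention, `H̄_{(b)}^{k,q}`
on `(R, ∞) × 𝕊²`, that is `H̄_b^{k, q + 3/2}`: restrictions to `r > R` of elements of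
`H_b^{k, q + 3/2}` with support in some `{x < C}`. -/
def MemExtendible (n : ℤ) (k q R : ℝ) (Φ : TestForm n (Set.Ioi R)) : Prop :=
  ∃ Ψ : TestForm n (Set.Ioi 0), MemHb n k (q + 3 / 2) Ψ ∧
    (∃ c : ℝ, 0 < c ∧ VanishesOn n (Set.Iio c) Ψ) ∧
    ∀ (w : testSections n (Set.Ioi R)) (w' : testSections n (Set.Ioi 0)),
      (w : SpacePair) = w' → Φ w = Ψ w'

/-- The supported space `Ḣ_{(b)}^{k,q} dvol` on `[R, ∞) × 𝕊²`, that is `Ḣ_b^{k, q + 3/2} dvol`: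
elements of `H_b^{k, q + 3/2} dvol` with support in `r ≥ R`. -/
def MemSupported (n : ℤ) (k q R : ℝ) (Φ : TestForm n (Set.Ioi 0)) : Prop :=
  MemHb n k (q + 3 / 2) Φ ∧ VanishesOn n (Set.Iio R) Φ

/-! ## The kernels -/

/-- `ker T̂_s(0) ∩ H̄_{(b)}^{k,q}` on `X = (r₊ - ε, ∞) × 𝕊²`. A distributional section `u` of `𝓑_s` is
a form on test sections `η` of `𝓑_{-s}`. The formal transpose of `T̂_s(0)` for the pairing
`∫ u η dvol` is `η ↦ r⁻² T̂_{-s}(0) (r² η)`, so that `T̂_s(0) u = 0` means `u(ψ) = 0` for each test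
section `ψ` of the form `ψ = r⁻² T̂_{-s}(0) (r² η)`. -/
def kernel (M a : ℝ) (n : ℤ) (ε k q : ℝ) : Set (TestForm (-n) (Set.Ioi (rPlus M a - ε))) :=
  {u | MemExtendible (-n) k q (rPlus M a - ε) u ∧
    ∀ η ψ : testSections (-n) (Set.Ioi (rPlus M a - ε)),
      rSq (ψ : SpacePair) = teukolsky M a (-n) (rSq (η : SpacePair)) → u ψ = 0}

/-- `ker T̂_s(0)^* ∩ Ḣ_{(b)}^{k,q} dvol` on `X`, where `T̂_s(0)^*` is the adjoint acting on the dual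
of the space of sections of `𝓑_s`: the elements are the forms `Φ` on sections `w` of `𝓑_s` with
`Φ(T̂_s(0) w) = 0`. (Hermitian duality represents `Φ` as `w ↦ ∫ w v̄ dvol` with a distributional
section `v` of `𝓑_s`.) -/
def adjointKernel (M a : ℝ) (n : ℤ) (ε k q : ℝ) : Set (TestForm n (Set.Ioi 0)) :=
  {Φ | MemSupported n k q (rPlus M a - ε) Φ ∧
    ∀ w w' : testSections n (Set.Ioi 0),
      (w' : SpacePair) = teukolsky M a n (w : SpacePair) → Φ w' = 0}

/-! ## The hypergeometric function -/

/-- `g` is holomorphic on `ℂ ∖ [1, ∞)` and equal to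
`∑_k (a)_k (b)_k / Γ(c + k) z^k / k!` for `|z| < 1`. (`1 / Γ` is zero at the poles of `Γ`.) -/
def IsOlverF (a b c : ℂ) (g : ℂ → ℂ) : Prop :=
  DifferentiableOn ℂ g {z | 1 - z ∈ Complex.slitPlane} ∧
  ∀ z : ℂ, ‖z‖ < 1 → g z = ∑' k : ℕ,
    (ascPochhammer ℂ k).eval a * (ascPochhammer ℂ k).eval b / Complex.Gamma (c + k) *
      (z ^ k / (k.factorial : ℂ))

open Classical in
/-- Olver's hypergeometric function `𝐅(a, b, c, z)`, `z ∈ ℂ ∖ [1, ∞)`: the analytic continuation of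
its defining power series. -/
def olverF (a b c z : ℂ) : ℂ := if h : ∃ g, IsOlverF a b c g then h.choose z else 0

/-! ## The modes -/

/-- `(r₊ - r) / (r₊ - r₋)`. -/
def zVar (M a r : ℝ) : ℂ := (((rPlus M a - r) / gap M a : ℝ) : ℂ)

/-- `2 i a m / (r₊ - r₋)`. -/
def iKappa (M a m : ℝ) : ℂ := Complex.I * ((2 * a * m / gap M a : ℝ) : ℂ)

open Classical in
/-- Radial factor of `u_{l,m}`. -/
def uRadial (M a : ℝ) (n : ℤ) (l m r : ℝ) : ℂ :=
  let s : ℂ := (spin n : ℂ)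
  let N : ℕ := (n / 2).toNat
  if ¬ Even n ∨ a * m ≠ 0 then
    olverF (-l - s) (1 + l - s) (1 - s + iKappa M a m) (zVar M a r)
  else if n < 0 then
    olverF (-l - s) (1 + l - s) (1 - s) (zVar M a r)
  else
    (((r - rPlus M a) / gap M a : ℝ) : ℂ) ^ N * (((r - rMinus M a) / gap M a : ℝ) : ℂ) ^ N *
      olverF (-l + s) (1 + l + s) (1 + s) (zVar M a r)

/-- The homogeneous distribution `x_+^α`, for `α ∈ ℂ` not a negative integer, on a function `φ` that
is smooth on a neighbourhood of `[0, ∞)` and has bounded support there: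
`x_+^α = (α + 1)⁻¹ ⋯ (α + k)⁻¹ (d/dx)^k x_+^{α + k}` with `Re α + k > -1`. -/
def xPlusPow (α : ℂ) (φ : ℝ → ℂ) : ℂ :=
  let k : ℕ := ⌈|α.re|⌉₊
  (-1) ^ k / (∏ i ∈ Finset.range k, (α + 1 + i)) *
    ∫ x : ℝ in Set.Ioi 0, (x : ℂ) ^ (α + k) * iteratedDeriv k φ x

open Classical in
/-- Radial factor of `u*_{l,m}`, a distribution in `r` applied to the test function `φ`.
The three cases contain `(r - r₊)_+^α`, a function on `(r₊, ∞)`, and a combination of such a function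
with derivatives of the Dirac mass at `r₊`. -/
def uStarRadial (M a : ℝ) (n : ℤ) (l m : ℝ) (φ : ℝ → ℂ) : ℂ :=
  let s : ℂ := (spin n : ℂ)
  let N : ℕ := (n / 2).toNat
  let N' : ℕ := (-(n / 2)).toNat
  let κ : ℂ := iKappa M a m
  if ¬ Even n ∨ a * m ≠ 0 then
    (gap M a : ℂ) ^ (s + κ) *
      xPlusPow (-s - κ) (fun x =>
        olverF (-l - κ) (1 + l - κ) (1 - s - κ) (zVar M a (rPlus M a + x)) * φ (rPlus M a + x))
  else if n < 0 then
    ∫ r : ℝ in Set.Ioi (rPlus M a),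
      (((r - rPlus M a) / gap M a : ℝ) : ℂ) ^ N' * (((r - rMinus M a) / gap M a : ℝ) : ℂ) ^ N' *
        olverF (-l - s) (1 + l - s) (1 - s) (zVar M a r) * φ r
  else
    ((⌊l + spin n⌋₊.factorial / ⌊l - spin n⌋₊.factorial * gap M a ^ (-spin n) : ℝ) : ℂ) *
        (∫ r : ℝ in Set.Ioi (rPlus M a),
          olverF (-l + s) (1 + l + s) (1 + s) (zVar M a r) * φ r)
      + ∑ j ∈ Finset.range N,
        ((⌊l + spin n - 1 - j⌋₊.factorial /
            (⌊l - spin n + 1 + j⌋₊.factorial * (N - 1 - j).factorial) *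
            gap M a ^ (-spin n + 1 + j) : ℝ) : ℂ) *
          ((-1) ^ j * iteratedDeriv j φ (rPlus M a))

/-- The section `u_{l,m} = (radial factor) f` of `𝓑_s` over `X`, as the form
`η ↦ ∫ u_{l,m} η dvol`. -/
def uMode (M a : ℝ) (n : ℤ) (ε l m : ℝ) (f : SpherePair) :
    TestForm (-n) (Set.Ioi (rPlus M a - ε)) := fun η =>
  ∫ r : ℝ in Set.Ioi (rPlus M a - ε),
    uRadial M a n l m r * areaIntegral (fun ζ => f.1 ζ * (η : SpacePair).1 (r, ζ)) * (r : ℂ) ^ 2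

/-- The complex conjugate of `u*_{l,m} = (radial factor) f dr sin θ dθ dφ`, as a form on sections
`w` of `𝓑_s`: it is the conjugate of `u*_{l,m}` applied to `w̄`. -/
def uStarModeConj (M a : ℝ) (n : ℤ) (l m : ℝ) (f : SpherePair) :
    TestForm n (Set.Ioi 0) := fun w =>
  conj (uStarRadial M a n l m
    (fun r => areaIntegral (fun ζ => f.1 ζ * conj ((w : SpacePair).1 (r, ζ)))))

/-- The indices `(l, m)` with `l` below a bound. -/
abbrev ModesBelow (n : ℤ) (b : ℝ) : Type := {lm : ℝ × ℝ // IsMode n lm.1 lm.2 ∧ lm.1 < b}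

end KerrTeukolsky

end

noncomputable section

namespace KerrTeukolsky

open Complex MeasureTheory Filter Topology Set

/-! ## Wirtinger derivatives -/

/-- The real-linear map `v ↦ p v + q v̄`. -/
def wirt (p q : ℂ) : ℂ →L[ℝ] ℂ :=
  p • ContinuousLinearMap.id ℝ ℂ + q • (conjCLE : ℂ →L[ℝ] ℂ)

@[simp] lemma wirt_apply (p q v : ℂ) : wirt p q v = p * v + q * conj v := by
  simp [wirt]

/-- `g` is real differentiable at `ζ` with Wirtinger derivatives `p` and `q`. -/
def HasWirt (g : ℂ → ℂ) (p q ζ : ℂ) : Prop := HasFDerivAt (𝕜 := ℝ) g (wirt p q) ζ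

/-- The Wirtinger derivative `∂g/∂ζ`. -/
def dz (g : ℂ → ℂ) (ζ : ℂ) : ℂ := (fderiv ℝ g ζ 1 - I * fderiv ℝ g ζ I) / 2

/-- The Wirtinger derivative `∂g/∂ζ̄`. -/
def dzb (g : ℂ → ℂ) (ζ : ℂ) : ℂ := (fderiv ℝ g ζ 1 + I * fderiv ℝ g ζ I) / 2

lemma realLinear_eq_wirt (L : ℂ →L[ℝ] ℂ) :
    L = wirt ((L 1 - I * L I) / 2) ((L 1 + I * L I) / 2) := by
  ext v
  have hv : v = v.re • (1 : ℂ) + v.im • I := by rw [real_smul, real_smul, mul_one, re_add_im]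
  have h1 : L v = v.re * L 1 + v.im * L I := by
    calc L v = L (v.re • (1 : ℂ) + v.im • I) := by rw [← hv]
      _ = _ := by rw [map_add, L.map_smul, L.map_smul, real_smul, real_smul]
  have h2 : conj v = v.re - v.im * I := by
    apply Complex.ext <;> simp
  rw [wirt_apply, h1, h2]
  conv_rhs => rw [show (v : ℂ) = v.re + v.im * I from (re_add_im v).symm]
  simp only [add_re, ofReal_re, mul_re, ofReal_im, I_re, I_im, add_im, mul_im]
  push_cast
  linear_combination ((v.im : ℂ) * L I) * I_sq

lemma DifferentiableAt.hasWirt {g : ℂ → ℂ} {ζ : ℂ} (h : DifferentiableAt ℝ g ζ) :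
    HasWirt g (dz g ζ) (dzb g ζ) ζ := by
  unfold HasWirt dz dzb
  rw [← realLinear_eq_wirt]
  exact h.hasFDerivAt

lemma hasWirt_of_contDiff {g : ℂ → ℂ} (hg : ContDiff ℝ ∞ g) (z : ℂ) :
    HasWirt g (dz g z) (dzb g z) z :=
  DifferentiableAt.hasWirt ((hg.differentiable (by simp)) z)

lemma two_le_infty : (2 : WithTop ℕ∞) ≤ ((⊤ : ℕ∞) : WithTop ℕ∞) := WithTop.coe_le_coe.2 le_top

namespace HasWirt

variable {g h : ℂ → ℂ} {p q p' q' ζ : ℂ}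

lemma of_fderiv {L : ℂ →L[ℝ] ℂ} (H : HasFDerivAt g L ζ)
    (hL : ∀ v, L v = p * v + q * (starRingEnd ℂ) v) : HasWirt g p q ζ := by
  have : wirt p q = L := by ext v; simp [hL]
  unfold HasWirt; rw [this]; exact H

lemma dz_eq (H : HasWirt g p q ζ) : dz g ζ = p := by
  have := H.fderiv
  simp only [dz, this, wirt_apply, map_one, conj_I]
  linear_combination (-p / 2 + q / 2) * I_sq

lemma dzb_eq (H : HasWirt g p q ζ) : dzb g ζ = q := by
  have := H.fderiv
  simp only [dzb, this, wirt_apply, map_one, conj_I]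
  linear_combination (p / 2 - q / 2) * I_sq

lemma congr_val (H : HasWirt g p q ζ) (hp : p = p') (hq : q = q') : HasWirt g p' q' ζ := by
  subst hp hq; exact H

lemma congr_ev (H : HasWirt g p q ζ) (e : h =ᶠ[𝓝 ζ] g) : HasWirt h p q ζ :=
  HasFDerivAt.congr_of_eventuallyEq H e

lemma const (c ζ : ℂ) : HasWirt (fun _ => c) 0 0 ζ :=
  of_fderiv (hasFDerivAt_const c ζ) fun v => by simp

lemma id (ζ : ℂ) : HasWirt (fun z => z) 1 0 ζ :=
  of_fderiv (hasFDerivAt_id ζ) fun v => by simp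

lemma star (ζ : ℂ) : HasWirt (fun z => conj z) 0 1 ζ :=
  of_fderiv (conjCLE : ℂ →L[ℝ] ℂ).hasFDerivAt fun v => by simp

lemma add (H : HasWirt g p q ζ) (H' : HasWirt h p' q' ζ) :
    HasWirt (fun z => g z + h z) (p + p') (q + q') ζ :=
  of_fderiv (HasFDerivAt.add H H') fun v => by simp; ring

lemma mul (H : HasWirt g p q ζ) (H' : HasWirt h p' q' ζ) :
    HasWirt (fun z => g z * h z) (p * h ζ + g ζ * p') (q * h ζ + g ζ * q') ζ :=
  of_fderiv (HasFDerivAt.mul H H') fun v => by simp; ring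

lemma const_mul (H : HasWirt g p q ζ) (c : ℂ) :
    HasWirt (fun z => c * g z) (c * p) (c * q) ζ :=
  ((HasWirt.const c ζ).mul H).congr_val (by simp) (by simp)

lemma neg (H : HasWirt g p q ζ) : HasWirt (fun z => -g z) (-p) (-q) ζ :=
  ((H.const_mul (-1)).congr_val (by ring) (by ring)).congr_ev (by simp)

lemma sub (H : HasWirt g p q ζ) (H' : HasWirt h p' q' ζ) :
    HasWirt (fun z => g z - h z) (p - p') (q - q') ζ :=
  ((H.add H'.neg).congr_val (by ring) (by ring)).congr_ev (by simp [sub_eq_add_neg])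

lemma sum {ι : Type*} {s : Finset ι} {G : ι → ℂ → ℂ} {P Q : ι → ℂ}
    (H : ∀ i ∈ s, HasWirt (G i) (P i) (Q i) ζ) :
    HasWirt (fun z => ∑ i ∈ s, G i z) (∑ i ∈ s, P i) (∑ i ∈ s, Q i) ζ := by
  classical
  induction s using Finset.induction_on with
  | empty => simpa using HasWirt.const 0 ζ
  | insert a s ha ih =>
    simp only [Finset.sum_insert ha]
    exact (H a (by simp)).add (ih fun i hi => H i (by simp [hi]))

lemma comp_hol {F : ℂ → ℂ} {F' : ℂ} (hF : HasDerivAt F F' (g ζ)) (H : HasWirt g p q ζ) :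
    HasWirt (fun z => F (g z)) (F' * p) (F' * q) ζ := by
  have h1 := (hF.hasFDerivAt.restrictScalars ℝ).comp ζ H
  exact of_fderiv h1 fun v => by simp; ring

lemma comp_inner {F : ℂ → ℂ} {F' : ℂ} (H : HasWirt g p q (F ζ)) (hF : HasDerivAt F F' ζ) :
    HasWirt (fun z => g (F z)) (p * F') (q * (starRingEnd ℂ) F') ζ := by
  have h1 := HasFDerivAt.comp ζ H (hF.hasFDerivAt.restrictScalars ℝ)
  exact of_fderiv h1 fun v => by simp; ring

lemma pow (H : HasWirt g p q ζ) (n : ℕ) :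
    HasWirt (fun z => g z ^ n) (n * g ζ ^ (n - 1) * p) (n * g ζ ^ (n - 1) * q) ζ :=
  comp_hol (F := fun w => w ^ n) (hasDerivAt_pow n (g ζ)) H

lemma conj_comp (H : HasWirt g p q ζ) :
    HasWirt (fun z => (starRingEnd ℂ) (g z)) ((starRingEnd ℂ) q) ((starRingEnd ℂ) p) ζ := by
  have h1 := ((conjCLE : ℂ →L[ℝ] ℂ).hasFDerivAt (x := g ζ)).comp ζ H
  exact of_fderiv h1 fun v => by simp; ring

lemma normSq_fun {k : ℝ → ℂ} {k' : ℂ} (hk : HasDerivAt k k' (‖ζ‖ ^ 2)) :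
    HasWirt (fun z => k (‖z‖ ^ 2)) (k' * (starRingEnd ℂ) ζ) (k' * ζ) ζ := by
  have h0 : HasFDerivAt (fun z : ℂ => ‖z‖ ^ 2) (2 • (innerSL ℝ ζ)) ζ :=
    (hasStrictFDerivAt_norm_sq ζ).hasFDerivAt
  have h1 := HasFDerivAt.comp ζ hk.hasFDerivAt h0
  refine of_fderiv h1 fun v => ?_
  simp [Complex.inner]
  have : ((ζ.re * v.re + ζ.im * v.im : ℝ) : ℂ) = ((starRingEnd ℂ) ζ * v + ζ * (starRingEnd ℂ) v) / 2 := by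
    apply Complex.ext <;> simp <;> ring
  push_cast at this
  rw [mul_comm (v.re : ℂ), mul_comm (v.im : ℂ), this]; ring

end HasWirt

lemma rot_eq (g : ℂ → ℂ) (ζ : ℂ) : rot g ζ = I * (ζ * dz g ζ - conj ζ * dzb g ζ) := by
  have := congrArg (fun L : ℂ →L[ℝ] ℂ => L (I * ζ)) (realLinear_eq_wirt (fderiv ℝ g ζ))
  simp only [wirt_apply, map_mul, conj_I] at this
  rw [rot, this, dz, dzb]; ring

lemma laplacian_eq_dz_dzb {g : ℂ → ℂ} {ζ : ℂ} (h : ContDiffAt ℝ 2 g ζ) :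
    Laplacian.laplacian g ζ = 4 * dz (dzb g) ζ := by
  have hd : DifferentiableAt ℝ (fderiv ℝ g) ζ :=
    (h.fderiv_right (m := 1) (by norm_num)).differentiableAt (by norm_num)
  have hs : fderiv ℝ (fderiv ℝ g) ζ 1 I = fderiv ℝ (fderiv ℝ g) ζ I 1 :=
    (h.isSymmSndFDerivAt (by simp)).eq 1 I
  have h1 : ∀ w : ℂ, HasFDerivAt (fun z => fderiv ℝ g z w)
      ((ContinuousLinearMap.apply ℝ ℂ w).comp (fderiv ℝ (fderiv ℝ g) ζ)) ζ := fun w =>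
    (ContinuousLinearMap.apply ℝ ℂ w).hasFDerivAt.comp ζ hd.hasFDerivAt
  have h2 : fderiv ℝ (dzb g) ζ = (1 / 2 : ℂ) • ((ContinuousLinearMap.apply ℝ ℂ 1).comp
      (fderiv ℝ (fderiv ℝ g) ζ) + I • (ContinuousLinearMap.apply ℝ ℂ I).comp
      (fderiv ℝ (fderiv ℝ g) ζ)) := by
    have h3 := ((h1 1).add ((h1 I).const_smul I)).const_smul (1 / 2 : ℂ)
    refine HasFDerivAt.fderiv (h3.congr_of_eventuallyEq (Eventually.of_forall fun z => ?_))
    simp [dzb]; ring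
  rw [InnerProductSpace.laplacian_eq_iteratedFDeriv_complexPlane]
  simp only [iteratedFDeriv_two_apply, dz, h2]
  simp [hs]
  linear_combination (fderiv ℝ (fderiv ℝ g) ζ I I) * I_sq

lemma spinLaplacian_eq (n : ℤ) {g : ℂ → ℂ} {ζ : ℂ} (h : ContDiffAt ℝ 2 g ζ) :
    spinLaplacian n g ζ = -(1 + ζ * conj ζ) ^ 2 * dz (dzb g) ζ
      - (spin n : ℂ) * (1 + ζ * conj ζ) * (ζ * dz g ζ - conj ζ * dzb g ζ)
      + (spin n : ℂ) ^ 2 * (ζ * conj ζ) * g ζ := by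
  have hn : ((‖ζ‖ : ℝ) : ℂ) ^ 2 = ζ * conj ζ := by rw [mul_conj, normSq_eq_norm_sq]; push_cast; rfl
  rw [spinLaplacian, laplacian_eq_dz_dzb h, rot_eq]
  push_cast
  rw [hn]
  linear_combination (spin n : ℂ) * (1 + ζ * conj ζ) * (ζ * dz g ζ - conj ζ * dzb g ζ) * I_sq

lemma contDiff_dz {g : ℂ → ℂ} (h : ContDiff ℝ ∞ g) : ContDiff ℝ ∞ (dz g) := by
  have := h.fderiv_right (m := ∞) (by simp)
  unfold dz
  fun_prop

lemma contDiff_dzb {g : ℂ → ℂ} (h : ContDiff ℝ ∞ g) : ContDiff ℝ ∞ (dzb g) := by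
  have := h.fderiv_right (m := ∞) (by simp)
  unfold dzb
  fun_prop

lemma contDiff_conj : ContDiff ℝ ∞ (fun z : ℂ => conj z) := conjCLE.contDiff

lemma contDiff_spinLaplacian (n : ℤ) {g : ℂ → ℂ} (h : ContDiff ℝ ∞ g) :
    ContDiff ℝ ∞ (spinLaplacian n g) := by
  have h2 : spinLaplacian n g = fun ζ => -(1 + ζ * conj ζ) ^ 2 * dz (dzb g) ζ
      - (spin n : ℂ) * (1 + ζ * conj ζ) * (ζ * dz g ζ - conj ζ * dzb g ζ)
      + (spin n : ℂ) ^ 2 * (ζ * conj ζ) * g ζ :=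
    funext fun ζ => spinLaplacian_eq n (h.contDiffAt.of_le two_le_infty)
  have a := contDiff_dz (contDiff_dzb h)
  have b := contDiff_dz h
  have c := contDiff_dzb h
  have e := contDiff_conj
  rw [h2]
  fun_prop

/-! ## The transition function -/

lemma norm_transition (n : ℤ) {ζ : ℂ} (hζ : ζ ≠ 0) : ‖transition n ζ‖ = 1 := by
  simp [transition, norm_zpow, hζ]

lemma hasWirt_unit_zpow (n : ℤ) {ζ : ℂ} (hζ : ζ ≠ 0) :
    HasWirt (fun z : ℂ => (z / (‖z‖ : ℂ)) ^ n) ((spin n : ℂ) / ζ * (ζ / (‖ζ‖ : ℂ)) ^ n)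
      (-(spin n : ℂ) / conj ζ * (ζ / (‖ζ‖ : ℂ)) ^ n) ζ := by
  have hn : (‖ζ‖ : ℂ) ≠ 0 := by simpa using hζ
  have hc : conj ζ ≠ 0 := by simpa using hζ
  have hn2 : ((‖ζ‖ : ℝ) : ℂ) ^ 2 = ζ * conj ζ := by rw [mul_conj, normSq_eq_norm_sq]; push_cast; rfl
  have hk : HasDerivAt (fun t : ℝ => ((Real.sqrt t : ℝ) : ℂ)⁻¹)
      (-(1 / (2 * (‖ζ‖ : ℂ))) / (‖ζ‖ : ℂ) ^ 2) (‖ζ‖ ^ 2) := by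
    have h0 : (‖ζ‖ ^ 2 : ℝ) ≠ 0 := by positivity
    have h1 := ((Real.hasDerivAt_sqrt h0).ofReal_comp).inv (by simpa [Real.sqrt_sq] using hζ)
    refine h1.congr_deriv ?_
    rw [Real.sqrt_sq (norm_nonneg ζ)]; push_cast; ring
  have h2 := (HasWirt.id ζ).mul (HasWirt.normSq_fun hk)
  have hu : ζ / (‖ζ‖ : ℂ) ≠ 0 := div_ne_zero hζ hn
  have h3 : HasWirt (fun z : ℂ => z / (‖z‖ : ℂ)) (1 / (2 * (‖ζ‖ : ℂ)))
      (- ζ / (2 * conj ζ * (‖ζ‖ : ℂ))) ζ := by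
    refine (h2.congr_val ?_ ?_).congr_ev (Eventually.of_forall fun z => ?_)
    · simp only [Real.sqrt_sq (norm_nonneg ζ)]
      field_simp
      rw [hn2]; ring
    · simp only [Real.sqrt_sq (norm_nonneg ζ)]
      field_simp
      rw [hn2]; ring
    · simp [Real.sqrt_sq, div_eq_mul_inv]
  refine (HasWirt.comp_hol (F := fun w => w ^ n) (g := fun z : ℂ => z / (‖z‖ : ℂ)) (hasDerivAt_zpow n _ (Or.inl hu)) h3).congr_val ?_ ?_
  · rw [zpow_sub_one₀ hu]; simp only [spin]; push_cast; field_simp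
  · rw [zpow_sub_one₀ hu]; simp only [spin]; push_cast; field_simp

/-- The component over the sphere minus the south pole in terms of the other one. -/
lemma fst_eq_of_glue {n : ℤ} {g₁ g₂ : ℂ → ℂ}
    (hg : ∀ ζ, ζ ≠ 0 → g₂ ζ⁻¹ = transition n ζ * g₁ ζ) {ζ : ℂ} (hζ : ζ ≠ 0) :
    g₁ ζ = (ζ / (‖ζ‖ : ℂ)) ^ n * g₂ ζ⁻¹ := by
  have hu : ζ / (‖ζ‖ : ℂ) ≠ 0 := div_ne_zero hζ (by simpa using hζ)
  rw [hg ζ hζ, transition, zpow_neg, ← mul_assoc, mul_inv_cancel₀ (zpow_ne_zero _ hu), one_mul]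

lemma spinLaplacian_glue {n : ℤ} {g₁ g₂ : ℂ → ℂ} (h₁ : ContDiff ℝ ∞ g₁) (h₂ : ContDiff ℝ ∞ g₂)
    (hg : ∀ ζ, ζ ≠ 0 → g₂ ζ⁻¹ = transition n ζ * g₁ ζ) {ζ : ℂ} (hζ : ζ ≠ 0) :
    spinLaplacian n g₂ ζ⁻¹ = transition n ζ * spinLaplacian n g₁ ζ := by
  have hd := @hasWirt_of_contDiff
  have hinv : ∀ z : ℂ, z ≠ 0 → HasDerivAt (fun z : ℂ => z⁻¹) (-(z ^ 2)⁻¹) z := fun z hz =>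
    hasDerivAt_inv hz
  have hne : ∀ z : ℂ, z ≠ 0 → ∀ᶠ w in 𝓝 z, w ≠ 0 := fun z hz => isOpen_ne.mem_nhds hz
  have W1 : ∀ z : ℂ, z ≠ 0 → HasWirt g₁
      ((z / (‖z‖ : ℂ)) ^ n * ((spin n : ℂ) / z * g₂ z⁻¹ - (z ^ 2)⁻¹ * dz g₂ z⁻¹))
      ((z / (‖z‖ : ℂ)) ^ n * (-(spin n : ℂ) / conj z * g₂ z⁻¹ - (conj z ^ 2)⁻¹ * dzb g₂ z⁻¹)) z := by
    intro z hz
    refine (((hasWirt_unit_zpow n hz).mul ((hd h₂ z⁻¹).comp_inner (hinv z hz))).congr_val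
      ?_ ?_).congr_ev ((hne z hz).mono fun w hw => fst_eq_of_glue hg hw)
    · ring
    · simp only [map_neg, map_inv₀, map_pow]; ring
  have hc : conj ζ ≠ 0 := by simpa using hζ
  have W2 : HasWirt (dzb g₁) ((ζ / (‖ζ‖ : ℂ)) ^ n * ((spin n : ℂ) / ζ *
        (-(spin n : ℂ) / conj ζ * g₂ ζ⁻¹ - (conj ζ ^ 2)⁻¹ * dzb g₂ ζ⁻¹)
        + ((spin n : ℂ) / conj ζ * (ζ ^ 2)⁻¹ * dz g₂ ζ⁻¹
          + (conj ζ ^ 2)⁻¹ * (ζ ^ 2)⁻¹ * dz (dzb g₂) ζ⁻¹))) (dzb (dzb g₁) ζ) ζ := by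
    have A := (HasWirt.star ζ).comp_hol (F := fun w => -(spin n : ℂ) / w)
      ((hasDerivAt_inv hc).const_mul (-(spin n : ℂ)))
    have B := (HasWirt.star ζ).comp_hol (F := fun w => (w ^ 2)⁻¹)
      ((hasDerivAt_pow 2 (conj ζ)).inv (pow_ne_zero 2 hc))
    have C := (hasWirt_unit_zpow n hζ).mul
      ((A.mul ((hd h₂ ζ⁻¹).comp_inner (hinv ζ hζ))).sub
        (B.mul ((hd (contDiff_dzb h₂) ζ⁻¹).comp_inner (hinv ζ hζ))))
    have C' := C.congr_ev ((hne ζ hζ).mono fun w hw => (W1 w hw).dzb_eq)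
    refine C'.congr_val ?_ C'.dzb_eq.symm
    ring
  rw [spinLaplacian_eq n (h₁.contDiffAt.of_le two_le_infty), spinLaplacian_eq n (h₂.contDiffAt.of_le two_le_infty),
    W2.dz_eq, (W1 ζ hζ).dz_eq, (W1 ζ hζ).dzb_eq, fst_eq_of_glue hg hζ, transition, zpow_neg]
  have hu : ζ / (‖ζ‖ : ℂ) ≠ 0 := div_ne_zero hζ (by simpa using hζ)
  have hun := zpow_ne_zero n hu
  simp only [map_inv₀]
  generalize (ζ / (‖ζ‖ : ℂ)) ^ n = U at hun
  generalize conj ζ = c at *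
  field_simp
  ring

section
variable {n : ℤ} {g : SpherePair}

/-! ## Integration over the sphere -/

lemma det_mulLeft (c : ℂ) : (c • ContinuousLinearMap.id ℝ ℂ).det = normSq c := by
  rw [← Algebra.norm_complex_apply, Algebra.norm_apply]
  rfl

lemma areaIntegral_inv (g : ℂ → ℂ) : areaIntegral (fun ζ => g ζ⁻¹) = areaIntegral g := by
  have him : (fun ζ : ℂ => ζ⁻¹) '' {0}ᶜ = {0}ᶜ := by
    ext z; simp only [mem_image, mem_compl_iff, mem_singleton_iff]
    exact ⟨by rintro ⟨y, hy, rfl⟩; exact inv_ne_zero hy, fun h => ⟨z⁻¹, inv_ne_zero h, inv_inv z⟩⟩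
  have hd : ∀ z ∈ ({0}ᶜ : Set ℂ), HasFDerivWithinAt (fun ζ : ℂ => ζ⁻¹)
      ((-(z ^ 2)⁻¹) • ContinuousLinearMap.id ℝ ℂ) {0}ᶜ z := by
    intro z hz
    have h1 := ((hasDerivAt_inv (by simpa using hz : z ≠ 0)).hasFDerivAt.restrictScalars
      ℝ).hasFDerivWithinAt (s := {0}ᶜ)
    have h2 : ((-(z ^ 2)⁻¹) • ContinuousLinearMap.id ℝ ℂ) = ContinuousLinearMap.restrictScalars ℝ
          (ContinuousLinearMap.toSpanSingleton ℂ (-(z ^ 2)⁻¹)) := by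
      ext v; simp; ring
    rw [h2]; exact h1
  have key := integral_image_eq_integral_abs_det_fderiv_smul volume
    (measurableSet_singleton (0 : ℂ)).compl hd (inv_injective.injOn)
    (fun ζ => g ζ * ((4 / (1 + ‖ζ‖ ^ 2) ^ 2 : ℝ) : ℂ))
  rw [him] at key
  have hu : ∀ F : ℂ → ℂ, ∫ ζ in ({0}ᶜ : Set ℂ), F ζ = ∫ ζ, F ζ := fun F =>
    setIntegral_eq_integral_of_ae_compl_eq_zero (by
      filter_upwards [compl_mem_ae_iff.2 (measure_singleton (0 : ℂ))] with z hz h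
      exact absurd hz h)
  unfold areaIntegral
  rw [← hu, ← hu, key]
  refine setIntegral_congr_fun (measurableSet_singleton (0 : ℂ)).compl fun z hz => ?_
  have hz : z ≠ 0 := by simpa using hz
  have hn : ‖z‖ ≠ 0 := by simpa using hz
  simp only [det_mulLeft, real_smul]
  rw [normSq_neg, map_inv₀, map_pow, normSq_eq_norm_sq, abs_of_nonneg (by positivity), norm_inv, mul_left_comm]
  congr 1
  have : (1 + ‖z‖ ^ 2 : ℝ) ≠ 0 := by positivity
  have : (1 + (‖z‖ ^ 2)⁻¹ : ℝ) ≠ 0 := by positivity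
  norm_cast
  field_simp
  try ring

lemma integrable_area_weight : Integrable (fun ζ : ℂ => (4 / (1 + ‖ζ‖ ^ 2) ^ 2 : ℝ)) := by
  have h1 : Integrable (fun ζ : ℂ => 16 * (1 + ‖ζ‖) ^ (-4 : ℝ)) :=
    (integrable_one_add_norm (by simp; norm_num)).const_mul 16
  refine h1.mono' ?_ (Eventually.of_forall fun ζ => ?_)
  · exact (Continuous.div (by fun_prop) (by fun_prop) fun x => by positivity).aestronglyMeasurable
  · rw [Real.norm_of_nonneg (by positivity), show (-4 : ℝ) = -((4 : ℕ) : ℝ) by norm_num,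
      Real.rpow_neg (by positivity), Real.rpow_natCast, ← div_eq_mul_inv,
      div_le_div_iff₀ (by positivity) (by positivity)]
    have h2 : (1 + ‖ζ‖) ^ 2 ≤ 2 * (1 + ‖ζ‖ ^ 2) := by nlinarith [sq_nonneg (1 - ‖ζ‖)]
    have h3 := pow_le_pow_left₀ (by positivity) h2 2
    nlinarith

lemma integrable_area {F : ℂ → ℂ} (hF : Continuous F) {C : ℝ} (hC : ∀ ζ, ‖F ζ‖ ≤ C) :
    Integrable (fun ζ => F ζ * ((4 / (1 + ‖ζ‖ ^ 2) ^ 2 : ℝ) : ℂ)) := by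
  have h := integrable_area_weight.ofReal (𝕜 := ℂ)
  exact h.bdd_mul (c := C) hF.aestronglyMeasurable (Eventually.of_forall hC)

lemma IsSmoothSection.norm_snd
    (hg : ∀ ζ : ℂ, ζ ≠ 0 → g.2 ζ⁻¹ = transition n ζ * g.1 ζ) {ζ : ℂ} (hζ : ζ ≠ 0) :
    ‖g.2 ζ⁻¹‖ = ‖g.1 ζ‖ := by
  rw [hg ζ hζ, norm_mul, norm_transition n hζ, one_mul]

lemma IsSmoothSection.bounded (hg : IsSmoothSection n g) :
    ∃ C, ∀ ζ, ‖g.1 ζ‖ ≤ C := by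
  obtain ⟨C₁, h₁⟩ := (isCompact_closedBall (0 : ℂ) 1).exists_bound_of_continuousOn
    hg.smooth_fst.continuous.continuousOn
  obtain ⟨C₂, h₂⟩ := (isCompact_closedBall (0 : ℂ) 1).exists_bound_of_continuousOn
    hg.smooth_snd.continuous.continuousOn
  refine ⟨max C₁ C₂, fun ζ => ?_⟩
  by_cases h : ‖ζ‖ ≤ 1
  · exact (h₁ ζ (by simpa using h)).trans (le_max_left _ _)
  · have hζ : ζ ≠ 0 := by rintro rfl; simp at h
    rw [← IsSmoothSection.norm_snd hg.glue hζ]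
    refine (h₂ ζ⁻¹ ?_).trans (le_max_right _ _)
    simp only [mem_closedBall_zero_iff, norm_inv]
    exact inv_le_one_of_one_le₀ (not_le.1 h).le

lemma IsSmoothSection.spinLaplacian (hg : IsSmoothSection n g) :
    IsSmoothSection n (spinLaplacian n g.1, spinLaplacian n g.2) :=
  ⟨contDiff_spinLaplacian n hg.smooth_fst, contDiff_spinLaplacian n hg.smooth_snd,
    fun _ hζ => spinLaplacian_glue hg.smooth_fst hg.smooth_snd hg.glue hζ⟩

lemma IsSmoothSection.integrable_mul_conj {n n' : ℤ} {g h : SpherePair} (hg : IsSmoothSection n g)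
    (hh : IsSmoothSection n' h) :
    Integrable (fun ζ => g.1 ζ * conj (h.1 ζ) * ((4 / (1 + ‖ζ‖ ^ 2) ^ 2 : ℝ) : ℂ)) := by
  obtain ⟨C, hC⟩ := hg.bounded
  obtain ⟨D, hD⟩ := hh.bounded
  refine integrable_area (C := C * D) ?_ fun ζ => ?_
  · exact hg.smooth_fst.continuous.mul (continuous_conj.comp hh.smooth_fst.continuous)
  · rw [norm_mul, RCLike.norm_conj]
    exact mul_le_mul (hC ζ) (hD ζ) (norm_nonneg _) ((norm_nonneg _).trans (hC ζ))

/-! ## Integration by parts -/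

lemma integral_fderiv_mul {a b : ℂ → ℂ} (ha : ContDiff ℝ ∞ a) (hb : ContDiff ℝ ∞ b)
    (hc : HasCompactSupport a) (v : ℂ) :
    ∫ ζ, fderiv ℝ a ζ v * b ζ = -∫ ζ, a ζ * fderiv ℝ b ζ v := by
  have ca : Continuous (fun ζ => fderiv ℝ a ζ v) :=
    (ha.continuous_fderiv (by simp)).clm_apply continuous_const
  have cb : Continuous (fun ζ => fderiv ℝ b ζ v) :=
    (hb.continuous_fderiv (by simp)).clm_apply continuous_const
  rw [integral_mul_fderiv_eq_neg_fderiv_mul_of_integrable, neg_neg]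
  · exact (ca.mul hb.continuous).integrable_of_hasCompactSupport
      ((hc.fderiv_apply ℝ v).mul_right)
  · exact (ha.continuous.mul cb).integrable_of_hasCompactSupport hc.mul_right
  · exact (ha.continuous.mul hb.continuous).integrable_of_hasCompactSupport hc.mul_right
  · exact fun x _ => ha.differentiable (by simp) x
  · exact fun x _ => hb.differentiable (by simp) x

lemma hasCompactSupport_dz {a : ℂ → ℂ} (hc : HasCompactSupport a) : HasCompactSupport (dz a) := by
  have h := (hc.fderiv_apply ℝ (1 : ℂ)).sub ((hc.fderiv_apply ℝ I).mul_left (f := fun _ => I))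
  exact h.mul_right (f' := fun _ => (1 / 2 : ℂ)) |>.mono (by
    intro z; simp only [Function.mem_support, dz, Pi.mul_apply, Pi.sub_apply]; intro h1 h2
    apply h1; rw [div_eq_mul_one_div]; exact h2)

lemma hasCompactSupport_dzb {a : ℂ → ℂ} (hc : HasCompactSupport a) : HasCompactSupport (dzb a) := by
  have h := (hc.fderiv_apply ℝ (1 : ℂ)).add ((hc.fderiv_apply ℝ I).mul_left (f := fun _ => I))
  exact h.mul_right (f' := fun _ => (1 / 2 : ℂ)) |>.mono (by
    intro z; simp only [Function.mem_support, dzb, Pi.mul_apply, Pi.add_apply]; intro h1 h2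
    apply h1; rw [div_eq_mul_one_div]; exact h2)

lemma integral_dz_mul {a b : ℂ → ℂ} (ha : ContDiff ℝ ∞ a) (hb : ContDiff ℝ ∞ b)
    (hc : HasCompactSupport a) : ∫ ζ, dz a ζ * b ζ = -∫ ζ, a ζ * dz b ζ := by
  have ca : ∀ v, Continuous (fun ζ => fderiv ℝ a ζ v) := fun v =>
    (ha.continuous_fderiv (by simp)).clm_apply continuous_const
  have cb : ∀ v, Continuous (fun ζ => fderiv ℝ b ζ v) := fun v =>
    (hb.continuous_fderiv (by simp)).clm_apply continuous_const
  have i1 : ∀ v, Integrable (fun ζ => fderiv ℝ a ζ v * b ζ) := fun v =>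
    ((ca v).mul hb.continuous).integrable_of_hasCompactSupport ((hc.fderiv_apply ℝ v).mul_right)
  have i2 : ∀ v, Integrable (fun ζ => a ζ * fderiv ℝ b ζ v) := fun v =>
    (ha.continuous.mul (cb v)).integrable_of_hasCompactSupport hc.mul_right
  have e1 : ∀ ζ, dz a ζ * b ζ = (1 / 2) * (fderiv ℝ a ζ 1 * b ζ) - (I / 2) * (fderiv ℝ a ζ I * b ζ) :=
    fun ζ => by rw [dz]; ring
  have e2 : ∀ ζ, a ζ * dz b ζ = (1 / 2) * (a ζ * fderiv ℝ b ζ 1) - (I / 2) * (a ζ * fderiv ℝ b ζ I) :=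
    fun ζ => by rw [dz]; ring
  simp_rw [e1, e2]
  rw [integral_sub ((i1 1).const_mul _) ((i1 I).const_mul _),
    integral_sub ((i2 1).const_mul _) ((i2 I).const_mul _)]
  simp only [integral_const_mul, integral_fderiv_mul ha hb hc]
  ring

lemma integral_dzb_mul {a b : ℂ → ℂ} (ha : ContDiff ℝ ∞ a) (hb : ContDiff ℝ ∞ b)
    (hc : HasCompactSupport a) : ∫ ζ, dzb a ζ * b ζ = -∫ ζ, a ζ * dzb b ζ := by
  have ca : ∀ v, Continuous (fun ζ => fderiv ℝ a ζ v) := fun v =>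
    (ha.continuous_fderiv (by simp)).clm_apply continuous_const
  have cb : ∀ v, Continuous (fun ζ => fderiv ℝ b ζ v) := fun v =>
    (hb.continuous_fderiv (by simp)).clm_apply continuous_const
  have i1 : ∀ v, Integrable (fun ζ => fderiv ℝ a ζ v * b ζ) := fun v =>
    ((ca v).mul hb.continuous).integrable_of_hasCompactSupport ((hc.fderiv_apply ℝ v).mul_right)
  have i2 : ∀ v, Integrable (fun ζ => a ζ * fderiv ℝ b ζ v) := fun v =>
    (ha.continuous.mul (cb v)).integrable_of_hasCompactSupport hc.mul_right
  have e1 : ∀ ζ, dzb a ζ * b ζ = (1 / 2) * (fderiv ℝ a ζ 1 * b ζ) + (I / 2) * (fderiv ℝ a ζ I * b ζ) :=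
    fun ζ => by rw [dzb]; ring
  have e2 : ∀ ζ, a ζ * dzb b ζ = (1 / 2) * (a ζ * fderiv ℝ b ζ 1) + (I / 2) * (a ζ * fderiv ℝ b ζ I) :=
    fun ζ => by rw [dzb]; ring
  simp_rw [e1, e2]
  rw [integral_add ((i1 1).const_mul _) ((i1 I).const_mul _),
    integral_add ((i2 1).const_mul _) ((i2 I).const_mul _)]
  simp only [integral_const_mul, integral_fderiv_mul ha hb hc]
  ring

lemma one_add_mul_conj_ne_zero (ζ : ℂ) : 1 + ζ * conj ζ ≠ 0 := by
  rw [mul_conj]; norm_cast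
  have := normSq_nonneg ζ
  positivity

lemma contDiff_inv_one_add : ContDiff ℝ ∞ (fun ζ : ℂ => (1 + ζ * conj ζ)⁻¹) := by
  have := contDiff_conj
  exact ContDiff.inv (by fun_prop) one_add_mul_conj_ne_zero

lemma area_weight_eq (ζ : ℂ) :
    ((4 / (1 + ‖ζ‖ ^ 2) ^ 2 : ℝ) : ℂ) = 4 * ((1 + ζ * conj ζ)⁻¹) ^ 2 := by
  rw [mul_conj, normSq_eq_norm_sq]; push_cast; rw [inv_pow, div_eq_mul_inv]

lemma integral_add₄ {a b c d : ℂ → ℂ} (ha : Integrable a) (hb : Integrable b) (hc : Integrable c)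
    (hd : Integrable d) : ∫ z, (a z + b z + c z + d z) = (∫ z, a z) + (∫ z, b z) + (∫ z, c z) + ∫ z, d z := by
  have h2 : Integrable (fun z => a z + b z) := ha.add hb
  have h3 : Integrable (fun z => a z + b z + c z) := h2.add hc
  rw [integral_add h3 hd, integral_add h2 hc, integral_add ha hb]

/-- The spin-weighted Laplacian is symmetric, one of the functions having compact support. -/
lemma areaIntegral_spinLaplacian_of_hasCompactSupport (n : ℤ) {g f : ℂ → ℂ}
    (hg : ContDiff ℝ ∞ g) (hf : ContDiff ℝ ∞ f) (hc : HasCompactSupport g) :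
    areaIntegral (fun ζ => spinLaplacian n g ζ * conj (f ζ)) =
      areaIntegral (fun ζ => g ζ * conj (spinLaplacian n f ζ)) := by
  set s : ℂ := (spin n : ℂ) with hs
  set w : ℂ → ℂ := fun ζ => (1 + ζ * conj ζ)⁻¹ with hw
  set h : ℂ → ℂ := fun ζ => conj (f ζ) with hh
  have cw : ContDiff ℝ ∞ w := contDiff_inv_one_add
  have ch : ContDiff ℝ ∞ h := contDiff_conj.comp hf
  have cc := contDiff_conj
  have Wh : ∀ ζ, HasWirt h (conj (dzb f ζ)) (conj (dz f ζ)) ζ := fun ζ =>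
    (hasWirt_of_contDiff hf ζ).conj_comp
  have hdz : ∀ ζ, dz h ζ = conj (dzb f ζ) := fun ζ => (Wh ζ).dz_eq
  have hdzb : ∀ ζ, dzb h ζ = conj (dz f ζ) := fun ζ => (Wh ζ).dzb_eq
  have hdd : ∀ ζ, dzb (dz h) ζ = conj (dz (dzb f) ζ) := fun ζ => by
    rw [show dz h = fun ζ => conj (dzb f ζ) from funext hdz]
    exact ((hasWirt_of_contDiff (contDiff_dzb hf) ζ).conj_comp).dzb_eq
  have Ww : ∀ ζ, HasWirt w (-conj ζ * w ζ ^ 2) (-ζ * w ζ ^ 2) ζ := fun ζ => by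
    have h1 := HasWirt.comp_hol (F := fun z => z⁻¹) (g := fun z => 1 + z * conj z)
      (hasDerivAt_inv (one_add_mul_conj_ne_zero ζ))
      ((HasWirt.const 1 ζ).add ((HasWirt.id ζ).mul (HasWirt.star ζ)))
    refine h1.congr_val ?_ ?_ <;> simp only [hw] <;> field_simp [one_add_mul_conj_ne_zero ζ] <;> ring
  have hD : ∀ ζ, (1 + ζ * conj ζ) * w ζ = 1 := fun ζ =>
    mul_inv_cancel₀ (one_add_mul_conj_ne_zero ζ)
  have L : ∀ ζ, spinLaplacian n g ζ * conj (f ζ) * ((4 / (1 + ‖ζ‖ ^ 2) ^ 2 : ℝ) : ℂ) =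
      (-4) * (dz (dzb g) ζ * h ζ) + (-4 * s) * (dz g ζ * (ζ * w ζ * h ζ))
        + (4 * s) * (dzb g ζ * (conj ζ * w ζ * h ζ))
        + 4 * s ^ 2 * (g ζ * (ζ * conj ζ * w ζ ^ 2 * h ζ)) := fun ζ => by
    rw [spinLaplacian_eq n (hg.contDiffAt.of_le two_le_infty), area_weight_eq]
    change _ * h ζ * (4 * w ζ ^ 2) = _
    linear_combination (-4 * dz (dzb g) ζ * h ζ * ((1 + ζ * conj ζ) * w ζ + 1)
      - 4 * s * (ζ * dz g ζ - conj ζ * dzb g ζ) * w ζ * h ζ) * hD ζ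
  have R : ∀ ζ, g ζ * conj (spinLaplacian n f ζ) * ((4 / (1 + ‖ζ‖ ^ 2) ^ 2 : ℝ) : ℂ) =
      (-4) * (g ζ * dzb (dz h) ζ) + (4 * s) * (g ζ * dz (fun ζ => ζ * w ζ * h ζ) ζ)
        + (-4 * s) * (g ζ * dzb (fun ζ => conj ζ * w ζ * h ζ) ζ)
        + 4 * s ^ 2 * (g ζ * (ζ * conj ζ * w ζ ^ 2 * h ζ)) := fun ζ => by
    rw [spinLaplacian_eq n (hf.contDiffAt.of_le two_le_infty), area_weight_eq,
      (((HasWirt.id ζ).mul (Ww ζ)).mul (Wh ζ)).dz_eq,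
      (((HasWirt.star ζ).mul (Ww ζ)).mul (Wh ζ)).dzb_eq, hdd]
    change _ * (4 * w ζ ^ 2) = _
    simp only [map_add, map_sub, map_mul, map_neg, map_pow, map_one, conj_conj, hs, conj_ofReal]
    linear_combination (-4 * conj (dz (dzb f) ζ) * g ζ * ((1 + ζ * conj ζ) * w ζ + 1)
      + 4 * s * (ζ * conj (dzb f ζ) - conj ζ * conj (dz f ζ)) * w ζ * g ζ) * hD ζ
  have c1 : ContDiff ℝ ∞ (fun ζ => ζ * w ζ * h ζ) := by fun_prop
  have c2 : ContDiff ℝ ∞ (fun ζ => conj ζ * w ζ * h ζ) := by fun_prop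
  have c3 : ContDiff ℝ ∞ (fun ζ => ζ * conj ζ * w ζ ^ 2 * h ζ) := by fun_prop
  have int : ∀ {u v : ℂ → ℂ}, ContDiff ℝ ∞ u → ContDiff ℝ ∞ v → HasCompactSupport u →
      ∀ c : ℂ, Integrable (fun ζ => c * (u ζ * v ζ)) := fun hu hv hcu c =>
    ((hu.continuous.mul hv.continuous).integrable_of_hasCompactSupport hcu.mul_right).const_mul c
  have k1 := hasCompactSupport_dz hc
  have k2 := hasCompactSupport_dzb hc
  have k3 := hasCompactSupport_dz k2
  have d1 := contDiff_dz hg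
  have d2 := contDiff_dzb hg
  have d3 := contDiff_dz d2
  unfold areaIntegral
  simp_rw [L, R]
  rw [integral_add₄ (int d3 ch k3 _) (int d1 c1 k1 _) (int d2 c2 k2 _) (int hg c3 hc _),
    integral_add₄ (int hg (contDiff_dzb (contDiff_dz ch)) hc _)
      (int hg (contDiff_dz c1) hc _) (int hg (contDiff_dzb c2) hc _) (int hg c3 hc _)]
  simp only [integral_const_mul]
  rw [integral_dz_mul d2 ch k2, integral_dzb_mul hg (contDiff_dz ch) hc,
    integral_dz_mul hg c1 hc, integral_dzb_mul hg c2 hc]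
  ring

end

section
variable {n : ℤ} {l m : ℝ} {f : SpherePair} {ζ : ℂ}

/-! ## Symmetry of the spin-weighted Laplacian on sections -/

/-- The function `σ (1 - |ζ|²) / (1 + |ζ|²)`, the height on the sphere for `σ = 1`. -/
def height (σ : ℝ) (ζ : ℂ) : ℝ := σ * ((1 - ‖ζ‖ ^ 2) / (1 + ‖ζ‖ ^ 2))

/-- A smooth cutoff on the sphere as a function of the height. -/
def poleCutoff (σ : ℝ) (ζ : ℂ) : ℂ := ((Real.smoothTransition (height σ ζ + 1 / 2) : ℝ) : ℂ)

lemma contDiff_poleCutoff (σ : ℝ) : ContDiff ℝ ∞ (poleCutoff σ) := by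
  have h1 : ContDiff ℝ ∞ (fun ζ : ℂ => ‖ζ‖ ^ 2) := contDiff_norm_sq ℝ
  have h2 : ContDiff ℝ ∞ (height σ) :=
    contDiff_const.mul (ContDiff.div (contDiff_const.sub h1) (contDiff_const.add h1)
      fun z => by positivity)
  exact ofRealCLM.contDiff.comp (Real.smoothTransition.contDiff.comp (h2.add contDiff_const))

lemma height_inv (σ : ℝ) (hζ : ζ ≠ 0) : height σ ζ⁻¹ = height (-σ) ζ := by
  have hn : ‖ζ‖ ≠ 0 := by simpa using hζ
  have : (1 + ‖ζ‖ ^ 2 : ℝ) ≠ 0 := by positivity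
  have : (1 + (‖ζ‖ ^ 2)⁻¹ : ℝ) ≠ 0 := by positivity
  simp only [height, norm_inv, inv_pow]
  field_simp
  ring

lemma poleCutoff_inv (σ : ℝ) (hζ : ζ ≠ 0) : poleCutoff σ ζ⁻¹ = poleCutoff (-σ) ζ := by
  rw [poleCutoff, poleCutoff, height_inv σ hζ]

lemma poleCutoff_eq_zero (h : 2 ≤ ‖ζ‖) : poleCutoff 1 ζ = 0 := by
  rw [poleCutoff, Real.smoothTransition.zero_of_nonpos, ofReal_zero]
  have h1 : (1 - ‖ζ‖ ^ 2) / (1 + ‖ζ‖ ^ 2) ≤ -(1 / 2) := by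
    rw [div_le_iff₀ (by positivity)]; nlinarith
  simp only [height]; linarith

lemma poleCutoff_eq_one (h : 2 ≤ ‖ζ‖) : poleCutoff (-1) ζ = 1 := by
  rw [poleCutoff, Real.smoothTransition.one_of_one_le, ofReal_one]
  have h1 : (1 - ‖ζ‖ ^ 2) / (1 + ‖ζ‖ ^ 2) ≤ -(1 / 2) := by
    rw [div_le_iff₀ (by positivity)]; nlinarith
  simp only [height]; linarith

lemma hasCompactSupport_of_norm_le {g : ℂ → ℂ} (h : ∀ ζ, 2 ≤ ‖ζ‖ → g ζ = 0) :
    HasCompactSupport g :=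
  HasCompactSupport.intro (isCompact_closedBall (0 : ℂ) 2) fun z hz => h z (by
    simp only [mem_closedBall_zero_iff, not_le] at hz; exact hz.le)

/-- A smooth section is the sum of sections supported away from one of the poles. -/
lemma IsSmoothSection.exists_split {g : SpherePair} (hg : IsSmoothSection n g) :
    ∃ A B : SpherePair, IsSmoothSection n A ∧ IsSmoothSection n B ∧
      (∀ ζ, g.1 ζ = A.1 ζ + B.1 ζ) ∧ HasCompactSupport A.1 ∧ HasCompactSupport B.2 := by
  refine ⟨(fun ζ => poleCutoff 1 ζ * g.1 ζ, fun ζ => poleCutoff (-1) ζ * g.2 ζ),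
    (fun ζ => (1 - poleCutoff 1 ζ) * g.1 ζ, fun ζ => (1 - poleCutoff (-1) ζ) * g.2 ζ),
    ⟨(contDiff_poleCutoff 1).mul hg.smooth_fst, (contDiff_poleCutoff (-1)).mul hg.smooth_snd, fun ζ hζ => ?_⟩,
    ⟨(contDiff_const.sub (contDiff_poleCutoff 1)).mul hg.smooth_fst,
      (contDiff_const.sub (contDiff_poleCutoff (-1))).mul hg.smooth_snd, fun ζ hζ => ?_⟩,
    fun ζ => by ring, hasCompactSupport_of_norm_le fun ζ hζ => ?_,
    hasCompactSupport_of_norm_le fun ζ hζ => ?_⟩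
  · simp only [poleCutoff_inv _ hζ, neg_neg, hg.glue ζ hζ]; ring
  · simp only [poleCutoff_inv _ hζ, neg_neg, hg.glue ζ hζ]; ring
  · simp [poleCutoff_eq_zero hζ]
  · simp [poleCutoff_eq_one hζ]

lemma IsSmoothSection.areaIntegral_swap {g h : SpherePair} (hg : IsSmoothSection n g)
    (hh : IsSmoothSection n h) :
    areaIntegral (fun ζ => g.1 ζ * conj (h.1 ζ)) = areaIntegral (fun ζ => g.2 ζ * conj (h.2 ζ)) := by
  rw [← areaIntegral_inv (fun ζ => g.2 ζ * conj (h.2 ζ))]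
  unfold areaIntegral
  refine integral_congr_ae ?_
  filter_upwards [compl_mem_ae_iff.2 (measure_singleton (0 : ℂ))] with z hz
  have hz : z ≠ 0 := hz
  have h1 : transition n z * conj (transition n z) = 1 := by
    rw [mul_conj, normSq_eq_norm_sq, norm_transition n hz]; simp
  simp only [hg.glue z hz, hh.glue z hz, map_mul]
  linear_combination (-(g.1 z * conj (h.1 z)) * ((4 / (1 + ‖z‖ ^ 2) ^ 2 : ℝ) : ℂ)) * h1

lemma IsSmoothSection.areaIntegral_spinLaplacian {g h : SpherePair}
    (hg : IsSmoothSection n g) (hh : IsSmoothSection n h) :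
    areaIntegral (fun ζ => KerrTeukolsky.spinLaplacian n g.1 ζ * conj (h.1 ζ)) =
      areaIntegral (fun ζ => g.1 ζ * conj (KerrTeukolsky.spinLaplacian n h.1 ζ)) := by
  obtain ⟨A, B, hA, hB, hAB, cA, cB⟩ := hg.exists_split
  have e : ∀ ζ, KerrTeukolsky.spinLaplacian n g.1 ζ =
      KerrTeukolsky.spinLaplacian n A.1 ζ + KerrTeukolsky.spinLaplacian n B.1 ζ := fun ζ => by
    have e1 : g.1 = fun ζ => A.1 ζ + B.1 ζ := funext hAB
    have w := fun {f : ℂ → ℂ} (hf : ContDiff ℝ ∞ f) => hasWirt_of_contDiff hf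
    have d1 : ∀ ζ, dzb g.1 ζ = dzb A.1 ζ + dzb B.1 ζ := fun ζ => by
      rw [e1]; exact ((w hA.smooth_fst ζ).add (w hB.smooth_fst ζ)).dzb_eq
    have d2 : dz g.1 ζ = dz A.1 ζ + dz B.1 ζ := by
      rw [e1]; exact ((w hA.smooth_fst ζ).add (w hB.smooth_fst ζ)).dz_eq
    have d3 : dz (dzb g.1) ζ = dz (dzb A.1) ζ + dz (dzb B.1) ζ := by
      rw [funext d1]
      exact ((w (contDiff_dzb hA.smooth_fst) ζ).add (w (contDiff_dzb hB.smooth_fst) ζ)).dz_eq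
    rw [spinLaplacian_eq n (hg.smooth_fst.contDiffAt.of_le two_le_infty),
      spinLaplacian_eq n (hA.smooth_fst.contDiffAt.of_le two_le_infty),
      spinLaplacian_eq n (hB.smooth_fst.contDiffAt.of_le two_le_infty), d1, d2, d3, hAB]
    ring
  have add : ∀ {a b c d : SpherePair} (_ : IsSmoothSection n a) (_ : IsSmoothSection n b)
      (_ : IsSmoothSection n c), areaIntegral (fun ζ => (a.1 ζ + b.1 ζ) * conj (c.1 ζ)) =
        areaIntegral (fun ζ => a.1 ζ * conj (c.1 ζ)) +
        areaIntegral (fun ζ => b.1 ζ * conj (c.1 ζ)) := fun ha hb hc => by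
    unfold areaIntegral
    rw [← integral_add (ha.integrable_mul_conj hc) (hb.integrable_mul_conj hc)]
    simp only [add_mul]
  have hL : ∀ {a : SpherePair}, IsSmoothSection n a → IsSmoothSection n _ :=
    fun ha => IsSmoothSection.spinLaplacian ha
  simp_rw [e, hAB]
  rw [add (hL hA) (hL hB) hh (d := h), add hA hB (hL hh) (d := h),
    areaIntegral_spinLaplacian_of_hasCompactSupport n hA.smooth_fst hh.smooth_fst cA]
  congr 1
  rw [(hL hB).areaIntegral_swap hh, hB.areaIntegral_swap (hL hh)]
  exact areaIntegral_spinLaplacian_of_hasCompactSupport n hB.smooth_snd hh.smooth_snd cB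

/-! ## Properties of spin-weighted harmonics -/

/-- The pairing of a section with a section of the same bundle over the sphere. -/
def sphereInner (g h : ℂ → ℂ) : ℂ := areaIntegral (fun ζ => g ζ * conj (h ζ))

lemma sphereInner_const_mul (c : ℂ) (g h : ℂ → ℂ) :
    sphereInner (fun ζ => c * g ζ) h = c * sphereInner g h := by
  simp only [sphereInner, areaIntegral, mul_assoc]
  rw [integral_const_mul]

lemma sphereInner_mul_conj (c : ℂ) (g h : ℂ → ℂ) :
    sphereInner g (fun ζ => c * h ζ) = conj c * sphereInner g h := by
  simp only [sphereInner, areaIntegral, map_mul]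
  rw [← integral_const_mul]
  congr 1; ext ζ; ring

lemma IsSpinHarmonic.sphereInner_spinLaplacian {f g : SpherePair}
    (hf : IsSpinHarmonic n l m f) (hg : IsSmoothSection n g) :
    sphereInner (spinLaplacian n g.1) f.1 = (eigenvalue n l : ℂ) * sphereInner g.1 f.1 := by
  unfold sphereInner
  rw [hg.areaIntegral_spinLaplacian hf.isSmoothSection]
  simp_rw [hf.eigen_fst]
  have := sphereInner_mul_conj (eigenvalue n l : ℂ) g.1 f.1
  rwa [conj_ofReal] at this

lemma IsSpinHarmonic.rot_fst (hf : IsSpinHarmonic n l m f)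
    (ζ : ℂ) : rot f.1 ζ = I * ((m + spin n : ℝ) : ℂ) * f.1 ζ := by
  have := hf.phi_fst ζ
  rw [phiDeriv] at this
  push_cast
  linear_combination this

lemma hasDerivAt_rotate {g : ℂ → ℂ} (hg : ContDiff ℝ ∞ g) (ζ : ℂ) (t : ℝ) :
    HasDerivAt (fun t : ℝ => g (exp (t * I) * ζ)) (rot g (exp (t * I) * ζ)) t := by
  have h0 : HasDerivAt (fun t : ℝ => (t : ℂ) * I) (1 * I) t := (hasDerivAt_id t).ofReal_comp.mul_const I
  have h1 : HasDerivAt (fun t : ℝ => exp (t * I) * ζ) (I * (exp (t * I) * ζ)) t :=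
    (h0.cexp.mul_const ζ).congr_deriv (by ring)
  exact ((hg.differentiable (by simp)) (exp (t * I) * ζ)).hasFDerivAt.comp_hasDerivAt t h1

lemma IsSpinHarmonic.rotate (hf : IsSpinHarmonic n l m f)
    (α : ℝ) (ζ : ℂ) : f.1 (exp (α * I) * ζ) = exp (((m + spin n : ℝ) : ℂ) * α * I) * f.1 ζ := by
  set k : ℂ := ((m + spin n : ℝ) : ℂ) with hk
  have hd : ∀ t : ℝ, HasDerivAt (fun t : ℝ => exp (-k * t * I) * f.1 (exp (t * I) * ζ)) 0 t := fun t => by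
    have h0 : HasDerivAt (fun t : ℝ => -k * (t : ℂ) * I) (-k * 1 * I) t :=
      ((hasDerivAt_id t).ofReal_comp.const_mul (-k)).mul_const I
    refine (h0.cexp.mul (hasDerivAt_rotate hf.isSmoothSection.smooth_fst ζ t)).congr_deriv ?_
    rw [hf.rot_fst, ← hk]; ring
  have hc := is_const_of_deriv_eq_zero (fun t => (hd t).differentiableAt) (fun t => (hd t).deriv) α 0
  simp only [ofReal_zero, mul_zero, zero_mul, exp_zero, one_mul] at hc
  rw [← hc, ← mul_assoc, ← exp_add, show k * α * I + -k * α * I = 0 by ring, exp_zero, one_mul]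

lemma areaIntegral_rotate (g : ℂ → ℂ) (α : ℝ) :
    areaIntegral (fun ζ => g (exp (α * I) * ζ)) = areaIntegral g := by
  have hmp := (rotation (Circle.exp α)).measurePreserving
  have := hmp.integral_comp (rotation (Circle.exp α)).toHomeomorph.measurableEmbedding
    (fun ζ => g ζ * ((4 / (1 + ‖ζ‖ ^ 2) ^ 2 : ℝ) : ℂ))
  unfold areaIntegral
  rw [← this]
  simp [rotation_apply, Circle.coe_exp]

lemma eigenvalue_injOn {l l' : ℝ} (hl : 0 ≤ l) (hl' : 0 ≤ l')
    (h : eigenvalue n l = eigenvalue n l') : l = l' := by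
  simp only [eigenvalue] at h
  have h1 : (l - l') * (l + l' + 1) = 0 := by linear_combination h
  rcases mul_eq_zero.1 h1 with h2 | h2
  · linarith
  · linarith

lemma sphereInner_eq_zero {l m l' m' : ℝ} (hl : 0 ≤ l) (hl' : 0 ≤ l')
    {f f' : SpherePair} (hf : IsSpinHarmonic n l m f) (hf' : IsSpinHarmonic n l' m' f')
    (h : (l, m) ≠ (l', m')) : sphereInner f'.1 f.1 = 0 := by
  by_cases hll : l = l'
  · have hm : m' - m ≠ 0 := fun h' => h (by rw [hll, show m = m' by linarith])
    have hmc : ((m' - m : ℝ) : ℂ) ≠ 0 := by exact_mod_cast hm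
    have key := areaIntegral_rotate (fun ζ => f'.1 ζ * conj (f.1 ζ)) (Real.pi / (m' - m))
    simp only [hf.rotate, hf'.rotate, map_mul] at key
    have e : ∀ ζ, exp (((m' + spin n : ℝ) : ℂ) * ((Real.pi / (m' - m) : ℝ) : ℂ) * I) * f'.1 ζ *
        (conj (exp (((m + spin n : ℝ) : ℂ) * ((Real.pi / (m' - m) : ℝ) : ℂ) * I)) * conj (f.1 ζ))
        = (-1) * f'.1 ζ * conj (f.1 ζ) := fun ζ => by
      rw [← exp_conj, mul_mul_mul_comm, ← exp_add]
      simp only [map_mul, conj_ofReal, conj_I]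
      rw [show ((m' + spin n : ℝ) : ℂ) * ((Real.pi / (m' - m) : ℝ) : ℂ) * I +
        ((m + spin n : ℝ) : ℂ) * ((Real.pi / (m' - m) : ℝ) : ℂ) * -I = Real.pi * I by
          push_cast at hmc ⊢; field_simp; ring, exp_pi_mul_I, mul_assoc]
    simp_rw [e] at key
    have k2 := sphereInner_const_mul (-1) f'.1 f.1
    simp only [sphereInner] at k2 ⊢
    rw [k2] at key
    linear_combination (-1 / 2) * key
  · have h1 := hf.sphereInner_spinLaplacian hf'.isSmoothSection
    rw [show spinLaplacian n f'.1 = fun ζ => (eigenvalue n l' : ℂ) * f'.1 ζ from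
      funext hf'.eigen_fst, sphereInner_const_mul] at h1
    have h2 : (eigenvalue n l' : ℂ) - eigenvalue n l ≠ 0 := by
      rw [← ofReal_sub]
      exact_mod_cast fun h3 => hll (eigenvalue_injOn hl hl' (by linarith))
    have h3 : ((eigenvalue n l' : ℂ) - eigenvalue n l) * sphereInner f'.1 f.1 = 0 := by
      linear_combination h1
    exact (mul_eq_zero.1 h3).resolve_left h2

lemma sphereInner_self (hf : IsSpinHarmonic n l m f) :
    sphereInner f.1 f.1 = 1 := hf.normalized

/-! ## Uniqueness of the harmonics -/

/-- The potential in the equation `g'' = -g'/ρ + V g` for `g(ρ) = f₁(ρ)`, `ρ > 0`. -/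
def harmonicPotential (n : ℤ) (l m ρ : ℝ) : ℝ :=
  (m + spin n) ^ 2 / ρ ^ 2 + 4 / (1 + ρ ^ 2) ^ 2 *
    (-(spin n * (m + spin n) * (1 + ρ ^ 2)) + spin n ^ 2 * ρ ^ 2 - eigenvalue n l)

lemma hasDerivAt_fst_real {g : ℂ → ℂ} (hg : ContDiff ℝ ∞ g) (v : ℂ) (ρ : ℝ) :
    HasDerivAt (fun ρ : ℝ => fderiv ℝ g ρ v) (fderiv ℝ (fderiv ℝ g) ρ 1 v) ρ := by
  have h1 : HasFDerivAt (fun z => fderiv ℝ g z v)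
      ((ContinuousLinearMap.apply ℝ ℂ v).comp (fderiv ℝ (fderiv ℝ g) ρ)) (ρ : ℂ) :=
    (ContinuousLinearMap.apply ℝ ℂ v).hasFDerivAt.comp (ρ : ℂ)
      (((hg.fderiv_right (m := ∞) (by simp)).differentiable (by simp)) ρ).hasFDerivAt
  have h2 := h1.comp_hasDerivAt ρ (hasDerivAt_id ρ).ofReal_comp
  simpa using! h2

lemma hasDerivAt_real {g : ℂ → ℂ} (hg : ContDiff ℝ ∞ g) (ρ : ℝ) :
    HasDerivAt (fun ρ : ℝ => g ρ) (fderiv ℝ g ρ 1) ρ := by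
  have h2 := ((hg.differentiable (by simp)) (ρ : ℂ)).hasFDerivAt.comp_hasDerivAt ρ
    (hasDerivAt_id ρ).ofReal_comp
  simpa using! h2

lemma IsSpinHarmonic.ode (hf : IsSpinHarmonic n l m f)
    {ρ : ℝ} (hρ : 0 < ρ) :
    HasDerivAt (fun ρ : ℝ => fderiv ℝ f.1 ρ 1)
      (-(fderiv ℝ f.1 ρ 1) / ρ + (harmonicPotential n l m ρ : ℂ) * f.1 ρ) ρ := by
  have hs := hf.isSmoothSection.smooth_fst
  refine (hasDerivAt_fst_real hs 1 ρ).congr_deriv ?_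
  have hρc : (ρ : ℂ) ≠ 0 := by exact_mod_cast hρ.ne'
  set k : ℂ := ((m + spin n : ℝ) : ℂ) with hk
  have hrot : ∀ ζ, fderiv ℝ f.1 ζ (I * ζ) = I * k * f.1 ζ := hf.rot_fst
  have hy : fderiv ℝ f.1 ρ I * ρ = I * k * f.1 ρ := by
    rw [← hrot, show I * (ρ : ℂ) = ρ • I by rw [real_smul, mul_comm], map_smul, real_smul, mul_comm]
  have hd : DifferentiableAt ℝ (fderiv ℝ f.1) (ρ : ℂ) :=
    ((hs.fderiv_right (m := ∞) (by simp)).differentiable (by simp)) ρ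
  have hyy : fderiv ℝ (fderiv ℝ f.1) ρ I I * ρ - fderiv ℝ f.1 ρ 1 = I * k * fderiv ℝ f.1 ρ I := by
    have hl : HasFDerivAt (fun ζ : ℂ => I * ζ) (I • ContinuousLinearMap.id ℝ ℂ) (ρ : ℂ) := by
      simpa using! (hasFDerivAt_id (𝕜 := ℝ) (ρ : ℂ)).const_smul I
    have h1 := hd.hasFDerivAt.clm_apply hl
    have h2 : HasFDerivAt (fun ζ => I * k * f.1 ζ) ((I * k) • fderiv ℝ f.1 ρ) (ρ : ℂ) :=
      ((hs.differentiable (by simp)) (ρ : ℂ)).hasFDerivAt.const_smul (I * k)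
    rw [show (fun ζ => fderiv ℝ f.1 ζ (I * ζ)) = fun ζ => I * k * f.1 ζ from funext hrot] at h1
    have h3 := congrArg (fun L : ℂ →L[ℝ] ℂ => L I) (h1.unique h2)
    simp only [_root_.add_apply, ContinuousLinearMap.comp_apply,
      _root_.smul_apply, ContinuousLinearMap.id_apply, smul_eq_mul,
      ContinuousLinearMap.flip_apply, I_mul_I, map_neg] at h3
    rw [show I * (ρ : ℂ) = ρ • I by rw [real_smul, mul_comm], map_smul, real_smul] at h3
    linear_combination h3
  have hE := hf.eigen_fst ρ
  rw [KerrTeukolsky.spinLaplacian, InnerProductSpace.laplacian_eq_iteratedFDeriv_complexPlane,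
    hf.rot_fst ρ, ← hk] at hE
  simp only [iteratedFDeriv_two_apply] at hE
  simp only [Matrix.cons_val_zero, Matrix.cons_val_one, norm_real] at hE
  simp only [Real.norm_eq_abs, sq_abs] at hE
  have hDne : (1 + (ρ : ℂ) ^ 2) ≠ 0 := by
    have : (1 + ρ ^ 2 : ℝ) ≠ 0 := by positivity
    exact_mod_cast this
  have hIy : fderiv ℝ f.1 ρ I = I * k * f.1 ρ / ρ := by field_simp; exact hy
  have hyy' : fderiv ℝ (fderiv ℝ f.1) ρ I I =
      (fderiv ℝ f.1 ρ 1 + I * k * (I * k * f.1 ρ / ρ)) / ρ := by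
    rw [← hIy]; field_simp; linear_combination hyy
  rw [hyy'] at hE
  simp only [harmonicPotential]
  push_cast at hE hk ⊢
  rw [← hk]
  generalize fderiv ℝ (fderiv ℝ f.1) ρ 1 1 = X at *
  generalize fderiv ℝ f.1 ρ 1 = Y at *
  generalize f.1 ρ = F at *
  have h4 : X = -Y / ρ + k ^ 2 / ρ ^ 2 * F + 4 / (1 + (ρ : ℂ) ^ 2) ^ 2 *
      (-(spin n * k * (1 + (ρ : ℂ) ^ 2)) + spin n ^ 2 * ρ ^ 2 - eigenvalue n l) * F := by
    field_simp at hE ⊢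
    simp only [I_sq] at hE
    linear_combination (-1) * hE
  rw [h4]; ring

lemma continuousOn_harmonicPotential (n : ℤ) (l m : ℝ) :
    ContinuousOn (harmonicPotential n l m) (Ioi 0) := by
  unfold harmonicPotential
  refine ContinuousOn.add (ContinuousOn.div (by fun_prop) (by fun_prop) fun x hx => ?_)
    (ContinuousOn.mul (ContinuousOn.div (by fun_prop) (by fun_prop) fun x hx => by positivity)
      (by fun_prop))
  exact pow_ne_zero 2 (ne_of_gt hx)

/-- A solution of `g'' = -g'/ρ + V g` on `(0,∞)` with zero initial data vanishes. -/
lemma ode_zero {V : ℝ → ℝ} (hV : ContinuousOn V (Ioi 0)) {g g' : ℝ → ℂ}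
    (h1 : ∀ ρ, 0 < ρ → HasDerivAt g (g' ρ) ρ)
    (h2 : ∀ ρ, 0 < ρ → HasDerivAt g' (-(g' ρ) / ρ + (V ρ : ℂ) * g ρ) ρ) {ρ₀ : ℝ} (hρ₀ : 0 < ρ₀)
    (h3 : g ρ₀ = 0) (h4 : g' ρ₀ = 0) {ρ : ℝ} (hρ : 0 < ρ) : g ρ = 0 := by
  set a := min ρ₀ ρ / 2 with ha
  set b := max ρ₀ ρ + 1 with hb
  have ha0 : 0 < a := by have := lt_min hρ₀ hρ; positivity
  have hmem : ∀ t, t = ρ₀ ∨ t = ρ → t ∈ Ioo a b := by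
    have h5 : a < min ρ₀ ρ := by have := lt_min hρ₀ hρ; rw [ha]; linarith
    rintro t (rfl | rfl)
    · exact ⟨h5.trans_le (min_le_left _ _), by have := le_max_left t ρ; rw [hb]; linarith⟩
    · exact ⟨h5.trans_le (min_le_right _ _), by have := le_max_right ρ₀ t; rw [hb]; linarith⟩
  obtain ⟨C, hC⟩ := (isCompact_Icc (a := a) (b := b)).exists_bound_of_continuousOn
    (hV.mono fun x hx => lt_of_lt_of_le ha0 hx.1)
  have hC0 : 0 ≤ C := (norm_nonneg _).trans (hC ρ (Ioo_subset_Icc_self (hmem ρ (Or.inr rfl))))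
  set v : ℝ → ℂ × ℂ → ℂ × ℂ := fun t y => (y.2, -y.2 / t + (V t : ℂ) * y.1) with hv
  have hlip : ∀ t ∈ Ioo a b, LipschitzOnWith (1 + 1 / a + C).toNNReal (v t) univ := by
    intro t ht
    refine LipschitzOnWith.of_dist_le_mul fun y _ z _ => ?_
    rw [Real.coe_toNNReal _ (by positivity), dist_eq_norm, dist_eq_norm]
    have e : v t y - v t z = v t (y - z) := by
      simp only [hv, Prod.fst_sub, Prod.snd_sub, Prod.mk_sub_mk]
      congr 1; ring
    rw [e]
    generalize y - z = w
    have ht0 : 0 < t := ha0.trans ht.1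
    have n1 : ‖w.1‖ ≤ ‖w‖ := norm_fst_le w
    have n2 : ‖w.2‖ ≤ ‖w‖ := norm_snd_le w
    have hinv : 0 ≤ 1 / a := by positivity
    refine max_le ?_ ?_
    · change ‖w.2‖ ≤ _
      nlinarith [norm_nonneg w, mul_nonneg hinv (norm_nonneg w), mul_nonneg hC0 (norm_nonneg w)]
    · change ‖-w.2 / (t : ℂ) + (V t : ℂ) * w.1‖ ≤ _
      have h6 : ‖-w.2 / (t : ℂ)‖ ≤ 1 / a * ‖w‖ := by
        rw [norm_div, norm_neg, norm_real, Real.norm_of_nonneg ht0.le, div_eq_inv_mul, ← one_div]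
        exact mul_le_mul (one_div_le_one_div_of_le ha0 ht.1.le) n2 (norm_nonneg _) hinv
      have h7 : ‖(V t : ℂ) * w.1‖ ≤ C * ‖w‖ := by
        rw [norm_mul, norm_real]
        exact mul_le_mul (hC t (Ioo_subset_Icc_self ht)) n1 (norm_nonneg _) hC0
      refine (norm_add_le _ _).trans ?_
      nlinarith [norm_nonneg w]
  have huniq := ODE_solution_unique_of_mem_Ioo (v := v) (s := fun _ => univ)
    (f := fun t => (g t, g' t)) (g := fun _ => (0 : ℂ × ℂ)) hlip (hmem ρ₀ (Or.inl rfl))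
    (fun t ht => ⟨(h1 t (ha0.trans ht.1)).prodMk (h2 t (ha0.trans ht.1)), mem_univ _⟩)
    (fun t _ => ⟨by simpa [hv] using! hasDerivAt_const t (0 : ℂ × ℂ), mem_univ _⟩)
    (by simp [h3, h4])
  have := huniq (hmem ρ (Or.inr rfl))
  simpa using congrArg Prod.fst this

lemma IsSpinHarmonic.fst_eq_polar (hf : IsSpinHarmonic n l m f)
    (ζ : ℂ) : f.1 ζ = exp (((m + spin n : ℝ) : ℂ) * arg ζ * I) * f.1 (‖ζ‖ : ℂ) := by
  conv_lhs => rw [← norm_mul_exp_arg_mul_I ζ, mul_comm]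
  exact hf.rotate _ _

/-- Harmonics with the same indices differ by a phase. -/
lemma IsSpinHarmonic.unique {f f' : SpherePair} (hf : IsSpinHarmonic n l m f)
    (hf' : IsSpinHarmonic n l m f') : ∃ c : ℂ, ‖c‖ = 1 ∧ ∀ ζ, f'.1 ζ = c * f.1 ζ := by
  have hs := hf.isSmoothSection.smooth_fst
  have hs' := hf'.isSmoothSection.smooth_fst
  set W : ℝ → ℂ := fun ρ => ρ * (fderiv ℝ f'.1 ρ 1 * f.1 ρ - f'.1 ρ * fderiv ℝ f.1 ρ 1) with hW
  have hWd : ∀ ρ : ℝ, 0 < ρ → HasDerivAt W 0 ρ := fun ρ hρ => by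
    have h1 := (hasDerivAt_id ρ).ofReal_comp.mul (((hf'.ode hρ).mul (hasDerivAt_real hs ρ)).sub
      ((hasDerivAt_real hs' ρ).mul (hf.ode hρ)))
    refine h1.congr_deriv ?_
    have hρc : (ρ : ℂ) ≠ 0 := by exact_mod_cast hρ.ne'
    simp only [ofReal_one, id, Pi.mul_apply, Pi.sub_apply]
    field_simp
    ring
  have hW0 : Tendsto W (𝓝[>] 0) (𝓝 0) := by
    have hc : Continuous W := by
      have c1 := (hs.continuous_fderiv (by simp)).clm_apply (continuous_const (y := (1 : ℂ)))
      have c2 := (hs'.continuous_fderiv (by simp)).clm_apply (continuous_const (y := (1 : ℂ)))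
      have c3 := hs.continuous
      have c4 := hs'.continuous
      fun_prop
    have := hc.tendsto 0
    rw [show W 0 = 0 by simp [hW]] at this
    exact this.mono_left nhdsWithin_le_nhds
  have hWz : ∀ ρ : ℝ, 0 < ρ → W ρ = 0 := fun ρ hρ => by
    refine tendsto_nhds_unique (Tendsto.congr' ?_ tendsto_const_nhds) hW0
    filter_upwards [self_mem_nhdsWithin] with t ht
    exact (convex_Ioi (0 : ℝ)).is_const_of_fderivWithin_eq_zero (𝕜 := ℝ)
      (fun x hx => (hWd x hx).differentiableAt.differentiableWithinAt)
      (fun x hx => by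
        rw [fderivWithin_of_isOpen isOpen_Ioi hx]
        ext; simp [(hWd x hx).deriv]) hρ ht
  obtain ⟨ρ₀, hρ₀, hne⟩ : ∃ ρ : ℝ, 0 < ρ ∧ f.1 ρ ≠ 0 := by
    by_contra! hall
    have h1 : ∀ ζ : ℂ, ζ ≠ 0 → f.1 ζ = 0 := fun ζ hζ => by
      rw [hf.fst_eq_polar, hall ‖ζ‖ (by positivity), mul_zero]
    have h2 := hf.normalized
    unfold areaIntegral at h2
    rw [integral_congr_ae (g := fun _ => 0), integral_zero] at h2
    · exact zero_ne_one h2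
    · filter_upwards [compl_mem_ae_iff.2 (measure_singleton (0 : ℂ))] with z hz
      simp [h1 z hz]
  set c := f'.1 ρ₀ / f.1 ρ₀ with hc
  have hz : ∀ ρ : ℝ, 0 < ρ → f'.1 ρ - c * f.1 ρ = 0 := fun ρ hρ => by
    refine ode_zero (V := harmonicPotential n l m) (g := fun ρ => f'.1 ρ - c * f.1 ρ)
      (g' := fun ρ => fderiv ℝ f'.1 ρ 1 - c * fderiv ℝ f.1 ρ 1)
      (continuousOn_harmonicPotential n l m)
      (fun t _ => (hasDerivAt_real hs' t).sub ((hasDerivAt_real hs t).const_mul c))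
      (fun t ht => ((hf'.ode ht).sub ((hf.ode ht).const_mul c)).congr_deriv (by ring)) hρ₀ ?_ ?_ hρ
    · simp [hc, hne]
    · have := hWz ρ₀ hρ₀
      simp only [hW, mul_eq_zero, ofReal_eq_zero, hρ₀.ne', false_or] at this
      simp only [hc]
      field_simp
      linear_combination this
  have hz' : ∀ ζ : ℂ, ζ ≠ 0 → f'.1 ζ = c * f.1 ζ := fun ζ hζ => by
    rw [hf.fst_eq_polar, hf'.fst_eq_polar, sub_eq_zero.1 (hz ‖ζ‖ (by positivity))]; ring
  have hz'' : ∀ ζ, f'.1 ζ = c * f.1 ζ := by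
    have := Continuous.ext_on (dense_compl_singleton (0 : ℂ)) hs'.continuous
      (continuous_const.mul hs.continuous) (fun ζ hζ => hz' ζ hζ)
    exact fun ζ => congrFun this ζ
  refine ⟨c, ?_, hz''⟩
  have h5 := sphereInner_self hf'
  rw [show f'.1 = fun ζ => c * f.1 ζ from funext hz'', sphereInner_const_mul, sphereInner_mul_conj,
    sphereInner_self hf, mul_one, mul_conj, normSq_eq_norm_sq] at h5
  have h6 : ‖c‖ ^ 2 = 1 := by exact_mod_cast h5
  nlinarith [norm_nonneg c]

/-! ## Complex conjugation -/

lemma spin_neg (n : ℤ) : spin (-n) = -spin n := by simp [spin]; ring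

lemma eigenvalue_neg (n : ℤ) (l : ℝ) : eigenvalue (-n) l = eigenvalue n l := by
  simp only [eigenvalue, spin_neg]; ring

lemma isMode_neg (h : IsMode n l m) : IsMode (-n) l (-m) := by
  obtain ⟨j, i, hl, hi, hm⟩ := h
  have h2 : ∃ k : ℕ, 2 * l = k := ⟨n.natAbs + 2 * j, by
    rw [hl, spin, abs_div]; push_cast; rw [Nat.cast_natAbs]; push_cast; norm_num; ring⟩
  obtain ⟨k, hk⟩ := h2
  have hik : i ≤ k := by rw [hk] at hi; exact_mod_cast hi
  refine ⟨j, k - i, by rw [spin_neg, abs_neg, hl], ?_, ?_⟩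
  · rw [hk]; exact_mod_cast Nat.sub_le k i
  · rw [hm, Nat.cast_sub hik, ← hk]; ring

lemma conj_transition (n : ℤ) (hζ : ζ ≠ 0) : conj (transition n ζ) = transition (-n) ζ := by
  have h1 : conj (ζ / (‖ζ‖ : ℂ)) = (ζ / (‖ζ‖ : ℂ))⁻¹ := by
    rw [inv_def, normSq_eq_norm_sq]
    simp [hζ]
  rw [transition, transition, map_zpow₀, h1, inv_zpow, ← zpow_neg]

/-- The fibrewise complex conjugate. -/
def conjPair (f : SpherePair) : SpherePair := (fun ζ => conj (f.1 ζ), fun ζ => conj (f.2 ζ))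

lemma spinLaplacian_conj (n : ℤ) {g : ℂ → ℂ} (hg : ContDiff ℝ ∞ g) (ζ : ℂ) :
    spinLaplacian (-n) (fun ζ => conj (g ζ)) ζ = conj (spinLaplacian n g ζ) := by
  have w := fun ζ => (hasWirt_of_contDiff hg ζ).conj_comp
  have hcg : ContDiff ℝ ∞ (fun ζ => conj (g ζ)) := contDiff_conj.comp hg
  have h1 : dz (dzb fun ζ => conj (g ζ)) ζ = conj (dz (dzb g) ζ) := by
    have e1 : Laplacian.laplacian (fun ζ => conj (g ζ)) ζ = conj (Laplacian.laplacian g ζ) := by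
      exact (hg.contDiffAt.of_le two_le_infty).laplacian_CLM_comp_left (l := (conjCLE : ℂ →L[ℝ] ℂ))
    rw [laplacian_eq_dz_dzb (hg.contDiffAt.of_le two_le_infty),
      laplacian_eq_dz_dzb (hcg.contDiffAt.of_le two_le_infty), map_mul] at e1
    have h4 : conj (4 : ℂ) = 4 := map_ofNat _ 4
    rw [h4] at e1
    exact mul_left_cancel₀ (by norm_num) e1
  rw [spinLaplacian_eq n (hg.contDiffAt.of_le two_le_infty),
    spinLaplacian_eq (-n) (hcg.contDiffAt.of_le two_le_infty), h1,
    (w ζ).dz_eq, (w ζ).dzb_eq, spin_neg]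
  simp only [map_add, map_sub, map_mul, map_neg, map_pow, map_one, conj_conj, conj_ofReal]
  push_cast
  ring

lemma phiDeriv_conj (σ : ℝ) (n : ℤ) {g : ℂ → ℂ} (hg : ContDiff ℝ ∞ g) (ζ : ℂ) :
    phiDeriv σ (-n) (fun ζ => conj (g ζ)) ζ = conj (phiDeriv σ n g ζ) := by
  have w := (hasWirt_of_contDiff hg ζ).conj_comp
  simp only [phiDeriv, rot_eq, w.dz_eq, w.dzb_eq, spin_neg, map_sub, map_mul, conj_I, conj_conj, conj_ofReal]
  push_cast
  ring

lemma IsSpinHarmonic.conj (hf : IsSpinHarmonic n l m f) :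
    IsSpinHarmonic (-n) l (-m) (conjPair f) where
  isSmoothSection := ⟨contDiff_conj.comp hf.isSmoothSection.smooth_fst,
    contDiff_conj.comp hf.isSmoothSection.smooth_snd, fun ζ hζ => by
      simp only [conjPair, hf.isSmoothSection.glue ζ hζ, map_mul, conj_transition n hζ]⟩
  eigen_fst ζ := by
    simp only [conjPair, spinLaplacian_conj n hf.isSmoothSection.smooth_fst, hf.eigen_fst, map_mul,
      conj_ofReal, eigenvalue_neg]
  eigen_snd ζ := by
    simp only [conjPair, spinLaplacian_conj n hf.isSmoothSection.smooth_snd, hf.eigen_snd, map_mul,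
      conj_ofReal, eigenvalue_neg]
  phi_fst ζ := by
    have := phiDeriv_conj 1 n hf.isSmoothSection.smooth_fst ζ
    simp only [ofReal_one] at this
    simp only [conjPair, this, hf.phi_fst, map_mul, conj_ofReal, conj_I]
    push_cast; ring
  phi_snd ζ := by
    have := phiDeriv_conj (-1) n hf.isSmoothSection.smooth_snd ζ
    simp only [ofReal_neg, ofReal_one] at this
    simp only [conjPair, this, hf.phi_snd, map_mul, conj_ofReal, conj_I]
    push_cast; ring
  normalized := by
    rw [← hf.normalized]
    congr 1; ext ζ; simp [conjPair, mul_comm]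

end

section
variable {n : ℤ} {l : ℝ}

/-! ## Existence of spin-weighted harmonics -/

lemma IsMode.exists_nat {l m : ℝ} (h : IsMode n l m) :
    ∃ A B i : ℕ, (A : ℝ) = l + spin n ∧ (B : ℝ) = l - spin n ∧ i ≤ A + B ∧ m = -l + i := by
  obtain ⟨j, i, hl, hi, hm⟩ := h
  have key : ∃ A B : ℕ, (A : ℝ) = l + spin n ∧ (B : ℝ) = l - spin n := by
    rcases le_total 0 n with hn | hn
    · refine ⟨n.toNat + j, j, ?_, ?_⟩
      · have : ((n.toNat : ℤ) : ℝ) = n := by rw [Int.toNat_of_nonneg hn]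
        push_cast at this ⊢
        rw [hl, this, spin, abs_of_nonneg (by positivity)]; ring
      · rw [hl, spin, abs_of_nonneg (by positivity)]; ring
    · have hn' : (n : ℝ) / 2 ≤ 0 := by
        have : (n : ℝ) ≤ 0 := by exact_mod_cast hn
        linarith
      refine ⟨j, (-n).toNat + j, ?_, ?_⟩
      · rw [hl, spin, abs_of_nonpos hn']; ring
      · have : (((-n).toNat : ℤ) : ℝ) = -n := by rw [Int.toNat_of_nonneg (by omega)]; push_cast; ring
        push_cast at this ⊢
        rw [hl, this, spin, abs_of_nonpos hn']; ring
  obtain ⟨A, B, hA, hB⟩ := key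
  refine ⟨A, B, i, hA, hB, ?_, hm⟩
  have : (i : ℝ) ≤ A + B := by rw [hA, hB]; linarith
  exact_mod_cast this

/-- `ζ^a ζ̄^b (1 + |ζ|²)^{-l}`. -/
def sphMonomial (l : ℝ) (a b : ℕ) (ζ : ℂ) : ℂ :=
  ζ ^ a * conj ζ ^ b * (((1 + ‖ζ‖ ^ 2) ^ (-l) : ℝ) : ℂ)

lemma contDiff_sphMonomial (l : ℝ) (a b : ℕ) : ContDiff ℝ ∞ (sphMonomial l a b) := by
  have h1 : ContDiff ℝ ∞ (fun ζ : ℂ => (1 + ‖ζ‖ ^ 2) ^ (-l)) :=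
    (contDiff_const.add (contDiff_norm_sq ℝ)).rpow_const_of_ne fun z => by positivity
  have h2 := contDiff_conj
  have h3 : ContDiff ℝ ∞ (fun ζ : ℂ => (((1 + ‖ζ‖ ^ 2) ^ (-l) : ℝ) : ℂ)) :=
    ofRealCLM.contDiff.comp h1
  unfold sphMonomial
  fun_prop

lemma hasWirt_sphMonomial (l : ℝ) (a b : ℕ) (ζ : ℂ) :
    HasWirt (sphMonomial l a b)
      ((1 + ζ * conj ζ)⁻¹ * (a * sphMonomial l (a - 1) b ζ + (a - l) * sphMonomial l a (b + 1) ζ))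
      ((1 + ζ * conj ζ)⁻¹ * (b * sphMonomial l a (b - 1) ζ + (b - l) * sphMonomial l (a + 1) b ζ))
      ζ := by
  have hD := one_add_mul_conj_ne_zero ζ
  have hpos : (0 : ℝ) < 1 + ‖ζ‖ ^ 2 := by positivity
  have hk : HasDerivAt (fun t : ℝ => (((1 + t) ^ (-l) : ℝ) : ℂ))
      (((1 * -l * (1 + ‖ζ‖ ^ 2) ^ (-l - 1) : ℝ)) : ℂ) (‖ζ‖ ^ 2) :=
    (((hasDerivAt_id (‖ζ‖ ^ 2)).const_add 1).rpow_const (Or.inl hpos.ne')).ofReal_comp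
  have h1 := (((HasWirt.id ζ).pow a).mul ((HasWirt.star ζ).pow b)).mul (HasWirt.normSq_fun hk)
  have hr : (((1 + ‖ζ‖ ^ 2) ^ (-l - 1) : ℝ) : ℂ) =
      (((1 + ‖ζ‖ ^ 2) ^ (-l) : ℝ) : ℂ) * (1 + ζ * conj ζ)⁻¹ := by
    rw [Real.rpow_sub_one hpos.ne', mul_conj, normSq_eq_norm_sq]; push_cast; ring
  refine h1.congr_val ?_ ?_
  · simp only [sphMonomial]
    push_cast at hr ⊢
    rw [hr]
    rcases a with _ | a
    · field_simp
      push_cast; ring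
    · simp only [Nat.add_sub_cancel]
      field_simp
      push_cast; ring
  · simp only [sphMonomial]
    push_cast at hr ⊢
    rw [hr]
    rcases b with _ | b
    · field_simp
      push_cast; ring
    · simp only [Nat.add_sub_cancel]
      field_simp
      push_cast; ring

lemma rot_sphMonomial (l : ℝ) (a b : ℕ) (ζ : ℂ) :
    rot (sphMonomial l a b) ζ = I * (a - b) * sphMonomial l a b ζ := by
  have hD := one_add_mul_conj_ne_zero ζ
  rw [rot_eq, (hasWirt_sphMonomial l a b ζ).dz_eq, (hasWirt_sphMonomial l a b ζ).dzb_eq]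
  have h1 : (a : ℂ) * sphMonomial l (a - 1) b ζ * ζ = a * sphMonomial l a b ζ := by
    rcases a with _ | a
    · simp
    · simp only [Nat.add_sub_cancel, sphMonomial]; ring
  have h2 : (b : ℂ) * sphMonomial l a (b - 1) ζ * conj ζ = b * sphMonomial l a b ζ := by
    rcases b with _ | b
    · simp
    · simp only [Nat.add_sub_cancel, sphMonomial]; ring
  have h3 : sphMonomial l a (b + 1) ζ = sphMonomial l a b ζ * conj ζ := by simp only [sphMonomial]; ring
  have h4 : sphMonomial l (a + 1) b ζ = sphMonomial l a b ζ * ζ := by simp only [sphMonomial]; ring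
  rw [h3, h4]
  field_simp
  linear_combination h1 - h2

lemma spinLaplacian_sphMonomial (n : ℤ) (l : ℝ) (a b : ℕ) (ζ : ℂ) :
    spinLaplacian n (sphMonomial l a b) ζ = (eigenvalue n l : ℂ) * sphMonomial l a b ζ
      - a * b * (sphMonomial l a b ζ + sphMonomial l (a - 1) (b - 1) ζ)
      - (l + spin n - a) * (l - spin n - b) * (sphMonomial l a b ζ + sphMonomial l (a + 1) (b + 1) ζ) := by
  have hD := one_add_mul_conj_ne_zero ζ
  have hdb : dzb (sphMonomial l a b) = fun ζ => (1 + ζ * conj ζ)⁻¹ *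
      (b * sphMonomial l a (b - 1) ζ + (b - l) * sphMonomial l (a + 1) b ζ) :=
    funext fun ζ => (hasWirt_sphMonomial l a b ζ).dzb_eq
  have hinv := HasWirt.comp_hol (F := fun z => z⁻¹) (g := fun z => 1 + z * conj z)
      (hasDerivAt_inv hD) ((HasWirt.const 1 ζ).add ((HasWirt.id ζ).mul (HasWirt.star ζ)))
  have hdd := (hinv.mul (((hasWirt_sphMonomial l a (b - 1) ζ).const_mul (b : ℂ)).add
    ((hasWirt_sphMonomial l (a + 1) b ζ).const_mul ((b : ℂ) - l)))).dz_eq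
  rw [← hdb] at hdd
  have h := rot_sphMonomial l a b ζ
  rw [rot_eq] at h
  have h' : ζ * dz (sphMonomial l a b) ζ - conj ζ * dzb (sphMonomial l a b) ζ =
      (a - b) * sphMonomial l a b ζ := by
    rw [mul_assoc] at h
    exact mul_left_cancel₀ I_ne_zero h
  rw [spinLaplacian_eq n ((contDiff_sphMonomial l a b).contDiffAt.of_le two_le_infty), h', hdd]
  have hb : (b : ℂ) * sphMonomial l a (b - 1 + 1) ζ = b * sphMonomial l a b ζ := by
    rcases b with _ | b <;> simp
  have hb2 : (b : ℂ) * (sphMonomial l a (b - 1) ζ * conj ζ) = b * sphMonomial l a b ζ := by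
    rcases b with _ | b
    · simp
    · simp only [Nat.add_sub_cancel, sphMonomial]; ring
  have h3 : sphMonomial l (a + 1) (b + 1) ζ = sphMonomial l a b ζ * (ζ * conj ζ) := by
    simp only [sphMonomial]; ring
  have h4 : sphMonomial l (a + 1) b ζ = sphMonomial l a b ζ * ζ := by simp only [sphMonomial]; ring
  simp only [Nat.add_sub_cancel, h3, h4, eigenvalue]
  push_cast
  generalize sphMonomial l a (b - 1 + 1) ζ = e1 at *
  generalize sphMonomial l a (b - 1) ζ = e2 at *
  generalize sphMonomial l (a - 1) (b - 1) ζ = e3 at *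
  generalize sphMonomial l a b ζ = e0 at *
  generalize conj ζ = c at *
  field_simp
  linear_combination (-((a : ℂ) - l)) * hb + hb2

/-- Signed products of binomial coefficients, the coefficients of the harmonics. -/
def harmonicCoeff (A B p q j : ℕ) : ℂ := (-1) ^ j * (A.choose (j + p) : ℂ) * (B.choose (j + q) : ℂ)

lemma choose_succ_mul (A a : ℕ) :
    (A.choose (a + 1) : ℂ) * (a + 1) = (A.choose a : ℂ) * ((A : ℂ) - a) := by
  rcases le_or_gt a A with h | h
  · rw [← Nat.cast_sub h]; exact_mod_cast Nat.choose_succ_right_eq A a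
  · rw [Nat.choose_eq_zero_of_lt h, Nat.choose_eq_zero_of_lt (by omega)]; simp

lemma harmonicCoeff_succ (A B p q j : ℕ) :
    harmonicCoeff A B p q (j + 1) * (((j + p : ℕ) : ℂ) + 1) * (((j + q : ℕ) : ℂ) + 1) =
      -(harmonicCoeff A B p q j * ((A : ℂ) - (j + p : ℕ)) * ((B : ℂ) - (j + q : ℕ))) := by
  have h1 := choose_succ_mul A (j + p)
  have h2 := choose_succ_mul B (j + q)
  simp only [harmonicCoeff, show j + 1 + p = j + p + 1 by ring, show j + 1 + q = j + q + 1 by ring, pow_succ]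
  linear_combination (-(-1) ^ j * (B.choose (j + q + 1) : ℂ) * (((j + q : ℕ) : ℂ) + 1)) * h1
    - (-1) ^ j * ((A.choose (j + p) : ℂ) * ((A : ℂ) - (j + p : ℕ))) * h2

/-- The component over the sphere minus the south pole of a harmonic, not normalised. -/
def harmonicFst (A B p q : ℕ) (ζ : ℂ) : ℂ := ∑ j ∈ Finset.range (A + B + 1),
  harmonicCoeff A B p q j * sphMonomial (((A : ℝ) + B) / 2) (j + p) (j + q) ζ

/-- The component over the sphere minus the north pole of a harmonic, not normalised. -/
def harmonicSnd (A B p q : ℕ) (ζ : ℂ) : ℂ := ∑ j ∈ Finset.range (A + B + 1),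
  harmonicCoeff A B p q j * sphMonomial (((A : ℝ) + B) / 2) (A - (j + p)) (B - (j + q)) ζ

lemma contDiff_harmonicFst (A B p q : ℕ) : ContDiff ℝ ∞ (harmonicFst A B p q) :=
  ContDiff.sum fun _ _ => contDiff_const.mul (contDiff_sphMonomial _ _ _)

lemma contDiff_harmonicSnd (A B p q : ℕ) : ContDiff ℝ ∞ (harmonicSnd A B p q) :=
  ContDiff.sum fun _ _ => contDiff_const.mul (contDiff_sphMonomial _ _ _)

lemma rot_sum {ι : Type*} (s : Finset ι) (c : ι → ℂ) {G : ι → ℂ → ℂ}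
    (hG : ∀ i ∈ s, ContDiff ℝ ∞ (G i)) (ζ : ℂ) :
    rot (fun z => ∑ i ∈ s, c i * G i z) ζ = ∑ i ∈ s, c i * rot (G i) ζ := by
  have h := HasWirt.sum (s := s) fun i hi => (hasWirt_of_contDiff (hG i hi) ζ).const_mul (c i)
  simp only [rot_eq, h.dz_eq, h.dzb_eq, Finset.mul_sum, ← Finset.sum_sub_distrib]
  exact Finset.sum_congr rfl fun i _ => by ring

lemma spinLaplacian_sum {ι : Type*} (n : ℤ) (s : Finset ι) (c : ι → ℂ) {G : ι → ℂ → ℂ}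
    (hG : ∀ i ∈ s, ContDiff ℝ ∞ (G i)) (ζ : ℂ) :
    spinLaplacian n (fun z => ∑ i ∈ s, c i * G i z) ζ = ∑ i ∈ s, c i * spinLaplacian n (G i) ζ := by
  have hs : ContDiff ℝ ∞ (fun z => ∑ i ∈ s, c i * G i z) :=
    ContDiff.sum fun i hi => contDiff_const.mul (hG i hi)
  have h := fun z => HasWirt.sum (s := s) fun i hi => (hasWirt_of_contDiff (hG i hi) z).const_mul (c i)
  have h2 : dz (dzb fun z => ∑ i ∈ s, c i * G i z) ζ = ∑ i ∈ s, c i * dz (dzb (G i)) ζ := by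
    rw [show (dzb fun z => ∑ i ∈ s, c i * G i z) = fun z => ∑ i ∈ s, c i * dzb (G i) z from
      funext fun z => (h z).dzb_eq]
    exact (HasWirt.sum (s := s) fun i hi =>
      (hasWirt_of_contDiff (contDiff_dzb (hG i hi)) ζ).const_mul (c i)).dz_eq
  rw [spinLaplacian_eq n (hs.contDiffAt.of_le two_le_infty), h2, (h ζ).dz_eq, (h ζ).dzb_eq]
  rw [Finset.sum_congr rfl fun i hi => congrArg (c i * ·)
    (spinLaplacian_eq n (ζ := ζ) ((hG i hi).contDiffAt.of_le two_le_infty))]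
  simp only [Finset.mul_sum, ← Finset.sum_sub_distrib, ← Finset.sum_add_distrib]
  exact Finset.sum_congr rfl fun i _ => by ring

lemma rot_harmonicFst (A B p q : ℕ) (ζ : ℂ) :
    rot (harmonicFst A B p q) ζ = I * ((p : ℂ) - q) * harmonicFst A B p q ζ := by
  unfold harmonicFst
  rw [rot_sum _ _ fun i _ => contDiff_sphMonomial _ _ _, Finset.mul_sum]
  refine Finset.sum_congr rfl fun j _ => ?_
  rw [rot_sphMonomial]; push_cast; ring

lemma rot_harmonicSnd (A B p q : ℕ) (ζ : ℂ) :
    rot (harmonicSnd A B p q) ζ = I * ((A : ℂ) - B - (p - q)) * harmonicSnd A B p q ζ := by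
  unfold harmonicSnd
  rw [rot_sum _ _ fun i _ => contDiff_sphMonomial _ _ _, Finset.mul_sum]
  refine Finset.sum_congr rfl fun j _ => ?_
  by_cases h : j + p ≤ A ∧ j + q ≤ B
  · rw [rot_sphMonomial, Nat.cast_sub h.1, Nat.cast_sub h.2]; push_cast; ring
  · have : harmonicCoeff A B p q j = 0 := by
      rw [not_and_or, not_le, not_le] at h
      rcases h with h | h <;> simp [harmonicCoeff, Nat.choose_eq_zero_of_lt h]
    rw [this]; ring

lemma spinLaplacian_harmonicFst {A B p q : ℕ} (hA : (A : ℝ) = l + spin n)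
    (hB : (B : ℝ) = l - spin n) (hpq : p * q = 0) (ζ : ℂ) :
    spinLaplacian n (harmonicFst A B p q) ζ = (eigenvalue n l : ℂ) * harmonicFst A B p q ζ := by
  have hl : ((A : ℝ) + B) / 2 = l := by rw [hA, hB]; ring
  have hAc : (A : ℂ) = l + spin n := by exact_mod_cast congrArg ((↑) : ℝ → ℂ) hA
  have hBc : (B : ℂ) = l - spin n := by exact_mod_cast congrArg ((↑) : ℝ → ℂ) hB
  unfold harmonicFst
  rw [spinLaplacian_sum _ _ _ fun i _ => contDiff_sphMonomial _ _ _, hl]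
  simp_rw [spinLaplacian_sphMonomial, ← hAc, ← hBc]
  set G : ℕ → ℂ := fun j => sphMonomial l (j + p) (j + q) ζ + sphMonomial l (j + p - 1) (j + q - 1) ζ
  have e : ∀ j, harmonicCoeff A B p q j * ((eigenvalue n l : ℂ) * sphMonomial l (j + p) (j + q) ζ
      - (j + p : ℕ) * (j + q : ℕ) * (sphMonomial l (j + p) (j + q) ζ + sphMonomial l (j + p - 1) (j + q - 1) ζ)
      - ((A : ℂ) - (j + p : ℕ)) * ((B : ℂ) - (j + q : ℕ)) *
        (sphMonomial l (j + p) (j + q) ζ + sphMonomial l (j + p + 1) (j + q + 1) ζ)) =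
      (eigenvalue n l : ℂ) * (harmonicCoeff A B p q j * sphMonomial l (j + p) (j + q) ζ)
      + (harmonicCoeff A B p q (j + 1) * ((j + 1 + p : ℕ) * (j + 1 + q : ℕ) * G (j + 1))
        - harmonicCoeff A B p q j * ((j + p : ℕ) * (j + q : ℕ) * G j)) := fun j => by
    have h1 := harmonicCoeff_succ A B p q j
    have h2 : G (j + 1) =
        sphMonomial l (j + p + 1) (j + q + 1) ζ + sphMonomial l (j + p) (j + q) ζ := by
      simp only [G, show j + 1 + p = j + p + 1 by ring, show j + 1 + q = j + q + 1 by ring, Nat.add_sub_cancel]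
    rw [h2, show j + 1 + p = j + p + 1 by ring, show j + 1 + q = j + q + 1 by ring]
    simp only [G]
    push_cast at h1 ⊢
    linear_combination (-(sphMonomial l (j + p) (j + q) ζ + sphMonomial l (j + p + 1) (j + q + 1) ζ)) * h1
  rw [Finset.sum_congr rfl fun j _ => e j, Finset.sum_add_distrib, ← Finset.mul_sum,
    Finset.sum_range_sub (fun j => harmonicCoeff A B p q j * ((j + p : ℕ) * (j + q : ℕ) * G j))]
  have z1 : harmonicCoeff A B p q (A + B + 1) = 0 := by
    simp [harmonicCoeff, Nat.choose_eq_zero_of_lt (show A < A + B + 1 + p by omega)]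
  have z2 : ((0 + p : ℕ) : ℂ) * ((0 + q : ℕ) : ℂ) = 0 := by
    rw [zero_add, zero_add]; exact_mod_cast hpq
  rw [z1, z2]; ring

lemma sphMonomial_inv {A B a b : ℕ} (hA : (A : ℝ) = l + spin n)
    (hB : (B : ℝ) = l - spin n) (ha : a ≤ A) (hb : b ≤ B) {ζ : ℂ} (hζ : ζ ≠ 0) :
    sphMonomial l (A - a) (B - b) ζ⁻¹ = transition n ζ * sphMonomial l a b ζ := by
  have hn : (0 : ℝ) < ‖ζ‖ := by simpa using hζ
  have hnc : ((‖ζ‖ : ℝ) : ℂ) ≠ 0 := by exact_mod_cast hn.ne'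
  have hc : conj ζ ≠ 0 := by simpa using hζ
  have hAB : (A : ℤ) - B = n := by
    have : ((A : ℝ) - B) = n := by rw [hA, hB, spin]; ring
    exact_mod_cast this
  have hpow : (((1 + ‖ζ⁻¹‖ ^ 2) ^ (-l) : ℝ) : ℂ) =
      (((1 + ‖ζ‖ ^ 2) ^ (-l) : ℝ) : ℂ) * (‖ζ‖ : ℂ) ^ (A + B) := by
    have h1 : (1 + ‖ζ⁻¹‖ ^ 2 : ℝ) = (1 + ‖ζ‖ ^ 2) * (‖ζ‖ ^ 2)⁻¹ := by
      rw [norm_inv]; field_simp; ring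
    have h2 : ((‖ζ‖ ^ 2)⁻¹ : ℝ) ^ (-l) = ‖ζ‖ ^ (A + B) := by
      rw [Real.rpow_neg (by positivity), Real.inv_rpow (by positivity), inv_inv,
        ← Real.rpow_natCast, ← Real.rpow_natCast, ← Real.rpow_mul hn.le]
      congr 1; push_cast; rw [hA, hB]; ring
    rw [h1, Real.mul_rpow (by positivity) (by positivity), h2]; push_cast; ring
  have hcc : conj ζ = (‖ζ‖ : ℂ) ^ 2 / ζ := by
    rw [eq_div_iff hζ, mul_comm, mul_conj, normSq_eq_norm_sq]; push_cast; rfl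
  simp only [sphMonomial, hpow, transition, map_inv₀]
  rw [hcc, ← hAB, neg_sub, zpow_sub₀ (div_ne_zero hζ hnc)]
  simp only [zpow_natCast]
  obtain ⟨a', rfl⟩ := Nat.exists_eq_add_of_le ha
  obtain ⟨b', rfl⟩ := Nat.exists_eq_add_of_le hb
  simp only [Nat.add_sub_cancel_left]
  generalize ((‖ζ‖ : ℝ) : ℂ) = N at *
  simp only [div_pow, inv_pow]
  field_simp
  ring

lemma harmonic_glue {A B : ℕ} (p q : ℕ) (hA : (A : ℝ) = l + spin n)
    (hB : (B : ℝ) = l - spin n) {ζ : ℂ} (hζ : ζ ≠ 0) :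
    harmonicSnd A B p q ζ⁻¹ = transition n ζ * harmonicFst A B p q ζ := by
  have hl : ((A : ℝ) + B) / 2 = l := by rw [hA, hB]; ring
  unfold harmonicSnd harmonicFst
  rw [hl, Finset.mul_sum]
  refine Finset.sum_congr rfl fun j _ => ?_
  by_cases h : j + p ≤ A ∧ j + q ≤ B
  · rw [sphMonomial_inv hA hB h.1 h.2 hζ]; ring
  · have : harmonicCoeff A B p q j = 0 := by
      rw [not_and_or, not_le, not_le] at h
      rcases h with h | h <;> simp [harmonicCoeff, Nat.choose_eq_zero_of_lt h]
    rw [this]; ring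

lemma exists_harmonicFst_ne_zero {A B p q : ℕ} (hp : p ≤ A) (hq : q ≤ B) :
    ∃ ζ, harmonicFst A B p q ζ ≠ 0 := by
  by_contra! h
  set F : ℝ → ℂ := fun ρ => ∑ j ∈ Finset.range (A + B + 1), harmonicCoeff A B p q j * (ρ : ℂ) ^ (2 * j)
  have hF : Continuous F := by fun_prop
  have h1 : ∀ ρ ∈ ({0}ᶜ : Set ℝ), F ρ = 0 := fun ρ hρ => by
    have hρ : ρ ≠ 0 := hρ
    have hρc : (ρ : ℂ) ≠ 0 := by exact_mod_cast hρ
    have h2 := h ρ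
    unfold harmonicFst at h2
    have h3 : (((1 + ‖(ρ : ℂ)‖ ^ 2) ^ (-(((A : ℝ) + B) / 2)) : ℝ) : ℂ) ≠ 0 := by
      have : (0 : ℝ) < (1 + ‖(ρ : ℂ)‖ ^ 2) ^ (-(((A : ℝ) + B) / 2)) :=
        Real.rpow_pos_of_pos (by positivity) _
      exact_mod_cast this.ne'
    have h4 : (ρ : ℂ) ^ (p + q) * (((1 + ‖(ρ : ℂ)‖ ^ 2) ^ (-(((A : ℝ) + B) / 2)) : ℝ) : ℂ) * F ρ = 0 := by
      rw [← h2, Finset.mul_sum]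
      refine Finset.sum_congr rfl fun j _ => ?_
      simp only [sphMonomial, conj_ofReal]
      ring
    exact (mul_eq_zero.1 h4).resolve_left (mul_ne_zero (pow_ne_zero _ hρc) h3)
  have h2 : F = fun _ => 0 := Continuous.ext_on (dense_compl_singleton (0 : ℝ)) hF continuous_const h1
  have h3 := congrFun h2 0
  simp only [F, Finset.sum_range_succ' _ (A + B)] at h3
  simp [harmonicCoeff, Nat.mul_add] at h3
  rcases h3 with h3 | h3
  · exact (Nat.choose_pos hp).ne' h3
  · exact (Nat.choose_pos hq).ne' h3

/-- Spin-weighted spherical harmonics exist for all indices. -/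
theorem exists_isSpinHarmonic {l m : ℝ} (h : IsMode n l m) :
    ∃ f, IsSpinHarmonic n l m f := by
  obtain ⟨A, B, i, hA, hB, hi, hm⟩ := h.exists_nat
  set p := i - B
  set q := B - i
  have hpq : p * q = 0 := by
    rcases le_total i B with h | h
    · simp [p, Nat.sub_eq_zero_of_le h]
    · simp [q, Nat.sub_eq_zero_of_le h]
  have hk : (p : ℂ) - q = m + spin n := by
    have : (p : ℝ) - q = m + spin n := by
      rw [hm, show -l + (i : ℝ) + spin n = i - B by rw [hB]; ring]
      rcases le_total i B with h | h
      · simp only [p, q, Nat.sub_eq_zero_of_le h, Nat.cast_sub h]; simp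
      · simp only [p, q, Nat.sub_eq_zero_of_le h, Nat.cast_sub h]; simp
    exact_mod_cast congrArg ((↑) : ℝ → ℂ) this
  have hABc : (A : ℂ) - B = 2 * spin n := by
    have : (A : ℝ) - B = 2 * spin n := by rw [hA, hB]; ring
    exact_mod_cast congrArg ((↑) : ℝ → ℂ) this
  have hY : IsSmoothSection n (harmonicFst A B p q, harmonicSnd A B p q) :=
    ⟨contDiff_harmonicFst A B p q, contDiff_harmonicSnd A B p q, fun ζ hζ => harmonic_glue p q hA hB hζ⟩
  have hE : ∀ ζ, spinLaplacian n (harmonicFst A B p q) ζ = _ :=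
    spinLaplacian_harmonicFst hA hB hpq
  have hE2 : ∀ ζ, spinLaplacian n (harmonicSnd A B p q) ζ =
      (eigenvalue n l : ℂ) * harmonicSnd A B p q ζ := by
    have := Continuous.ext_on (dense_compl_singleton (0 : ℂ))
      (contDiff_spinLaplacian n hY.smooth_snd).continuous
      (continuous_const (y := (eigenvalue n l : ℂ)) |>.mul hY.smooth_snd.continuous) fun ζ hζ => by
        have hζ : ζ ≠ 0 := hζ
        have h1 := spinLaplacian_glue hY.smooth_fst hY.smooth_snd hY.glue (inv_ne_zero hζ)
        have h2 := hY.glue ζ⁻¹ (inv_ne_zero hζ)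
        simp only [inv_inv] at h1 h2
        simp only [h1, hE, Pi.mul_apply, h2]; ring
    exact fun ζ => congrFun this ζ
  set N : ℝ := ∫ ζ, ‖harmonicFst A B p q ζ‖ ^ 2 * (4 / (1 + ‖ζ‖ ^ 2) ^ 2) with hN
  have hint := hY.integrable_mul_conj hY
  have hcast : ∀ ζ, harmonicFst A B p q ζ * conj (harmonicFst A B p q ζ) * ((4 / (1 + ‖ζ‖ ^ 2) ^ 2 : ℝ) : ℂ) =
      ((‖harmonicFst A B p q ζ‖ ^ 2 * (4 / (1 + ‖ζ‖ ^ 2) ^ 2) : ℝ) : ℂ) := fun ζ => by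
    rw [mul_conj, normSq_eq_norm_sq]; push_cast; rfl
  have hNpos : 0 < N := by
    obtain ⟨ζ₀, h0⟩ := exists_harmonicFst_ne_zero (A := A) (B := B) (p := p) (q := q)
      (by omega) (by omega)
    have hcont : Continuous fun ζ => ‖harmonicFst A B p q ζ‖ ^ 2 * (4 / (1 + ‖ζ‖ ^ 2) ^ 2) :=
      (hY.smooth_fst.continuous.norm.pow 2).mul
        (Continuous.div (by fun_prop) (by fun_prop) fun x => by positivity)
    refine (integral_pos_iff_support_of_nonneg (fun z => by positivity) ?_).2
      (hcont.isOpen_support.measure_pos _ ⟨ζ₀, ?_⟩)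
    · refine hint.re.congr (Eventually.of_forall fun z => ?_)
      simp only [hcast]; exact ofReal_re _
    · have : 0 < ‖harmonicFst A B p q ζ₀‖ := norm_pos_iff.2 h0
      have : 0 < ‖harmonicFst A B p q ζ₀‖ ^ 2 * (4 / (1 + ‖ζ₀‖ ^ 2) ^ 2) := by positivity
      exact this.ne'
  have hSN : (((Real.sqrt N)⁻¹ : ℝ) : ℂ) * conj (((Real.sqrt N)⁻¹ : ℝ) : ℂ) * (N : ℂ) = 1 := by
    rw [conj_ofReal, ← ofReal_mul, ← ofReal_mul, ← mul_inv, Real.mul_self_sqrt hNpos.le,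
      inv_mul_cancel₀ hNpos.ne', ofReal_one]
  set c : ℂ := (((Real.sqrt N)⁻¹ : ℝ) : ℂ)
  have lap : ∀ {g : ℂ → ℂ}, ContDiff ℝ ∞ g → ∀ ζ,
      spinLaplacian n (fun z => c * g z) ζ = c * spinLaplacian n g ζ := fun hg ζ => by
    simpa using spinLaplacian_sum n {()} (fun _ => c) (G := fun _ => _) (fun _ _ => hg) ζ
  have hrot : ∀ {g : ℂ → ℂ}, ContDiff ℝ ∞ g → ∀ ζ,
      rot (fun z => c * g z) ζ = c * rot g ζ := fun hg ζ => by
    simpa using rot_sum {()} (fun _ => c) (G := fun _ => _) (fun _ _ => hg) ζ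
  refine ⟨(fun ζ => c * harmonicFst A B p q ζ, fun ζ => c * harmonicSnd A B p q ζ),
    ⟨contDiff_const.mul hY.smooth_fst, contDiff_const.mul hY.smooth_snd, fun ζ hζ => ?_⟩,
    fun ζ => ?_, fun ζ => ?_, fun ζ => ?_, fun ζ => ?_, ?_⟩
  · simp only [harmonic_glue p q hA hB hζ]; ring
  · simp only [lap hY.smooth_fst, hE]; ring
  · simp only [lap hY.smooth_snd, hE2]; ring
  · simp only [phiDeriv, hrot hY.smooth_fst, rot_harmonicFst, hk]; ring
  · simp only [phiDeriv, hrot hY.smooth_snd, rot_harmonicSnd, hk, hABc]; ring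
  · have h1 := sphereInner_const_mul c (harmonicFst A B p q) (fun ζ => c * harmonicFst A B p q ζ)
    have h2 : sphereInner (harmonicFst A B p q) (harmonicFst A B p q) = N := by
      unfold sphereInner areaIntegral
      simp_rw [hcast]
      exact integral_ofReal
    rw [sphereInner_mul_conj c (harmonicFst A B p q) (harmonicFst A B p q), h2] at h1
    refine h1.trans ?_
    rw [← hSN]; ring

end

/-! ## Radial test functions and the Mellin transform -/

/-- Smooth functions with compact support in `J ∩ (0,∞)`. -/
def radialTest (J : Set ℝ) : Submodule ℂ (ℝ → ℂ) where
  carrier := {φ | ContDiff ℝ ∞ φ ∧ ∃ K : Set ℝ, IsCompact K ∧ K ⊆ J ∩ Ioi 0 ∧ ∀ r, r ∉ K → φ r = 0}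
  add_mem' := by
    rintro v w ⟨hv, K, hK, hKJ, hvK⟩ ⟨hw, L, hL, hLJ, hwL⟩
    refine ⟨hv.add hw, K ∪ L, hK.union hL, union_subset hKJ hLJ, fun r hr => ?_⟩
    simp only [mem_union, not_or] at hr
    simp [hvK r hr.1, hwL r hr.2]
  zero_mem' := ⟨contDiff_const, ∅, isCompact_empty, by simp, fun _ _ => rfl⟩
  smul_mem' := by
    rintro c v ⟨hv, K, hK, hKJ, hvK⟩
    exact ⟨contDiff_const.smul hv, K, hK, hKJ, fun r hr => by simp [hvK r hr]⟩

lemma deriv_eq_zero_of_isOpen {f : ℝ → ℂ} {U : Set ℝ} (hU : IsOpen U) (h : ∀ x ∈ U, f x = 0) {r : ℝ}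
    (hr : r ∈ U) : deriv f r = 0 := by
  rw [EventuallyEq.deriv_eq (f := fun _ => 0) (eventually_of_mem (hU.mem_nhds hr) h), deriv_const]

namespace radialTest

variable {J : Set ℝ} {φ : ℝ → ℂ}

lemma mono {J' : Set ℝ} (hJ : J ⊆ J') (h : φ ∈ radialTest J) : φ ∈ radialTest J' := by
  obtain ⟨h1, K, hK, hKJ, h2⟩ := h
  exact ⟨h1, K, hK, fun x hx => ⟨hJ (hKJ hx).1, (hKJ hx).2⟩, h2⟩

lemma hasCompactSupport (h : φ ∈ radialTest J) : HasCompactSupport φ := by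
  obtain ⟨_, K, hK, _, h2⟩ := h
  exact HasCompactSupport.intro hK h2

/-- Multiplication by a function that is smooth near `J`. -/
lemma mul {a : ℝ → ℂ} {U : Set ℝ} (hU : IsOpen U) (ha : ContDiffOn ℝ ∞ a U)
    (hJ : J ∩ Ioi 0 ⊆ U) (h : φ ∈ radialTest J) : (fun r => a r * φ r) ∈ radialTest J := by
  obtain ⟨h1, K, hK, hKJ, h2⟩ := h
  refine ⟨contDiff_iff_contDiffAt.2 fun r => ?_, K, hK, hKJ, fun r hr => by simp [h2 r hr]⟩
  by_cases hr : r ∈ K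
  · exact (ha.contDiffAt (hU.mem_nhds (hJ (hKJ hr)))).mul h1.contDiffAt
  · exact (contDiffAt_const (c := 0)).congr_of_eventuallyEq
      (eventually_of_mem (hK.isClosed.isOpen_compl.mem_nhds hr) fun x hx => by simp [h2 x hx])

lemma smooth_mul {a : ℝ → ℂ} (ha : ContDiff ℝ ∞ a) (h : φ ∈ radialTest J) :
    (fun r => a r * φ r) ∈ radialTest J :=
  mul isOpen_univ ha.contDiffOn (subset_univ _) h

lemma deriv (h : φ ∈ radialTest J) : deriv φ ∈ radialTest J := by
  obtain ⟨h1, K, hK, hKJ, h2⟩ := h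
  refine ⟨(contDiff_infty_iff_deriv.1 h1).2, K, hK, hKJ, fun r hr => ?_⟩
  exact deriv_eq_zero_of_isOpen hK.isClosed.isOpen_compl h2 hr

lemma iteratedDeriv (h : φ ∈ radialTest J) (k : ℕ) : iteratedDeriv k φ ∈ radialTest J := by
  induction k with
  | zero => simpa using h
  | succ k ih => rw [iteratedDeriv_succ]; exact radialTest.deriv ih

/-- A compact interval in `(R,∞) ∩ (0,∞)` that contains the support. -/
lemma exists_Icc_Ioi {R : ℝ} (h : φ ∈ radialTest (Ioi R)) :
    ∃ a b : ℝ, R < a ∧ 0 < a ∧ a < b ∧ ∀ r, r ∉ Icc a b → φ r = 0 := by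
  obtain ⟨_, K, hK, hKJ, h2⟩ := h
  obtain ⟨b, hb⟩ := hK.bddAbove
  rcases K.eq_empty_or_nonempty with rfl | hne
  · exact ⟨max R 0 + 1, max R 0 + 2, by linarith [le_max_left R 0], by linarith [le_max_right R 0],
      by linarith, fun r _ => h2 r (by simp)⟩
  · have h3 := hKJ (hK.sInf_mem hne)
    refine ⟨sInf K, max b (sInf K + 1), h3.1, h3.2, lt_max_of_lt_right (by linarith), fun r hr => h2 r ?_⟩
    exact fun hrK => hr ⟨csInf_le hK.bddBelow hrK, (hb hrK).trans (le_max_left _ _)⟩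

lemma exists_Icc (h : φ ∈ radialTest J) :
    ∃ a b : ℝ, 0 < a ∧ a < b ∧ ∀ r, r ∉ Icc a b → φ r = 0 := by
  obtain ⟨h1, K, hK, hKJ, h2⟩ := h
  obtain ⟨a, b, h⟩ := exists_Icc_Ioi (R := 0) ⟨h1, K, hK, fun x hx => ⟨(hKJ hx).2, (hKJ hx).2⟩, h2⟩
  exact ⟨a, b, h.2⟩

lemma integrable (h : φ ∈ radialTest J) : Integrable φ :=
  h.1.continuous.integrable_of_hasCompactSupport (hasCompactSupport h)

lemma integrableOn_cpow_mul (h : φ ∈ radialTest J) (s : ℂ) :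
    IntegrableOn (fun r : ℝ => (r : ℂ) ^ s * φ r) (Ioi 0) := by
  refine (integrable (mul isOpen_Ioi (fun r hr => ContDiffAt.contDiffWithinAt ?_)
    inter_subset_right h)).integrableOn
  have h1 : ContDiffAt ℂ ∞ (fun z : ℂ => z ^ s) (r : ℂ) :=
    (AnalyticAt.cpow analyticAt_id analyticAt_const (ofReal_mem_slitPlane.2 hr)).contDiffAt
  exact (h1.restrict_scalars ℝ).comp r ofRealCLM.contDiff.contDiffAt

end radialTest

section
variable {n : ℤ} {J : Set ℝ} {w : SpacePair} {f : SpherePair}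

lemma mellin_eq (φ : ℝ → ℂ) (s : ℂ) : mellin φ s = ∫ r in Ioi (0 : ℝ), (r : ℂ) ^ (s - 1) * φ r := rfl

lemma mellin_deriv {φ : ℝ → ℂ} (h : φ ∈ radialTest J) (s : ℂ) :
    mellin (deriv φ) s = -(s - 1) * mellin φ (s - 1) := by
  obtain ⟨a, b, ha, _, hab⟩ := radialTest.exists_Icc h
  have key := integral_Ioi_mul_deriv_eq_deriv_mul (a := (0 : ℝ)) (a' := 0) (b' := 0)
    (u := fun r : ℝ => (r : ℂ) ^ (s - 1)) (v := φ) (u' := fun r : ℝ => (s - 1) * (r : ℂ) ^ (s - 1 - 1))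
    (v' := deriv φ)
    (fun r hr => by
      have h1 := (hasDerivAt_id (r : ℂ)).cpow_const (c := s - 1) (ofReal_mem_slitPlane.2 hr)
      simpa using! h1.comp_ofReal)
    (fun r _ => ((h.1.differentiable (by simp)) r).hasDerivAt)
    (radialTest.integrableOn_cpow_mul (radialTest.deriv h) _)
    (by
      have := (radialTest.integrableOn_cpow_mul h (s - 1 - 1)).const_mul (s - 1)
      exact IntegrableOn.congr_fun (s := Ioi (0 : ℝ)) this (fun r _ => by simp [mul_assoc])
        measurableSet_Ioi)
    (by
      refine tendsto_const_nhds.congr' ?_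
      filter_upwards [nhdsWithin_le_nhds (Iio_mem_nhds ha)] with r hr
      simp [hab r fun h => not_lt.2 h.1 hr])
    (by
      refine tendsto_const_nhds.congr' ?_
      filter_upwards [Ioi_mem_atTop b] with r hr
      simp [hab r fun h => not_lt.2 h.2 hr])
  rw [mellin_eq, key, mellin_eq, ← integral_const_mul]
  simp only [sub_zero, zero_sub, ← integral_neg]
  refine setIntegral_congr_fun measurableSet_Ioi fun r _ => ?_
  ring

lemma mellin_iteratedDeriv {φ : ℝ → ℂ} (h : φ ∈ radialTest J) (k : ℕ) (s : ℂ) :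
    mellin (iteratedDeriv k φ) s = (∏ i ∈ Finset.range k, -(s - 1 - i)) * mellin φ (s - k) := by
  induction k generalizing s with
  | zero => simp
  | succ k ih =>
    rw [iteratedDeriv_succ, mellin_deriv (radialTest.iteratedDeriv h k), ih, Finset.prod_range_succ']
    rw [show s - ((k + 1 : ℕ) : ℂ) = s - 1 - k by push_cast; ring]
    have : ∀ i ∈ Finset.range k, -(s - 1 - 1 - (i : ℂ)) = -(s - 1 - ((i + 1 : ℕ) : ℂ)) :=
      fun i _ => by push_cast; ring
    rw [Finset.prod_congr rfl this]
    simp; ring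

lemma mellin_mul_deriv {φ : ℝ → ℂ} (h : φ ∈ radialTest J) (s : ℂ) :
    mellin (fun r => (r : ℂ) * deriv φ r) s = -s * mellin φ s := by
  have := mellin_deriv h (s + 1)
  rw [add_sub_cancel_right] at this
  rw [← this, mellin_eq, mellin_eq]
  refine setIntegral_congr_fun measurableSet_Ioi fun r hr => ?_
  have hr0 : (r : ℂ) ≠ 0 := by exact_mod_cast (ne_of_gt hr : r ≠ 0)
  simp only [add_sub_cancel_right]
  rw [← mul_assoc, Complex.cpow_sub _ _ hr0, cpow_one, div_mul_cancel₀ _ hr0]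

/-! ## Operations on test sections -/

/-- The product of a radial function and a section over the sphere. -/
def tensor (φ : ℝ → ℂ) (f : SpherePair) : SpacePair :=
  (fun p => φ p.1 * f.1 p.2, fun p => φ p.1 * f.2 p.2)

lemma tensor_mem {φ : ℝ → ℂ} (hφ : φ ∈ radialTest J)
    (hf : IsSmoothSection n f) : tensor φ f ∈ testSections n J := by
  obtain ⟨h1, K, hK, hKJ, h2⟩ := hφ
  refine ⟨(h1.comp contDiff_fst).mul (hf.smooth_fst.comp contDiff_snd),
    (h1.comp contDiff_fst).mul (hf.smooth_snd.comp contDiff_snd), fun r ζ hζ => ?_, K, hK, hKJ,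
    fun r hr ζ => by simp [tensor, h2 r hr]⟩
  simp only [tensor, hf.glue ζ hζ]; ring

lemma testSections.section (hw : w ∈ testSections n J) (r : ℝ) :
    IsSmoothSection n (fun ζ => w.1 (r, ζ), fun ζ => w.2 (r, ζ)) :=
  ⟨hw.1.comp (contDiff_const.prodMk contDiff_id), hw.2.1.comp (contDiff_const.prodMk contDiff_id),
    fun ζ hζ => hw.2.2.1 r ζ hζ⟩

lemma testSections.bounded (hw : w ∈ testSections n J) :
    ∃ C, ∀ r ζ, ‖w.1 (r, ζ)‖ ≤ C := by
  obtain ⟨h1, h2, hg, K, hK, hKJ, h0⟩ := hw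
  obtain ⟨C₁, b₁⟩ := (hK.prod (isCompact_closedBall (0 : ℂ) 1)).exists_bound_of_continuousOn
    h1.continuous.continuousOn
  obtain ⟨C₂, b₂⟩ := (hK.prod (isCompact_closedBall (0 : ℂ) 1)).exists_bound_of_continuousOn
    h2.continuous.continuousOn
  refine ⟨max 0 (max C₁ C₂), fun r ζ => ?_⟩
  by_cases hr : r ∈ K
  · refine le_max_of_le_right ?_
    by_cases h : ‖ζ‖ ≤ 1
    · exact le_max_of_le_left (b₁ (r, ζ) ⟨hr, by simpa using h⟩)
    · have hζ : ζ ≠ 0 := by rintro rfl; simp at h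
      have := IsSmoothSection.norm_snd (n := n) (g := (fun ζ => w.1 (r, ζ), fun ζ => w.2 (r, ζ)))
        (hg r) hζ
      simp only at this
      rw [← this]
      refine le_max_of_le_right (b₂ (r, ζ⁻¹) ⟨hr, ?_⟩)
      simp only [mem_closedBall_zero_iff, norm_inv]
      exact inv_le_one_of_one_le₀ (not_le.1 h).le
  · rw [(h0 r hr ζ).1, norm_zero]; exact le_max_left _ _

lemma radialDeriv_eq {w : ℝ × ℂ → ℂ} (hw : ContDiff ℝ ∞ w) (p : ℝ × ℂ) :
    radialDeriv w p = fderiv ℝ w p (1, 0) := by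
  have h1 : HasDerivAt (fun r : ℝ => (r, p.2)) ((1 : ℝ), (0 : ℂ)) p.1 :=
    (hasDerivAt_id p.1).prodMk (hasDerivAt_const _ _)
  exact (((hw.differentiable (by simp)) p).hasFDerivAt.comp_hasDerivAt p.1 h1).deriv

lemma hasDerivAt_radial {w : ℝ × ℂ → ℂ} (hw : ContDiff ℝ ∞ w) (r : ℝ) (ζ : ℂ) :
    HasDerivAt (fun r => w (r, ζ)) (radialDeriv w (r, ζ)) r := by
  have h1 : HasDerivAt (fun r : ℝ => (r, ζ)) ((1 : ℝ), (0 : ℂ)) r :=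
    (hasDerivAt_id r).prodMk (hasDerivAt_const _ _)
  exact (((hw.differentiable (by simp)) (r, ζ)).hasFDerivAt.comp_hasDerivAt r
    h1).differentiableAt.hasDerivAt

lemma contDiff_radialDeriv {w : ℝ × ℂ → ℂ} (hw : ContDiff ℝ ∞ w) : ContDiff ℝ ∞ (radialDeriv w) := by
  rw [funext (radialDeriv_eq hw)]
  exact (hw.fderiv_right (m := ∞) (by simp)).clm_apply contDiff_const

/-- `∂_r` on pairs of components. -/
def radialDerivPair (w : SpacePair) : SpacePair := (radialDeriv w.1, radialDeriv w.2)

lemma radialDerivPair_mem (hw : w ∈ testSections n J) :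
    radialDerivPair w ∈ testSections n J := by
  obtain ⟨h1, h2, hg, K, hK, hKJ, h0⟩ := hw
  refine ⟨contDiff_radialDeriv h1, contDiff_radialDeriv h2, fun r ζ hζ => ?_, K, hK, hKJ, fun r hr ζ => ?_⟩
  · have : (fun r => w.2 (r, ζ⁻¹)) = fun r => transition n ζ * w.1 (r, ζ) :=
      funext fun r => hg r ζ hζ
    exact (hasDerivAt_radial h2 r ζ⁻¹).unique
      (this ▸ (hasDerivAt_radial h1 r ζ).const_mul (transition n ζ))
  · have hev := hK.isClosed.isOpen_compl.mem_nhds hr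
    exact ⟨(hasDerivAt_radial h1 r ζ).unique ((hasDerivAt_const r (0 : ℂ)).congr_of_eventuallyEq
        (eventually_of_mem hev fun x hx => (h0 x hx ζ).1)),
      (hasDerivAt_radial h2 r ζ).unique ((hasDerivAt_const r (0 : ℂ)).congr_of_eventuallyEq
        (eventually_of_mem hev fun x hx => (h0 x hx ζ).2))⟩

/-- Multiplication of pairs of components by a radial function. -/
def radialMul (a : ℝ → ℂ) (w : SpacePair) : SpacePair :=
  (fun p => a p.1 * w.1 p, fun p => a p.1 * w.2 p)

lemma radialMul_mem {a : ℝ → ℂ} {U : Set ℝ} (hU : IsOpen U)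
    (ha : ContDiffOn ℝ ∞ a U) (hJ : J ∩ Ioi 0 ⊆ U) (hw : w ∈ testSections n J) :
    radialMul a w ∈ testSections n J := by
  obtain ⟨h1, h2, hg, K, hK, hKJ, h0⟩ := hw
  have key : ∀ {g : ℝ × ℂ → ℂ}, ContDiff ℝ ∞ g → (∀ r, r ∉ K → ∀ ζ, g (r, ζ) = 0) →
      ContDiff ℝ ∞ (fun p : ℝ × ℂ => a p.1 * g p) := fun {g} hgs hg0 =>
    contDiff_iff_contDiffAt.2 fun p => by
      by_cases hr : p.1 ∈ K
      · exact ((ha.contDiffAt (hU.mem_nhds (hJ (hKJ hr)))).comp p contDiff_fst.contDiffAt).mul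
          hgs.contDiffAt
      · exact (contDiffAt_const (c := 0)).congr_of_eventuallyEq (eventually_of_mem
          ((hK.isClosed.isOpen_compl.preimage continuous_fst).mem_nhds hr) fun x hx =>
            mul_eq_zero_of_right _ (hg0 x.1 hx x.2))
  refine ⟨key h1 fun r hr ζ => (h0 r hr ζ).1, key h2 fun r hr ζ => (h0 r hr ζ).2,
    fun r ζ hζ => ?_, K, hK, hKJ, fun r hr ζ => ?_⟩
  · simp only [radialMul, hg r ζ hζ]; ring
  · simp [radialMul, h0 r hr ζ]

/-- The spin-weighted Laplacian on pairs of components over space. -/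
def laplacianPair (n : ℤ) (w : SpacePair) : SpacePair :=
  (fun p => spinLaplacian n (fun ζ => w.1 (p.1, ζ)) p.2, fun p => spinLaplacian n (fun ζ => w.2 (p.1, ζ)) p.2)

lemma contDiff_spinLaplacian_slice (n : ℤ) {w : ℝ × ℂ → ℂ} (hw : ContDiff ℝ ∞ w) :
    ContDiff ℝ ∞ (fun p : ℝ × ℂ => spinLaplacian n (fun ζ => w (p.1, ζ)) p.2) := by
  have slice : ∀ {w : ℝ × ℂ → ℂ}, ContDiff ℝ ∞ w → ∀ r : ℝ, ContDiff ℝ ∞ (fun ζ => w (r, ζ)) :=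
    fun hw r => hw.comp (contDiff_const.prodMk contDiff_id)
  have hfd : ∀ {w : ℝ × ℂ → ℂ}, ContDiff ℝ ∞ w → ∀ (p : ℝ × ℂ) (v : ℂ),
      fderiv ℝ (fun ζ => w (p.1, ζ)) p.2 v = fderiv ℝ w p (0, v) := fun {w} hw p v => by
    have h1 : HasFDerivAt (fun ζ : ℂ => (p.1, ζ)) (ContinuousLinearMap.inr ℝ ℝ ℂ) p.2 :=
      hasFDerivAt_prodMk_right p.1 p.2
    have h2 := (((hw.differentiable (by simp)) p).hasFDerivAt.comp p.2 h1).fderiv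
    rw [show (fun ζ => w (p.1, ζ)) = w ∘ fun ζ : ℂ => (p.1, ζ) from rfl, h2]
    simp
  set D1 : (ℝ × ℂ → ℂ) → ℝ × ℂ → ℂ := fun w p => (fderiv ℝ w p (0, 1) - I * fderiv ℝ w p (0, I)) / 2
    with hD1
  set D2 : (ℝ × ℂ → ℂ) → ℝ × ℂ → ℂ := fun w p => (fderiv ℝ w p (0, 1) + I * fderiv ℝ w p (0, I)) / 2
    with hD2
  have e1 : ∀ {w : ℝ × ℂ → ℂ}, ContDiff ℝ ∞ w → ∀ p : ℝ × ℂ,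
      dz (fun ζ => w (p.1, ζ)) p.2 = D1 w p := fun hw p => by
    simp only [dz, hfd hw, hD1]
  have e2 : ∀ {w : ℝ × ℂ → ℂ}, ContDiff ℝ ∞ w → ∀ p : ℝ × ℂ,
      dzb (fun ζ => w (p.1, ζ)) p.2 = D2 w p := fun hw p => by
    simp only [dzb, hfd hw, hD2]
  have s1 : ∀ {w : ℝ × ℂ → ℂ}, ContDiff ℝ ∞ w → ContDiff ℝ ∞ (D1 w) := fun hw => by
    have := hw.fderiv_right (m := ∞) (by simp)
    simp only [hD1]; fun_prop
  have s2 : ∀ {w : ℝ × ℂ → ℂ}, ContDiff ℝ ∞ w → ContDiff ℝ ∞ (D2 w) := fun hw => by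
    have := hw.fderiv_right (m := ∞) (by simp)
    simp only [hD2]; fun_prop
  have e3 : ∀ p : ℝ × ℂ, dz (dzb fun ζ => w (p.1, ζ)) p.2 = D1 (D2 w) p := fun p => by
    rw [← e1 (s2 hw)]
    congr 1
    exact funext fun ζ => e2 hw (p.1, ζ)
  have main : (fun p : ℝ × ℂ => spinLaplacian n (fun ζ => w (p.1, ζ)) p.2) = fun p =>
      -(1 + p.2 * conj p.2) ^ 2 * D1 (D2 w) p
      - (spin n : ℂ) * (1 + p.2 * conj p.2) * (p.2 * D1 w p - conj p.2 * D2 w p)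
      + (spin n : ℂ) ^ 2 * (p.2 * conj p.2) * w p := funext fun p => by
    rw [spinLaplacian_eq n ((slice hw p.1).contDiffAt.of_le two_le_infty), e3, e1 hw, e2 hw]
  rw [main]
  have hc : ContDiff ℝ ∞ (fun p : ℝ × ℂ => conj p.2) := contDiff_conj.comp contDiff_snd
  have := s1 hw
  have := s2 hw
  have := s1 (s2 hw)
  fun_prop

lemma spinLaplacian_zero (n : ℤ) (ζ : ℂ) : spinLaplacian n (fun _ => 0) ζ = 0 := by
  have := spinLaplacian_sum n (∅ : Finset ℕ) (fun _ => 0) (G := fun _ _ => 0)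
    (fun _ _ => contDiff_const) ζ
  simpa using this

lemma laplacianPair_mem (hw : w ∈ testSections n J) :
    laplacianPair n w ∈ testSections n J := by
  refine ⟨contDiff_spinLaplacian_slice n hw.1, contDiff_spinLaplacian_slice n hw.2.1,
    fun r ζ hζ => (testSections.section hw r).spinLaplacian.glue ζ hζ, ?_⟩
  obtain ⟨h1, h2, hg, K, hK, hKJ, h0⟩ := hw
  refine ⟨K, hK, hKJ, fun r hr ζ => ?_⟩
  simp only [laplacianPair, (h0 r hr _).1, (h0 r hr _).2, spinLaplacian_zero, and_self]

/-! ## Mode coefficients -/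

/-- The coefficient of `w` along `f`, a function of `r`. -/
def modeCoeff (w : SpacePair) (f : SpherePair) (r : ℝ) : ℂ := sphereInner (fun ζ => w.1 (r, ζ)) f.1

lemma mellinCoeff_eq (p : ℝ) (w : SpacePair) (f : SpherePair) (lam : ℝ) :
    mellinCoeff p w f lam = mellin (modeCoeff w f) (p + lam * I) := rfl

lemma hasDerivAt_modeCoeff {n n' : ℤ}
    (hw : w ∈ testSections n J) (hf : IsSmoothSection n' f) (r : ℝ) :
    HasDerivAt (modeCoeff w f) (modeCoeff (radialDerivPair w) f r) r := by
  obtain ⟨C, hC⟩ := testSections.bounded (radialDerivPair_mem hw)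
  obtain ⟨D, hD⟩ := hf.bounded
  have hint : ∀ {v : SpacePair}, v ∈ testSections n J → ∀ r : ℝ, Integrable (fun ζ =>
      v.1 (r, ζ) * conj (f.1 ζ) * ((4 / (1 + ‖ζ‖ ^ 2) ^ 2 : ℝ) : ℂ)) := fun hv r =>
    (testSections.section hv r).integrable_mul_conj hf
  have hC0 : 0 ≤ C := (norm_nonneg _).trans (hC 0 0)
  exact (hasDerivAt_integral_of_dominated_loc_of_deriv_le (𝕜 := ℝ)
    (F := fun r ζ => w.1 (r, ζ) * conj (f.1 ζ) * ((4 / (1 + ‖ζ‖ ^ 2) ^ 2 : ℝ) : ℂ))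
    (F' := fun r ζ => (radialDerivPair w).1 (r, ζ) * conj (f.1 ζ) * ((4 / (1 + ‖ζ‖ ^ 2) ^ 2 : ℝ) : ℂ))
    (bound := fun ζ => C * D * (4 / (1 + ‖ζ‖ ^ 2) ^ 2)) univ_mem
    (Eventually.of_forall fun r => (hint hw r).aestronglyMeasurable) (hint hw r)
    (hint (radialDerivPair_mem hw) r).aestronglyMeasurable
    (Eventually.of_forall fun ζ x _ => by
      rw [norm_mul, norm_mul, RCLike.norm_conj, norm_real, Real.norm_of_nonneg (by positivity)]
      gcongr
      · exact hC x ζ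
      · exact hD ζ)
    (integrable_area_weight.const_mul _)
    (Eventually.of_forall fun ζ x _ =>
      ((hasDerivAt_radial hw.1 x ζ).mul_const _).mul_const _)).2

lemma modeCoeff_mem {n n' : ℤ}
    (hw : w ∈ testSections n J) (hf : IsSmoothSection n' f) : modeCoeff w f ∈ radialTest J := by
  have key : ∀ (k : ℕ) {w : SpacePair}, w ∈ testSections n J → ContDiff ℝ k (modeCoeff w f) := by
    intro k
    induction k with
    | zero =>
      intro w hw
      exact contDiff_zero.2 (continuous_iff_continuousAt.2 fun r =>
        (hasDerivAt_modeCoeff hw hf r).continuousAt)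
    | succ k ih =>
      intro w hw
      rw [show ((k + 1 : ℕ) : WithTop ℕ∞) = (k : WithTop ℕ∞) + 1 by push_cast; rfl, contDiff_succ_iff_deriv]
      refine ⟨fun r => (hasDerivAt_modeCoeff hw hf r).differentiableAt, by simp, ?_⟩
      rw [show deriv (modeCoeff w f) = modeCoeff (radialDerivPair w) f from
        funext fun r => (hasDerivAt_modeCoeff hw hf r).deriv]
      exact ih (radialDerivPair_mem hw)
  refine ⟨contDiff_infty.2 fun k => key k hw, ?_⟩
  obtain ⟨_, _, _, K, hK, hKJ, h0⟩ := hw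
  refine ⟨K, hK, hKJ, fun r hr => ?_⟩
  simp [modeCoeff, sphereInner, areaIntegral, (h0 r hr _).1]

end

/-! ## Expansion of test sections into modes -/

section
variable {n : ℤ} {J : Set ℝ} {l m : ℝ} {f : SpherePair} {w : SpacePair}

lemma IsMode.nonneg (h : IsMode n l m) : 0 ≤ l := by
  obtain ⟨j, i, rfl, _⟩ := h
  positivity

lemma IsMode.eigenvalue_nonneg (h : IsMode n l m) : 0 ≤ eigenvalue n l := by
  obtain ⟨A, B, i, hA, hB, _⟩ := h.exists_nat
  rw [eigenvalue, ← hA, ← hB]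
  have := h.nonneg
  positivity

lemma modeCoeff_add {n' : ℤ} {v w : SpacePair} (hv : v ∈ testSections n J)
    (hw : w ∈ testSections n J) (hf : IsSmoothSection n' f) (r : ℝ) :
    modeCoeff (v + w) f r = modeCoeff v f r + modeCoeff w f r := by
  simp only [modeCoeff, sphereInner, areaIntegral]
  rw [← integral_add ((testSections.section hv r).integrable_mul_conj hf)
    ((testSections.section hw r).integrable_mul_conj hf)]
  congr 1; funext ζ
  simp only [Prod.fst_add, Pi.add_apply]; ring

lemma modeCoeff_smul (c : ℂ) (w : SpacePair) (f : SpherePair) (r : ℝ) :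
    modeCoeff (c • w) f r = c * modeCoeff w f r :=
  sphereInner_const_mul c (fun ζ => w.1 (r, ζ)) f.1

lemma modeCoeff_tensor (φ : ℝ → ℂ) (g f : SpherePair) (r : ℝ) :
    modeCoeff (tensor φ g) f r = φ r * sphereInner g.1 f.1 :=
  sphereInner_const_mul (φ r) g.1 f.1

lemma modeCoeff_radialMul (a : ℝ → ℂ) (w : SpacePair) (f : SpherePair) (r : ℝ) :
    modeCoeff (radialMul a w) f r = a r * modeCoeff w f r :=
  sphereInner_const_mul (a r) (fun ζ => w.1 (r, ζ)) f.1

lemma modeCoeff_laplacianPair (hw : w ∈ testSections n J)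
    (hf : IsSpinHarmonic n l m f) (r : ℝ) :
    modeCoeff (laplacianPair n w) f r = (eigenvalue n l : ℂ) * modeCoeff w f r := by
  have h := hf.sphereInner_spinLaplacian (testSections.section hw r)
  simpa only [modeCoeff, laplacianPair] using h

lemma mellin_add_of_mem {φ ψ : ℝ → ℂ} (hφ : φ ∈ radialTest J) (hψ : ψ ∈ radialTest J) (s : ℂ) :
    mellin (fun r => φ r + ψ r) s = mellin φ s + mellin ψ s := by
  simp only [mellin_eq, mul_add]
  exact integral_add (radialTest.integrableOn_cpow_mul hφ _)
    (radialTest.integrableOn_cpow_mul hψ _)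

lemma mellin_const_mul (c : ℂ) (φ : ℝ → ℂ) (s : ℂ) :
    mellin (fun r => c * φ r) s = c * mellin φ s := by
  simp only [mellin_eq, ← integral_const_mul]
  refine setIntegral_congr_fun measurableSet_Ioi fun r _ => ?_
  ring

lemma mellinCoeff_add {n' : ℤ} {v w : SpacePair} (hv : v ∈ testSections n J)
    (hw : w ∈ testSections n J) (hf : IsSmoothSection n' f) (p lam : ℝ) :
    mellinCoeff p (v + w) f lam = mellinCoeff p v f lam + mellinCoeff p w f lam := by
  rw [mellinCoeff_eq, mellinCoeff_eq, mellinCoeff_eq,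
    ← mellin_add_of_mem (modeCoeff_mem hv hf) (modeCoeff_mem hw hf)]
  congr 1
  exact funext fun r => modeCoeff_add hv hw hf r

lemma mellinCoeff_smul (c : ℂ) (w : SpacePair) (f : SpherePair) (p lam : ℝ) :
    mellinCoeff p (c • w) f lam = c * mellinCoeff p w f lam := by
  rw [mellinCoeff_eq, mellinCoeff_eq, ← mellin_const_mul]
  congr 1
  exact funext fun r => modeCoeff_smul c w f r

/-- The operator `r ∂_r + p`. -/
def eulerPair (p : ℝ) (w : SpacePair) : SpacePair :=
  radialMul (fun r => (r : ℂ)) (radialDerivPair w) + (p : ℂ) • w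

lemma radialMul_id_mem (hw : w ∈ testSections n J) :
    radialMul (fun r => (r : ℂ)) w ∈ testSections n J :=
  radialMul_mem isOpen_univ ofRealCLM.contDiff.contDiffOn (subset_univ _) hw

lemma eulerPair_mem (p : ℝ) (hw : w ∈ testSections n J) :
    eulerPair p w ∈ testSections n J :=
  (testSections n J).add_mem (radialMul_id_mem (radialDerivPair_mem hw))
    ((testSections n J).smul_mem _ hw)

lemma mellinCoeff_eulerPair {n' : ℤ} (hw : w ∈ testSections n J)
    (hf : IsSmoothSection n' f) (p lam : ℝ) :
    mellinCoeff p (eulerPair p w) f lam = -(lam * I) * mellinCoeff p w f lam := by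
  rw [eulerPair, mellinCoeff_add (radialMul_id_mem (radialDerivPair_mem hw))
    ((testSections n J).smul_mem _ hw) hf, mellinCoeff_smul, mellinCoeff_eq, mellinCoeff_eq]
  have h1 : modeCoeff (radialMul (fun r => (r : ℂ)) (radialDerivPair w)) f
      = fun r : ℝ => (r : ℂ) * deriv (modeCoeff w f) r := funext fun r => by
    rw [modeCoeff_radialMul, (hasDerivAt_modeCoeff hw hf r).deriv]
  rw [h1, mellin_mul_deriv (modeCoeff_mem hw hf)]
  ring

/-- The operator `1 - (r ∂_r + p)² + Δ^{[s]}`, whose symbol is `1 + λ² + eigenvalue`. -/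
def hbPair (n : ℤ) (p : ℝ) (w : SpacePair) : SpacePair :=
  w + ((-1 : ℂ) • eulerPair p (eulerPair p w) + laplacianPair n w)

lemma hbPair_mem (p : ℝ) (hw : w ∈ testSections n J) :
    hbPair n p w ∈ testSections n J :=
  (testSections n J).add_mem hw ((testSections n J).add_mem
    ((testSections n J).smul_mem _ (eulerPair_mem p (eulerPair_mem p hw))) (laplacianPair_mem hw))

lemma mellinCoeff_hbPair (hw : w ∈ testSections n J)
    (hf : IsSpinHarmonic n l m f) (p lam : ℝ) :
    mellinCoeff p (hbPair n p w) f lam = ((1 + lam ^ 2 + eigenvalue n l : ℝ) : ℂ) * mellinCoeff p w f lam := by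
  have hs := hf.isSmoothSection
  have he := eulerPair_mem p (eulerPair_mem p hw)
  have h1 : mellinCoeff p (laplacianPair n w) f lam = eigenvalue n l * mellinCoeff p w f lam := by
    rw [mellinCoeff_eq, mellinCoeff_eq, ← mellin_const_mul]
    congr 1
    exact funext fun r => modeCoeff_laplacianPair hw hf r
  rw [hbPair, mellinCoeff_add hw ((testSections n J).add_mem
    ((testSections n J).smul_mem _ he) (laplacianPair_mem hw)) hs,
    mellinCoeff_add ((testSections n J).smul_mem _ he) (laplacianPair_mem hw) hs,
    mellinCoeff_smul, mellinCoeff_eulerPair (eulerPair_mem p hw) hs,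
    mellinCoeff_eulerPair hw hs, h1]
  push_cast
  linear_combination (-(lam : ℂ) ^ 2 * mellinCoeff p w f lam) * I_sq

lemma mellinCoeff_bounded (hw : w ∈ testSections n J) (p : ℝ) :
    ∃ C, ∀ (l m : ℝ) (f : SpherePair), IsSpinHarmonic n l m f → ∀ lam, ‖mellinCoeff p w f lam‖ ≤ C := by
  obtain ⟨C, hC⟩ := testSections.bounded hw
  set W : ℝ := ∫ ζ : ℂ, (4 / (1 + ‖ζ‖ ^ 2) ^ 2 : ℝ)
  have hbd : ∀ (l m : ℝ) (f : SpherePair), IsSpinHarmonic n l m f → ∀ r,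
      ‖modeCoeff w f r‖ ≤ (C ^ 2 * W + 1) / 2 := fun l m f hf r => by
    have h1 : ∫ ζ : ℂ, ‖f.1 ζ‖ ^ 2 * (4 / (1 + ‖ζ‖ ^ 2) ^ 2) = 1 := by
      have := hf.normalized
      have e : (fun ζ : ℂ => f.1 ζ * conj (f.1 ζ) * ((4 / (1 + ‖ζ‖ ^ 2) ^ 2 : ℝ) : ℂ)) =
          fun ζ => ((‖f.1 ζ‖ ^ 2 * (4 / (1 + ‖ζ‖ ^ 2) ^ 2) : ℝ) : ℂ) := funext fun ζ => by
        rw [mul_conj, normSq_eq_norm_sq]; push_cast; ring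
      rw [areaIntegral, e, integral_complex_ofReal] at this
      exact_mod_cast this
    have h2 : Integrable (fun ζ : ℂ => ‖f.1 ζ‖ ^ 2 * (4 / (1 + ‖ζ‖ ^ 2) ^ 2)) := by
      by_contra h
      rw [integral_undef h] at h1
      exact one_ne_zero h1.symm
    have h3 := (integrable_area_weight.const_mul (C ^ 2)).add h2
    calc ‖modeCoeff w f r‖ ≤ ∫ ζ : ℂ, (C ^ 2 * (4 / (1 + ‖ζ‖ ^ 2) ^ 2) +
          ‖f.1 ζ‖ ^ 2 * (4 / (1 + ‖ζ‖ ^ 2) ^ 2)) / 2 := by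
          refine norm_integral_le_of_norm_le (h3.div_const 2) (Eventually.of_forall fun ζ => ?_)
          rw [norm_mul, norm_mul, RCLike.norm_conj, norm_real, Real.norm_of_nonneg (by positivity)]
          have h4 := hC r ζ
          have h5 : ‖w.1 (r, ζ)‖ * ‖f.1 ζ‖ ≤ (C ^ 2 + ‖f.1 ζ‖ ^ 2) / 2 := by
            nlinarith [sq_nonneg (C - ‖f.1 ζ‖), norm_nonneg (f.1 ζ)]
          have h6 : (0 : ℝ) ≤ 4 / (1 + ‖ζ‖ ^ 2) ^ 2 := by positivity
          nlinarith
      _ = (C ^ 2 * W + 1) / 2 := by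
          rw [integral_div, integral_add (integrable_area_weight.const_mul (C ^ 2)) h2, h1, integral_const_mul]
  obtain ⟨_, _, _, K, hK, hKJ, h0⟩ := hw
  have hKpos : ∀ r ∈ K, 0 < r := fun r hr => (hKJ hr).2
  have hcont : ContinuousOn (fun r : ℝ => r ^ (p - 1) * ((C ^ 2 * W + 1) / 2)) K :=
    (continuousOn_id.rpow_const fun r hr => Or.inl (hKpos r hr).ne').mul continuousOn_const
  refine ⟨∫ r in K, r ^ (p - 1) * ((C ^ 2 * W + 1) / 2), fun l m f hf lam => ?_⟩
  have e : mellinCoeff p w f lam =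
      ∫ r in K, (r : ℂ) ^ ((p : ℂ) + lam * I - 1) * modeCoeff w f r := by
    rw [mellinCoeff]
    refine setIntegral_eq_of_subset_of_forall_sdiff_eq_zero measurableSet_Ioi
      (fun r hr => hKpos r hr) fun r hr => ?_
    simp [areaIntegral, (h0 r hr.2 _).1]
  rw [e]
  refine norm_integral_le_of_norm_le (hcont.integrableOn_compact hK) ?_
  refine (ae_restrict_iff' hK.measurableSet).2 (Eventually.of_forall fun r hr => ?_)
  rw [norm_mul, norm_cpow_eq_rpow_re_of_pos (hKpos r hr)]
  simp only [sub_re, add_re, ofReal_re, mul_re, I_re, mul_zero, ofReal_im, I_im, mul_one, sub_self,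
    add_zero, one_re]
  exact mul_le_mul_of_nonneg_left (hbd l m f hf r) (Real.rpow_nonneg (hKpos r hr).le _)

lemma mellinCoeff_decay (hw : w ∈ testSections n J) (p : ℝ) (N : ℕ) :
    ∃ C, ∀ (l m : ℝ) (f : SpherePair), IsMode n l m → IsSpinHarmonic n l m f → ∀ lam,
      ‖mellinCoeff p w f lam‖ * (1 + lam ^ 2 + eigenvalue n l) ^ N ≤ C := by
  induction N generalizing w with
  | zero =>
    obtain ⟨C, hC⟩ := mellinCoeff_bounded hw p
    exact ⟨C, fun l m f _ hf lam => by simpa using hC l m f hf lam⟩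
  | succ N ih =>
    obtain ⟨C, hC⟩ := ih (hbPair_mem p hw)
    refine ⟨C, fun l m f hm hf lam => le_trans (le_of_eq ?_) (hC l m f hm hf lam)⟩
    have := hm.eigenvalue_nonneg
    rw [mellinCoeff_hbPair hw hf, norm_mul, norm_real, Real.norm_of_nonneg (by positivity)]
    ring

/-- The contribution of one mode to the norm. -/
def modeNormSq (n : ℤ) (k p : ℝ) (w : SpacePair) (l m : ℝ) : ℝ≥0∞ :=
  ⨆ (f : SpherePair) (_ : IsSpinHarmonic n l m f), ∫⁻ lam : ℝ, ENNReal.ofReal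
    ((1 + lam ^ 2 + eigenvalue n l) ^ k * ‖mellinCoeff p w f lam‖ ^ 2)

lemma hbNormSq_eq (n : ℤ) (k p : ℝ) (w : SpacePair) :
    hbNormSq n k p w = ∑' lm : {lm : ℝ × ℝ // IsMode n lm.1 lm.2}, modeNormSq n k p w lm.1.1 lm.1.2 := rfl

lemma mellinCoeff_phase {f f' : SpherePair} {c : ℂ} (h : ∀ ζ, f'.1 ζ = c * f.1 ζ) (p : ℝ)
    (w : SpacePair) (lam : ℝ) : mellinCoeff p w f' lam = conj c * mellinCoeff p w f lam := by
  rw [mellinCoeff_eq, mellinCoeff_eq, ← mellin_const_mul]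
  congr 1
  funext r
  rw [modeCoeff, funext h, sphereInner_mul_conj]
  rfl

lemma modeNormSq_eq (hf : IsSpinHarmonic n l m f) (k p : ℝ) (w : SpacePair) :
    modeNormSq n k p w l m = ∫⁻ lam : ℝ, ENNReal.ofReal
      ((1 + lam ^ 2 + eigenvalue n l) ^ k * ‖mellinCoeff p w f lam‖ ^ 2) := by
  refine le_antisymm (iSup₂_le fun f' hf' => ?_) (le_iSup₂_of_le f hf le_rfl)
  obtain ⟨c, hc, h⟩ := hf.unique hf'
  refine le_of_eq (lintegral_congr fun lam => ?_)
  rw [mellinCoeff_phase h, norm_mul, RCLike.norm_conj, hc, one_mul]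

lemma tsum_modes_ne_top (n : ℤ) :
    ∑' lm : {lm : ℝ × ℝ // IsMode n lm.1 lm.2},
      ENNReal.ofReal ((1 + eigenvalue n lm.1.1) ^ (-(2 : ℝ))) ≠ ⊤ := by
  classical
  choose j i hl hi hm using fun lm : {lm : ℝ × ℝ // IsMode n lm.1 lm.2} => lm.2
  have hinj : Function.Injective fun lm => (j lm, i lm) := fun x y hxy => by
    simp only [Prod.mk.injEq] at hxy
    have h1 : x.1.1 = y.1.1 := by rw [hl x, hl y, hxy.1]
    exact Subtype.ext (Prod.ext h1 (by rw [hm x, hm y, h1, hxy.2]))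
  set D : ℝ := 2 + 2 * |spin n|
  have hD : 0 < D := by positivity
  set g : ℕ × ℕ → ℝ≥0∞ := fun x =>
    ENNReal.ofReal (4 * D ^ 2 * (((1 : ℝ) + x.1) ^ (-(2 : ℝ)) * (1 + x.2) ^ (-(2 : ℝ))))
  have hle : ∀ lm : {lm : ℝ × ℝ // IsMode n lm.1 lm.2},
      ENNReal.ofReal ((1 + eigenvalue n lm.1.1) ^ (-(2 : ℝ))) ≤ g (j lm, i lm) := fun lm => by
    refine ENNReal.ofReal_le_ofReal ?_
    have hs := abs_nonneg (spin n)
    have he : eigenvalue n lm.1.1 = 2 * |spin n| * j lm + j lm ^ 2 + |spin n| + j lm := by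
      rw [eigenvalue, hl lm]
      have := sq_abs (spin n)
      linear_combination this
    have h1 : (1 + j lm : ℝ) ^ 2 ≤ 2 * (1 + eigenvalue n lm.1.1) := by
      rw [he]
      nlinarith [mul_nonneg hs (Nat.cast_nonneg (α := ℝ) (j lm)), sq_nonneg ((j lm : ℝ)),
        Nat.cast_nonneg (α := ℝ) (j lm)]
    have h2 : (1 + i lm : ℝ) ≤ D * (1 + j lm) := by
      have := hi lm
      rw [hl lm] at this
      simp only [D]
      nlinarith [mul_nonneg hs (Nat.cast_nonneg (α := ℝ) (j lm)), Nat.cast_nonneg (α := ℝ) (j lm)]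
    have h0 : 0 < 1 + eigenvalue n lm.1.1 := by linarith [lm.2.eigenvalue_nonneg]
    have hj : (0 : ℝ) < 1 + j lm := by positivity
    have hi' : (0 : ℝ) < 1 + i lm := by positivity
    simp only [Real.rpow_neg h0.le, Real.rpow_neg hj.le, Real.rpow_neg hi'.le, Real.rpow_two]
    rw [← mul_inv, ← div_eq_mul_inv, inv_eq_one_div, div_le_div_iff₀ (by positivity) (by positivity), one_mul]
    have h3 : (1 + i lm : ℝ) ^ 2 ≤ D ^ 2 * (1 + j lm) ^ 2 := by
      rw [← mul_pow]; exact pow_le_pow_left₀ hi'.le h2 2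
    calc (1 + j lm : ℝ) ^ 2 * (1 + i lm) ^ 2 ≤ (1 + j lm : ℝ) ^ 2 * (D ^ 2 * (1 + j lm) ^ 2) := by
          gcongr
      _ = D ^ 2 * ((1 + j lm : ℝ) ^ 2 * (1 + j lm : ℝ) ^ 2) := by ring
      _ ≤ D ^ 2 * (2 * (1 + eigenvalue n lm.1.1) * (2 * (1 + eigenvalue n lm.1.1))) := by gcongr
      _ = _ := by ring
  have hsum : Summable fun x : ℕ × ℕ =>
      4 * D ^ 2 * (((1 : ℝ) + x.1) ^ (-(2 : ℝ)) * (1 + x.2) ^ (-(2 : ℝ))) := by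
    have h1 : Summable fun x : ℕ => ((1 : ℝ) + x) ^ (-(2 : ℝ)) := by
      have h := (summable_nat_add_iff 1).2 (Real.summable_nat_rpow.2 (by norm_num : -(2 : ℝ) < -1))
      refine h.congr fun x => ?_
      push_cast; rw [add_comm]
    exact (h1.mul_of_nonneg h1 (fun x => by positivity) (fun x => by positivity)).mul_left _
  refine ne_top_of_le_ne_top ?_ ((ENNReal.tsum_le_tsum hle).trans
    (ENNReal.tsum_comp_le_tsum_of_injective hinj g))
  exact hsum.tsum_ofReal_ne_top

lemma hbNormSq_ne_top (hw : w ∈ testSections n J) (k p : ℝ) :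
    hbNormSq n k p w ≠ ⊤ := by
  obtain ⟨N, hN⟩ := exists_nat_ge ((k + 3) / 2)
  obtain ⟨C, hC⟩ := mellinCoeff_decay hw p N
  have hint : ∫⁻ lam : ℝ, ENNReal.ofReal ((1 + lam ^ 2)⁻¹) ≠ ⊤ := by
    rw [← ofReal_integral_eq_lintegral_ofReal integrable_inv_one_add_sq
      (Eventually.of_forall fun x => by positivity)]
    exact ENNReal.ofReal_ne_top
  have hle : ∀ lm : {lm : ℝ × ℝ // IsMode n lm.1 lm.2}, modeNormSq n k p w lm.1.1 lm.1.2 ≤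
      ENNReal.ofReal (C ^ 2) * (∫⁻ lam : ℝ, ENNReal.ofReal ((1 + lam ^ 2)⁻¹)) *
        ENNReal.ofReal ((1 + eigenvalue n lm.1.1) ^ (-(2 : ℝ))) := fun lm => by
    obtain ⟨f, hf⟩ := exists_isSpinHarmonic lm.2
    have he := lm.2.eigenvalue_nonneg
    rw [modeNormSq_eq hf, ← lintegral_const_mul' _ _ ENNReal.ofReal_ne_top,
      ← lintegral_mul_const' _ _ ENNReal.ofReal_ne_top]
    refine lintegral_mono fun lam => ?_
    rw [← ENNReal.ofReal_mul (by positivity), ← ENNReal.ofReal_mul (by positivity)]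
    refine ENNReal.ofReal_le_ofReal ?_
    set E := 1 + lam ^ 2 + eigenvalue n lm.1.1 with hE
    have hE1 : 1 ≤ E := by nlinarith [sq_nonneg lam]
    have hE0 : 0 < E := by linarith
    have h1 := hC _ _ f lm.2 hf lam
    rw [← hE] at h1
    have h2 : ‖mellinCoeff p w f lam‖ ^ 2 * E ^ (2 * N) ≤ C ^ 2 := by
      rw [pow_mul' E 2 N, ← mul_pow]
      exact pow_le_pow_left₀ (by positivity) h1 2
    have h3 : E ^ k ≤ E ^ (2 * N) * E ^ (-(3 : ℝ)) := by
      rw [← Real.rpow_natCast, ← Real.rpow_add hE0]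
      refine Real.rpow_le_rpow_of_exponent_le hE1 ?_
      push_cast; linarith
    have h4 : E ^ (-(3 : ℝ)) ≤ (1 + lam ^ 2)⁻¹ * (1 + eigenvalue n lm.1.1) ^ (-(2 : ℝ)) := by
      rw [show (-(3 : ℝ)) = -1 + -2 by norm_num, Real.rpow_add hE0, Real.rpow_neg_one]
      refine mul_le_mul (inv_anti₀ (by positivity) (by linarith)) ?_ (by positivity) (by positivity)
      exact Real.rpow_le_rpow_of_nonpos (by positivity) (by nlinarith [sq_nonneg lam]) (by norm_num)
    calc E ^ k * ‖mellinCoeff p w f lam‖ ^ 2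
        ≤ E ^ (2 * N) * E ^ (-(3 : ℝ)) * ‖mellinCoeff p w f lam‖ ^ 2 := by gcongr
      _ = ‖mellinCoeff p w f lam‖ ^ 2 * E ^ (2 * N) * E ^ (-(3 : ℝ)) := by ring
      _ ≤ C ^ 2 * ((1 + lam ^ 2)⁻¹ * (1 + eigenvalue n lm.1.1) ^ (-(2 : ℝ))) := by gcongr
      _ = _ := by ring
  rw [hbNormSq_eq]
  refine ne_top_of_le_ne_top ?_ (ENNReal.tsum_le_tsum hle)
  rw [ENNReal.tsum_mul_left]
  exact ENNReal.mul_ne_top (ENNReal.mul_ne_top ENNReal.ofReal_ne_top hint) (tsum_modes_ne_top n)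

end

section
variable {n : ℤ} {J : Set ℝ} {l m : ℝ} {f : SpherePair} {k p : ℝ}

lemma testSections_le (n : ℤ) (J : Set ℝ) : testSections n J ≤ testSections n (Ioi 0) := by
  rintro w ⟨h1, h2, hg, K, hK, hKJ, h0⟩
  exact ⟨h1, h2, hg, K, hK, fun x hx => ⟨(hKJ hx).2, (hKJ hx).2⟩, h0⟩

lemma testSections_mono (n : ℤ) {J J' : Set ℝ} (h : J ⊆ J') : testSections n J ≤ testSections n J' := by
  rintro w ⟨h1, h2, hg, K, hK, hKJ, h0⟩
  exact ⟨h1, h2, hg, K, hK, fun x hx => ⟨h (hKJ hx).1, (hKJ hx).2⟩, h0⟩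

lemma radialTest_le (J : Set ℝ) : radialTest J ≤ radialTest (Ioi 0) := by
  rintro w ⟨h1, K, hK, hKJ, h0⟩
  exact ⟨h1, K, hK, fun x hx => ⟨(hKJ hx).2, (hKJ hx).2⟩, h0⟩

/-- The product of radial test functions with a section over the sphere. -/
def tensorTest (J : Set ℝ) (hf : IsSmoothSection n f) :
    radialTest J →ₗ[ℂ] testSections n J where
  toFun φ := ⟨tensor φ f, tensor_mem φ.2 hf⟩
  map_add' φ ψ := Subtype.ext (Prod.ext
    (funext fun p => by simp [tensor, add_mul]) (funext fun p => by simp [tensor, add_mul]))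
  map_smul' c φ := Subtype.ext (Prod.ext
    (funext fun p => by simp [tensor, mul_assoc]) (funext fun p => by simp [tensor, mul_assoc]))

/-- The coefficient along `f` as a radial test function. -/
def coeffTest {n' : ℤ} (hf : IsSmoothSection n' f) :
    testSections n J →ₗ[ℂ] radialTest J where
  toFun w := ⟨modeCoeff w f, modeCoeff_mem w.2 hf⟩
  map_add' v w := Subtype.ext (funext fun r => modeCoeff_add v.2 w.2 hf r)
  map_smul' c w := Subtype.ext (funext fun r => modeCoeff_smul c w f r)

lemma coeffTest_tensorTest_self (hf : IsSpinHarmonic n l m f) (φ : radialTest J) :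
    coeffTest hf.isSmoothSection (tensorTest J hf.isSmoothSection φ) = φ :=
  Subtype.ext (funext fun r => by
    change modeCoeff (tensor φ f) f r = _
    rw [modeCoeff_tensor, sphereInner_self hf, mul_one])

lemma coeffTest_tensorTest_of_ne {l' m' : ℝ} {f f' : SpherePair} (hf : IsSpinHarmonic n l m f)
    (hf' : IsSpinHarmonic n l' m' f') (hl : 0 ≤ l) (hl' : 0 ≤ l') (h : (l, m) ≠ (l', m'))
    (φ : radialTest J) :
    coeffTest hf.isSmoothSection (tensorTest J hf'.isSmoothSection φ) = 0 :=
  Subtype.ext (funext fun r => by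
    change modeCoeff (tensor φ f') f r = 0
    rw [modeCoeff_tensor, sphereInner_eq_zero hl hl' hf hf' h, mul_zero])

/-- The square of the Sobolev norm of a radial function of weight `p`, on the Mellin side. -/
notation "𝓜²(" φ "," e "," k "," p ")" =>
  ∫⁻ lam : ℝ, ENNReal.ofReal ((1 + lam ^ 2 + e) ^ k * ‖mellin φ (p + lam * I)‖ ^ 2)

lemma modeNormSq_eq_coeffTest (hf : IsSpinHarmonic n l m f) (k p : ℝ)
    (w : testSections n J) :
    modeNormSq n k p w l m = 𝓜²((coeffTest hf.isSmoothSection w : ℝ → ℂ), eigenvalue n l, k, p) :=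
  modeNormSq_eq hf k p w

/-- The indices of the modes. -/
abbrev Modes (n : ℤ) : Type := {lm : ℝ × ℝ // IsMode n lm.1 lm.2}

/-- The part of a test section along one mode. -/
def modePart (hf : IsSmoothSection n f) : testSections n J →ₗ[ℂ] testSections n J :=
  (tensorTest J hf).comp (coeffTest hf)

lemma modeNormSq_sub_sum {f : Modes n → SpherePair}
    (hf : ∀ p : Modes n, IsSpinHarmonic n p.1.1 p.1.2 (f p)) (w : testSections n J)
    (S : Finset (Modes n)) (k p : ℝ) (lm : Modes n) :
    modeNormSq n k p ((w - ∑ q ∈ S, modePart (hf q).isSmoothSection w : testSections n J) : SpacePair)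
        lm.1.1 lm.1.2 =
      ({x | x ∉ S} : Set (Modes n)).indicator (fun x => modeNormSq n k p w x.1.1 x.1.2) lm := by
  classical
  have hcoeff : coeffTest (hf lm).isSmoothSection (w - ∑ q ∈ S, modePart (hf q).isSmoothSection w) =
      if lm ∈ S then 0 else coeffTest (hf lm).isSmoothSection w := by
    have h1 : ∀ q : Modes n, coeffTest (hf lm).isSmoothSection (modePart (hf q).isSmoothSection w) =
        if lm = q then coeffTest (hf lm).isSmoothSection w else 0 := fun q => by
      by_cases h : lm = q
      · subst h
        rw [if_pos rfl]
        exact coeffTest_tensorTest_self (hf lm) _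
      · rw [if_neg h]
        exact coeffTest_tensorTest_of_ne (hf lm) (hf q) lm.2.nonneg q.2.nonneg
          (fun h' => h (Subtype.ext h')) _
    rw [map_sub, map_sum, Finset.sum_congr rfl fun q _ => h1 q, Finset.sum_ite_eq]
    split_ifs <;> simp
  rw [modeNormSq_eq_coeffTest (hf lm), hcoeff]
  by_cases h : lm ∈ S
  · simp [h, mellin_eq]
  · rw [if_neg h, indicator_of_mem (by simpa using h), modeNormSq_eq_coeffTest (hf lm)]

lemma MemHb.hasSum {Φ : TestForm n (Ioi 0)} (hΦ : MemHb n k p Φ) {f : Modes n → SpherePair}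
    (hf : ∀ p : Modes n, IsSpinHarmonic n p.1.1 p.1.2 (f p)) (w : testSections n (Ioi 0)) :
    HasSum (fun q => Φ (modePart (hf q).isSmoothSection w)) (Φ w) := by
  obtain ⟨hlin, C, hC⟩ := hΦ
  set L := IsLinearMap.mk' Φ hlin
  have key : ∀ S : Finset (Modes n),
      ENNReal.ofReal (‖Φ w - ∑ q ∈ S, Φ (modePart (hf q).isSmoothSection w)‖ ^ 2) ≤
        C * ∑' x : {x // x ∉ S}, modeNormSq n (-k) (3 - p) w x.1.1.1 x.1.1.2 := fun S => by
    have h1 : Φ w - ∑ q ∈ S, Φ (modePart (hf q).isSmoothSection w) =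
        Φ (w - ∑ q ∈ S, modePart (hf q).isSmoothSection w) := by
      change L w - ∑ q ∈ S, L _ = L _
      rw [map_sub, map_sum]
    rw [h1]
    refine (hC _).trans (le_of_eq ?_)
    congr 1
    rw [hbNormSq_eq, tsum_congr (modeNormSq_sub_sum hf w S (-k) (3 - p)), ← tsum_subtype]
    rfl
  have h0 : Tendsto (fun S : Finset (Modes n) => (C : ℝ≥0∞) *
      ∑' x : {x // x ∉ S}, modeNormSq n (-k) (3 - p) w x.1.1.1 x.1.1.2) atTop (𝓝 0) := by
    have h := ENNReal.tendsto_tsum_compl_atTop_zero (hbNormSq_ne_top w.2 (-k) (3 - p))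
    have h' := ENNReal.Tendsto.const_mul (a := (C : ℝ≥0∞)) h (Or.inr ENNReal.coe_ne_top)
    rw [mul_zero] at h'
    exact h'
  have h1 := tendsto_of_tendsto_of_tendsto_of_le_of_le tendsto_const_nhds h0 (fun _ => zero_le) key
  have h2 := (ENNReal.tendsto_toReal ENNReal.zero_ne_top).comp h1
  simp only [Function.comp_def, ENNReal.toReal_zero] at h2
  have h3 : Tendsto (fun S : Finset (Modes n) =>
      ‖Φ w - ∑ q ∈ S, Φ (modePart (hf q).isSmoothSection w)‖ ^ 2) atTop (𝓝 0) :=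
    h2.congr fun S => ENNReal.toReal_ofReal (by positivity)
  have h4 := h3.sqrt
  simp only [Real.sqrt_zero, Real.sqrt_sq (norm_nonneg _)] at h4
  rw [HasSum, tendsto_iff_norm_sub_tendsto_zero]
  exact h4.congr fun S => norm_sub_rev _ _

lemma hbNormSq_tensor (hm : IsMode n l m) (hf : IsSpinHarmonic n l m f)
    (k p : ℝ) (φ : radialTest J) :
    hbNormSq n k p (tensor φ f) = 𝓜²((φ : ℝ → ℂ), eigenvalue n l, k, p) := by
  rw [hbNormSq_eq, tsum_eq_single (⟨(l, m), hm⟩ : Modes n) fun lm hlm => ?_]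
  · have := modeNormSq_eq_coeffTest hf k p (tensorTest J hf.isSmoothSection φ)
    rwa [coeffTest_tensorTest_self hf] at this
  · obtain ⟨g, hg⟩ := exists_isSpinHarmonic lm.2
    have := modeNormSq_eq_coeffTest hg k p (tensorTest J hf.isSmoothSection φ)
    rw [coeffTest_tensorTest_of_ne hg hf lm.2.nonneg hm.nonneg fun h => hlm (Subtype.ext h)] at this
    refine this.trans ?_
    simp [mellin_eq]

/-- A form that depends on one mode only. -/
lemma memHb_of_mode (hm : IsMode n l m) (hf : IsSpinHarmonic n l m f)
    {Φ : TestForm n (Ioi 0)} (hlin : IsLinearMap ℂ Φ) {C : ℝ≥0}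
    (h : ∀ w : testSections n (Ioi 0), ENNReal.ofReal (‖Φ w‖ ^ 2) ≤
      C * 𝓜²(modeCoeff w f, eigenvalue n l, -k, (3 - p : ℝ))) : MemHb n k p Φ := by
  refine ⟨hlin, C, fun w => (h w).trans ?_⟩
  gcongr
  have := modeNormSq_eq_coeffTest hf (-k) (3 - p) w
  refine (le_of_eq this.symm).trans ?_
  exact ENNReal.le_tsum (f := fun lm : Modes n => modeNormSq n (-k) (3 - p) w lm.1.1 lm.1.2)
    (⟨(l, m), hm⟩ : Modes n)

lemma memHb_zero (k p : ℝ) : MemHb n k p 0 :=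
  ⟨⟨fun _ _ => by simp, fun _ _ => by simp⟩, 0, fun _ => by simp⟩

lemma MemHb.smul {Φ : TestForm n (Ioi 0)} (h : MemHb n k p Φ) (c : ℂ) :
    MemHb n k p (c • Φ) := by
  obtain ⟨hl, C, hC⟩ := h
  refine ⟨⟨fun x y => by simp [hl.map_add, mul_add], fun a x => by
    simp only [Pi.smul_apply, hl.map_smul, smul_eq_mul]; ring⟩, ‖c‖₊ ^ 2 * C, fun w => ?_⟩
  rw [Pi.smul_apply, norm_smul, mul_pow, ENNReal.ofReal_mul (by positivity), ENNReal.coe_mul, mul_assoc]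
  refine mul_le_mul' (le_of_eq ?_) (hC w)
  rw [ENNReal.ofReal_pow (norm_nonneg _), ofReal_norm, enorm_eq_nnnorm, ENNReal.coe_pow]

lemma MemHb.add {Φ Ψ : TestForm n (Ioi 0)} (h : MemHb n k p Φ) (h' : MemHb n k p Ψ) :
    MemHb n k p (Φ + Ψ) := by
  obtain ⟨hl, C, hC⟩ := h
  obtain ⟨hl', C', hC'⟩ := h'
  refine ⟨⟨fun x y => by simp only [Pi.add_apply, hl.map_add, hl'.map_add]; ring, fun a x => by
    simp only [Pi.add_apply, hl.map_smul, hl'.map_smul, smul_add]⟩, 2 * C + 2 * C', fun w => ?_⟩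
  have h1 : ‖Φ w + Ψ w‖ ^ 2 ≤ 2 * ‖Φ w‖ ^ 2 + 2 * ‖Ψ w‖ ^ 2 := by
    have := norm_add_le (Φ w) (Ψ w)
    nlinarith [norm_nonneg (Φ w + Ψ w), sq_nonneg (‖Φ w‖ - ‖Ψ w‖)]
  calc ENNReal.ofReal (‖(Φ + Ψ) w‖ ^ 2) ≤ ENNReal.ofReal (2 * ‖Φ w‖ ^ 2 + 2 * ‖Ψ w‖ ^ 2) :=
        ENNReal.ofReal_le_ofReal h1
    _ = 2 * ENNReal.ofReal (‖Φ w‖ ^ 2) + 2 * ENNReal.ofReal (‖Ψ w‖ ^ 2) := by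
        rw [ENNReal.ofReal_add (by positivity) (by positivity), ENNReal.ofReal_mul (by norm_num),
          ENNReal.ofReal_mul (by norm_num)]
        norm_num
    _ ≤ 2 * (C * hbNormSq n (-k) (3 - p) w) + 2 * (C' * hbNormSq n (-k) (3 - p) w) := by
        gcongr
        · exact hC w
        · exact hC' w
    _ = _ := by push_cast; ring

lemma finite_modesBelow (n : ℤ) (b : ℝ) : Finite (ModesBelow n b) := by
  choose j i hl hi hm using fun p : ModesBelow n b => p.2.1
  obtain ⟨N, hN⟩ := exists_nat_ge (2 * b)
  obtain ⟨N', hN'⟩ := exists_nat_ge b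
  refine Finite.of_injective (β := Fin (N' + 1) × Fin (N + 1)) (fun p =>
    (⟨j p, ?_⟩, ⟨i p, ?_⟩)) fun x y hxy => ?_
  · have h1 := p.2.2
    rw [hl p] at h1
    have : (j p : ℝ) < N' + 1 := by linarith [abs_nonneg (spin n)]
    exact_mod_cast this
  · have : (i p : ℝ) < N + 1 := by linarith [hi p, p.2.2]
    exact_mod_cast this
  · simp only [Prod.mk.injEq, Fin.mk.injEq] at hxy
    have h1 : x.1.1 = y.1.1 := by rw [hl x, hl y, hxy.1]
    exact Subtype.ext (Prod.ext h1 (by rw [hm x, hm y, h1, hxy.2]))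

end

/-! ## The radial operator -/

/-- The action of the Teukolsky operator on the radial factor of a mode, with the horizon at `rp`,
gap `d` and `κ = 2iam/d`. -/
def radOp (rp d : ℝ) (κ l s : ℂ) (φ : ℝ → ℂ) (r : ℝ) : ℂ :=
  -(((r : ℂ) - rp) * ((r : ℂ) - rp + d)) * deriv (deriv φ) r +
    ((2 * ((r : ℂ) - rp) + d) * (s - 1) - d * κ) * deriv φ r + (l + s) * (l - s + 1) * φ r

section
variable {rp d : ℝ} {κ l s : ℂ} {φ : ℝ → ℂ}

lemma contDiff_deriv (h : ContDiff ℝ ∞ φ) : ContDiff ℝ ∞ (deriv φ) := (contDiff_infty_iff_deriv.1 h).2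

lemma contDiff_iteratedDeriv (h : ContDiff ℝ ∞ φ) (k : ℕ) : ContDiff ℝ ∞ (iteratedDeriv k φ) := by
  induction k with
  | zero => simpa using h
  | succ k ih => rw [iteratedDeriv_succ]; exact contDiff_deriv ih

lemma hasDerivAt_of_contDiff (h : ContDiff ℝ ∞ φ) (r : ℝ) : HasDerivAt φ (deriv φ r) r :=
  ((h.differentiable (by simp)) r).hasDerivAt

lemma contDiff_radOp (h : ContDiff ℝ ∞ φ) : ContDiff ℝ ∞ (radOp rp d κ l s φ) := by
  have h1 := contDiff_deriv h
  have h2 := contDiff_deriv h1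
  have h3 : ContDiff ℝ ∞ (fun r : ℝ => (r : ℂ)) := ofRealCLM.contDiff
  unfold radOp
  fun_prop

lemma deriv_radOp (h : ContDiff ℝ ∞ φ) :
    deriv (radOp rp d κ l s φ) = radOp rp d κ l (s - 1) (deriv φ) := funext fun r => by
  have h0 := hasDerivAt_of_contDiff h r
  have h1 := hasDerivAt_of_contDiff (contDiff_deriv h) r
  have h2 := hasDerivAt_of_contDiff (contDiff_deriv (contDiff_deriv h)) r
  have hx : HasDerivAt (fun r : ℝ => (r : ℂ) - rp) 1 r :=
    (hasDerivAt_id r).ofReal_comp.sub_const _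
  have key := (((hx.mul (hx.add_const (d : ℂ))).neg.mul h2).add
    ((((hx.const_mul 2).add_const (d : ℂ)).mul_const (s - 1)).sub_const (d * κ) |>.mul h1)).add
    (h0.const_mul ((l + s) * (l - s + 1)))
  refine key.deriv.trans ?_
  simp only [radOp, Pi.mul_apply, Pi.neg_apply]
  ring

lemma iteratedDeriv_radOp (h : ContDiff ℝ ∞ φ) (k : ℕ) :
    iteratedDeriv k (radOp rp d κ l s φ) = radOp rp d κ l (s - k) (iteratedDeriv k φ) := by
  induction k with
  | zero => simp
  | succ k ih =>
    rw [iteratedDeriv_succ, ih, deriv_radOp (contDiff_iteratedDeriv h k), iteratedDeriv_succ]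
    push_cast
    rw [sub_sub]

lemma radOp_mem {J : Set ℝ} (h : φ ∈ radialTest J) : radOp rp d κ l s φ ∈ radialTest J := by
  have h3 : ContDiff ℝ ∞ (fun r : ℝ => (r : ℂ)) := ofRealCLM.contDiff
  have h1 := radialTest.deriv h
  refine (radialTest J).add_mem ((radialTest J).add_mem
    (radialTest.smooth_mul (a := fun r : ℝ => -(((r : ℂ) - rp) * ((r : ℂ) - rp + d)))
      (by fun_prop) (radialTest.deriv h1))
    (radialTest.smooth_mul (a := fun r : ℝ => (2 * ((r : ℂ) - rp) + d) * (s - 1) - d * κ)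
      (by fun_prop) h1))
    (radialTest.smooth_mul (a := fun _ : ℝ => (l + s) * (l - s + 1)) (by fun_prop) h)

end

/-! ## Auxiliary smooth functions -/

/-- A smooth function that is `0` for `r ≤ a` and `1` for `r ≥ b`. -/
def stepUp (a b r : ℝ) : ℂ := (Real.smoothTransition ((r - a) / (b - a)) : ℝ)

lemma contDiff_stepUp (a b : ℝ) : ContDiff ℝ ∞ (stepUp a b) :=
  ofRealCLM.contDiff.comp (Real.smoothTransition.contDiff.comp (by fun_prop))

lemma stepUp_of_le {a b r : ℝ} (hab : a < b) (h : r ≤ a) : stepUp a b r = 0 := by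
  rw [stepUp, Real.smoothTransition.zero_of_nonpos, ofReal_zero]
  exact div_nonpos_of_nonpos_of_nonneg (by linarith) (by linarith)

lemma stepUp_of_ge {a b r : ℝ} (hab : a < b) (h : b ≤ r) : stepUp a b r = 1 := by
  rw [stepUp, Real.smoothTransition.one_of_one_le, ofReal_one]
  rw [le_div_iff₀ (by linarith)]; linarith

lemma contDiff_stepUp_mul {a b c : ℝ} {g : ℝ → ℂ} (hab : a < b) (hca : c < a)
    (hg : ContDiffOn ℝ ∞ g (Ioi c)) : ContDiff ℝ ∞ (fun r => stepUp a b r * g r) := by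
  refine contDiff_iff_contDiffAt.2 fun r => ?_
  rcases lt_or_ge r a with h | h
  · exact (contDiffAt_const (c := 0)).congr_of_eventuallyEq (eventually_of_mem (Iio_mem_nhds h)
      fun x hx => by simp [stepUp_of_le hab (le_of_lt hx)])
  · exact (contDiff_stepUp a b).contDiffAt.mul (hg.contDiffAt (Ioi_mem_nhds (hca.trans_le h)))

lemma contDiffOn_cpow (c : ℝ) (β : ℂ) :
    ContDiffOn ℝ ∞ (fun r : ℝ => ((r : ℂ) - c) ^ β) (Ioi c) := fun r hr => by
  refine ContDiffAt.contDiffWithinAt ?_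
  have h0 : (r : ℂ) - c ∈ slitPlane := by
    rw [← ofReal_sub]; exact ofReal_mem_slitPlane.2 (sub_pos.2 hr)
  have h1 : ContDiffAt ℂ ∞ (fun z : ℂ => z ^ β) ((r : ℂ) - c) :=
    (AnalyticAt.cpow analyticAt_id analyticAt_const h0).contDiffAt
  exact (h1.restrict_scalars ℝ).comp r (ofRealCLM.contDiff.contDiffAt.sub contDiffAt_const)

lemma hasDerivAt_cpow_sub {c r : ℝ} (h : c < r) (β : ℂ) :
    HasDerivAt (fun r : ℝ => ((r : ℂ) - c) ^ β) (β * ((r : ℂ) - c) ^ (β - 1)) r := by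
  have h0 : (r : ℂ) - c ∈ slitPlane := by
    rw [← ofReal_sub]; exact ofReal_mem_slitPlane.2 (sub_pos.2 h)
  have h1 := ((hasDerivAt_id (r : ℂ)).sub_const (c : ℂ)).cpow_const (c := β) h0
  simpa using! h1.comp_ofReal

/-- Smooth dependence of an average of dilations. -/
lemma hasDerivAt_dilationIntegral {μ : Measure ℝ} {w : ℝ → ℂ} {g : ℝ → ℝ} {H : ℝ → ℂ} {G : ℝ}
    (hw : Integrable w μ) (hg : AEStronglyMeasurable g μ) (hG : ∀ᵐ τ ∂μ, |g τ| ≤ G)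
    (hH : ContDiff ℝ ∞ H) (c r : ℝ) :
    HasDerivAt (fun r => ∫ τ, w τ * H (c + g τ * (r - c)) ∂μ)
      (∫ τ, w τ * g τ * deriv H (c + g τ * (r - c)) ∂μ) r := by
  set S : Set ℝ := Metric.closedBall c (G * (|r - c| + 1))
  have hmem : ∀ τ x : ℝ, |g τ| ≤ G → x ∈ Metric.ball r 1 → c + g τ * (x - c) ∈ S :=
    fun τ x hτ hx => by
      rw [Metric.mem_closedBall, Real.dist_eq, add_sub_cancel_left, abs_mul]
      have h1 : |x - c| ≤ |r - c| + 1 := by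
        rw [Metric.mem_ball, Real.dist_eq] at hx
        calc |x - c| = |(r - c) + (x - r)| := by ring_nf
          _ ≤ |r - c| + |x - r| := abs_add_le _ _
          _ ≤ _ := by linarith
      exact mul_le_mul hτ h1 (abs_nonneg _) ((abs_nonneg _).trans hτ)
  obtain ⟨C, hC⟩ := (isCompact_closedBall c (G * (|r - c| + 1))).exists_bound_of_continuousOn
    hH.continuous.continuousOn
  obtain ⟨C', hC'⟩ := (isCompact_closedBall c (G * (|r - c| + 1))).exists_bound_of_continuousOn
    (contDiff_deriv hH).continuous.continuousOn
  have hms : ∀ {F : ℝ → ℂ}, Continuous F → ∀ x : ℝ,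
      AEStronglyMeasurable (fun τ => F (c + g τ * (x - c))) μ := fun hF x =>
    hF.comp_aestronglyMeasurable (aestronglyMeasurable_const.add (hg.mul_const _))
  have hr : r ∈ Metric.ball r 1 := Metric.mem_ball_self one_pos
  refine (hasDerivAt_integral_of_dominated_loc_of_deriv_le (𝕜 := ℝ)
    (F := fun r τ => w τ * H (c + g τ * (r - c)))
    (F' := fun r τ => w τ * g τ * deriv H (c + g τ * (r - c)))
    (bound := fun τ => ‖w τ‖ * (G * C')) (Metric.ball_mem_nhds r one_pos)
    (Eventually.of_forall fun x => hw.aestronglyMeasurable.mul (hms hH.continuous x)) ?_ ?_ ?_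
    (hw.norm.mul_const _) ?_).2
  · refine (hw.norm.mul_const C).mono' (hw.aestronglyMeasurable.mul (hms hH.continuous r)) ?_
    filter_upwards [hG] with τ hτ
    rw [norm_mul]
    exact mul_le_mul_of_nonneg_left (hC _ (hmem τ r hτ hr)) (norm_nonneg _)
  · exact (hw.aestronglyMeasurable.mul (continuous_ofReal.comp_aestronglyMeasurable hg)).mul
      (hms (contDiff_deriv hH).continuous r)
  · filter_upwards [hG] with τ hτ x hx
    rw [norm_mul, norm_mul, norm_real, Real.norm_eq_abs, mul_assoc]
    have := hC' _ (hmem τ x hτ hx)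
    have h0 := (abs_nonneg _).trans hτ
    gcongr
  · filter_upwards with τ x _
    have h1 : HasDerivAt (fun x : ℝ => c + g τ * (x - c)) (g τ) x := by
      simpa using (((hasDerivAt_id x).sub_const c).const_mul (g τ)).const_add c
    have h2 := (hasDerivAt_of_contDiff hH (c + g τ * (x - c))).scomp x h1
    refine (h2.const_mul (w τ)).congr_deriv ?_
    rw [real_smul]; ring

lemma contDiff_dilationIntegral {μ : Measure ℝ} {w : ℝ → ℂ} {g : ℝ → ℝ} {H : ℝ → ℂ} {G : ℝ}
    (hw : Integrable w μ) (hg : AEStronglyMeasurable g μ) (hG : ∀ᵐ τ ∂μ, |g τ| ≤ G)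
    (hH : ContDiff ℝ ∞ H) (c : ℝ) :
    ContDiff ℝ ∞ (fun r => ∫ τ, w τ * H (c + g τ * (r - c)) ∂μ) := by
  refine contDiff_infty.2 fun k => ?_
  induction k generalizing w H with
  | zero =>
    exact contDiff_zero.2 (continuous_iff_continuousAt.2 fun r =>
      (hasDerivAt_dilationIntegral hw hg hG hH c r).continuousAt)
  | succ k ih =>
    rw [show ((k + 1 : ℕ) : WithTop ℕ∞) = (k : WithTop ℕ∞) + 1 by push_cast; rfl, contDiff_succ_iff_deriv]
    refine ⟨fun r => (hasDerivAt_dilationIntegral hw hg hG hH c r).differentiableAt, by simp, ?_⟩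
    rw [show deriv _ = _ from funext fun r => (hasDerivAt_dilationIntegral hw hg hG hH c r).deriv]
    refine ih ?_ (contDiff_deriv hH)
    refine hw.mul_bdd (c := G) (continuous_ofReal.comp_aestronglyMeasurable hg) ?_
    filter_upwards [hG] with τ hτ
    rwa [norm_real, Real.norm_eq_abs]

lemma exists_iterated_primitive {v : ℝ → ℂ} {b : ℝ} (hv : ContDiff ℝ ∞ v) (hb : ∀ r, b ≤ r → v r = 0)
    (k : ℕ) : ∃ u : ℝ → ℂ, ContDiff ℝ ∞ u ∧ (∀ r, b ≤ r → u r = 0) ∧ iteratedDeriv k u = v := by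
  induction k generalizing v with
  | zero => exact ⟨v, hv, hb, by simp⟩
  | succ k ih =>
    obtain ⟨u, hu, hu0, huv⟩ := ih hv hb
    have hd : ∀ r, HasDerivAt (fun r => ∫ t in b..r, u t) (u r) r := fun r =>
      intervalIntegral.integral_hasDerivAt_right (hu.continuous.intervalIntegrable _ _)
        hu.continuous.stronglyMeasurable.stronglyMeasurableAtFilter hu.continuous.continuousAt
    refine ⟨fun r => ∫ t in b..r, u t, ?_, fun r hr => ?_, ?_⟩
    · refine contDiff_infty_iff_deriv.2 ⟨fun r => (hd r).differentiableAt, ?_⟩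
      rwa [funext fun r => (hd r).deriv]
    · refine (intervalIntegral.integral_congr (g := fun _ => (0 : ℂ)) fun t ht => ?_).trans
        intervalIntegral.integral_zero
      rw [uIcc_of_le hr] at ht
      exact hu0 t ht.1
    · rw [iteratedDeriv_succ', funext fun r => (hd r).deriv, huv]

lemma eq_zero_of_iteratedDeriv_eq_zero {y : ℝ → ℂ} {a b : ℝ} (hy : ContDiff ℝ ∞ y)
    (hb : ∀ r, b ≤ r → y r = 0) (k : ℕ) (hk : ∀ r, a < r → iteratedDeriv k y r = 0) :
    ∀ r, a < r → y r = 0 := by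
  induction k generalizing y with
  | zero => simpa using hk
  | succ k ih =>
    have hd : ∀ r, a < r → deriv y r = 0 := by
      refine ih (contDiff_deriv hy) (fun r hr => ?_) fun r hr => ?_
      · have h1 : ∀ r, b < r → deriv y r = 0 := fun r =>
          deriv_eq_zero_of_isOpen isOpen_Ioi fun x hx => hb x (le_of_lt hx)
        rcases hr.eq_or_lt with rfl | hr
        · exact tendsto_nhds_unique
            (((contDiff_deriv hy).continuous.tendsto b).mono_left nhdsWithin_le_nhds)
            (tendsto_const_nhds.congr' (by
              filter_upwards [self_mem_nhdsWithin] with x hx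
              exact (h1 x hx).symm) : Tendsto (deriv y) (𝓝[>] b) (𝓝 0))
        · exact h1 r hr
      · rw [← iteratedDeriv_succ']; exact hk r hr
    intro r hr
    have h1 := isOpen_Ioi.is_const_of_deriv_eq_zero (isPreconnected_Ioi (a := a))
      (hy.differentiable (by simp)).differentiableOn (fun x hx => hd x hx)
      (show r ∈ Ioi a from hr) (show max r b ∈ Ioi a from lt_max_of_lt_left hr)
    rw [h1, hb _ (le_max_right _ _)]

/-! ## Functionals that annihilate the range of the radial operator, supported near the horizon -/

lemma cpow_add_one_eq {z : ℂ} (hz : z ≠ 0) (β : ℂ) : z ^ (β + 1) = z ^ β * z := by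
  rw [cpow_add _ _ hz, cpow_one]

lemma integrableOn_cpow_mul_of_eq_zero {α : ℂ} (hα : -1 < α.re) {h : ℝ → ℂ}
    (hc : ContinuousOn h (Ici 0)) {b : ℝ} (hb : ∀ x, b ≤ x → h x = 0) :
    IntegrableOn (fun x : ℝ => (x : ℂ) ^ α * h x) (Ioi 0) := by
  set B := max b 1
  have hB : 0 < B := lt_max_of_lt_right one_pos
  have h1 : IntegrableOn (fun x : ℝ => (x : ℂ) ^ α * h x) (Ioc 0 B) := by
    have h2 := (intervalIntegral.intervalIntegrable_cpow' (a := 0) (b := B) hα).mul_continuousOn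
      (g := h) (hc.mono (by rw [uIcc_of_le hB.le]; exact fun x hx => hx.1))
    exact (intervalIntegrable_iff_integrableOn_Ioc_of_le hB.le).1 h2
  refine h1.of_forall_sdiff_eq_zero measurableSet_Ioi fun x hx => ?_
  have : b ≤ x := by
    by_contra hlt
    exact hx.2 ⟨hx.1, (not_le.1 hlt).le.trans (le_max_left _ _)⟩
  rw [hb x this, mul_zero]

lemma integral_Ioi_deriv_eq_zero {F F' : ℝ → ℂ} {b : ℝ} (hF : ∀ x, 0 < x → HasDerivAt F (F' x) x)
    (hF' : IntegrableOn F' (Ioi 0)) (h0 : Tendsto F (𝓝[>] 0) (𝓝 0)) (hb : ∀ x, b ≤ x → F x = 0) :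
    ∫ x in Ioi (0 : ℝ), F' x = 0 := by
  have h1 : Tendsto F atTop (𝓝 0) := tendsto_const_nhds.congr' (by
    filter_upwards [eventually_ge_atTop b] with x hx using (hb x hx).symm)
  have h2 := integral_Ioi_of_hasDerivAt_of_tendsto (f := Function.update F 0 0) (f' := F') (a := 0)
    (m := 0) ?_ ?_ hF' ?_
  · simpa using h2
  · rw [continuousWithinAt_update_same]
    refine h0.mono_left (nhdsWithin_mono _ ?_)
    intro x hx
    exact lt_of_le_of_ne hx.1 (Ne.symm hx.2)
  · intro x hx
    refine (hF x hx).congr_of_eventuallyEq ?_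
    filter_upwards [Ioi_mem_nhds hx] with y hy
    rw [Function.update_of_ne (ne_of_gt hy)]
  · refine h1.congr' ?_
    filter_upwards [Ioi_mem_atTop 0] with y hy
    rw [Function.update_of_ne (ne_of_gt hy)]

lemma tendsto_cpow_mul_nhdsGT {α : ℂ} (hα : 0 < α.re) {h : ℝ → ℂ} (hc : ContinuousWithinAt h (Ici 0) 0) :
    Tendsto (fun x : ℝ => (x : ℂ) ^ α * h x) (𝓝[>] 0) (𝓝 0) := by
  have h1 : Tendsto (fun x : ℝ => (x : ℂ) ^ α) (𝓝[>] 0) (𝓝 0) := by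
    rw [tendsto_zero_iff_norm_tendsto_zero]
    have h2 : Tendsto (fun x : ℝ => x ^ α.re) (𝓝[>] 0) (𝓝 0) := by
      have := (Real.continuousAt_rpow_const 0 α.re (Or.inr hα.le)).tendsto
      rw [Real.zero_rpow hα.ne'] at this
      exact this.mono_left nhdsWithin_le_nhds
    refine h2.congr' ?_
    filter_upwards [self_mem_nhdsWithin] with x hx
    rw [norm_cpow_eq_rpow_re_of_pos hx]
  have h2 := h1.mul (hc.tendsto.mono_left (nhdsWithin_mono _ Ioi_subset_Ici_self))
  simpa using h2

/-- The functional `φ ↦ ∫₀^∞ x^{l+κ} (x+d)^{l-κ} φ^{(N)}(rp + x) dx`. -/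
def horizonForm (rp d : ℝ) (κ : ℂ) (l : ℝ) (N : ℕ) (φ : ℝ → ℂ) : ℂ :=
  ∫ x : ℝ in Ioi 0, (x : ℂ) ^ (l + κ) * (((x : ℂ) + d) ^ (l - κ) * iteratedDeriv N φ (rp + x))

section
variable {rp d : ℝ} {κ : ℂ} {l : ℝ} {N : ℕ} {s : ℂ} {φ : ℝ → ℂ} {J : Set ℝ}

lemma hasDerivAt_add_cpow {x : ℝ} (hx : -d < x) (β : ℂ) :
    HasDerivAt (fun x : ℝ => ((x : ℂ) + d) ^ β) (β * ((x : ℂ) + d) ^ (β - 1)) x := by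
  simpa using hasDerivAt_cpow_sub (c := -d) hx β

lemma continuousOn_add_cpow (hd : 0 < d) (β : ℂ) :
    ContinuousOn (fun x : ℝ => ((x : ℂ) + d) ^ β) (Ici 0) := fun _ hx =>
  (hasDerivAt_add_cpow (lt_of_lt_of_le (neg_lt_zero.2 hd) hx) β).continuousAt.continuousWithinAt

lemma radialTest.exists_eq_zero_of_le (h : φ ∈ radialTest J) : ∃ b, ∀ r, b ≤ r → φ r = 0 := by
  obtain ⟨a, b, _, _, hab⟩ := radialTest.exists_Icc h
  exact ⟨b + 1, fun r hr => hab r fun h => by linarith [h.2]⟩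

lemma integrableOn_horizonForm (hd : 0 < d) (hκ : κ.re = 0) (hl : 0 ≤ l) (h : φ ∈ radialTest J) :
    IntegrableOn (fun x : ℝ => (x : ℂ) ^ (l + κ) *
      (((x : ℂ) + d) ^ (l - κ) * iteratedDeriv N φ (rp + x))) (Ioi 0) := by
  obtain ⟨b, hb⟩ := radialTest.exists_eq_zero_of_le (radialTest.iteratedDeriv h N)
  refine integrableOn_cpow_mul_of_eq_zero (b := b - rp) (by simp [hκ]; linarith)
    ((continuousOn_add_cpow hd _).mul ?_) fun x hx => by rw [hb _ (by linarith), mul_zero]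
  exact ((contDiff_iteratedDeriv h.1 N).continuous.comp (by fun_prop)).continuousOn

lemma horizonForm_add (hd : 0 < d) (hκ : κ.re = 0) (hl : 0 ≤ l) {ψ : ℝ → ℂ} (h : φ ∈ radialTest J)
    (h' : ψ ∈ radialTest J) :
    horizonForm rp d κ l N (φ + ψ) = horizonForm rp d κ l N φ + horizonForm rp d κ l N ψ := by
  unfold horizonForm
  rw [← integral_add (integrableOn_horizonForm hd hκ hl h) (integrableOn_horizonForm hd hκ hl h')]
  refine setIntegral_congr_fun measurableSet_Ioi fun x _ => ?_
  rw [iteratedDeriv_add (h.1.contDiffAt.of_le (mod_cast le_top))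
    (h'.1.contDiffAt.of_le (mod_cast le_top))]
  ring

lemma horizonForm_smul (c : ℂ) (φ : ℝ → ℂ) :
    horizonForm rp d κ l N (c • φ) = c * horizonForm rp d κ l N φ := by
  unfold horizonForm
  rw [← integral_const_mul]
  refine setIntegral_congr_fun measurableSet_Ioi fun x _ => ?_
  rw [iteratedDeriv_const_smul_field c φ, smul_eq_mul]
  ring

/-- The horizon functional on radial test functions. -/
def horizonLM (J : Set ℝ) (rp : ℝ) (hd : 0 < d) (hκ : κ.re = 0) (hl : 0 ≤ l) (N : ℕ) :
    radialTest J →ₗ[ℂ] ℂ where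
  toFun φ := horizonForm rp d κ l N φ
  map_add' φ ψ := horizonForm_add hd hκ hl φ.2 ψ.2
  map_smul' c φ := horizonForm_smul c φ

lemma iteratedDeriv_radOp_eq (hN : (N : ℂ) = l + s) (h : ContDiff ℝ ∞ φ) (r : ℝ) :
    iteratedDeriv N (radOp rp d κ l s φ) r =
      -(((r : ℂ) - rp) * ((r : ℂ) - rp + d) * deriv (deriv (iteratedDeriv N φ)) r +
        ((l + 1) * (2 * ((r : ℂ) - rp) + d) + d * κ) * deriv (iteratedDeriv N φ) r) := by
  rw [iteratedDeriv_radOp h, hN, radOp]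
  ring

lemma horizonForm_radOp (hd : 0 < d) (hκ : κ.re = 0) (hl : 0 ≤ l) (hN : (N : ℂ) = l + s)
    (h : φ ∈ radialTest J) : horizonForm rp d κ l N (radOp rp d κ l s φ) = 0 := by
  have hmem := radialTest.deriv (radialTest.iteratedDeriv h N)
  set χ := deriv (iteratedDeriv N φ)
  obtain ⟨b, hb⟩ := radialTest.exists_eq_zero_of_le hmem
  refine integral_Ioi_deriv_eq_zero (b := b - rp)
    (F := fun x : ℝ => -((x : ℂ) ^ (l + 1 + κ) * (((x : ℂ) + d) ^ (l + 1 - κ) * χ (rp + x))))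
    (fun x hx => ?_) (integrableOn_horizonForm hd hκ hl (radOp_mem h)) ?_ fun x hx => ?_
  · have hx0 : (x : ℂ) ≠ 0 := ofReal_ne_zero.2 hx.ne'
    have hxd : (x : ℂ) + d ≠ 0 := by rw [← ofReal_add]; exact ofReal_ne_zero.2 (by linarith)
    have h1 : HasDerivAt (fun x : ℝ => (x : ℂ) ^ ((l : ℂ) + 1 + κ))
        ((l + 1 + κ) * (x : ℂ) ^ ((l : ℂ) + κ)) x := by
      have := hasDerivAt_cpow_sub (c := 0) hx ((l : ℂ) + 1 + κ)
      simp only [ofReal_zero, sub_zero] at this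
      rwa [show (l : ℂ) + 1 + κ - 1 = l + κ by ring] at this
    have h2 := hasDerivAt_add_cpow (d := d) (x := x) (by linarith) ((l : ℂ) + 1 - κ)
    rw [show (l : ℂ) + 1 - κ - 1 = l - κ by ring] at h2
    have h3 : HasDerivAt (fun x : ℝ => χ (rp + x)) (deriv χ (rp + x)) x :=
      (hasDerivAt_of_contDiff hmem.1 (rp + x)).comp_const_add rp x
    refine (h1.mul (h2.mul h3)).neg.congr_deriv ?_
    rw [iteratedDeriv_radOp_eq hN h.1]
    simp only [Pi.mul_apply]
    have e1 : (x : ℂ) ^ ((l : ℂ) + 1 + κ) = (x : ℂ) ^ ((l : ℂ) + κ) * x := by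
      rw [← cpow_add_one_eq hx0]; ring_nf
    have e2 : ((x : ℂ) + d) ^ ((l : ℂ) + 1 - κ) = ((x : ℂ) + d) ^ ((l : ℂ) - κ) * (x + d) := by
      rw [← cpow_add_one_eq hxd]; ring_nf
    rw [e1, e2]
    push_cast
    ring
  · have := tendsto_cpow_mul_nhdsGT (α := l + 1 + κ) (by simp [hκ]; linarith)
      (h := fun x : ℝ => ((x : ℂ) + d) ^ ((l : ℂ) + 1 - κ) * χ (rp + x))
      (((continuousOn_add_cpow hd _) 0 self_mem_Ici).mul
        (hmem.1.continuous.comp (by fun_prop : Continuous fun x => rp + x)).continuousWithinAt)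
    simpa using this.neg
  · simp [hb (rp + x) (by linarith)]

/-- On `(a, ∞)` the radial equation `T u = φ` is solved by a function that vanishes for large `r`,
if the horizon functional vanishes on `φ`. -/
lemma exists_radOp_eq (hκ : κ.re = 0) (hl : 0 ≤ l) (hN : (N : ℂ) = l + s)
    (h : φ ∈ radialTest J) (h0 : horizonForm rp d κ l N φ = 0) {a : ℝ} (ha : rp - d < a) (harp : a < rp) :
    ∃ (u : ℝ → ℂ) (b : ℝ), ContDiff ℝ ∞ u ∧ (∀ r, b ≤ r → u r = 0) ∧
      ∀ r, a < r → radOp rp d κ l s u r = φ r := by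
  obtain ⟨a', ha', haa⟩ := exists_between ha
  have hψ := radialTest.iteratedDeriv h N
  set ψ := iteratedDeriv N φ
  obtain ⟨b₀, hb₀⟩ := radialTest.exists_eq_zero_of_le hψ
  set b := max b₀ (rp + 1)
  have hb : ∀ r, b ≤ r → ψ r = 0 := fun r hr => hb₀ r ((le_max_left _ _).trans hr)
  have hbrp : rp < b := lt_of_lt_of_le (by linarith) (le_max_right _ _)
  set pw : ℂ → ℝ → ℂ := fun β r => stepUp a' a r * ((r : ℂ) - (rp - d : ℝ)) ^ β
  have hpw : ∀ β, ContDiff ℝ ∞ (pw β) := fun β => contDiff_stepUp_mul haa ha' (contDiffOn_cpow _ β)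
  have hpw1 : ∀ β r, a ≤ r → pw β r = ((r : ℂ) - (rp - d : ℝ)) ^ β := fun β r hr => by
    simp only [pw, stepUp_of_ge haa hr, one_mul]
  set H : ℝ → ℂ := fun r => pw (l - κ) r * ψ r
  have hH : ContDiff ℝ ∞ H := (hpw _).mul hψ.1
  set γ : ℂ := l + κ with hγ
  have hγre : γ.re = l := by simp [hγ, hκ]
  have hw : Integrable (fun τ : ℝ => (τ : ℂ) ^ γ) (volume.restrict (Ioc 0 1)) :=
    (intervalIntegrable_iff_integrableOn_Ioc_of_le zero_le_one).1
      (intervalIntegral.intervalIntegrable_cpow' (by rw [hγre]; linarith))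
  have hg : AEStronglyMeasurable (fun τ : ℝ => τ) (volume.restrict (Ioc 0 1)) :=
    continuous_id.aestronglyMeasurable
  have hG : ∀ᵐ τ : ℝ ∂(volume.restrict (Ioc 0 1)), |τ| ≤ 1 := by
    refine (ae_restrict_iff' measurableSet_Ioc).2 (Eventually.of_forall fun τ hτ => ?_)
    rw [abs_of_pos hτ.1]; exact hτ.2
  set I : ℝ → ℂ := fun r => ∫ τ in Ioc (0 : ℝ) 1, (τ : ℂ) ^ γ * H (rp + τ * (r - rp))
  have hI : ContDiff ℝ ∞ I := contDiff_dilationIntegral hw hg hG hH rp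
  have hI' : ∀ r, HasDerivAt I (∫ τ in Ioc (0 : ℝ) 1, (τ : ℂ) ^ γ * τ * deriv H (rp + τ * (r - rp))) r :=
    fun r => hasDerivAt_dilationIntegral hw hg hG hH rp r
  have hode : ∀ r : ℝ, ((r : ℂ) - rp) * deriv I r + (γ + 1) * I r = H r := fun r => by
    have hcont : Continuous fun τ : ℝ => H (rp + τ * (r - rp)) :=
      hH.continuous.comp (by fun_prop)
    have hcont' : Continuous fun τ : ℝ => deriv H (rp + τ * (r - rp)) :=
      (contDiff_deriv hH).continuous.comp (by fun_prop)
    have i1 : IntegrableOn (fun τ : ℝ => (τ : ℂ) ^ γ * H (rp + τ * (r - rp))) (Ioc 0 1) :=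
      (intervalIntegrable_iff_integrableOn_Ioc_of_le zero_le_one).1
      ((intervalIntegral.intervalIntegrable_cpow' (by rw [hγre]; linarith)).mul_continuousOn
        hcont.continuousOn)
    have i2 : IntegrableOn (fun τ : ℝ => (τ : ℂ) ^ γ * τ * deriv H (rp + τ * (r - rp))) (Ioc 0 1) := by
      simp only [mul_assoc]
      exact (intervalIntegrable_iff_integrableOn_Ioc_of_le zero_le_one).1
        ((intervalIntegral.intervalIntegrable_cpow' (by rw [hγre]; linarith)).mul_continuousOn
        (continuous_ofReal.mul hcont').continuousOn)
    have hFTC := intervalIntegral.integral_eq_sub_of_hasDerivAt_of_le (a := (0 : ℝ)) (b := 1)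
      (f := fun τ : ℝ => (τ : ℂ) ^ (γ + 1) * H (rp + τ * (r - rp)))
      (f' := fun τ : ℝ => ((r : ℂ) - rp) * ((τ : ℂ) ^ γ * τ * deriv H (rp + τ * (r - rp))) +
        (γ + 1) * ((τ : ℂ) ^ γ * H (rp + τ * (r - rp)))) zero_le_one
      (((continuous_ofReal_cpow_const (by simp [hγre]; linarith)).mul hcont).continuousOn)
      (fun τ hτ => by
        have hτ0 : (τ : ℂ) ≠ 0 := ofReal_ne_zero.2 hτ.1.ne'
        have h1 := hasDerivAt_cpow_sub (c := 0) hτ.1 (γ + 1)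
        simp only [ofReal_zero, sub_zero, add_sub_cancel_right] at h1
        have h2 : HasDerivAt (fun τ : ℝ => rp + τ * (r - rp)) (r - rp) τ := by
          simpa using ((hasDerivAt_id τ).mul_const (r - rp)).const_add rp
        have h3 := (hasDerivAt_of_contDiff hH (rp + τ * (r - rp))).scomp τ h2
        refine (h1.mul h3).congr_deriv ?_
        rw [cpow_add_one_eq hτ0, real_smul, Function.comp_apply]
        push_cast; ring)
      ((intervalIntegrable_iff_integrableOn_Ioc_of_le zero_le_one).2
        ((i2.const_mul _).add (i1.const_mul _)))
    rw [(hI' r).deriv]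
    simp only [I]
    rw [← integral_const_mul, ← integral_const_mul, ← integral_add (i2.const_mul _) (i1.const_mul _),
      ← intervalIntegral.integral_of_le zero_le_one, hFTC]
    have : γ + 1 ≠ 0 := fun h => by
      have := congrArg re h
      simp [hγre] at this
      linarith
    simp [zero_cpow this]
  have hIb : ∀ r, b ≤ r → I r = 0 := fun r hr => by
    have hx : 0 < r - rp := by linarith
    have h1 : ∫ x in (0 : ℝ)..(r - rp), (x : ℂ) ^ γ * H (rp + x) = 0 := by
      rw [intervalIntegral.integral_of_le hx.le, ← h0, horizonForm]
      symm
      refine (setIntegral_eq_of_subset_of_forall_sdiff_eq_zero measurableSet_Ioi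
        Ioc_subset_Ioi_self fun x hx' => ?_).trans (setIntegral_congr_fun measurableSet_Ioc
          fun x hx' => ?_)
      · have : r - rp < x := by
          by_contra hlt
          exact hx'.2 ⟨hx'.1, not_lt.1 hlt⟩
        change _ * (_ * ψ (rp + x)) = 0
        rw [hb _ (by linarith), mul_zero, mul_zero]
      · simp only [H, hpw1 _ _ (show a ≤ rp + x by linarith [hx'.1])]
        have e : ((rp + x : ℝ) : ℂ) - (rp - d : ℝ) = x + d := by push_cast; ring
        rw [e, ← mul_assoc]
    have h2 := intervalIntegral.smul_integral_comp_mul_left (a := (0 : ℝ)) (b := 1)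
      (fun x : ℝ => (x : ℂ) ^ γ * H (rp + x)) (r - rp)
    rw [mul_zero, mul_one, h1, smul_eq_zero_iff_right hx.ne', intervalIntegral.integral_of_le zero_le_one] at h2
    have h3 : ((r - rp : ℝ) : ℂ) ^ γ * I r = 0 := by
      rw [← h2]
      simp only [I]
      rw [← integral_const_mul]
      refine setIntegral_congr_fun measurableSet_Ioc fun τ hτ => ?_
      rw [ofReal_mul, mul_cpow_ofReal_nonneg hx.le hτ.1.le, mul_comm τ]
      ring
    refine (mul_eq_zero.1 h3).resolve_left ?_
    exact fun h => ofReal_ne_zero.2 hx.ne' ((cpow_eq_zero_iff _ _).1 h).1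
  set v : ℝ → ℂ := fun r => -(pw (-l - 1 + κ) r * I r)
  have hv : ContDiff ℝ ∞ v := ((hpw _).mul hI).neg
  obtain ⟨u, hu, hub, huv⟩ := exists_iterated_primitive hv (b := b)
    (fun r hr => by simp only [v, hIb r hr, mul_zero, neg_zero]) (N + 1)
  obtain ⟨b', hb'⟩ := radialTest.exists_eq_zero_of_le h
  refine ⟨u, b, hu, hub, fun r hr => ?_⟩
  refine sub_eq_zero.1 (eq_zero_of_iteratedDeriv_eq_zero (y := fun r => radOp rp d κ l s u r - φ r)
    (a := a) (b := max b' (b + 1)) ((contDiff_radOp hu).sub h.1) (fun r hr => ?_) N (fun r hr => ?_) r hr)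
  · have hbr : b < r := by linarith [(le_max_right b' (b + 1)).trans hr]
    have e1 : ∀ r, b < r → deriv u r = 0 := fun r =>
      deriv_eq_zero_of_isOpen isOpen_Ioi fun x hx => hub x (le_of_lt hx)
    have e2 := deriv_eq_zero_of_isOpen isOpen_Ioi e1 hbr
    simp [radOp, e1 r hbr, e2, hub r hbr.le, hb' r ((le_max_left _ _).trans hr)]
  · have e0 : iteratedDeriv N (fun r => radOp rp d κ l s u r - φ r) r =
        iteratedDeriv N (radOp rp d κ l s u) r - ψ r :=
      iteratedDeriv_fun_sub ((contDiff_radOp hu).contDiffAt.of_le (mod_cast le_top))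
        (h.1.contDiffAt.of_le (mod_cast le_top))
    rw [e0, iteratedDeriv_radOp_eq hN hu, ← iteratedDeriv_succ, huv]
    have hxd : (r : ℂ) - (rp - d : ℝ) ≠ 0 := sub_ne_zero.2 (ofReal_inj.not.2 (ha.trans hr).ne')
    have hv' : HasDerivAt v (-(((-l - 1 + κ) * ((r : ℂ) - (rp - d : ℝ)) ^ (-l - 1 + κ - 1 : ℂ)) * I r +
        ((r : ℂ) - (rp - d : ℝ)) ^ (-l - 1 + κ : ℂ) * deriv I r)) r := by
      have h1 := ((hasDerivAt_cpow_sub (c := rp - d) (ha.trans hr) (-l - 1 + κ)).mul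
        (hasDerivAt_of_contDiff hI r)).neg
      refine h1.congr_of_eventuallyEq ?_
      filter_upwards [Ioi_mem_nhds hr] with x hx
      simp [v, hpw1 _ x (le_of_lt hx)]
    rw [hv'.deriv]
    have e1 : v r = -(((r : ℂ) - (rp - d : ℝ)) ^ (-l - 1 + κ : ℂ) * I r) := by
      simp only [v, hpw1 _ r (le_of_lt hr)]
    have e2 : ((r : ℂ) - (rp - d : ℝ)) ^ (-l - 1 + κ : ℂ) =
        ((r : ℂ) - (rp - d : ℝ)) ^ (-l - 1 + κ - 1 : ℂ) * ((r : ℂ) - (rp - d : ℝ)) := by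
      rw [← cpow_add_one_eq hxd]; ring_nf
    have e3 : ((r : ℂ) - (rp - d : ℝ)) ^ (l - κ : ℂ) * (((r : ℂ) - (rp - d : ℝ)) ^ (-l - 1 + κ - 1 : ℂ)
        * (((r : ℂ) - (rp - d : ℝ)) * ((r : ℂ) - (rp - d : ℝ)))) = 1 := by
      rw [← sq, ← cpow_natCast, ← cpow_add _ _ hxd, ← cpow_add _ _ hxd]
      convert cpow_zero _ using 2
      push_cast; ring
    have e4 := hode r
    simp only [H, hpw1 _ r (le_of_lt hr), hγ] at e4
    rw [e1, e2]
    generalize ((r : ℂ) - (rp - d : ℝ)) ^ (-l - 1 + κ - 1 : ℂ) = Y at *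
    generalize ((r : ℂ) - (rp - d : ℝ)) ^ (l - κ : ℂ) = Z at *
    push_cast at *
    linear_combination (Y * (((r : ℂ) - (rp - d)) * ((r : ℂ) - (rp - d)))) * e4 + ψ r * e3

/-- A functional that annihilates the range of the radial operator and is supported near or outside
the horizon is a multiple of the horizon functional. -/
theorem exists_eq_smul_horizonLM (hd : 0 < d) (hκ : κ.re = 0) (hl : 0 ≤ l) (hN : (N : ℂ) = l + s)
    {R : ℝ} (hR0 : 0 ≤ rp - d) (hR : rp - d < R) (hRrp : R < rp) (v : radialTest (Ioi 0) →ₗ[ℂ] ℂ)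
    (hv : ∀ φ : radialTest (Ioi 0), v ⟨radOp rp d κ l s φ, radOp_mem φ.2⟩ = 0)
    (hsupp : ∀ φ : radialTest (Ioi 0), (φ : ℝ → ℂ) ∈ radialTest (Iio R) → v φ = 0) :
    ∃ c : ℂ, v = c • horizonLM (Ioi 0) rp hd hκ hl N := by
  set L := horizonLM (Ioi 0) rp hd hκ hl N
  have key : ∀ φ, L φ = 0 → v φ = 0 := fun φ hφ => by
    obtain ⟨a, ha, haR⟩ := exists_between hR
    obtain ⟨a₁, ha₁, ha₁R⟩ := exists_between haR
    obtain ⟨a₂, ha₂, ha₂R⟩ := exists_between ha₁R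
    obtain ⟨u, b, hu, hub, hT⟩ := exists_radOp_eq hκ hl hN φ.2 hφ ha (haR.trans hRrp)
    set w : ℝ → ℂ := fun r => stepUp a₁ a₂ r * u r
    have hw : w ∈ radialTest (Ioi 0) := by
      refine ⟨(contDiff_stepUp _ _).mul hu, Icc a₁ b, isCompact_Icc, fun r hr => ?_, fun r hr => ?_⟩
      · have : 0 < r := by linarith [hr.1]
        exact ⟨this, this⟩
      · rcases lt_or_ge r a₁ with h | h
        · simp only [w, stepUp_of_le ha₂ h.le, zero_mul]
        · have : b ≤ r := by
            by_contra hlt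
            exact hr ⟨h, (not_le.1 hlt).le⟩
          simp only [w, hub r this, mul_zero]
    have hmem := (radialTest (Ioi 0)).sub_mem (radOp_mem (rp := rp) (d := d) (κ := κ) (l := l)
      (s := s) hw) φ.2
    have hdiff : (radOp rp d κ l s w - φ : ℝ → ℂ) ∈ radialTest (Iio R) := by
      obtain ⟨h1, K, hK, hK0, h2⟩ := hmem
      refine ⟨h1, K ∩ Iic a₂, hK.inter_right isClosed_Iic, fun r hr =>
        ⟨lt_of_le_of_lt hr.2 ha₂R, (hK0 hr.1).2⟩, fun r hr => ?_⟩
      by_cases hrK : r ∈ K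
      · have hr2 : a₂ < r := by
          by_contra hlt
          exact hr ⟨hrK, not_lt.1 hlt⟩
        have e0 : w =ᶠ[𝓝 r] u := by
          filter_upwards [Ioi_mem_nhds hr2] with x hx
          simp only [w, stepUp_of_ge ha₂ (le_of_lt hx), one_mul]
        have e1 := e0.deriv
        rw [Pi.sub_apply, ← hT r (ha₁.trans (ha₂.trans hr2)), radOp, radOp, e1.deriv_eq, e1.eq_of_nhds,
          e0.eq_of_nhds, sub_self]
      · exact h2 r hrK
    have h1 := hsupp ⟨_, hmem⟩ hdiff
    have h2 := hv ⟨w, hw⟩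
    have h3 : (⟨_, hmem⟩ : radialTest (Ioi 0)) = ⟨radOp rp d κ l s w, radOp_mem hw⟩ - φ := rfl
    rw [h3, map_sub, h2, zero_sub, neg_eq_zero] at h1
    exact h1
  by_cases h : ∃ φ₀, L φ₀ ≠ 0
  · obtain ⟨φ₀, h₀⟩ := h
    refine ⟨v φ₀ / L φ₀, LinearMap.ext fun φ => ?_⟩
    have h1 := key (φ - (L φ / L φ₀) • φ₀) (by
      rw [map_sub, map_smul, smul_eq_mul, div_mul_cancel₀ _ h₀, sub_self])
    rw [map_sub, map_smul, sub_eq_zero] at h1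
    rw [h1, LinearMap.smul_apply, smul_eq_mul, smul_eq_mul]
    ring
  · push Not at h
    exact ⟨0, LinearMap.ext fun φ => by rw [key φ (h φ), zero_smul, LinearMap.zero_apply]⟩

end

/-! ## Mellin transforms of dilated functions -/

/-- Dilation towards `rp`. -/
def dilate (rp t : ℝ) (Y : ℝ → ℂ) (r : ℝ) : ℂ := Y (rp + (r - rp) / t)

section
variable {rp R t : ℝ} {Y : ℝ → ℂ}

lemma dilate_mem (hR : 0 ≤ R) (hRrp : R < rp) (ht : 0 < t) (ht1 : t ≤ 1) (hY : Y ∈ radialTest (Ioi R)) :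
    dilate rp t Y ∈ radialTest (Ioi R) := by
  obtain ⟨h1, K, hK, hKR, h0⟩ := hY
  refine ⟨h1.comp (by fun_prop), (fun y => rp + t * (y - rp)) '' K, hK.image (by fun_prop), ?_,
    fun r hr => h0 _ fun hrK => hr ⟨_, hrK, ?_⟩⟩
  · rintro _ ⟨y, hy, rfl⟩
    have hyR : R < y := (hKR hy).1
    have : R < rp + t * (y - rp) := by nlinarith
    exact ⟨this, lt_of_le_of_lt hR this⟩
  · field_simp; ring

lemma deriv_dilate (hY : ContDiff ℝ ∞ Y) (t r : ℝ) :
    HasDerivAt (dilate rp t Y) ((t : ℂ)⁻¹ * dilate rp t (deriv Y) r) r := by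
  have h1 : HasDerivAt (fun r : ℝ => rp + (r - rp) / t) (1 / t) r := by
    simpa using (((hasDerivAt_id r).sub_const rp).div_const t).const_add rp
  have := (hasDerivAt_of_contDiff hY (rp + (r - rp) / t)).scomp r h1
  refine this.congr_deriv ?_
  rw [real_smul, dilate]
  push_cast
  rw [one_div]

lemma integral_norm_dilate (ht : 0 < t) (Y : ℝ → ℂ) : ∫ r, ‖dilate rp t Y r‖ = t * ∫ r, ‖Y r‖ := by
  have h1 := integral_sub_right_eq_self (fun x : ℝ => ‖Y (rp + x / t)‖) (μ := volume) rp
  have h2 := Measure.integral_comp_div (fun x : ℝ => ‖Y (rp + x)‖) t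
  have h3 := integral_add_left_eq_self (fun x : ℝ => ‖Y x‖) (μ := volume) rp
  simp only [dilate]
  rw [h1, h2, h3, abs_of_pos ht, smul_eq_mul]

lemma mellin_mul_dilate_le_aux (hR : 0 ≤ R) (hRrp : R < rp) (k : ℕ) {G : ℝ → ℂ}
    (hG : ContDiff ℝ ∞ G) (hY : Y ∈ radialTest (Ioi R)) (p : ℝ) :
    ∃ C, ∀ t, 0 < t → t ≤ 1 → ∀ lam : ℝ,
      (t * |lam|) ^ k * ‖mellin (fun r => G r * dilate rp t Y r) (p + lam * I)‖ ≤ C * t := by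
  induction k generalizing G Y p with
  | zero =>
    obtain ⟨α, β, hα, hαβ, h0⟩ := radialTest.exists_Icc hY
    set α' := min α rp
    set β' := max β rp
    have hα' : 0 < α' := lt_min hα (lt_of_le_of_lt hR hRrp)
    have hcont : ContinuousOn (fun r : ℝ => r ^ (p - 1) * ‖G r‖) (Icc α' β') :=
      (continuousOn_id.rpow_const fun r hr => Or.inl (hα'.trans_le hr.1).ne').mul
        hG.continuous.norm.continuousOn
    obtain ⟨C, hC⟩ := isCompact_Icc.exists_bound_of_continuousOn hcont
    refine ⟨C * ∫ r, ‖Y r‖, fun t ht ht1 lam => ?_⟩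
    have hd := dilate_mem hR hRrp ht ht1 hY
    have hint := (radialTest.integrable hd).norm
    rw [pow_zero, one_mul, mul_assoc, mul_comm _ t, ← integral_norm_dilate (rp := rp) ht, ← integral_const_mul]
    have hC0 : 0 ≤ C := (norm_nonneg _).trans (hC α' ⟨le_rfl, (min_le_left _ _).trans
      (hαβ.le.trans (le_max_left _ _))⟩)
    calc ‖mellin (fun r => G r * dilate rp t Y r) (p + lam * I)‖
        ≤ ∫ r in Ioi (0 : ℝ), C * ‖dilate rp t Y r‖ := by
          rw [mellin_eq]
          refine norm_integral_le_of_norm_le (hint.const_mul C).integrableOn ?_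
          refine (ae_restrict_iff' measurableSet_Ioi).2 (Eventually.of_forall fun r hr => ?_)
          rw [norm_mul, norm_mul, norm_cpow_eq_rpow_re_of_pos hr, ← mul_assoc]
          by_cases hrm : rp + (r - rp) / t ∈ Icc α β
          · have e : ((p : ℂ) + lam * I - 1).re = p - 1 := by simp
            rw [e]
            have hr' : r ∈ Icc α' β' := by
              obtain ⟨h1, h2⟩ := hrm
              have e2 : r = (1 - t) * rp + t * (rp + (r - rp) / t) := by field_simp; ring
              have i1 : α' ≤ rp + (r - rp) / t := (min_le_left _ _).trans h1
              have i2 : rp + (r - rp) / t ≤ β' := h2.trans (le_max_left _ _)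
              have i3 : α' ≤ rp := min_le_right _ _
              have i4 : rp ≤ β' := le_max_right _ _
              constructor <;> rw [e2] <;> nlinarith
            have := hC r hr'
            rw [Real.norm_of_nonneg (mul_nonneg (Real.rpow_nonneg (le_of_lt hr) _) (norm_nonneg _))]
              at this
            gcongr
          · rw [show dilate rp t Y r = 0 from h0 _ hrm]; simp
      _ ≤ ∫ r, C * ‖dilate rp t Y r‖ :=
          setIntegral_le_integral (hint.const_mul C)
            (Eventually.of_forall fun r => mul_nonneg hC0 (norm_nonneg _))
  | succ k ih =>
    obtain ⟨C₁, h₁⟩ := ih (contDiff_deriv hG) hY (p + 1)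
    obtain ⟨C₂, h₂⟩ := ih hG (radialTest.deriv hY) (p + 1)
    refine ⟨max C₁ 0 + C₂, fun t ht ht1 lam => ?_⟩
    have hd := dilate_mem hR hRrp ht ht1 hY
    have hd' := dilate_mem hR hRrp ht ht1 (radialTest.deriv hY)
    have hm := radialTest.smooth_mul hG hd
    set M := mellin (fun r => G r * dilate rp t Y r) (p + lam * I)
    have h5 := h₁ t ht ht1 lam
    have h6 := h₂ t ht ht1 lam
    set A := mellin (fun r => deriv G r * dilate rp t Y r) ((p + 1 : ℝ) + lam * I)
    set B := mellin (fun r => G r * dilate rp t (deriv Y) r) ((p + 1 : ℝ) + lam * I)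
    have e1 : deriv (fun r => G r * dilate rp t Y r) = fun r =>
        deriv G r * dilate rp t Y r + (t : ℂ)⁻¹ * (G r * dilate rp t (deriv Y) r) := funext fun r => by
      refine ((hasDerivAt_of_contDiff hG r).mul (deriv_dilate hY.1 t r)).deriv.trans ?_
      ring
    have e2 := mellin_deriv hm ((p + 1 : ℝ) + lam * I)
    rw [e1, mellin_add_of_mem (radialTest.smooth_mul (contDiff_deriv hG) hd)
      (radialTest.smooth_mul (a := fun _ => (t : ℂ)⁻¹) contDiff_const (radialTest.smooth_mul hG hd')),
      mellin_const_mul,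
      show (((p + 1 : ℝ) : ℂ) + lam * I - 1) = p + lam * I by push_cast; ring] at e2
    have htc : (t : ℂ) ≠ 0 := ofReal_ne_zero.2 ht.ne'
    have e3 : (t : ℂ) * -(p + lam * I) * M = t * A + B := by
      rw [mul_assoc, ← e2]; field_simp; rfl
    have e4 : t * |lam| * ‖M‖ ≤ t * ‖A‖ + ‖B‖ := by
      have h3 := norm_add_le ((t : ℂ) * A) B
      rw [← e3, norm_mul, norm_mul, norm_mul, norm_real, Real.norm_of_nonneg ht.le, norm_neg] at h3
      refine le_trans ?_ h3
      gcongr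
      have := abs_im_le_norm ((p : ℂ) + lam * I)
      simpa using this
    have h7 : 0 ≤ (t * |lam|) ^ k := by positivity
    calc (t * |lam|) ^ (k + 1) * ‖M‖ = (t * |lam|) ^ k * (t * |lam| * ‖M‖) := by ring
      _ ≤ _ := mul_le_mul_of_nonneg_left e4 h7
      _ = t * ((t * |lam|) ^ k * ‖A‖) + (t * |lam|) ^ k * ‖B‖ := by ring
      _ ≤ t * (C₁ * t) + C₂ * t := by gcongr
      _ ≤ (max C₁ 0 + C₂) * t := by
        have : t * (C₁ * t) ≤ max C₁ 0 * t := by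
          calc t * (C₁ * t) ≤ t * (max C₁ 0 * t) := by gcongr; exact le_max_left _ _
            _ ≤ 1 * (max C₁ 0 * t) := by gcongr
            _ = _ := one_mul _
        linarith

lemma mellin_mul_dilate_le (hR : 0 ≤ R) (hRrp : R < rp) (k : ℕ) {G : ℝ → ℂ}
    (hG : ContDiff ℝ ∞ G) (hY : Y ∈ radialTest (Ioi R)) (p : ℝ) :
    ∃ C, 0 ≤ C ∧ ∀ t, 0 < t → t ≤ 1 → ∀ lam : ℝ,
      (1 + t * |lam|) ^ k * ‖mellin (fun r => G r * dilate rp t Y r) (p + lam * I)‖ ≤ C * t := by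
  obtain ⟨C₀, h₀⟩ := mellin_mul_dilate_le_aux hR hRrp 0 hG hY p
  obtain ⟨C₁, h₁⟩ := mellin_mul_dilate_le_aux hR hRrp k hG hY p
  have key : ∀ t, 0 < t → t ≤ 1 → ∀ lam : ℝ, (1 + t * |lam|) ^ k *
      ‖mellin (fun r => G r * dilate rp t Y r) (p + lam * I)‖ ≤ 2 ^ (k - 1) * (C₀ + C₁) * t :=
    fun t ht ht1 lam => by
      have h2 := add_pow_le (zero_le_one' ℝ) (mul_nonneg ht.le (abs_nonneg lam)) k
      have h3 := h₀ t ht ht1 lam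
      have h4 := h₁ t ht ht1 lam
      rw [pow_zero, one_mul] at h3
      calc _ ≤ 2 ^ (k - 1) * (1 ^ k + (t * |lam|) ^ k) *
            ‖mellin (fun r => G r * dilate rp t Y r) (p + lam * I)‖ := by gcongr
        _ = 2 ^ (k - 1) * (‖mellin (fun r => G r * dilate rp t Y r) (p + lam * I)‖ +
            (t * |lam|) ^ k * ‖mellin (fun r => G r * dilate rp t Y r) (p + lam * I)‖) := by ring
        _ ≤ 2 ^ (k - 1) * (C₀ * t + C₁ * t) := by gcongr
        _ = _ := by ring
  refine ⟨2 ^ (k - 1) * (C₀ + C₁), ?_, key⟩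
  have := key 1 one_pos le_rfl 0
  rw [mul_one] at this
  exact le_trans (by positivity) this

lemma mellin_decay {φ : ℝ → ℂ} {J : Set ℝ} (hφ : φ ∈ radialTest J) (k : ℕ) (p : ℝ) :
    ∃ C, 0 ≤ C ∧ ∀ lam : ℝ, (1 + |lam|) ^ k * ‖mellin φ (p + lam * I)‖ ≤ C := by
  obtain ⟨C, hC0, hC⟩ := mellin_mul_dilate_le (rp := 1) (R := 0) le_rfl one_pos k
    (G := fun _ => 1) contDiff_const (radialTest_le J hφ) p
  refine ⟨C, hC0, fun lam => ?_⟩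
  have := hC 1 one_pos le_rfl lam
  simpa [dilate] using this

end

/-! ## Dyadic sums -/

lemma sum_dyadic_le (lam : ℝ) (J : ℕ) :
    ∑ j ∈ Finset.range J, (1 / 2 : ℝ) ^ j * (1 + |lam|) / (1 + (1 / 2 : ℝ) ^ j * |lam|) ^ 2 ≤ 4 := by
  set F : ℕ → ℝ := fun j => (1 / 2 : ℝ) ^ j * |lam| / (1 + (1 / 2 : ℝ) ^ j * |lam|)
  set E : ℕ → ℝ := fun j => 2 * (1 / 2 : ℝ) ^ j
  have hF : ∀ j, 0 ≤ F j := fun j => by positivity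
  have h1 : ∀ j, (1 / 2 : ℝ) ^ j * (1 + |lam|) / (1 + (1 / 2 : ℝ) ^ j * |lam|) ^ 2 ≤
      (E j - E (j + 1)) + 2 * (F j - F (j + 1)) := fun j => by
    simp only [E, F, pow_succ _ j]
    set t := (1 / 2 : ℝ) ^ j
    have ht : 0 < t := by positivity
    set y := t * |lam| with hy
    have hy0 : 0 ≤ y := by positivity
    have e1 : t * (1 + |lam|) = t + y := by rw [hy]; ring
    have e2 : t * (1 / 2) * |lam| = y / 2 := by rw [hy]; ring
    rw [e1, e2]
    have h3 : t / (1 + y) ^ 2 ≤ t := div_le_self ht.le (by nlinarith)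
    have h4 : y / (1 + y) ^ 2 ≤ 2 * (y / (1 + y) - y / 2 / (1 + y / 2)) := by
      have : 2 * (y / (1 + y) - y / 2 / (1 + y / 2)) = 2 * y / ((1 + y) * (2 + y)) := by
        field_simp; ring
      rw [this, div_le_div_iff₀ (by positivity) (by positivity)]
      nlinarith [mul_nonneg hy0 hy0, mul_nonneg (mul_nonneg hy0 hy0) hy0]
    rw [add_div]
    linarith
  refine (Finset.sum_le_sum fun j _ => h1 j).trans ?_
  rw [Finset.sum_add_distrib, ← Finset.mul_sum, Finset.sum_range_sub', Finset.sum_range_sub']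
  have h2 : F 0 ≤ 1 := by
    simp only [F, pow_zero, one_mul]
    rw [div_le_one (by positivity)]
    linarith
  have h3 : 0 ≤ E J := by positivity
  have h4 : E 0 = 2 := by simp [E]
  linarith [hF J]

lemma dyadic_term_le {l : ℝ} (hl : 0 ≤ l) {k : ℕ} (hk : l + 2 ≤ k) {t : ℝ} (ht : 0 < t) (ht1 : t ≤ 1)
    (lam : ℝ) : (1 + |lam|) ^ (l + 1) * (t ^ (l + 1) / (1 + t * |lam|) ^ k) ≤
      t * (1 + |lam|) / (1 + t * |lam|) ^ 2 := by
  have hL : 0 < 1 + |lam| := by positivity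
  have hy : 1 ≤ 1 + t * |lam| := by
    have : 0 ≤ t * |lam| := by positivity
    linarith
  have h1 : t * (1 + |lam|) ≤ 1 + t * |lam| := by linarith
  have h2 : (t * (1 + |lam|)) ^ l ≤ (1 + t * |lam|) ^ ((k : ℝ) - 2) :=
    (Real.rpow_le_rpow (by positivity) h1 hl).trans
      (Real.rpow_le_rpow_of_exponent_le hy (by linarith))
  rw [← mul_div_assoc, ← Real.mul_rpow hL.le ht.le, mul_comm (1 + |lam|) t,
    div_le_div_iff₀ (by positivity) (by positivity), Real.rpow_add (by positivity), Real.rpow_one]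
  have h3 : (1 + t * |lam|) ^ k = (1 + t * |lam|) ^ ((k : ℝ) - 2) * (1 + t * |lam|) ^ 2 := by
    rw [← Real.rpow_natCast, ← Real.rpow_natCast _ 2, ← Real.rpow_add (by positivity)]
    norm_num
  rw [h3]
  have h4 : 0 ≤ (1 + t * |lam|) ^ 2 * (t * (1 + |lam|)) := by positivity
  nlinarith [mul_le_mul_of_nonneg_right h2 h4]

lemma lintegral_hump_le {t : ℝ} (ht : 0 < t) :
    ∫⁻ lam : ℝ, ENNReal.ofReal (t / (1 + t * |lam|) ^ 2) ≤ ENNReal.ofReal Real.pi := by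
  have h1 : Integrable fun lam : ℝ => t * (1 + (t * lam) ^ 2)⁻¹ :=
    (integrable_inv_one_add_sq.comp_mul_left' ht.ne').const_mul t
  have h2 : ∫ lam : ℝ, t * (1 + (t * lam) ^ 2)⁻¹ = Real.pi := by
    rw [integral_const_mul, Measure.integral_comp_mul_left (fun x : ℝ => (1 + x ^ 2)⁻¹) t,
      integral_univ_inv_one_add_sq, abs_of_pos (inv_pos.2 ht), smul_eq_mul,
      mul_inv_cancel_left₀ ht.ne']
  calc _ ≤ ∫⁻ lam : ℝ, ENNReal.ofReal (t * (1 + (t * lam) ^ 2)⁻¹) := by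
        refine lintegral_mono fun lam => ENNReal.ofReal_le_ofReal ?_
        rw [div_eq_mul_inv]
        gcongr
        have : 0 ≤ t * |lam| := by positivity
        have h3 : (t * lam) ^ 2 = (t * |lam|) ^ 2 := by rw [mul_pow, mul_pow, sq_abs]
        nlinarith
    _ = _ := by
        rw [← ofReal_integral_eq_lintegral_ofReal h1 (Eventually.of_forall fun x => by positivity), h2]

lemma symbol_le {e : ℝ} (he : 0 ≤ e) (k : ℝ) :
    ∃ C, 0 ≤ C ∧ ∀ lam : ℝ, (1 + lam ^ 2 + e) ^ k ≤ C * (1 + |lam|) ^ (2 * k) := by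
  have h2 : ∀ lam : ℝ, (1 + |lam|) ^ (2 * k) = ((1 + |lam|) ^ 2) ^ k := fun lam => by
    rw [← Real.rpow_natCast, ← Real.rpow_mul (by positivity)]; norm_num
  rcases le_or_gt 0 k with hk | hk
  · refine ⟨(1 + e) ^ k, by positivity, fun lam => ?_⟩
    rw [h2, ← Real.mul_rpow (by positivity) (by positivity)]
    refine Real.rpow_le_rpow (by positivity) ?_ hk
    nlinarith [sq_abs lam, abs_nonneg lam, mul_nonneg he (abs_nonneg lam), mul_nonneg he (sq_nonneg lam)]
  · refine ⟨(1 / 2) ^ k, by positivity, fun lam => ?_⟩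
    rw [h2, ← Real.mul_rpow (by positivity) (by positivity)]
    refine Real.rpow_le_rpow_of_nonpos (by positivity) ?_ hk.le
    nlinarith [sq_abs lam, sq_nonneg (1 - |lam|)]

lemma norm_prod_le (N : ℕ) (p : ℝ) :
    ∃ C, 0 ≤ C ∧ ∀ lam : ℝ, ‖∏ i ∈ Finset.range N, -((p : ℂ) + lam * I - 1 - i)‖ ≤ C * (1 + |lam|) ^ N := by
  refine ⟨(|p| + 1 + N) ^ N, by positivity, fun lam => ?_⟩
  rw [norm_prod, ← mul_pow]
  refine (Finset.prod_le_prod (fun _ _ => norm_nonneg _) fun i hi =>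
    (?_ : _ ≤ (|p| + 1 + N) * (1 + |lam|))).trans (by simp)
  rw [norm_neg]
  have hi' : (i : ℝ) ≤ N := by exact_mod_cast (Finset.mem_range.1 hi).le
  calc ‖(p : ℂ) + lam * I - 1 - i‖ ≤ ‖(p : ℂ)‖ + ‖(lam : ℂ) * I‖ + ‖(1 : ℂ)‖ + ‖(i : ℂ)‖ :=
        (norm_sub_le _ _).trans (add_le_add_left ((norm_sub_le _ _).trans
          (add_le_add_left (norm_add_le _ _) _)) _)
    _ = |p| + |lam| + 1 + i := by simp
    _ ≤ _ := by nlinarith [abs_nonneg p, abs_nonneg lam, mul_nonneg (abs_nonneg p) (abs_nonneg lam),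
        mul_nonneg (Nat.cast_nonneg (α := ℝ) N) (abs_nonneg lam)]

/-! ## Functionals of finite regularity across the horizon -/

lemma radialTest.exists_isCompact {J : Set ℝ} {φ : ℝ → ℂ} (h : φ ∈ radialTest J) :
    ∃ K : Set ℝ, IsCompact K ∧ K ⊆ J ∩ Ioi 0 ∧ ∀ r, r ∉ K → φ r = 0 ∧ _root_.deriv φ r = 0 := by
  obtain ⟨h1, K, hK, hKJ, h2⟩ := h
  exact ⟨K, hK, hKJ, fun r hr => ⟨h2 r hr, deriv_eq_zero_of_isOpen hK.isClosed.isOpen_compl h2 hr⟩⟩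

/-- Iterated differentiation of radial test functions. -/
def iterDerivLM (J : Set ℝ) (k : ℕ) : radialTest J →ₗ[ℂ] radialTest J where
  toFun φ := ⟨iteratedDeriv k φ, radialTest.iteratedDeriv φ.2 k⟩
  map_add' φ ψ := Subtype.ext (funext fun _ =>
    iteratedDeriv_add (φ.2.1.contDiffAt.of_le (mod_cast le_top))
      (ψ.2.1.contDiffAt.of_le (mod_cast le_top)))
  map_smul' c φ := Subtype.ext (funext fun _ => iteratedDeriv_const_smul_field c (φ : ℝ → ℂ))

/-- Multiplication of radial test functions by a smooth function. -/
def mulLM (J : Set ℝ) {G : ℝ → ℂ} (hG : ContDiff ℝ ∞ G) : radialTest J →ₗ[ℂ] radialTest J where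
  toFun φ := ⟨fun r => G r * (φ : ℝ → ℂ) r, radialTest.smooth_mul hG φ.2⟩
  map_add' _ _ := Subtype.ext (funext fun _ => mul_add _ _ _)
  map_smul' _ _ := Subtype.ext (funext fun _ => mul_left_comm _ _ _)

section
variable {rp d R : ℝ} {κ : ℂ} {l s : ℝ} {N : ℕ}

/-- A smooth function equal to `(r - (rp - d))^β` for `r ≥ R`. -/
def cutPow (rp d R : ℝ) (β : ℂ) (r : ℝ) : ℂ :=
  stepUp ((rp - d + R) / 2) R r * ((r : ℂ) - (rp - d : ℝ)) ^ β

lemma contDiff_cutPow (hR : rp - d < R) (β : ℂ) : ContDiff ℝ ∞ (cutPow rp d R β) :=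
  contDiff_stepUp_mul (by linarith) (by linarith) (contDiffOn_cpow _ β)

lemma cutPow_of_ge (hR : rp - d < R) {r : ℝ} (hr : R ≤ r) (β : ℂ) :
    cutPow rp d R β r = ((r : ℂ) - (rp - d : ℝ)) ^ β := by
  rw [cutPow, stepUp_of_ge (by linarith) hr, one_mul]

lemma exists_radOp_iteratedDeriv_eq (hN : (N : ℝ) = l + s) (hR : rp - d < R) {X : ℝ → ℂ}
    (hX : X ∈ radialTest (Ioi R)) : ∃ φ ∈ radialTest (Ioi R),
      iteratedDeriv (N + 1) (fun r => cutPow rp d R (l - κ + 1) r *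
        (-((r : ℂ) - rp) * deriv X r + (l + κ) * X r)) = radOp rp d (-κ) l (-s) φ := by
  set χ : ℝ → ℂ := fun r => cutPow rp d R (l - κ) r * X r
  have hχ : χ ∈ radialTest (Ioi R) := radialTest.smooth_mul (contDiff_cutPow hR _) hX
  obtain ⟨K, hK, hKR, h0⟩ := radialTest.exists_isCompact hX
  have hA : (fun r : ℝ => cutPow rp d R (l - κ + 1) r * (-((r : ℂ) - rp) * deriv X r + (l + κ) * X r)) =
      fun r : ℝ => -(((r : ℂ) - rp) * ((r : ℂ) - rp + d)) * deriv χ r +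
        (l * (2 * ((r : ℂ) - rp) + d) + d * κ) * χ r := funext fun r => by
    have hd1 : deriv χ r = deriv (cutPow rp d R (l - κ)) r * X r +
        cutPow rp d R (l - κ) r * deriv X r :=
      ((hasDerivAt_of_contDiff (contDiff_cutPow hR _) r).mul (hasDerivAt_of_contDiff hX.1 r)).deriv
    by_cases hr : r ∈ K
    · have hRr : R < r := (hKR hr).1
      have hpos : rp - d < r := hR.trans hRr
      have hxd : (r : ℂ) - (rp - d : ℝ) ≠ 0 := sub_ne_zero.2 (ofReal_inj.not.2 hpos.ne')
      have hd2 : deriv (cutPow rp d R (l - κ)) r =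
          (l - κ) * ((r : ℂ) - (rp - d : ℝ)) ^ (l - κ - 1 : ℂ) := by
        have := hasDerivAt_cpow_sub hpos (l - κ : ℂ)
        refine (this.congr_of_eventuallyEq ?_).deriv
        filter_upwards [Ioi_mem_nhds hRr] with x hx using cutPow_of_ge hR (le_of_lt hx) _
      have e1 : ((r : ℂ) - (rp - d : ℝ)) ^ (l - κ : ℂ) =
          ((r : ℂ) - (rp - d : ℝ)) ^ (l - κ - 1 : ℂ) * ((r : ℂ) - (rp - d : ℝ)) := by
        rw [← cpow_add_one_eq hxd]; ring_nf
      simp only [χ]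
      rw [hd1, hd2, cutPow_of_ge hR hRr.le, cutPow_of_ge hR hRr.le, cpow_add_one_eq hxd, e1]
      push_cast; ring
    · simp only [hd1, χ, (h0 r hr).1, (h0 r hr).2]; ring
  have hB : deriv (fun r : ℝ => -(((r : ℂ) - rp) * ((r : ℂ) - rp + d)) * deriv χ r +
        (l * (2 * ((r : ℂ) - rp) + d) + d * κ) * χ r) = radOp rp d (-κ) l l χ := funext fun r => by
    have hx : HasDerivAt (fun r : ℝ => (r : ℂ) - rp) 1 r :=
      (hasDerivAt_id r).ofReal_comp.sub_const _
    refine (((hx.mul (hx.add_const (d : ℂ))).neg.mul (hasDerivAt_of_contDiff (contDiff_deriv hχ.1) r)).add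
      (((((hx.const_mul 2).add_const (d : ℂ)).const_mul (l : ℂ)).add_const (d * κ)).mul
        (hasDerivAt_of_contDiff hχ.1 r))).deriv.trans ?_
    simp only [radOp, Pi.mul_apply, Pi.neg_apply]
    ring
  refine ⟨iteratedDeriv N χ, radialTest.iteratedDeriv hχ N, ?_⟩
  rw [hA, iteratedDeriv_succ', hB, iteratedDeriv_radOp hχ.1]
  have : (l : ℂ) - N = -s := by
    have : (N : ℂ) = l + s := by exact_mod_cast hN
    rw [this]; ring
  rw [this]

lemma exists_dilation_primitive (hR0 : 0 ≤ R) (hRrp : R < rp) {X : ℝ → ℂ}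
    (hX : X ∈ radialTest (Ioi R)) {t : ℝ} (ht : 0 < t) (ht1 : t ≤ 1) :
    ∃ ψ ∈ radialTest (Ioi R), ∀ r : ℝ, -((r : ℂ) - rp) * deriv ψ r + (l + κ) * ψ r =
      X r - (t : ℂ) ^ (l + κ) * dilate rp t X r := by
  set γ : ℂ := l + κ
  have hpw : ∀ β : ℂ, ContinuousOn (fun τ : ℝ => (τ : ℂ) ^ β) (Icc t 1) := fun β τ hτ => by
    have := (hasDerivAt_cpow_sub (c := 0) (ht.trans_le hτ.1) β).continuousAt.continuousWithinAt
      (s := Icc t 1)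
    simpa using this
  have hw : Integrable (fun τ : ℝ => (τ : ℂ) ^ (γ - 1)) (volume.restrict (Ioc t 1)) :=
    ((hpw (γ - 1)).integrableOn_compact isCompact_Icc).mono_set Ioc_subset_Icc_self
  have hinv : ContinuousOn (fun τ : ℝ => τ⁻¹) (Icc t 1) :=
    continuousOn_id.inv₀ fun τ hτ => (ht.trans_le hτ.1).ne'
  have hg : AEStronglyMeasurable (fun τ : ℝ => τ⁻¹) (volume.restrict (Ioc t 1)) :=
    measurable_inv.aestronglyMeasurable
  have hG : ∀ᵐ τ : ℝ ∂(volume.restrict (Ioc t 1)), |τ⁻¹| ≤ t⁻¹ := by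
    refine (ae_restrict_iff' measurableSet_Ioc).2 (Eventually.of_forall fun τ hτ => ?_)
    rw [abs_of_pos (inv_pos.2 (ht.trans hτ.1))]
    exact inv_anti₀ ht hτ.1.le
  set ψ : ℝ → ℂ := fun r => ∫ τ in Ioc t 1, (τ : ℂ) ^ (γ - 1) * X (rp + τ⁻¹ * (r - rp))
  have hψ : ContDiff ℝ ∞ ψ := contDiff_dilationIntegral hw hg hG hX.1 rp
  have hψ' := fun r => hasDerivAt_dilationIntegral hw hg hG hX.1 rp r
  refine ⟨ψ, ?_, fun r => ?_⟩
  · obtain ⟨_, K, hK, hKR, h0⟩ := hX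
    refine ⟨hψ, (fun x : ℝ × ℝ => rp + x.1 * (x.2 - rp)) '' (Icc t 1 ×ˢ K),
      (isCompact_Icc.prod hK).image (by fun_prop), ?_, fun r hr => ?_⟩
    · rintro _ ⟨⟨τ, y⟩, ⟨hτ, hy⟩, rfl⟩
      have hyR : R < y := (hKR hy).1
      have hτ0 := ht.trans_le hτ.1
      have hτ1 : τ ≤ 1 := hτ.2
      have : R < rp + τ * (y - rp) := by nlinarith
      exact ⟨this, lt_of_le_of_lt hR0 this⟩
    · simp only [ψ]
      rw [setIntegral_congr_fun (g := fun _ => 0) measurableSet_Ioc fun τ hτ => ?_, integral_zero]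
      have hτ0 := ht.trans hτ.1
      simp only
      rw [h0 _ fun hK' => hr ⟨(τ, rp + τ⁻¹ * (r - rp)), ⟨⟨hτ.1.le, hτ.2⟩, hK'⟩, ?_⟩, mul_zero]
      simp only
      field_simp
      ring
  · have hc : ∀ {F : ℝ → ℂ}, Continuous F →
        ContinuousOn (fun τ : ℝ => F (rp + τ⁻¹ * (r - rp))) (Icc t 1) := fun hF =>
      hF.comp_continuousOn (continuousOn_const.add (hinv.mul continuousOn_const))
    have i1 : IntegrableOn (fun τ : ℝ => (τ : ℂ) ^ (γ - 1) * X (rp + τ⁻¹ * (r - rp))) (Ioc t 1) :=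
      (((hpw _).mul (hc hX.1.continuous)).integrableOn_compact isCompact_Icc).mono_set
        Ioc_subset_Icc_self
    have i2 : IntegrableOn (fun τ : ℝ => (τ : ℂ) ^ (γ - 1) * (τ⁻¹ : ℝ) *
        deriv X (rp + τ⁻¹ * (r - rp))) (Ioc t 1) :=
      ((((hpw _).mul (continuous_ofReal.comp_continuousOn hinv)).mul
        (hc (contDiff_deriv hX.1).continuous)).integrableOn_compact isCompact_Icc).mono_set
        Ioc_subset_Icc_self
    have hFTC := intervalIntegral.integral_eq_sub_of_hasDerivAt_of_le (a := t) (b := 1)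
      (f := fun τ : ℝ => (τ : ℂ) ^ γ * X (rp + τ⁻¹ * (r - rp)))
      (f' := fun τ : ℝ => -((r : ℂ) - rp) * ((τ : ℂ) ^ (γ - 1) * (τ⁻¹ : ℝ) *
          deriv X (rp + τ⁻¹ * (r - rp))) + γ * ((τ : ℂ) ^ (γ - 1) * X (rp + τ⁻¹ * (r - rp)))) ht1
      ((hpw _).mul (hc hX.1.continuous))
      (fun τ hτ => by
        have hτp : 0 < τ := ht.trans hτ.1
        have hτ0 : (τ : ℂ) ≠ 0 := ofReal_ne_zero.2 hτp.ne'
        have h1 := hasDerivAt_cpow_sub (c := 0) hτp γ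
        simp only [ofReal_zero, sub_zero] at h1
        have h2 : HasDerivAt (fun τ : ℝ => rp + τ⁻¹ * (r - rp)) (-(τ ^ 2)⁻¹ * (r - rp)) τ := by
          simpa using ((hasDerivAt_inv hτp.ne').mul_const (r - rp)).const_add rp
        have h3 := (hasDerivAt_of_contDiff hX.1 (rp + τ⁻¹ * (r - rp))).scomp τ h2
        refine (h1.mul h3).congr_deriv ?_
        have e : (τ : ℂ) ^ γ = (τ : ℂ) ^ (γ - 1) * τ := by
          rw [← cpow_add_one_eq hτ0, sub_add_cancel]
        rw [e, real_smul, Function.comp_apply]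
        push_cast
        field_simp
        ring)
      ((intervalIntegrable_iff_integrableOn_Ioc_of_le ht1).2
        ((i2.const_mul _).add (i1.const_mul _)))
    rw [(hψ' r).deriv]
    simp only [ψ]
    rw [← integral_const_mul, ← integral_const_mul, ← integral_add (i2.const_mul _) (i1.const_mul _),
      ← intervalIntegral.integral_of_le ht1, hFTC]
    simp [dilate, div_eq_inv_mul]

/-- A functional that annihilates the range of the radial operator and is bounded in the critical
Sobolev norm annihilates derivatives of order `N + 1`. -/
theorem eq_zero_on_iteratedDeriv (hR0 : 0 ≤ R) (hR : rp - d < R) (hRrp : R < rp)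
    (hκ : κ.re = 0) (hl : 0 ≤ l) (hN : (N : ℝ) = l + s) {e p : ℝ} (he : 0 ≤ e) {C : ℝ≥0}
    (V : radialTest (Ioi R) →ₗ[ℂ] ℂ)
    (hV : ∀ φ : radialTest (Ioi R), ENNReal.ofReal (‖V φ‖ ^ 2) ≤ C * 𝓜²((φ : ℝ → ℂ), e, -(s + 1 / 2), p))
    (hT : ∀ φ : radialTest (Ioi R), V ⟨radOp rp d (-κ) l (-s) φ, radOp_mem φ.2⟩ = 0)
    (φ : radialTest (Ioi R)) : V (iterDerivLM (Ioi R) (N + 1) φ) = 0 := by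
  set G := cutPow rp d R (l - κ + 1)
  have hG : ContDiff ℝ ∞ G := contDiff_cutPow hR _
  set W : radialTest (Ioi R) →ₗ[ℂ] ℂ := V ∘ₗ iterDerivLM (Ioi R) (N + 1) ∘ₗ mulLM (Ioi R) hG
  have hW0 : ∀ X : radialTest (Ioi R), ∀ Y : radialTest (Ioi R),
      (∀ r : ℝ, (Y : ℝ → ℂ) r = -((r : ℂ) - rp) * deriv (X : ℝ → ℂ) r + (l + κ) * (X : ℝ → ℂ) r) →
      W Y = 0 := fun X Y hXY => by
    obtain ⟨φ, hφ, h⟩ := exists_radOp_iteratedDeriv_eq (κ := κ) hN hR X.2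
    rw [← hT ⟨φ, hφ⟩]
    refine congrArg V (Subtype.ext ?_)
    simp only [← h]
    change iteratedDeriv (N + 1) (fun r => G r * (Y : ℝ → ℂ) r) = _
    congr 1
    funext r
    rw [hXY]
  set X := fun (t : ℝ) (ht : 0 < t) (ht1 : t ≤ 1) (φ : radialTest (Ioi R)) =>
    (⟨dilate rp t φ, dilate_mem hR0 hRrp ht ht1 φ.2⟩ : radialTest (Ioi R))
  have hscale : ∀ (φ : radialTest (Ioi R)) (t : ℝ) (ht : 0 < t) (ht1 : t ≤ 1),
      W φ = (t : ℂ) ^ (l + κ) * W (X t ht ht1 φ) := fun φ t ht ht1 => by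
    obtain ⟨ψ, hψ, h⟩ := exists_dilation_primitive (l := l) hR0 hRrp φ.2 ht ht1
    have := hW0 ⟨ψ, hψ⟩ (φ - (t : ℂ) ^ (l + κ) • X t ht ht1 φ) fun r => (h r).symm
    rwa [map_sub, map_smul, smul_eq_mul, sub_eq_zero] at this
  obtain ⟨k, hk⟩ := exists_nat_ge (l + 2)
  have main : ∀ φ : radialTest (Ioi R), W φ = 0 := fun φ => by
    obtain ⟨C₁, hC₁, h₁⟩ := mellin_mul_dilate_le hR0 hRrp k hG φ.2 (p - (N + 1 : ℕ))
    obtain ⟨C₂, hC₂, h₂⟩ := norm_prod_le (N + 1) p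
    obtain ⟨C₃, hC₃, h₃⟩ := symbol_le he (-(s + 1 / 2))
    have hj0 : ∀ j : ℕ, (0 : ℝ) < (1 / 2) ^ j := fun j => by positivity
    have hj1 : ∀ j : ℕ, (1 / 2 : ℝ) ^ j ≤ 1 := fun j => pow_le_one₀ (by norm_num) (by norm_num)
    set Y : ℕ → radialTest (Ioi R) := fun J => ∑ j ∈ Finset.range J,
      (((1 / 2 : ℝ) ^ j : ℝ) : ℂ) ^ (l + κ) • X _ (hj0 j) (hj1 j) φ
    have hY : ∀ J, W (Y J) = J * W φ := fun J => by
      simp only [Y, map_sum, map_smul, smul_eq_mul, ← hscale, Finset.sum_const, Finset.card_range, nsmul_eq_mul]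
    set hump : ℕ → ℝ → ℝ := fun j lam => (1 / 2 : ℝ) ^ j / (1 + (1 / 2 : ℝ) ^ j * |lam|) ^ 2
    have hhump : ∀ j lam, 0 ≤ hump j lam := fun j lam => by positivity
    set D := C₃ * (C₂ * C₁) ^ 2 * 4
    have hbound : ∀ (J : ℕ) (lam : ℝ), (1 + lam ^ 2 + e) ^ (-(s + 1 / 2)) *
        ‖mellin (iterDerivLM (Ioi R) (N + 1) (mulLM (Ioi R) hG (Y J)) : ℝ → ℂ) (p + lam * I)‖ ^ 2 ≤
        D * ∑ j ∈ Finset.range J, hump j lam := fun J lam => by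
      have hL : 0 < 1 + |lam| := by positivity
      set S := ∑ j ∈ Finset.range J, ((1 / 2 : ℝ) ^ j) ^ (l + 1) / (1 + (1 / 2 : ℝ) ^ j * |lam|) ^ k
      have hS0 : 0 ≤ S := by positivity
      set H := ∑ j ∈ Finset.range J, hump j lam
      have hH0 : 0 ≤ H := Finset.sum_nonneg fun j _ => hhump j lam
      have e1 : (mulLM (Ioi R) hG (Y J) : ℝ → ℂ) = fun r => ∑ j ∈ Finset.range J,
          (((1 / 2 : ℝ) ^ j : ℝ) : ℂ) ^ (l + κ) * (G r * dilate rp ((1 / 2 : ℝ) ^ j) φ r) :=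
        funext fun r => by
          change G r * (Y J : ℝ → ℂ) r = _
          have : (Y J : ℝ → ℂ) r = ∑ j ∈ Finset.range J, (((1 / 2 : ℝ) ^ j : ℝ) : ℂ) ^ (l + κ) *
              dilate rp ((1 / 2 : ℝ) ^ j) φ r := by
            simp only [Y, Submodule.coe_sum, Finset.sum_apply]
            rfl
          rw [this, Finset.mul_sum]
          exact Finset.sum_congr rfl fun j _ => by ring
      have e2 : ‖mellin (mulLM (Ioi R) hG (Y J) : ℝ → ℂ) (p + lam * I - (N + 1 : ℕ))‖ ≤ C₁ * S := by
        have e3 : mellin (mulLM (Ioi R) hG (Y J) : ℝ → ℂ) (p + lam * I - (N + 1 : ℕ)) =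
            ∑ j ∈ Finset.range J, (((1 / 2 : ℝ) ^ j : ℝ) : ℂ) ^ (l + κ) *
              mellin (fun r => G r * dilate rp ((1 / 2 : ℝ) ^ j) φ r) ((p - (N + 1 : ℕ) : ℝ) + lam * I) := by
          rw [e1, mellin_eq]
          simp only [Finset.mul_sum]
          rw [integral_finsetSum _ fun j _ => radialTest.integrableOn_cpow_mul
            (radialTest.smooth_mul (a := fun _ => (((1 / 2 : ℝ) ^ j : ℝ) : ℂ) ^ (l + κ)) contDiff_const
              (radialTest.smooth_mul hG (X _ (hj0 j) (hj1 j) φ).2)) _]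
          refine Finset.sum_congr rfl fun j _ => ?_
          rw [← mellin_const_mul, mellin_eq]
          congr 1
          funext r
          congr 2
          push_cast; ring
        rw [e3, Finset.mul_sum]
        refine (norm_sum_le _ _).trans (Finset.sum_le_sum fun j _ => ?_)
        have h4 := h₁ _ (hj0 j) (hj1 j) lam
        have hden : 0 < (1 + (1 / 2 : ℝ) ^ j * |lam|) ^ k := by positivity
        rw [norm_mul, norm_cpow_eq_rpow_re_of_pos (hj0 j), show ((l : ℂ) + κ).re = l by simp [hκ],
          Real.rpow_add (hj0 j), Real.rpow_one, ← mul_div_assoc, le_div_iff₀ hden]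
        have h5 : 0 ≤ ((1 / 2 : ℝ) ^ j) ^ l := by positivity
        nlinarith [mul_le_mul_of_nonneg_left h4 h5]
      have e4 : ‖mellin (iterDerivLM (Ioi R) (N + 1) (mulLM (Ioi R) hG (Y J)) : ℝ → ℂ)
          (p + lam * I)‖ ≤ C₂ * C₁ * ((1 + |lam|) ^ (N + 1) * S) := by
        have e5 := mellin_iteratedDeriv (mulLM (Ioi R) hG (Y J)).2 (N + 1) (p + lam * I)
        change ‖mellin (iteratedDeriv (N + 1) (mulLM (Ioi R) hG (Y J) : ℝ → ℂ)) (p + lam * I)‖ ≤ _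
        rw [e5, norm_mul]
        calc _ ≤ C₂ * (1 + |lam|) ^ (N + 1) * (C₁ * S) :=
              mul_le_mul (h₂ lam) e2 (norm_nonneg _) (by positivity)
          _ = _ := by ring
      have e6 : (1 + |lam|) ^ (l + 1) * S ≤ (1 + |lam|) * H := by
        simp only [S, H, Finset.mul_sum]
        refine Finset.sum_le_sum fun j _ => (dyadic_term_le hl hk (hj0 j) (hj1 j) lam).trans
          (le_of_eq ?_)
        simp only [hump]; ring
      have e7 : (1 + |lam|) * H ≤ 4 := by
        refine (le_of_eq ?_).trans (sum_dyadic_le lam J)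
        simp only [H, hump, Finset.mul_sum]
        exact Finset.sum_congr rfl fun j _ => by ring
      have e8 : (1 + |lam|) ^ (2 * -(s + 1 / 2)) * ((1 + |lam|) ^ (N + 1) * S) ^ 2 =
          ((1 + |lam|) ^ (l + 1) * S) ^ 2 / (1 + |lam|) := by
        rw [mul_pow, mul_pow, ← mul_assoc, mul_div_right_comm]
        congr 1
        rw [eq_div_iff hL.ne', ← pow_mul, ← Real.rpow_natCast, ← Real.rpow_natCast, ← Real.rpow_mul hL.le,
          ← Real.rpow_add hL]
        nth_rewrite 2 [← Real.rpow_one (1 + |lam|)]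
        rw [← Real.rpow_add hL]
        congr 1
        push_cast
        rw [hN]; ring
      calc _ ≤ C₃ * (1 + |lam|) ^ (2 * -(s + 1 / 2)) *
            (C₂ * C₁ * ((1 + |lam|) ^ (N + 1) * S)) ^ 2 := by
            gcongr
            exact h₃ lam
        _ = C₃ * (C₂ * C₁) ^ 2 * ((1 + |lam|) ^ (2 * -(s + 1 / 2)) * ((1 + |lam|) ^ (N + 1) * S) ^ 2) := by
            ring
        _ = C₃ * (C₂ * C₁) ^ 2 * (((1 + |lam|) ^ (l + 1) * S) ^ 2 / (1 + |lam|)) := by rw [e8]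
        _ ≤ C₃ * (C₂ * C₁) ^ 2 * (((1 + |lam|) * H) ^ 2 / (1 + |lam|)) := by gcongr
        _ = C₃ * (C₂ * C₁) ^ 2 * (((1 + |lam|) * H) * H) := by field_simp
        _ ≤ C₃ * (C₂ * C₁) ^ 2 * (4 * H) := by gcongr
        _ = D * H := by ring
    have hD : 0 ≤ D := by positivity
    have hJ : ∀ J : ℕ, (J : ℝ) ^ 2 * ‖W φ‖ ^ 2 ≤ (C * D * Real.pi) * J := fun J => by
      have h4 := hV (iterDerivLM (Ioi R) (N + 1) (mulLM (Ioi R) hG (Y J)))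
      have h5 : V (iterDerivLM (Ioi R) (N + 1) (mulLM (Ioi R) hG (Y J))) = J * W φ := hY J
      rw [h5, norm_mul, mul_pow, norm_natCast] at h4
      have h6 : 𝓜²((iterDerivLM (Ioi R) (N + 1) (mulLM (Ioi R) hG (Y J)) : ℝ → ℂ), e, -(s + 1 / 2), p) ≤
          ENNReal.ofReal (D * Real.pi * J) := by
        calc _ ≤ ∫⁻ lam : ℝ, ENNReal.ofReal D * ∑ j ∈ Finset.range J, ENNReal.ofReal (hump j lam) := by
              refine lintegral_mono fun lam => ?_
              rw [← ENNReal.ofReal_sum_of_nonneg fun j _ => hhump j lam, ← ENNReal.ofReal_mul hD]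
              exact ENNReal.ofReal_le_ofReal (hbound J lam)
          _ = ENNReal.ofReal D * ∑ j ∈ Finset.range J, ∫⁻ lam : ℝ, ENNReal.ofReal (hump j lam) := by
              rw [lintegral_const_mul' _ _ ENNReal.ofReal_ne_top, lintegral_finsetSum]
              intro j _
              have : Continuous (hump j) := by
                refine continuous_const.div (by fun_prop) fun lam => ?_
                have := hj0 j
                positivity
              exact this.measurable.ennreal_ofReal
          _ ≤ ENNReal.ofReal D * ∑ j ∈ Finset.range J, ENNReal.ofReal Real.pi := by
              gcongr with j _
              exact lintegral_hump_le (hj0 j)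
          _ = _ := by
              rw [Finset.sum_const, Finset.card_range, nsmul_eq_mul, mul_assoc,
                ENNReal.ofReal_mul hD, mul_comm Real.pi, ENNReal.ofReal_mul (Nat.cast_nonneg _),
                ENNReal.ofReal_natCast]
      have h7 := h4.trans (mul_le_mul_right h6 _)
      rw [← ENNReal.ofReal_coe_nnreal, ← ENNReal.ofReal_mul C.coe_nonneg,
        ENNReal.ofReal_le_ofReal_iff (by have := Real.pi_pos; positivity)] at h7
      linarith
    by_contra hne
    have hpos : 0 < ‖W φ‖ ^ 2 := by
      have := norm_pos_iff.2 hne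
      positivity
    obtain ⟨J, hJ'⟩ := exists_nat_gt (C * D * Real.pi / ‖W φ‖ ^ 2)
    rw [div_lt_iff₀ hpos] at hJ'
    have hJpos : 0 < (J : ℝ) := by
      have h0 : 0 ≤ C * D * Real.pi := by have := Real.pi_pos; positivity
      by_contra hneg
      nlinarith [not_lt.1 hneg]
    nlinarith [hJ J]
  have hG' : ContDiff ℝ ∞ (cutPow rp d R (-(l - κ + 1))) := contDiff_cutPow hR _
  have hfin := main (mulLM (Ioi R) hG' φ)
  have heq : mulLM (Ioi R) hG (mulLM (Ioi R) hG' φ) = φ := Subtype.ext (funext fun r => by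
    change G r * (cutPow rp d R (-(l - κ + 1)) r * (φ : ℝ → ℂ) r) = _
    obtain ⟨K, hK, hKR, h0⟩ := radialTest.exists_isCompact φ.2
    by_cases hr : r ∈ K
    · have hRr : R < r := (hKR hr).1
      have hxd : (r : ℂ) - (rp - d : ℝ) ≠ 0 := sub_ne_zero.2 (ofReal_inj.not.2 (hR.trans hRr).ne')
      simp only [G]
      rw [cutPow_of_ge hR hRr.le, cutPow_of_ge hR hRr.le, ← mul_assoc, ← cpow_add _ _ hxd,
        add_neg_cancel, cpow_zero, one_mul]
    · rw [(h0 r hr).1, mul_zero, mul_zero])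
  change V (iterDerivLM (Ioi R) (N + 1) (mulLM (Ioi R) hG (mulLM (Ioi R) hG' φ))) = 0 at hfin
  rwa [heq] at hfin

end

/-! ## Polynomial densities -/

section
variable {R rp : ℝ} {φ : ℝ → ℂ}

lemma setIntegral_Ioi_mul_eq {h : ℝ → ℂ} (hφ : φ ∈ radialTest (Ioi R)) :
    ∫ r in Ioi R, h r * φ r = ∫ r, h r * φ r := by
  obtain ⟨a, b, ha, -, -, h0⟩ := radialTest.exists_Icc_Ioi hφ
  refine setIntegral_eq_integral_of_forall_compl_eq_zero fun r hr => ?_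
  rw [h0 r fun h => hr (ha.trans_le h.1), mul_zero]

lemma integral_deriv_eq_zero_of_mem {J : Set ℝ} (h : φ ∈ radialTest J) : ∫ r, deriv φ r = 0 :=
  integral_eq_zero_of_hasDerivAt_of_integrable (fun r => hasDerivAt_of_contDiff h.1 r)
    (radialTest.integrable (radialTest.deriv h)) (radialTest.integrable h)

/-- Nonnegative test functions near a point. -/
lemma exists_bump {c δ : ℝ} (hδ : 0 < δ) (hc : δ < c) : ∃ ρ : ℝ → ℝ,
    (fun r => (ρ r : ℂ)) ∈ radialTest (Ioo (c - δ) (c + δ)) ∧ (∀ r, 0 ≤ ρ r) ∧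
      ∀ r ∈ Metric.ball c (δ / 4), ρ r = 1 := by
  let f : ContDiffBump c := ⟨δ / 4, δ / 2, by linarith, by linarith⟩
  refine ⟨f, ⟨ofRealCLM.contDiff.comp f.contDiff, Metric.closedBall c (δ / 2),
    isCompact_closedBall _ _, fun r hr => ?_, fun r hr => ?_⟩, fun r => f.nonneg, fun r hr =>
    f.one_of_mem_closedBall (Metric.ball_subset_closedBall hr)⟩
  · rw [Real.closedBall_eq_Icc] at hr
    refine ⟨⟨by linarith [hr.1], by linarith [hr.2]⟩, ?_⟩
    change 0 < r
    linarith [hr.1]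
  · have : f r = 0 := f.zero_of_le_dist (by
      rw [Metric.mem_closedBall, not_le] at hr
      exact hr.le)
    simp [this]

lemma exists_integral_eq_one (hR0 : 0 ≤ R) : ∃ ρ ∈ radialTest (Ioi R), ∫ r, ρ r = 1 := by
  obtain ⟨ρ, hρ, hρ0, hρ1⟩ := exists_bump (c := R + 2) one_pos (by linarith)
  have hcont : Continuous ρ := by
    have := continuous_re.comp hρ.1.continuous
    exact this
  have hcs : HasCompactSupport ρ := by
    have := (radialTest.hasCompactSupport hρ).comp_left (g := re) rfl
    exact this
  have hpos : 0 < ∫ r, ρ r := hcont.integral_pos_of_hasCompactSupport_nonneg_nonzero hcs hρ0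
    (x := R + 2) (by rw [hρ1 _ (Metric.mem_ball_self (by norm_num))]; norm_num)
  have hI : ∫ r, (ρ r : ℂ) = ((∫ r, ρ r : ℝ) : ℂ) := integral_complex_ofReal
  have hmem := radialTest.mono (J' := Ioi R) (fun r hr => by
    have := hr.1
    change R < r
    linarith) hρ
  refine ⟨_, (radialTest (Ioi R)).smul_mem ((∫ r, ρ r : ℝ) : ℂ)⁻¹ hmem, ?_⟩
  simp only [Pi.smul_apply, smul_eq_mul]
  rw [integral_const_mul, hI, inv_mul_cancel₀ (ofReal_ne_zero.2 hpos.ne')]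

lemma exists_primitive_mem (hφ : φ ∈ radialTest (Ioi R)) (h0 : ∫ r, φ r = 0) :
    ∃ ψ ∈ radialTest (Ioi R), deriv ψ = φ := by
  obtain ⟨α, b, ha, ha', hab, hz⟩ := radialTest.exists_Icc_Ioi hφ
  have hd : ∀ r, HasDerivAt (fun r => ∫ t in α..r, φ t) (φ r) r := fun r =>
    intervalIntegral.integral_hasDerivAt_right (hφ.1.continuous.intervalIntegrable _ _)
      hφ.1.continuous.stronglyMeasurable.stronglyMeasurableAtFilter hφ.1.continuous.continuousAt
  refine ⟨fun r => ∫ t in α..r, φ t, ⟨?_, Icc α b, isCompact_Icc, fun r hr => ?_,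
    fun r hr => ?_⟩, funext fun r => (hd r).deriv⟩
  · refine contDiff_infty_iff_deriv.2 ⟨fun r => (hd r).differentiableAt, ?_⟩
    rw [funext fun r => (hd r).deriv]; exact hφ.1
  · exact ⟨ha.trans_le hr.1, ha'.trans_le hr.1⟩
  · simp only
    rcases lt_or_ge r α with h | h
    · rw [intervalIntegral.integral_symm, neg_eq_zero, intervalIntegral.integral_of_le h.le,
        integral_Ioc_eq_integral_Ioo]
      exact setIntegral_eq_zero_of_forall_eq_zero fun t ht => hz t fun h' => not_le.2 ht.2 h'.1
    · rw [intervalIntegral.integral_of_le h, ← h0, ← integral_Icc_eq_integral_Ioc]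
      refine setIntegral_eq_integral_of_forall_compl_eq_zero fun t ht => hz t fun h2 => ht ⟨h2.1, ?_⟩
      by_contra hlt
      exact hr ⟨h, (not_le.1 hlt).le.trans h2.2⟩

open Polynomial

lemma exists_antiderivative (P : ℂ[X]) : ∃ Q : ℂ[X], derivative Q = P := by
  refine ⟨P.sum fun i a => C (a / (i + 1)) * X ^ (i + 1), ?_⟩
  conv_rhs => rw [P.as_sum_support_C_mul_X_pow]
  rw [sum_def, derivative_sum]
  refine Finset.sum_congr rfl fun i _ => ?_
  rw [derivative_C_mul_X_pow]
  push_cast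
  rw [div_mul_cancel₀ _ (Nat.cast_add_one_ne_zero i)]

lemma contDiff_eval (P : ℂ[X]) (rp : ℝ) : ContDiff ℝ ∞ (fun r : ℝ => P.eval ((r : ℂ) - rp)) := by
  have h1 : ContDiff ℂ ∞ (fun z : ℂ => P.eval z) := P.differentiable.contDiff
  exact (h1.restrict_scalars ℝ).comp (ofRealCLM.contDiff.sub contDiff_const)

lemma hasDerivAt_eval (P : ℂ[X]) (rp r : ℝ) :
    HasDerivAt (fun r : ℝ => P.eval ((r : ℂ) - rp)) ((derivative P).eval ((r : ℂ) - rp)) r := by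
  have h1 : HasDerivAt (fun z : ℂ => P.eval (z - rp)) ((derivative P).eval ((r : ℂ) - rp)) (r : ℂ) :=
    (P.hasDerivAt ((r : ℂ) - rp)).comp_sub_const (r : ℂ) (rp : ℂ)
  exact h1.comp_ofReal

/-- The functional given by a smooth density. -/
def densityLM (R : ℝ) {h : ℝ → ℂ} (hh : ContDiff ℝ ∞ h) : radialTest (Ioi R) →ₗ[ℂ] ℂ where
  toFun φ := ∫ r in Ioi R, h r * (φ : ℝ → ℂ) r
  map_add' φ ψ := by
    rw [← integral_add (radialTest.integrable (radialTest.smooth_mul hh φ.2)).integrableOn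
      (radialTest.integrable (radialTest.smooth_mul hh ψ.2)).integrableOn]
    simp only [Submodule.coe_add, Pi.add_apply, mul_add]
  map_smul' c φ := by
    simp only [RingHom.id_apply, smul_eq_mul, ← integral_const_mul, Submodule.coe_smul, Pi.smul_apply]
    congr 1; funext r; ring

/-- The functional given by a polynomial density in `r - rp`. -/
def polyLM (R rp : ℝ) (P : ℂ[X]) : radialTest (Ioi R) →ₗ[ℂ] ℂ := densityLM R (contDiff_eval P rp)

lemma polyLM_add (P Q : ℂ[X]) : polyLM R rp (P + Q) = polyLM R rp P + polyLM R rp Q :=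
  LinearMap.ext fun φ => by
    simp only [polyLM, densityLM, LinearMap.coe_mk, AddHom.coe_mk, LinearMap.add_apply]
    rw [← integral_add (radialTest.integrable (radialTest.smooth_mul (contDiff_eval P rp) φ.2)).integrableOn
      (radialTest.integrable (radialTest.smooth_mul (contDiff_eval Q rp) φ.2)).integrableOn]
    simp only [eval_add, add_mul]

lemma polyLM_smul (c : ℂ) (P : ℂ[X]) : polyLM R rp (c • P) = c • polyLM R rp P :=
  LinearMap.ext fun φ => by
    simp only [polyLM, densityLM, LinearMap.coe_mk, AddHom.coe_mk, LinearMap.smul_apply, smul_eq_mul,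
      ← integral_const_mul]
    congr 1; funext r
    rw [eval_smul, smul_eq_mul, mul_assoc]

lemma polyLM_deriv (P : ℂ[X]) (φ : radialTest (Ioi R)) :
    polyLM R rp P (iterDerivLM (Ioi R) 1 φ) = -polyLM R rp (derivative P) φ := by
  have hm := radialTest.smooth_mul (contDiff_eval P rp) φ.2
  have h1 := integral_deriv_eq_zero_of_mem hm
  have i1 := radialTest.integrable (radialTest.smooth_mul (contDiff_eval (derivative P) rp) φ.2)
  have i2 := radialTest.integrable
    (radialTest.smooth_mul (contDiff_eval P rp) (radialTest.deriv φ.2))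
  have h2 : deriv (fun r : ℝ => P.eval ((r : ℂ) - rp) * (φ : ℝ → ℂ) r) = fun r : ℝ =>
      (derivative P).eval ((r : ℂ) - rp) * (φ : ℝ → ℂ) r +
        P.eval ((r : ℂ) - rp) * deriv (φ : ℝ → ℂ) r := funext fun r =>
    ((hasDerivAt_eval P rp r).mul (hasDerivAt_of_contDiff φ.2.1 r)).deriv
  rw [h2, integral_add i1 i2] at h1
  rw [eq_neg_iff_add_eq_zero, add_comm]
  refine Eq.trans ?_ h1
  refine congrArg₂ _ (setIntegral_Ioi_mul_eq φ.2) ?_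
  refine Eq.trans (setIntegral_Ioi_mul_eq (iterDerivLM (Ioi R) 1 φ).2) ?_
  simp [iterDerivLM]

lemma exists_polynomial_of_iteratedDeriv (hR0 : 0 ≤ R) (rp : ℝ) (k : ℕ)
    (V : radialTest (Ioi R) →ₗ[ℂ] ℂ) (hV : ∀ φ, V (iterDerivLM (Ioi R) k φ) = 0) :
    ∃ P : ℂ[X], V = polyLM R rp P := by
  induction k generalizing V with
  | zero =>
    refine ⟨0, LinearMap.ext fun φ => ?_⟩
    have h1 := hV φ
    have h2 : iterDerivLM (Ioi R) 0 φ = φ := Subtype.ext (by simp [iterDerivLM])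
    rw [h2] at h1
    simp [h1, polyLM, densityLM]
  | succ k ih =>
    obtain ⟨P, hPV⟩ := ih (V ∘ₗ iterDerivLM (Ioi R) 1) fun φ => by
      rw [← hV φ]
      refine congrArg V (Subtype.ext ?_)
      change iteratedDeriv 1 (iteratedDeriv k (φ : ℝ → ℂ)) = iteratedDeriv (k + 1) (φ : ℝ → ℂ)
      rw [iteratedDeriv_one, iteratedDeriv_succ]
    obtain ⟨Q, hQ⟩ := exists_antiderivative (-P)
    obtain ⟨ρ, hρ, hρ1⟩ := exists_integral_eq_one hR0
    set U := V - polyLM R rp Q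
    have hU : ∀ φ, U (iterDerivLM (Ioi R) 1 φ) = 0 := fun φ => by
      have h1 := LinearMap.congr_fun hPV φ
      rw [LinearMap.comp_apply] at h1
      have h2 : polyLM R rp (-P) = -polyLM R rp P := by
        have := polyLM_smul (R := R) (rp := rp) (-1) P
        rwa [neg_one_smul, neg_one_smul] at this
      rw [LinearMap.sub_apply, h1, polyLM_deriv, hQ, h2, LinearMap.neg_apply, neg_neg, sub_self]
    have hUρ : ∀ φ : radialTest (Ioi R), U φ = U ⟨ρ, hρ⟩ * ∫ r, (φ : ℝ → ℂ) r := fun φ => by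
      set c := ∫ r, (φ : ℝ → ℂ) r
      obtain ⟨ψ, hψ, hψd⟩ := exists_primitive_mem (φ - c • (⟨ρ, hρ⟩ : radialTest (Ioi R))).2 (by
        simp only [Submodule.coe_sub, Submodule.coe_smul, Pi.sub_apply, Pi.smul_apply, smul_eq_mul]
        rw [integral_sub (radialTest.integrable φ.2) ((radialTest.integrable hρ).const_mul c),
          integral_const_mul, hρ1, mul_one, sub_self])
      have h1 := hU ⟨ψ, hψ⟩
      have h2 : iterDerivLM (Ioi R) 1 ⟨ψ, hψ⟩ = φ - c • (⟨ρ, hρ⟩ : radialTest (Ioi R)) :=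
        Subtype.ext (by rw [← hψd]; exact iteratedDeriv_one)
      rw [h2, map_sub, map_smul, sub_eq_zero, smul_eq_mul] at h1
      rw [h1, mul_comm]
    refine ⟨Q + C (U ⟨ρ, hρ⟩), ?_⟩
    rw [polyLM_add]
    refine LinearMap.ext fun φ => ?_
    have h1 := hUρ φ
    simp only [U, LinearMap.sub_apply] at h1
    rw [LinearMap.add_apply, ← sub_eq_iff_eq_add', h1]
    simp only [polyLM, densityLM, LinearMap.coe_mk, AddHom.coe_mk, eval_C]
    rw [setIntegral_Ioi_mul_eq φ.2, integral_const_mul]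
    simp only [U, LinearMap.sub_apply, polyLM, densityLM, LinearMap.coe_mk, AddHom.coe_mk]

lemma eq_zero_of_polyLM_eq_zero (hR0 : 0 ≤ R) {P : ℂ[X]} (h : polyLM R rp P = 0) : P = 0 := by
  obtain ⟨ρ, hρ, hρ0, hρ1⟩ := exists_bump (c := R + 2) one_pos (by linarith)
  have hmem := radialTest.mono (J' := Ioi R) (fun r hr => by
    have := hr.1
    change R < r
    linarith) hρ
  have hc : ContDiff ℝ ∞ (fun r : ℝ => conj (P.eval ((r : ℂ) - rp))) :=
    contDiff_conj.comp (contDiff_eval P rp)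
  have h1 := LinearMap.congr_fun h ⟨_, radialTest.smooth_mul hc hmem⟩
  simp only [polyLM, densityLM, LinearMap.coe_mk, AddHom.coe_mk, LinearMap.zero_apply] at h1
  rw [setIntegral_Ioi_mul_eq (radialTest.smooth_mul hc hmem)] at h1
  set F : ℝ → ℝ := fun r => ‖P.eval ((r : ℂ) - rp)‖ ^ 2 * ρ r
  have h2 : ∫ r, F r = 0 := by
    have : ∫ r, (F r : ℂ) = 0 := by
      rw [← h1]
      congr 1; funext r
      simp only [F]
      push_cast
      rw [← mul_assoc, mul_conj, normSq_eq_norm_sq]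
      push_cast; ring
    rw [integral_complex_ofReal] at this
    exact_mod_cast this
  have hρc : Continuous ρ := continuous_re.comp hρ.1.continuous
  have hFc : Continuous F := ((contDiff_eval P rp).continuous.norm.pow 2).mul hρc
  have hFs : HasCompactSupport F :=
    HasCompactSupport.mul_left ((radialTest.hasCompactSupport hρ).comp_left (g := re) rfl)
  have hzero : ∀ r ∈ Metric.ball (R + 2) (1 / 4), P.eval ((r : ℂ) - rp) = 0 := fun r hr => by
    by_contra hne
    have := hFc.integral_pos_of_hasCompactSupport_nonneg_nonzero hFs
      (fun r => mul_nonneg (sq_nonneg _) (hρ0 r)) (x := r) (μ := volume) (by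
        simp only [F, hρ1 r hr, mul_one]
        exact pow_ne_zero 2 (norm_ne_zero_iff.2 hne))
    exact this.ne' h2
  refine eq_zero_of_infinite_isRoot P (Set.Infinite.mono
    (s := (fun r : ℝ => (r : ℂ) - rp) '' Metric.ball (R + 2) (1 / 4)) ?_ ?_)
  · rintro _ ⟨r, hr, rfl⟩
    exact hzero r hr
  · refine Set.Infinite.image (fun x _ y _ hxy => ?_) ?_
    · have : (x : ℂ) = y := by simpa using hxy
      exact_mod_cast this
    · rw [Real.ball_eq_Ioo]
      exact Ioo_infinite (by linarith)

end

open Polynomial in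
/-- The radial operator on polynomials in `x = r - rp`. -/
def polyT (d : ℝ) (κ l s : ℂ) (P : ℂ[X]) : ℂ[X] :=
  -(X * (X * derivative (derivative P) + C (d : ℂ) * derivative (derivative P))) +
    (C (2 * (s - 1)) * (X * derivative P) + C (d * (s - 1) - d * κ) * derivative P) +
    C ((l + s) * (l - s + 1)) * P

section
variable {R rp d : ℝ} {κ l s : ℂ} {φ : ℝ → ℂ}

open Polynomial

lemma eval_polyT (P : ℂ[X]) (x : ℂ) : (polyT d κ l s P).eval x =
    -(x * (x + d)) * (derivative (derivative P)).eval x +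
      ((2 * x + d) * (s - 1) - d * κ) * (derivative P).eval x + (l + s) * (l - s + 1) * P.eval x := by
  simp only [polyT, eval_add, eval_neg, eval_mul, eval_X, eval_C]
  ring

lemma polyT_sub (P Q : ℂ[X]) : polyT d κ l s (P - Q) = polyT d κ l s P - polyT d κ l s Q := by
  simp only [polyT, derivative_sub]; ring

lemma polyT_smul (c : ℂ) (P : ℂ[X]) : polyT d κ l s (c • P) = c • polyT d κ l s P := by
  simp only [polyT, smul_eq_C_mul, derivative_C_mul]; ring

lemma coeff_polyT (P : ℂ[X]) (k : ℕ) : (polyT d κ l s P).coeff k =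
    (l + s - k) * (k + l - s + 1) * P.coeff k - d * (k + 1) * (k + 1 - s + κ) * P.coeff (k + 1) := by
  rcases k with _ | _ | k
  · simp only [polyT, coeff_add, coeff_neg, coeff_C_mul, coeff_X_mul_zero, coeff_derivative]
    push_cast; ring
  · simp only [polyT, coeff_add, coeff_neg, coeff_C_mul, coeff_X_mul, coeff_X_mul_zero, coeff_derivative]
    push_cast; ring
  · simp only [polyT, coeff_add, coeff_neg, coeff_C_mul, coeff_X_mul, coeff_derivative]
    push_cast; ring

lemma natDegree_of_polyT_eq_zero {N B : ℕ} (hN : (N : ℂ) = l + s) (hB : (B : ℂ) = l - s) {U : ℂ[X]}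
    (hU : polyT d κ l s U = 0) (hU0 : U ≠ 0) : U.natDegree = N := by
  by_contra hne
  have h1 := coeff_polyT (d := d) (κ := κ) (l := l) (s := s) U U.natDegree
  rw [hU, coeff_zero, coeff_eq_zero_of_natDegree_lt (Nat.lt_succ_self _), mul_zero, sub_zero,
    coeff_natDegree, ← hN, add_sub_assoc, ← hB] at h1
  refine mul_ne_zero (mul_ne_zero (fun h => hne ?_) ?_) (leadingCoeff_ne_zero.2 hU0) h1.symm
  · exact_mod_cast (sub_eq_zero.1 h).symm
  · exact_mod_cast Nat.succ_ne_zero (U.natDegree + B)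

/-- Polynomial solutions of the radial equation are determined by their coefficient of order
`N = l + s`. -/
lemma eq_zero_of_polyT_eq_zero {N B : ℕ} (hN : (N : ℂ) = l + s) (hB : (B : ℂ) = l - s) {P : ℂ[X]}
    (hP : polyT d κ l s P = 0) (h0 : P.coeff N = 0) : P = 0 := by
  by_contra hne
  rw [← natDegree_of_polyT_eq_zero hN hB hP hne] at h0
  exact leadingCoeff_ne_zero.2 hne h0

lemma eq_smul_of_polyT_eq_zero {N B : ℕ} (hN : (N : ℂ) = l + s) (hB : (B : ℂ) = l - s) {P U : ℂ[X]}
    (hP : polyT d κ l s P = 0) (hU : polyT d κ l s U = 0) (hU0 : U ≠ 0) :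
    P = (P.coeff N / U.coeff N) • U := by
  have h1 : U.coeff N ≠ 0 := fun h => hU0 (eq_zero_of_polyT_eq_zero hN hB hU h)
  refine sub_eq_zero.1 (eq_zero_of_polyT_eq_zero (d := d) (κ := κ) hN hB ?_ ?_)
  · rw [polyT_sub, polyT_smul, hP, hU, smul_zero, sub_zero]
  · rw [coeff_sub, coeff_smul, smul_eq_mul, div_mul_cancel₀ _ h1, sub_self]

/-- The boundary term in the integration by parts that moves the radial operator to a polynomial. -/
def bdryTerm (rp d : ℝ) (κ s : ℂ) (P : ℂ[X]) (φ : ℝ → ℂ) (r : ℝ) : ℂ :=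
  -(((r : ℂ) - rp) * ((r : ℂ) - rp + d)) * P.eval ((r : ℂ) - rp) * deriv φ r +
    (((r : ℂ) - rp) * ((r : ℂ) - rp + d) * (derivative P).eval ((r : ℂ) - rp) +
      (-s * (2 * ((r : ℂ) - rp) + d) + d * κ) * P.eval ((r : ℂ) - rp)) * φ r

lemma hasDerivAt_bdryTerm (hφ : ContDiff ℝ ∞ φ) (P : ℂ[X]) (r : ℝ) :
    HasDerivAt (bdryTerm rp d κ s P φ) (P.eval ((r : ℂ) - rp) * radOp rp d (-κ) l (-s) φ r -
      (polyT d κ l s P).eval ((r : ℂ) - rp) * φ r) r := by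
  have hx : HasDerivAt (fun r : ℝ => (r : ℂ) - rp) 1 r :=
    (hasDerivAt_id r).ofReal_comp.sub_const _
  have h0 := hasDerivAt_of_contDiff hφ r
  have h1 := hasDerivAt_of_contDiff (contDiff_deriv hφ) r
  have p0 := hasDerivAt_eval P rp r
  have p1 := hasDerivAt_eval (derivative P) rp r
  have hΔ := hx.mul (hx.add_const (d : ℂ))
  have key := ((hΔ.neg.mul p0).mul h1).add ((((hΔ.mul p1).add
    ((((hx.const_mul 2).add_const (d : ℂ)).const_mul (-s)).add_const (d * κ) |>.mul p0))).mul h0)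
  refine key.congr_deriv ?_
  rw [eval_polyT]
  simp only [radOp, Pi.mul_apply, Pi.neg_apply, Pi.add_apply]
  ring

lemma polyLM_radOp (P : ℂ[X]) (φ : radialTest (Ioi R)) :
    polyLM R rp P ⟨radOp rp d (-κ) l (-s) φ, radOp_mem φ.2⟩ = polyLM R rp (polyT d κ l s P) φ := by
  have hmem : bdryTerm rp d κ s P φ ∈ radialTest (Ioi R) := by
    have h3 : ContDiff ℝ ∞ (fun r : ℝ => (r : ℂ)) := ofRealCLM.contDiff
    have h4 := contDiff_eval P rp
    have h5 := contDiff_eval (derivative P) rp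
    exact (radialTest _).add_mem (radialTest.smooth_mul
      (a := fun r : ℝ => -(((r : ℂ) - rp) * ((r : ℂ) - rp + d)) * P.eval ((r : ℂ) - rp))
      (by fun_prop) (radialTest.deriv φ.2)) (radialTest.smooth_mul
      (a := fun r : ℝ => (((r : ℂ) - rp) * ((r : ℂ) - rp + d) * (derivative P).eval ((r : ℂ) - rp) +
      (-s * (2 * ((r : ℂ) - rp) + d) + d * κ) * P.eval ((r : ℂ) - rp))) (by fun_prop) φ.2)
  have h1 := integral_deriv_eq_zero_of_mem hmem
  have i1 := radialTest.integrable (radialTest.smooth_mul (contDiff_eval P rp)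
    (radOp_mem (rp := rp) (d := d) (κ := -κ) (l := l) (s := -s) φ.2))
  have i2 := radialTest.integrable
    (radialTest.smooth_mul (contDiff_eval (polyT d κ l s P) rp) φ.2)
  rw [funext fun r => (hasDerivAt_bdryTerm (rp := rp) (d := d) (κ := κ) (l := l) (s := s)
    φ.2.1 P r).deriv, integral_sub i1 i2, sub_eq_zero] at h1
  refine Eq.trans (setIntegral_Ioi_mul_eq (radOp_mem φ.2)) (h1.trans ?_)
  exact (setIntegral_Ioi_mul_eq φ.2).symm

end

/-- The structure of functionals across the horizon that annihilate the range of the radial operator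
and are bounded in the critical norm. -/
theorem exists_eq_smul_polyLM {R rp d : ℝ} {κ : ℂ} {l s : ℝ} {N B : ℕ} (hR0 : 0 ≤ R) (hR : rp - d < R)
    (hRrp : R < rp) (hκ : κ.re = 0) (hl : 0 ≤ l) (hN : (N : ℝ) = l + s) (hB : (B : ℝ) = l - s)
    {e p : ℝ} (he : 0 ≤ e) {C : ℝ≥0} (V : radialTest (Ioi R) →ₗ[ℂ] ℂ)
    (hV : ∀ φ : radialTest (Ioi R), ENNReal.ofReal (‖V φ‖ ^ 2) ≤ C * 𝓜²((φ : ℝ → ℂ), e, -(s + 1 / 2), p))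
    (hT : ∀ φ : radialTest (Ioi R), V ⟨radOp rp d (-κ) l (-s) φ, radOp_mem φ.2⟩ = 0)
    {U : Polynomial ℂ} (hU : polyT d κ l s U = 0) (hU0 : U ≠ 0) :
    ∃ c : ℂ, V = c • polyLM R rp U := by
  obtain ⟨P, hPV⟩ := exists_polynomial_of_iteratedDeriv hR0 rp (N + 1) V
    (eq_zero_on_iteratedDeriv hR0 hR hRrp hκ hl hN he V hV hT)
  have hP : polyT d κ l s P = 0 := by
    refine eq_zero_of_polyLM_eq_zero (rp := rp) hR0 (LinearMap.ext fun φ => ?_)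
    rw [← polyLM_radOp, ← hPV, hT, LinearMap.zero_apply]
  have h := eq_smul_of_polyT_eq_zero (N := N) (B := B) (by exact_mod_cast hN) (by exact_mod_cast hB)
    hP hU hU0
  exact ⟨_, by rw [hPV, ← polyLM_smul, ← h]⟩

/-! ## Growth at infinity -/

/-- A density that grows like `r^b` is not bounded in a norm of weight `p` unless `b + 1 < p`. -/
theorem growth_lt_weight {R p b k e : ℝ} (he : 0 ≤ e) {h : ℝ → ℂ} {c : ℂ} (hc : c ≠ 0)
    (hh : ContinuousOn h (Ioi R)) (hlim : Tendsto (fun r : ℝ => h r / ((r ^ b : ℝ) : ℂ)) atTop (𝓝 c))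
    {C : ℝ≥0} (hV : ∀ φ ∈ radialTest (Ioi R), ENNReal.ofReal (‖∫ r in Ioi R, h r * φ r‖ ^ 2) ≤
      C * 𝓜²(φ, e, k, p)) :
    b + 1 < p := by
  by_contra hβ
  rw [not_lt] at hβ
  obtain ⟨σ, hσ, hσ0, hσ1⟩ := exists_bump (c := 3) one_pos (by norm_num)
  set ρ : ℝ → ℝ := fun r => r * σ r
  set X : ℝ → ℂ := fun r => (ρ r : ℂ)
  have hρ : X ∈ radialTest (Ioo (3 - 1) (3 + 1)) :=
    (funext fun r => ofReal_mul r (σ r) : X = _) ▸ radialTest.smooth_mul ofRealCLM.contDiff hσ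
  have hρ0 : ∀ r, 0 ≤ r → 0 ≤ ρ r := fun r hr => mul_nonneg hr (hσ0 r)
  have hρz : ∀ r, (r ≤ 2 ∨ 4 ≤ r) → ρ r = 0 := fun r hr => by
    obtain ⟨_, K, _, hK, h0⟩ := hρ
    refine ofReal_eq_zero.1 (h0 r fun h' => ?_)
    have h1 := (hK h').1.1
    have h2 := (hK h').1.2
    rcases hr with h | h <;> linarith
  have hσc : Continuous σ := continuous_re.comp hσ.1.continuous
  -- the test functions
  set φ : ℝ → ℝ → ℂ := fun T r => stepUp (1 / 2) 1 r * (((r ^ (-p) : ℝ) : ℂ) * X (r ^ T⁻¹))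
  have hφ_eq : ∀ T : ℝ, 0 < T → ∀ r, 0 < r → φ T r = ((r ^ (-p) : ℝ) : ℂ) * X (r ^ T⁻¹) :=
    fun T hT r hr => by
      rcases le_or_gt 1 r with h1 | h1
      · simp only [φ, stepUp_of_ge (by norm_num : (1 / 2 : ℝ) < 1) h1, one_mul]
      · have : X (r ^ T⁻¹) = 0 := ofReal_eq_zero.2 (hρz _
          (.inl ((Real.rpow_le_one hr.le h1.le (inv_pos.2 hT).le).trans (by norm_num))))
        simp only [φ, this, mul_zero]
  have hsupp : ∀ T : ℝ, 0 < T → ∀ r, 0 < r → r ∉ Icc ((2 : ℝ) ^ T) (4 ^ T) → ρ (r ^ T⁻¹) = 0 :=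
    fun T hT r hr hrS => hρz _ <| by
      by_contra! hcon
      refine hrS ⟨?_, ?_⟩ <;> rw [← Real.rpow_inv_rpow hr.le hT.ne']
      · exact Real.rpow_le_rpow (by norm_num) hcon.1.le hT.le
      · exact Real.rpow_le_rpow (by positivity) hcon.2.le hT.le
  have hφz : ∀ T : ℝ, 0 < T → ∀ r ∉ Icc ((2 : ℝ) ^ T) (4 ^ T), φ T r = 0 := fun T hT r hr => by
    rcases le_or_gt r (1 / 2) with h1 | h1
    · simp only [φ, stepUp_of_le (by norm_num : (1 / 2 : ℝ) < 1) h1, zero_mul]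
    · simp only [φ, X, hsupp T hT r (by linarith) hr, ofReal_zero, mul_zero]
  have hsmooth : ∀ T : ℝ, 0 < T → ContDiff ℝ ∞ (φ T) := fun T hT => by
    refine contDiff_stepUp_mul (c := 0) (by norm_num) (by norm_num) ?_
    have hr : ∀ a : ℝ, ContDiffOn ℝ ∞ (fun r : ℝ => r ^ a) (Ioi 0) := fun a r hr =>
      (Real.contDiffAt_rpow_const_of_ne (ne_of_gt hr)).contDiffWithinAt
    exact (ofRealCLM.contDiff.comp_contDiffOn (hr (-p))).mul (hρ.1.comp_contDiffOn (hr T⁻¹))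
  have hlt : ∀ T : ℝ, max R 1 < 2 ^ T → ∀ r ∈ Icc ((2 : ℝ) ^ T) (4 ^ T), R < r ∧ 1 < r :=
    fun T hTR r hr => max_lt_iff.1 (hTR.trans_le hr.1)
  have hmem : ∀ T : ℝ, 0 < T → max R 1 < 2 ^ T → φ T ∈ radialTest (Ioi R) := fun T hT hTR =>
    ⟨hsmooth T hT, _, isCompact_Icc,
      fun r hr => ⟨(hlt T hTR r hr).1, one_pos.trans (hlt T hTR r hr).2⟩, hφz T hT⟩
  have hmellin : ∀ T : ℝ, 0 < T → ∀ lam : ℝ, mellin (φ T) (p + lam * I) = T * mellin X ((0 : ℝ) + (T * lam : ℝ) * I) :=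
    fun T hT lam => by
      have h1 := mellin_comp_rpow X (lam * I) T⁻¹
      have h2 : mellin (φ T) (p + lam * I) = mellin (fun r => X (r ^ T⁻¹)) (lam * I) := by
        rw [mellin_eq, mellin_eq]
        refine setIntegral_congr_fun measurableSet_Ioi fun r hr => ?_
        have hr0 : (r : ℂ) ≠ 0 := ofReal_ne_zero.2 (ne_of_gt hr)
        rw [hφ_eq T hT r hr, ofReal_cpow (le_of_lt hr), ← mul_assoc, ← cpow_add _ _ hr0]
        congr 2
        push_cast; ring
      rw [h2, h1, abs_of_pos (inv_pos.2 hT), inv_inv, real_smul]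
      congr 2
      push_cast
      field_simp
      ring
  -- upper bound of the norms
  obtain ⟨K, hK⟩ := exists_nat_ge (|k| + 1)
  obtain ⟨C₁, hC₁, h₁⟩ := mellin_decay hρ K 0
  obtain ⟨C₂, hC₂, h₂⟩ := symbol_le he k
  set D := C₂ * C₁ ^ 2 with hDdef
  have hD : 0 ≤ D := by positivity
  have hupper : ∀ T : ℝ, 1 ≤ T → 𝓜²(φ T, e, k, p) ≤ ENNReal.ofReal (D * T * Real.pi) := fun T hT => by
    have hT0 : 0 < T := by linarith
    calc _ ≤ ∫⁻ lam : ℝ, ENNReal.ofReal (D * T) * ENNReal.ofReal (T / (1 + T * |lam|) ^ 2) := by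
          refine lintegral_mono fun lam => ?_
          rw [← ENNReal.ofReal_mul (by positivity)]
          refine ENNReal.ofReal_le_ofReal ?_
          set y := 1 + T * |lam| with hy
          have hy1 : 1 ≤ y := by
            have : 0 ≤ T * |lam| := by positivity
            linarith
          have hy0 : 0 < y := by linarith
          have h3 := h₁ (T * lam)
          rw [abs_mul, abs_of_pos hT0, ← hy] at h3
          have h4 : (1 + |lam|) ^ (2 * k) ≤ y ^ (2 * |k|) := by
            have h5 : 1 + |lam| ≤ y := by
              have := mul_le_mul_of_nonneg_right hT (abs_nonneg lam)
              linarith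
            calc (1 + |lam|) ^ (2 * k) ≤ (1 + |lam|) ^ (2 * |k|) :=
                  Real.rpow_le_rpow_of_exponent_le (by linarith [abs_nonneg lam])
                    (by linarith [le_abs_self k])
              _ ≤ _ := Real.rpow_le_rpow (by positivity) h5 (by positivity)
          have h6 : y ^ (2 * |k|) * y ^ 2 ≤ y ^ K * y ^ K := by
            rw [← Real.rpow_natCast y 2, ← Real.rpow_natCast y K, ← Real.rpow_add hy0, ← Real.rpow_add hy0]
            refine Real.rpow_le_rpow_of_exponent_le hy1 ?_
            push_cast; linarith
          set m := ‖mellin X ((0 : ℝ) + (T * lam : ℝ) * I)‖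
          have hm0 : 0 ≤ m := norm_nonneg _
          rw [hmellin T hT0, norm_mul, norm_real, Real.norm_of_nonneg hT0.le, ← mul_div_assoc,
            le_div_iff₀ (by positivity)]
          have h7 : (y ^ K * m) ^ 2 ≤ C₁ ^ 2 := pow_le_pow_left₀ (by positivity) h3 2
          calc (1 + lam ^ 2 + e) ^ k * (T * m) ^ 2 * y ^ 2
              ≤ C₂ * y ^ (2 * |k|) * (T * m) ^ 2 * y ^ 2 := by
                gcongr
                exact (h₂ lam).trans (mul_le_mul_of_nonneg_left h4 hC₂)
            _ = C₂ * (T * m) ^ 2 * (y ^ (2 * |k|) * y ^ 2) := by ring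
            _ ≤ C₂ * (T * m) ^ 2 * (y ^ K * y ^ K) := by gcongr
            _ = C₂ * T ^ 2 * (y ^ K * m) ^ 2 := by ring
            _ ≤ C₂ * T ^ 2 * C₁ ^ 2 := by gcongr
            _ = D * T * T := by rw [hDdef]; ring
      _ = ENNReal.ofReal (D * T) * ∫⁻ lam : ℝ, ENNReal.ofReal (T / (1 + T * |lam|) ^ 2) :=
          lintegral_const_mul' _ _ ENNReal.ofReal_ne_top
      _ ≤ ENNReal.ofReal (D * T) * ENNReal.ofReal Real.pi := by
          gcongr
          exact lintegral_hump_le hT0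
      _ = _ := (ENNReal.ofReal_mul (by positivity)).symm
  -- lower bound of the functional
  set A : ℝ := ∫ r in Ioi (0 : ℝ), r⁻¹ * ρ r with hA
  have hApos : 0 < A := by
    have h1 := hσc.integral_pos_of_hasCompactSupport_nonneg_nonzero (μ := volume)
      ((radialTest.hasCompactSupport hσ).comp_left (g := re) rfl) hσ0 (x := 3)
      (by rw [hσ1 _ (Metric.mem_ball_self (by norm_num))]; norm_num)
    obtain ⟨_, K, _, hK, h0⟩ := hσ
    rwa [hA, setIntegral_congr_fun (g := σ) measurableSet_Ioi fun r hr => inv_mul_cancel_left₀ (ne_of_gt hr) _,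
      setIntegral_eq_integral_of_forall_compl_eq_zero fun r hr =>
        ofReal_eq_zero.1 (h0 r fun h => hr (hK h).2)]
  have hAT : ∀ T : ℝ, 0 < T → ∫ r in Ioi (0 : ℝ), r⁻¹ * ρ (r ^ T⁻¹) = T * A := fun T hT => by
    have h1 := mellin_comp_rpow X 0 T⁻¹
    rw [inv_pos.2 hT |> abs_of_pos, inv_inv, mellin_eq, mellin_eq, zero_div] at h1
    have h2 : ∀ f : ℝ → ℝ, ∫ r in Ioi (0 : ℝ), (r : ℂ) ^ ((0 : ℂ) - 1) * (f r : ℂ) =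
        ((∫ r in Ioi (0 : ℝ), r⁻¹ * f r : ℝ) : ℂ) := fun f => by
      rw [← integral_complex_ofReal]
      refine setIntegral_congr_fun measurableSet_Ioi fun r _ => ?_
      rw [zero_sub, cpow_neg_one]; push_cast; rfl
    rw [h2 fun r => ρ (r ^ T⁻¹), h2 ρ, real_smul] at h1
    exact_mod_cast h1
  have hlim' : Tendsto (fun r : ℝ => (h r / ((r ^ b : ℝ) : ℂ) / c).re) atTop (𝓝 1) := by
    have h1 := (hlim.div_const c)
    rw [div_self hc] at h1
    exact (continuous_re.tendsto 1).comp h1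
  obtain ⟨r₀, hr₀⟩ := eventually_atTop.1 ((tendsto_order.1 hlim').1 (1 / 2) (by norm_num))
  have hlower : ∀ T : ℝ, 0 < T → max (max R 1) r₀ < 2 ^ T →
      T * (A / 2 * ‖c‖) ≤ ‖∫ r in Ioi R, h r * φ T r‖ := fun T hT hTR => by
    have hTR' : max R 1 < 2 ^ T := (le_max_left _ _).trans_lt hTR
    set S := Icc ((2 : ℝ) ^ T) (4 ^ T)
    have hS : ∀ r ∈ S, R < r ∧ 1 < r := hlt T hTR'
    have hS0 : ∀ r ∈ S, 0 < r := fun r hr => one_pos.trans (hS r hr).2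
    have hint : IntegrableOn (fun r => h r * φ T r / c) S :=
      (((hh.mono fun r hr => (hS r hr).1).mul (hsmooth T hT).continuous.continuousOn).div_const
        c).integrableOn_compact isCompact_Icc
    have hint' : IntegrableOn (fun r : ℝ => r⁻¹ * ρ (r ^ T⁻¹) / 2) S :=
      (((continuousOn_id.inv₀ fun r hr => (hS0 r hr).ne').mul
        ((continuous_id.mul hσc).comp_continuousOn (continuousOn_id.rpow_const fun r hr =>
          .inl (hS0 r hr).ne'))).div_const 2).integrableOn_compact isCompact_Icc
    have hpt : ∀ r ∈ S, r⁻¹ * ρ (r ^ T⁻¹) / 2 ≤ (h r * φ T r / c).re := fun r hr => by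
      have hr0 := hS0 r hr
      have h1 := hr₀ r ((le_max_right _ _).trans (hTR.le.trans hr.1))
      have hrb : ((r ^ b : ℝ) : ℂ) ≠ 0 := ofReal_ne_zero.2 (Real.rpow_pos_of_pos hr0 b).ne'
      have e1 : h r * φ T r / c = ((r ^ b * r ^ (-p) * ρ (r ^ T⁻¹) : ℝ) : ℂ) *
          (h r / ((r ^ b : ℝ) : ℂ) / c) := by
        rw [hφ_eq T hT r hr0]
        push_cast
        field_simp
        rfl
      rw [e1, re_ofReal_mul]
      have e2 : r⁻¹ ≤ r ^ b * r ^ (-p) := by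
        rw [← Real.rpow_add hr0, ← Real.rpow_neg_one]
        exact Real.rpow_le_rpow_of_exponent_le (hS r hr).2.le (by linarith)
      have h3 := hρ0 (r ^ T⁻¹) (by positivity)
      have h4 := mul_le_mul_of_nonneg_right e2 h3
      have h5 : 0 ≤ r⁻¹ * ρ (r ^ T⁻¹) := by positivity
      nlinarith
    have h6 : T * A / 2 ≤ ((∫ r in Ioi R, h r * φ T r) / c).re := by
      rw [← hAT T hT, ← integral_div, ← integral_div,
        setIntegral_eq_of_subset_of_forall_sdiff_eq_zero measurableSet_Ioi hS0 ?_,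
        setIntegral_eq_of_subset_of_forall_sdiff_eq_zero measurableSet_Ioi fun r hr => (hS r hr).1]
      · exact (setIntegral_mono_on hint' hint.re measurableSet_Icc hpt).trans_eq (integral_re hint)
      · intro r hr
        rw [hφz T hT r hr.2, mul_zero, zero_div]
      · intro r hr
        rw [hsupp T hT r hr.1 hr.2, mul_zero, zero_div]
    have h7 : T * A / 2 ≤ ‖(∫ r in Ioi R, h r * φ T r) / c‖ := h6.trans (re_le_norm _)
    rw [norm_div, le_div_iff₀ (norm_pos_iff.2 hc)] at h7
    linarith
  -- contradiction
  set a := A / 2 * ‖c‖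
  have ha : 0 < a := by have := norm_pos_iff.2 hc; positivity
  obtain ⟨m, hm⟩ := exists_nat_gt (max (max (max R 1) r₀) (C * D * Real.pi / a ^ 2))
  set T : ℝ := (m : ℝ) + 1
  have hT1 : 1 ≤ T := by have := Nat.cast_nonneg (α := ℝ) m; linarith
  have hT0 : 0 < T := by linarith
  have hTm : (m : ℝ) < 2 ^ T := by
    have h1 : (m : ℝ) < 2 ^ m := by exact_mod_cast Nat.lt_two_pow_self
    refine h1.trans_le ?_
    rw [← Real.rpow_natCast]
    exact Real.rpow_le_rpow_of_exponent_le (by norm_num) (by simp [T])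
  have hTR : max (max R 1) r₀ < 2 ^ T := ((le_max_left _ _).trans_lt hm).trans hTm
  have h8 := (hV _ (hmem T hT0 ((le_max_left _ _).trans_lt hTR))).trans
    (mul_le_mul_right (hupper T hT1) _)
  rw [← ENNReal.ofReal_coe_nnreal, ← ENNReal.ofReal_mul C.coe_nonneg,
    ENNReal.ofReal_le_ofReal_iff (by have := Real.pi_pos; positivity)] at h8
  have h9 := pow_le_pow_left₀ (by positivity) (hlower T hT0 hTR) 2
  have h10 : C * D * Real.pi < a ^ 2 * T := by
    have := (le_max_right _ _).trans_lt hm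
    rw [div_lt_iff₀ (by positivity)] at this
    nlinarith
  nlinarith

/-! ### Bounds of functionals by Mellin transforms -/

variable {σ : ℝ} {G φ : ℝ → ℂ} {J : Set ℝ}

lemma integrable_one_add_abs_rpow {r : ℝ} (hr : 1 < r) : Integrable fun x : ℝ => (1 + |x|) ^ (-r) :=
  integrable_one_add_norm (E := ℝ) (by simpa using hr)

lemma radialTest.isBigO_zero (hφ : φ ∈ radialTest J) (g g' : ℝ → ℝ) :
    φ =O[atTop] g ∧ φ =O[𝓝[>] 0] g' := by
  obtain ⟨a, b, ha, hab, h0⟩ := radialTest.exists_Icc hφ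
  constructor
  · refine (Asymptotics.isBigO_zero g atTop).congr' ?_ EventuallyEq.rfl
    filter_upwards [eventually_gt_atTop b] with r hr
    exact (h0 r fun h => not_lt.2 h.2 hr).symm
  · refine (Asymptotics.isBigO_zero g' _).congr' ?_ EventuallyEq.rfl
    filter_upwards [Ioo_mem_nhdsGT ha] with r hr
    exact (h0 r fun h => not_lt.2 h.1 hr.2).symm

lemma radialTest.mellinConvergent (hφ : φ ∈ radialTest J) (s : ℂ) : MellinConvergent φ s :=
  mellinConvergent_of_isBigO_rpow (a := s.re + 1) (b := s.re - 1)
    (hφ.1.continuous.locallyIntegrable.locallyIntegrableOn _) (radialTest.isBigO_zero hφ _ 0).1 (by linarith)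
    (radialTest.isBigO_zero hφ 0 _).2 (by linarith)

lemma radialTest.differentiable_mellin (hφ : φ ∈ radialTest J) : Differentiable ℂ (mellin φ) := fun s =>
  mellin_differentiableAt_of_isBigO_rpow (a := s.re + 1) (b := s.re - 1)
    (hφ.1.continuous.locallyIntegrable.locallyIntegrableOn _) (radialTest.isBigO_zero hφ _ 0).1 (by linarith)
    (radialTest.isBigO_zero hφ 0 _).2 (by linarith)

lemma radialTest.continuous_mellin_line (hφ : φ ∈ radialTest J) (p : ℂ) :
    Continuous fun lam : ℝ => mellin φ (p + lam * I) :=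
  (radialTest.differentiable_mellin hφ).continuous.comp (by fun_prop)

lemma radialTest.integrable_mellin_line (hφ : φ ∈ radialTest J) (p : ℝ) :
    Integrable fun lam : ℝ => mellin φ (p + lam * I) := by
  obtain ⟨C, hC, h⟩ := mellin_decay hφ 2 p
  refine ((integrable_one_add_abs_rpow one_lt_two).const_mul C).mono'
    (radialTest.continuous_mellin_line hφ p).aestronglyMeasurable (ae_of_all _ fun lam => ?_)
  rw [Real.rpow_neg (by positivity), ← div_eq_mul_inv, le_div_iff₀ (by positivity), mul_comm]
  exact_mod_cast h lam

/-- Parseval's formula for the Mellin transform. -/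
lemma integral_mul_eq_mellin (hG : IntegrableOn (fun r : ℝ => (r : ℂ) ^ (-σ : ℂ) * G r) (Ioi 0))
    (hφ : φ ∈ radialTest J) : ∫ r in Ioi (0 : ℝ), G r * φ r =
      (1 / (2 * Real.pi) : ℝ) • ∫ lam : ℝ, mellin G ((1 - σ : ℝ) + (-lam : ℝ) * I) * mellin φ (σ + lam * I) := by
  have h1 : ∀ r : ℝ, 0 < r → G r * φ r = (1 / (2 * Real.pi) : ℝ) • ∫ lam : ℝ,
      (r : ℂ) ^ (-(lam : ℂ) * I) * ((r : ℂ) ^ (-σ : ℂ) * G r * mellin φ (σ + lam * I)) := fun r hr => by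
    have hr0 : (r : ℂ) ≠ 0 := ofReal_ne_zero.2 hr.ne'
    have h := mellinInv_mellin_eq σ φ hr (radialTest.mellinConvergent hφ σ)
      (radialTest.integrable_mellin_line hφ σ) hφ.1.continuous.continuousAt
    rw [← h, mellinInv, mul_smul_comm, ← integral_const_mul]
    congr 2
    ext lam
    rw [neg_add, cpow_add _ _ hr0, smul_eq_mul, neg_mul]
    ring
  rw [setIntegral_congr_fun measurableSet_Ioi h1, integral_smul, integral_integral_swap]
  · congr 2
    ext lam
    rw [show mellin G ((1 - σ : ℝ) + (-lam : ℝ) * I) = ∫ r in Ioi (0 : ℝ),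
      (r : ℂ) ^ (((1 - σ : ℝ) : ℂ) + (-lam : ℝ) * I - 1) * G r from rfl, ← integral_mul_const]
    refine setIntegral_congr_fun measurableSet_Ioi fun r hr => ?_
    have hr0 : (r : ℂ) ≠ 0 := ofReal_ne_zero.2 (ne_of_gt hr)
    rw [← mul_assoc, ← mul_assoc, ← cpow_add _ _ hr0]
    congr 3
    push_cast; ring
  · have h2 : Integrable (fun z : ℝ × ℝ => (z.1 : ℂ) ^ (-σ : ℂ) * G z.1 * mellin φ (σ + z.2 * I))
        ((volume.restrict (Ioi 0)).prod volume) :=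
      hG.mul_prod (radialTest.integrable_mellin_line hφ σ)
    refine h2.norm.mono' (AEStronglyMeasurable.mul ?_ h2.1) ?_
    · exact (by fun_prop : Measurable fun z : ℝ × ℝ => (z.1 : ℂ) ^ (-(z.2 : ℂ) * I)).aestronglyMeasurable
    · have h3 : ∀ᵐ z : ℝ × ℝ ∂((volume.restrict (Ioi 0)).prod volume), z.1 ∈ Ioi (0 : ℝ) :=
        Measure.quasiMeasurePreserving_fst.ae (ae_restrict_mem measurableSet_Ioi)
      filter_upwards [h3] with z hz
      simp only [Function.uncurry]
      rw [norm_mul, norm_cpow_eq_rpow_re_of_pos hz]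
      simp

lemma ofReal_sq_le_mul_lintegral {F g : ℝ → ℝ} (hF : Measurable F) (hg : Measurable g)
    (hF0 : ∀ x, 0 ≤ F x) {A : ℝ} (hA : 0 ≤ A)
    (h : ENNReal.ofReal A ≤ ∫⁻ x, ENNReal.ofReal (F x) * ENNReal.ofReal (g x)) :
    ENNReal.ofReal (A ^ 2) ≤ (∫⁻ x, ENNReal.ofReal (F x ^ 2)) * ∫⁻ x, ENNReal.ofReal (g x) ^ 2 := by
  have h1 := ENNReal.lintegral_mul_le_Lp_mul_Lq volume (Real.HolderConjugate.two_two)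
    hF.ennreal_ofReal.aemeasurable hg.ennreal_ofReal.aemeasurable
  have h2 := pow_le_pow_left' (h.trans h1) 2
  rw [← ENNReal.ofReal_pow hA, mul_pow, ← ENNReal.rpow_natCast, ← ENNReal.rpow_natCast,
    ← ENNReal.rpow_mul, ← ENNReal.rpow_mul] at h2
  norm_num at h2
  simpa only [ENNReal.ofReal_pow (hF0 _)] using h2

/-- A functional with a density whose Mellin transform is controlled is bounded in a weighted norm. -/
theorem exists_bound_of_mellin_le {b k e C₀ : ℝ} {N : ℕ} (he : 0 ≤ e)
    (hG : IntegrableOn (fun r : ℝ => (r : ℂ) ^ (-σ : ℂ) * G r) (Ioi 0))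
    (hK : ∀ lam : ℝ, ‖mellin G ((1 - σ : ℝ) + lam * I)‖ ≤ C₀ * (1 + |lam|) ^ b)
    (hb : 2 * (b + N + k) < -1) : ∃ C : ℝ≥0, ∀ φ ∈ radialTest (Ioi 0),
      ENNReal.ofReal (‖∫ r in Ioi (0 : ℝ), G r * iteratedDeriv N φ r‖ ^ 2) ≤ C * 𝓜²(φ, e, -k, (σ - N : ℝ)) := by
  obtain ⟨C₁, hC₁, h₁⟩ := norm_prod_le N σ
  obtain ⟨C₂, hC₂, h₂⟩ := symbol_le he k
  have hC₀ : 0 ≤ C₀ := by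
    have := (norm_nonneg _).trans (hK 0)
    simpa using this
  set F : ℝ → ℝ := fun lam => C₀ * C₁ * (1 + |lam|) ^ (b + N) * (1 + lam ^ 2 + e) ^ (k / 2)
  have hFm : Measurable F := by fun_prop
  have hw : ∀ lam : ℝ, 0 < 1 + lam ^ 2 + e := fun lam => by positivity
  have hF0 : ∀ lam, 0 ≤ F lam := fun lam => by have := hw lam; positivity
  have hF2 : ∀ lam, F lam ^ 2 ≤ (C₀ * C₁) ^ 2 * C₂ * (1 + |lam|) ^ (-(-(2 * (b + N + k)))) := fun lam => by
    have h3 : ((1 + lam ^ 2 + e) ^ (k / 2)) ^ 2 = (1 + lam ^ 2 + e) ^ k := by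
      rw [← Real.rpow_natCast, ← Real.rpow_mul (hw lam).le]; norm_num
    have h4 : ((1 + |lam|) ^ (b + N)) ^ 2 = (1 + |lam|) ^ (2 * (b + N)) := by
      rw [← Real.rpow_natCast, ← Real.rpow_mul (by positivity)]; norm_num [mul_comm]
    have h5 : (1 + |lam|) ^ (-(-(2 * (b + N + k)))) = (1 + |lam|) ^ (2 * (b + N)) * (1 + |lam|) ^ (2 * k) := by
      rw [← Real.rpow_add (by positivity)]; ring_nf
    simp only [F, mul_pow _ _ 2, h3, h4, h5]
    have h6 := h₂ lam
    calc _ ≤ C₀ ^ 2 * C₁ ^ 2 * (1 + |lam|) ^ (2 * (b + N)) * (C₂ * (1 + |lam|) ^ (2 * k)) := by gcongr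
      _ = _ := by ring
  have hfin : ∫⁻ lam, ENNReal.ofReal (F lam ^ 2) ≠ ⊤ := by
    have h3 := ((integrable_one_add_abs_rpow (r := -(2 * (b + N + k))) (by linarith)).const_mul
      ((C₀ * C₁) ^ 2 * C₂)).lintegral_lt_top
    exact ((lintegral_mono fun lam => ENNReal.ofReal_le_ofReal (hF2 lam)).trans_lt h3).ne
  refine ⟨(∫⁻ lam, ENNReal.ofReal (F lam ^ 2)).toNNReal, fun φ hφ => ?_⟩
  rw [ENNReal.coe_toNNReal hfin]
  set m : ℝ → ℂ := fun lam => mellin φ ((σ - N : ℝ) + lam * I) with hm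
  have hmc : Continuous m := radialTest.continuous_mellin_line hφ _
  set g : ℝ → ℝ := fun lam => (1 + lam ^ 2 + e) ^ (-(k / 2)) * ‖m lam‖
  have hgm : Measurable g := by
    have := hmc.measurable
    fun_prop
  have hψ := radialTest.iteratedDeriv hφ N
  have hpt : ∀ lam : ℝ, ‖mellin G ((1 - σ : ℝ) + (-lam : ℝ) * I) * mellin (iteratedDeriv N φ) (σ + lam * I)‖ ≤
      F lam * g lam := fun lam => by
    have e1 : F lam * g lam = C₀ * (1 + |lam|) ^ b * (C₁ * (1 + |lam|) ^ N * ‖m lam‖) := by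
      have : (1 + lam ^ 2 + e) ^ (k / 2) * (1 + lam ^ 2 + e) ^ (-(k / 2)) = 1 := by
        rw [← Real.rpow_add (hw lam)]; simp
      simp only [F, g]
      rw [Real.rpow_add (by positivity), Real.rpow_natCast]
      linear_combination (C₀ * C₁ * ((1 + |lam|) ^ b * (1 + |lam|) ^ N) * ‖m lam‖) * this
    rw [e1, norm_mul]
    have h3 := hK (-lam)
    rw [abs_neg] at h3
    refine mul_le_mul h3 ?_ (norm_nonneg _) (by positivity)
    rw [mellin_iteratedDeriv hφ, norm_mul]
    have e2 : (σ : ℂ) + lam * I - N = (σ - N : ℝ) + lam * I := by push_cast; ring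
    rw [e2]
    exact mul_le_mul_of_nonneg_right (h₁ lam) (norm_nonneg _)
  have h6 : ENNReal.ofReal ‖∫ r in Ioi (0 : ℝ), G r * iteratedDeriv N φ r‖ ≤
      ∫⁻ lam, ENNReal.ofReal (F lam) * ENNReal.ofReal (g lam) := by
    rw [integral_mul_eq_mellin hG hψ, norm_smul]
    have hpi : ‖(1 / (2 * Real.pi) : ℝ)‖ ≤ 1 := by
      rw [Real.norm_of_nonneg (by positivity), div_le_one (by positivity)]
      linarith [Real.pi_gt_three]
    refine (ENNReal.ofReal_le_ofReal (mul_le_of_le_one_left (norm_nonneg _) hpi)).trans ?_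
    rw [ofReal_norm]
    refine (enorm_integral_le_lintegral_enorm _).trans (lintegral_mono fun lam => ?_)
    rw [← ofReal_norm, ← ENNReal.ofReal_mul (hF0 lam)]
    exact ENNReal.ofReal_le_ofReal (hpt lam)
  refine (ofReal_sq_le_mul_lintegral hFm hgm hF0 (norm_nonneg _) h6).trans ?_
  gcongr with lam
  rw [← ENNReal.ofReal_pow (by have := hw lam; positivity)]
  refine ENNReal.ofReal_le_ofReal (le_of_eq ?_)
  simp only [g, mul_pow, hm]
  rw [← Real.rpow_natCast, ← Real.rpow_mul (hw lam).le]
  congr 2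
  push_cast; ring

/-! ### Decay of Mellin transforms of powers -/

lemma tendsto_cpow_shift (c : ℝ) (β : ℂ) :
    Tendsto (fun r : ℝ => ((r : ℂ) - c) ^ β / (r : ℂ) ^ β) atTop (𝓝 1) := by
  have h1 : Tendsto (fun r : ℝ => (((r - c) / r : ℝ) : ℂ)) atTop (𝓝 1) := by
    have : Tendsto (fun r : ℝ => 1 - c / r) atTop (𝓝 (1 - 0)) :=
      tendsto_const_nhds.sub (tendsto_const_nhds.div_atTop tendsto_id)
    rw [sub_zero] at this
    refine ((continuous_ofReal.tendsto 1).comp this).congr' ?_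
    filter_upwards [eventually_gt_atTop 0] with r hr
    simp only [Function.comp_apply]
    congr 1
    field_simp
  have h2 := (continuousAt_cpow_const (a := 1) (b := β) (by simp)).tendsto.comp h1
  rw [one_cpow] at h2
  refine h2.congr' ?_
  filter_upwards [eventually_gt_atTop (max c 0)] with r hr
  have hr0 : 0 < r := (le_max_right _ _).trans_lt hr
  have hrc : 0 < r - c := sub_pos.2 ((le_max_left _ _).trans_lt hr)
  have h3 := mul_cpow_ofReal_nonneg (div_pos hrc hr0).le hr0.le β
  have h4 : (((r - c) / r : ℝ) : ℂ) * r = (r : ℂ) - c := by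
    rw [← ofReal_mul, div_mul_cancel₀ _ hr0.ne']; push_cast; rfl
  rw [h4] at h3
  rw [h3, mul_div_cancel_right₀]
  · rfl
  · exact (cpow_ne_zero_iff.2 (Or.inl (ofReal_ne_zero.2 hr0.ne')))

/-- A smooth function that vanishes near `0` and is a product of two powers near `∞`. -/
structure IsFarPower (c₁ c₂ : ℝ) (a b : ℂ) (G : ℝ → ℂ) : Prop where
  smooth : ContDiff ℝ ∞ G
  zero : ∃ R, 0 < R ∧ ∀ r ≤ R, G r = 0
  eq : ∀ᶠ r : ℝ in atTop, G r = ((r : ℂ) - c₁) ^ a * ((r : ℂ) - c₂) ^ b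

variable {c₁ c₂ : ℝ} {a b : ℂ} {G : ℝ → ℂ}

lemma isFarPower_stepUp {A B : ℝ} (hAB : A < B) (hA0 : 0 < A) (hA₁ : c₁ < A) (hA₂ : c₂ < A) (a b : ℂ) :
    IsFarPower c₁ c₂ a b fun r : ℝ => stepUp A B r * (((r : ℂ) - c₁) ^ a * ((r : ℂ) - c₂) ^ b) where
  smooth := contDiff_stepUp_mul hAB (max_lt hA₁ hA₂)
    (((contDiffOn_cpow c₁ a).mono (Ioi_subset_Ioi (le_max_left _ _))).mul
      ((contDiffOn_cpow c₂ b).mono (Ioi_subset_Ioi (le_max_right _ _))))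
  zero := ⟨A, hA0, fun r hr => by rw [stepUp_of_le hAB hr, zero_mul]⟩
  eq := by
    filter_upwards [eventually_ge_atTop B] with r hr
    rw [stepUp_of_ge hAB hr, one_mul]

lemma IsFarPower.isBigO (h : IsFarPower c₁ c₂ a b G) :
    G =O[atTop] fun r : ℝ => r ^ (-(-(a + b).re)) := by
  have h1 := (tendsto_cpow_shift c₁ a).mul (tendsto_cpow_shift c₂ b)
  have h2 := h1.isBigO_one ℝ
  have h3 : (fun r : ℝ => (r : ℂ) ^ a * (r : ℂ) ^ b) =O[atTop] fun r : ℝ => r ^ (-(-(a + b).re)) := by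
    refine Asymptotics.IsBigO.of_bound 1 ?_
    filter_upwards [eventually_gt_atTop 0] with r hr
    rw [← cpow_add _ _ (ofReal_ne_zero.2 hr.ne'), norm_cpow_eq_rpow_re_of_pos hr, neg_neg, one_mul,
      Real.norm_of_nonneg (by positivity)]
  refine (h2.mul h3).congr' ?_ (by simp)
  filter_upwards [h.eq, eventually_gt_atTop 0] with r hr hr0
  have e1 : (r : ℂ) ^ a ≠ 0 := cpow_ne_zero_iff.2 (Or.inl (ofReal_ne_zero.2 hr0.ne'))
  have e2 : (r : ℂ) ^ b ≠ 0 := cpow_ne_zero_iff.2 (Or.inl (ofReal_ne_zero.2 hr0.ne'))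
  rw [hr]
  field_simp

lemma IsFarPower.eventually_zero (h : IsFarPower c₁ c₂ a b G) : ∀ᶠ r in 𝓝[>] (0 : ℝ), G r = 0 := by
  obtain ⟨R, hR, h0⟩ := h.zero
  filter_upwards [Ioo_mem_nhdsGT hR] with r hr using h0 r hr.2.le

lemma IsFarPower.mellinConvergent (h : IsFarPower c₁ c₂ a b G) {s : ℂ} (hs : (a + b).re + s.re < 0) :
    MellinConvergent G s :=
  mellinConvergent_of_isBigO_rpow (a := -(a + b).re) (b := s.re - 1)
    (h.smooth.continuous.locallyIntegrable.locallyIntegrableOn _) h.isBigO (by linarith)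
    ((Asymptotics.isBigO_zero _ _).congr' (h.eventually_zero.mono fun r hr => hr.symm) EventuallyEq.rfl)
    (by linarith)

/-- The derivative of a product of powers near infinity, up to a test function. -/
lemma IsFarPower.deriv_eq (h : IsFarPower c₁ c₂ a b G) : ∃ G₁ G₂ ψ : ℝ → ℂ,
    IsFarPower c₁ c₂ (a - 1) b G₁ ∧ IsFarPower c₁ c₂ a (b - 1) G₂ ∧ ψ ∈ radialTest univ ∧
      ∀ r, deriv G r = ψ r + (a * G₁ r + b * G₂ r) := by
  set A := max (max c₁ c₂) 0 + 1
  have hA : max (max c₁ c₂) 0 < A := lt_add_one _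
  have hA0 : 0 < A := (le_max_right _ _).trans_lt hA
  have hA₁ : c₁ < A := ((le_max_left _ _).trans (le_max_left _ _)).trans_lt hA
  have hA₂ : c₂ < A := ((le_max_right _ _).trans (le_max_left _ _)).trans_lt hA
  have h₁ := isFarPower_stepUp (lt_add_one A) hA0 hA₁ hA₂ (a - 1) b
  have h₂ := isFarPower_stepUp (lt_add_one A) hA0 hA₁ hA₂ a (b - 1)
  refine ⟨_, _, fun r => deriv G r - (a * _ + b * _), h₁, h₂, ?_, fun r => (sub_add_cancel _ _).symm⟩
  obtain ⟨R, hR, h0⟩ := h.zero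
  obtain ⟨B, hB⟩ := eventually_atTop.1 h.eq
  refine ⟨(contDiff_deriv h.smooth).sub ((contDiff_const.mul h₁.smooth).add (contDiff_const.mul h₂.smooth)),
    Icc (min R A) (max B (A + 1)), isCompact_Icc, fun r hr => ⟨mem_univ _, ?_⟩, fun r hr => ?_⟩
  · exact (lt_min hR hA0).trans_le hr.1
  · rcases lt_or_ge r (min R A) with h1 | h1
    · have e1 : deriv G r = 0 := deriv_eq_zero_of_isOpen isOpen_Iio
        (fun x hx => h0 x (le_of_lt hx)) (h1.trans_le (min_le_left _ _))
      beta_reduce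
      rw [e1, stepUp_of_le (lt_add_one A) (h1.trans_le (min_le_right _ _)).le]
      ring
    · have h2 : max B (A + 1) < r := by
        by_contra hcon
        exact hr ⟨h1, not_lt.1 hcon⟩
      have hrB := (le_max_left _ _).trans_lt h2
      have hrA := (le_max_right _ _).trans_lt h2
      have : G =ᶠ[𝓝 r] fun r => ((r : ℂ) - c₁) ^ a * ((r : ℂ) - c₂) ^ b := by
        filter_upwards [Ioi_mem_nhds hrB] with x hx using hB x (le_of_lt hx)
      beta_reduce
      have hd := ((hasDerivAt_cpow_sub (by linarith : c₁ < r) a).mul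
        (hasDerivAt_cpow_sub (by linarith : c₂ < r) b)).deriv
      rw [this.deriv_eq]
      refine (congrArg (· - _) hd).trans ?_
      rw [stepUp_of_ge (lt_add_one A) hrA.le]
      ring

lemma IsFarPower.mellin_deriv (h : IsFarPower c₁ c₂ a b G) {s : ℂ} (hs : (a + b).re + s.re < 0)
    (h' : MellinConvergent (deriv G) (s + 1)) : mellin (deriv G) (s + 1) = -s * mellin G s := by
  have hc := h.mellinConvergent hs
  rw [mellin, mellin]
  simp only [smul_eq_mul, add_sub_cancel_right]
  have hlim : Tendsto ((fun r : ℝ => (r : ℂ) ^ s) * G) atTop (𝓝 0) := by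
    have h1 : (fun r : ℝ => (r : ℂ) ^ s) =O[atTop] fun r : ℝ => r ^ s.re := by
      refine Asymptotics.IsBigO.of_bound 1 ?_
      filter_upwards [eventually_gt_atTop 0] with r hr
      rw [norm_cpow_eq_rpow_re_of_pos hr, one_mul, Real.norm_of_nonneg (by positivity)]
    refine (h1.mul h.isBigO).trans_tendsto ?_
    refine (tendsto_rpow_neg_atTop (y := -((a + b).re + s.re)) (by linarith)).congr' ?_
    filter_upwards [eventually_gt_atTop 0] with r hr
    rw [← Real.rpow_add hr]
    ring_nf
  rw [integral_Ioi_mul_deriv_eq_deriv_mul (u := fun r : ℝ => (r : ℂ) ^ s) (v := G) (a' := 0) (b' := 0)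
    (u' := fun r : ℝ => s * (r : ℂ) ^ (s - 1))
    (fun r hr => by simpa using hasDerivAt_cpow_sub (c := 0) (show (0 : ℝ) < r from hr) s)
    (fun r _ => hasDerivAt_of_contDiff h.smooth r) ?_ ?_ ?_ hlim]
  · rw [sub_zero, zero_sub, ← integral_neg, ← integral_const_mul]
    congr 1
    ext r; ring
  · have := h'
    rw [MellinConvergent] at this
    simpa using! this
  · have := hc.const_mul s
    simpa [Pi.mul_def, mul_assoc] using! this
  · refine (tendsto_const_nhds (x := (0 : ℂ))).congr' ?_
    filter_upwards [h.eventually_zero] with r hr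
    simp [hr]

lemma IsFarPower.mellin_decay (K : ℕ) : ∀ {a b : ℂ} {G : ℝ → ℂ} {c : ℝ}, IsFarPower c₁ c₂ a b G →
    (a + b).re + c < 0 → ∃ C, 0 ≤ C ∧ ∀ lam : ℝ, (1 + |lam|) ^ K * ‖mellin G (c + lam * I)‖ ≤ C := by
  induction K with
  | zero =>
    intro a b G c h hc
    refine ⟨∫ r in Ioi (0 : ℝ), ‖(r : ℂ) ^ ((c : ℂ) - 1) * G r‖, integral_nonneg fun _ => norm_nonneg _,
      fun lam => ?_⟩
    rw [pow_zero, one_mul]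
    refine (norm_integral_le_integral_norm _).trans (le_of_eq ?_)
    refine setIntegral_congr_fun measurableSet_Ioi fun r hr => ?_
    simp only [smul_eq_mul, norm_mul, norm_cpow_eq_rpow_re_of_pos hr]
    simp
  | succ K ih =>
    intro a b G c h hc
    obtain ⟨G₁, G₂, ψ, h₁, h₂, hψ, hG⟩ := h.deriv_eq
    obtain ⟨C₀, hC₀, hb₀⟩ := ih h hc
    have hc₁ : (a - 1 + b).re + (c + 1 : ℝ) < 0 := by simp at hc ⊢; linarith
    have hc₂ : (a + (b - 1)).re + (c + 1 : ℝ) < 0 := by simp at hc ⊢; linarith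
    obtain ⟨C₁, hC₁, hb₁⟩ := ih h₁ hc₁
    obtain ⟨C₂, hC₂, hb₂⟩ := ih h₂ hc₂
    obtain ⟨C₃, hC₃, hb₃⟩ := KerrTeukolsky.mellin_decay hψ K (c + 1)
    refine ⟨C₀ + (C₃ + (‖a‖ * C₁ + ‖b‖ * C₂)), by positivity, fun lam => ?_⟩
    have e0 : (((c + 1 : ℝ) : ℂ) + lam * I) = c + lam * I + 1 := by push_cast; ring
    specialize hb₀ lam; specialize hb₁ lam; specialize hb₂ lam; specialize hb₃ lam
    rw [e0] at hb₁ hb₂ hb₃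
    have hv₁ : MellinConvergent G₁ (c + lam * I + 1) := h₁.mellinConvergent (by simpa using! hc₁)
    have hv₂ : MellinConvergent G₂ (c + lam * I + 1) := h₂.mellinConvergent (by simpa using! hc₂)
    have hv₃ := radialTest.mellinConvergent hψ (c + lam * I + 1)
    have hadd := hasMellin_add hv₃ (hasMellin_add (hv₁.const_smul a) (hv₂.const_smul b)).1
    have hfun : deriv G = fun r => ψ r + (a • G₁ r + b • G₂ r) := funext hG
    have hm := h.mellin_deriv (s := c + lam * I) (by simpa using! hc) (by rw [hfun]; exact hadd.1)
    rw [hfun, hadd.2, (hasMellin_add (hv₁.const_smul a) (hv₂.const_smul b)).2, mellin_const_smul,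
      mellin_const_smul, smul_eq_mul, smul_eq_mul] at hm
    set L := 1 + |lam|
    have hL : L ≤ 1 + ‖(c : ℂ) + lam * I‖ := by
      have := abs_im_le_norm ((c : ℂ) + lam * I)
      simp at this
      linarith
    set z : ℂ := c + lam * I
    have hLK : 0 ≤ L ^ K := by positivity
    calc L ^ (K + 1) * ‖mellin G z‖ = L ^ K * (L * ‖mellin G z‖) := by ring
      _ ≤ L ^ K * ((1 + ‖z‖) * ‖mellin G z‖) := by gcongr
      _ = L ^ K * ‖mellin G z‖ + L ^ K * ‖-z * mellin G z‖ := by rw [norm_mul, norm_neg]; ring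
      _ ≤ C₀ + (C₃ + (‖a‖ * C₁ + ‖b‖ * C₂)) := by
        refine add_le_add hb₀ ?_
        rw [← hm]
        calc L ^ K * ‖mellin ψ (z + 1) + (a * mellin G₁ (z + 1) + b * mellin G₂ (z + 1))‖
            ≤ L ^ K * (‖mellin ψ (z + 1)‖ + (‖a‖ * ‖mellin G₁ (z + 1)‖ + ‖b‖ * ‖mellin G₂ (z + 1)‖)) := by
              gcongr
              refine (norm_add_le _ _).trans (add_le_add_right ((norm_add_le _ _).trans ?_) _)
              rw [norm_mul, norm_mul]
          _ = L ^ K * ‖mellin ψ (z + 1)‖ + (‖a‖ * (L ^ K * ‖mellin G₁ (z + 1)‖) +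
              ‖b‖ * (L ^ K * ‖mellin G₂ (z + 1)‖)) := by ring
          _ ≤ _ := by gcongr

/-! ### Boundedness of the functionals in the kernels -/

lemma norm_one_sub_stepUp_le (a b r : ℝ) : ‖1 - stepUp a b r‖ ≤ 1 := by
  rw [stepUp, ← ofReal_one, ← ofReal_sub, norm_real, Real.norm_of_nonneg]
  · linarith [Real.smoothTransition.nonneg ((r - a) / (b - a))]
  · linarith [Real.smoothTransition.le_one ((r - a) / (b - a))]

/-- A singular density `x_+^(l + κ)` with a smooth factor, cut off to a neighbourhood of the horizon. -/
def nearPower (rp : ℝ) (β : ℂ) (g : ℝ → ℂ) : ℝ → ℂ :=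
  (Ioi rp).indicator fun r => ((r : ℂ) - rp) ^ β * ((1 - stepUp (rp + 1) (rp + 2) r) * g r)

variable {rp l : ℝ} {κ : ℂ} {g : ℝ → ℂ}

lemma nearPower_bound (hrp : 0 < rp) (hl : 0 ≤ l) (hκ : κ.re = 0) (hg : ContDiff ℝ ∞ g) (s : ℂ) :
    ∃ M, ∀ r : ℝ, rp < r → r ≤ rp + 2 → ‖(r : ℂ) ^ s * (((r : ℂ) - rp) ^ (l + κ) * g r)‖ ≤ M := by
  have hc : ContinuousOn (fun r : ℝ => (r : ℂ) ^ s * g r) (Icc rp (rp + 2)) := fun r hr =>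
    ((continuousAt_ofReal_cpow_const _ _ (Or.inr (hrp.trans_le hr.1).ne')).mul
      hg.continuous.continuousAt).continuousWithinAt
  obtain ⟨M, hM⟩ := isCompact_Icc.exists_bound_of_continuousOn hc
  refine ⟨2 ^ l * M, fun r h1 h2 => ?_⟩
  have h3 : ‖((r : ℂ) - rp) ^ (l + κ)‖ ≤ 2 ^ l := by
    rw [← ofReal_sub, norm_cpow_eq_rpow_re_of_pos (sub_pos.2 h1)]
    simp only [add_re, ofReal_re, hκ, add_zero]
    exact Real.rpow_le_rpow (sub_pos.2 h1).le (by linarith) hl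
  calc _ = ‖((r : ℂ) - rp) ^ (l + κ)‖ * ‖(r : ℂ) ^ s * g r‖ := by simp only [norm_mul]; ring
    _ ≤ _ := mul_le_mul h3 (hM r ⟨h1.le, h2⟩) (norm_nonneg _) (by positivity)

lemma nearPower_convergent (hrp : 0 < rp) (hl : 0 ≤ l) (hκ : κ.re = 0) (hg : ContDiff ℝ ∞ g) (s : ℂ) :
    MellinConvergent (nearPower rp (l + κ) g) s := by
  obtain ⟨M, hM⟩ := nearPower_bound hrp hl hκ hg (s - 1)
  have hM0 : 0 ≤ M := (norm_nonneg _).trans (hM (rp + 1) (by linarith) (by linarith))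
  have hgm := hg.continuous.measurable
  have hsm := (contDiff_stepUp (rp + 1) (rp + 2)).continuous.measurable
  have hb : Integrable ((Icc rp (rp + 2)).indicator fun _ => M) :=
    (integrable_indicator_iff measurableSet_Icc).2 (integrableOn_const (by simp))
  refine hb.integrableOn.mono' ?_ (ae_of_all _ fun r => ?_)
  · refine Measurable.aestronglyMeasurable ?_
    refine (by fun_prop : Measurable fun r : ℝ => (r : ℂ) ^ (s - 1)).smul (Measurable.indicator ?_ measurableSet_Ioi)
    fun_prop
  · simp only [nearPower, indicator, mem_Ioi, smul_eq_mul]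
    by_cases h1 : rp < r
    · rw [if_pos h1]
      by_cases h2 : r ≤ rp + 2
      · rw [if_pos ⟨h1.le, h2⟩]
        calc _ = ‖1 - stepUp (rp + 1) (rp + 2) r‖ * ‖(r : ℂ) ^ (s - 1) * (((r : ℂ) - rp) ^ (l + κ) * g r)‖ := by
              simp only [norm_mul]; ring
          _ ≤ 1 * M := mul_le_mul (norm_one_sub_stepUp_le _ _ _) (hM r h1 h2) (norm_nonneg _) one_pos.le
          _ = M := one_mul M
      · rw [stepUp_of_ge (by linarith) (by linarith)]
        simp only [sub_self, zero_mul, mul_zero, norm_zero]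
        split_ifs <;> simp [hM0]
    · rw [if_neg h1, mul_zero, norm_zero]
      split_ifs <;> simp [hM0]

/-- The Mellin transform of `x_+^(l + κ)` decays like `|λ|^(-l - 1)`. -/
lemma nearPower_decay (hrp : 0 < rp) (hl : 0 ≤ l) (hκ : κ.re = 0) (hg : ContDiff ℝ ∞ g) (p : ℝ) :
    ∃ C, ∀ lam : ℝ, (1 + |lam|) ^ (l + 1) * ‖mellin (nearPower rp (l + κ) g) (p + lam * I)‖ ≤ C := by
  set η : ℝ → ℂ := fun r => 1 - stepUp (rp + 1) (rp + 2) r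
  have hη : ContDiff ℝ ∞ η := contDiff_const.sub (contDiff_stepUp _ _)
  have hη1 : ∀ r ≤ rp + 1, η r = 1 := fun r hr => by
    simp only [η]; rw [stepUp_of_le (by linarith) hr, sub_zero]
  have hη0 : ∀ r, rp + 2 ≤ r → η r = 0 := fun r hr => by
    simp only [η]; rw [stepUp_of_ge (by linarith) hr, sub_self]
  set D : ℝ → ℂ := fun r => η r - η (rp + 2 * (r - rp)) with hDdef
  have hD : D ∈ radialTest (Ioi rp) := by
    refine ⟨hη.sub (hη.comp (by fun_prop)), Icc (rp + 1 / 2) (rp + 2), isCompact_Icc,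
      fun r hr => ⟨by have := hr.1; simp only [mem_Ioi]; linarith,
        by have := hr.1; simp only [mem_Ioi]; linarith⟩, fun r hr => ?_⟩
    simp only [D]
    rcases le_or_gt r (rp + 1 / 2) with h | h
    · rw [hη1 r (by linarith), hη1 _ (by linarith), sub_self]
    · have h2 : rp + 2 ≤ r := by
        by_contra hcon
        exact hr ⟨h.le, (not_le.1 hcon).le⟩
      rw [hη0 r h2, hη0 _ (by linarith), sub_self]
  set Y : ℝ → ℂ := fun r => ((r : ℂ) - rp) ^ (l + κ) * D r with hYdef
  have hY' : Y ∈ radialTest (Ioi rp) :=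
    radialTest.mul isOpen_Ioi (contDiffOn_cpow rp _) inter_subset_left hD
  have hY : Y ∈ radialTest (Ioi 0) := radialTest.mono (Ioi_subset_Ioi hrp.le) hY'
  have hY0 : ∀ r ≤ rp, Y r = 0 := fun r hr => by
    obtain ⟨_, K, _, hK, h0⟩ := hY'
    exact h0 r fun h => not_lt.2 hr (hK h).1
  obtain ⟨k, hk⟩ := exists_nat_ge (l + 2)
  obtain ⟨C, hC, hdec⟩ := mellin_mul_dilate_le le_rfl hrp k hg hY p
  set t : ℕ → ℝ := fun j => (1 / 2) ^ j
  have ht : ∀ j, 0 < t j := fun j => by positivity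
  have ht1 : ∀ j, t j ≤ 1 := fun j => pow_le_one₀ (by norm_num) (by norm_num)
  set S : ℕ → ℝ → ℂ := fun J r => ∑ j ∈ Finset.range J, ((t j : ℝ) : ℂ) ^ (l + κ) * (g r * dilate rp (t j) Y r)
  have hmem : ∀ j, (fun r => g r * dilate rp (t j) Y r) ∈ radialTest (Ioi 0) := fun j =>
    radialTest.smooth_mul hg (dilate_mem le_rfl hrp (ht j) (ht1 j) hY)
  have hS : ∀ J r, S J r = (Ioi rp).indicator (fun r => ((r : ℂ) - rp) ^ (l + κ) *
      ((η r - η (rp + (r - rp) / t J)) * g r)) r := fun J r => by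
    simp only [S, indicator, mem_Ioi, dilate]
    by_cases h1 : rp < r
    · rw [if_pos h1]
      have h2 : ∀ j, ((t j : ℝ) : ℂ) ^ (l + κ) * (g r * Y (rp + (r - rp) / t j)) =
          ((r : ℂ) - rp) ^ (l + κ) * g r * (η (rp + (r - rp) / t j) - η (rp + (r - rp) / t (j + 1))) := fun j => by
        have h3 : ((r : ℂ) - rp) ^ (l + κ) =
            ((t j : ℝ) : ℂ) ^ (l + κ) * (((rp + (r - rp) / t j : ℝ) : ℂ) - rp) ^ (l + κ) := by
          rw [← ofReal_sub, ← ofReal_sub, ← mul_cpow_ofReal_nonneg (ht j).le (by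
            rw [add_sub_cancel_left]; exact (div_pos (sub_pos.2 h1) (ht j)).le), ← ofReal_mul,
            add_sub_cancel_left, mul_div_cancel₀ _ (ht j).ne']
        have h4 : rp + 2 * (rp + (r - rp) / t j - rp) = rp + (r - rp) / t (j + 1) := by
          simp only [t, pow_succ]; field_simp; ring
        simp only [hYdef, hDdef]
        rw [h3, h4]
        ring
      rw [Finset.sum_congr rfl fun j _ => h2 j, ← Finset.mul_sum,
        Finset.sum_range_sub' fun j => η (rp + (r - rp) / t j)]
      simp only [t, pow_zero, div_one, add_sub_cancel]
      ring
    · rw [if_neg h1]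
      refine Finset.sum_eq_zero fun j _ => ?_
      rw [hY0 _ (by have := div_nonpos_of_nonpos_of_nonneg (sub_nonpos.2 (not_lt.1 h1)) (ht j).le; linarith)]
      ring
  have hlim : ∀ lam : ℝ, Tendsto (fun J => mellin (S J) (p + lam * I)) atTop
      (𝓝 (mellin (nearPower rp (l + κ) g) (p + lam * I))) := fun lam => by
    obtain ⟨M, hM⟩ := nearPower_bound hrp hl hκ hg (p + lam * I - 1)
    have hM0 : 0 ≤ M := (norm_nonneg _).trans (hM (rp + 1) (by linarith) (by linarith))
    refine tendsto_integral_of_dominated_convergence ((Icc rp (rp + 2)).indicator fun _ => 2 * M) (fun J => ?_)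
      ((integrable_indicator_iff measurableSet_Icc).2 (integrableOn_const (by simp))).integrableOn
      (fun J => ae_of_all _ fun r => ?_) (ae_of_all _ fun r => ?_)
    · refine Measurable.aestronglyMeasurable ?_
      have : Measurable (S J) := Finset.measurable_sum _ fun j _ =>
        (hmem j).1.continuous.measurable.const_mul _
      fun_prop
    · rw [hS]
      simp only [indicator, mem_Ioi, smul_eq_mul]
      by_cases h1 : rp < r
      · rw [if_pos h1]
        by_cases h2 : r ≤ rp + 2
        · rw [if_pos ⟨h1.le, h2⟩]
          have h3 : ‖η r - η (rp + (r - rp) / t J)‖ ≤ 2 :=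
            (norm_sub_le _ _).trans (by
              linarith [norm_one_sub_stepUp_le (rp + 1) (rp + 2) r,
                norm_one_sub_stepUp_le (rp + 1) (rp + 2) (rp + (r - rp) / t J)])
          calc _ = ‖η r - η (rp + (r - rp) / t J)‖ *
                ‖(r : ℂ) ^ (p + lam * I - 1) * (((r : ℂ) - rp) ^ (l + κ) * g r)‖ := by
                simp only [norm_mul]; ring
            _ ≤ _ := mul_le_mul h3 (hM r h1 h2) (norm_nonneg _) (by norm_num)
        · have h3 : r - rp ≤ (r - rp) / t J := le_div_self (by linarith) (ht J) (ht1 J)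
          rw [hη0 r (by linarith), hη0 _ (by linarith)]
          simp only [sub_self, zero_mul, mul_zero, norm_zero]
          split_ifs <;> simp [hM0]
      · rw [if_neg h1, mul_zero, norm_zero]
        split_ifs <;> simp [hM0]
    · refine Tendsto.const_smul ?_ _
      simp only [hS, nearPower, indicator, mem_Ioi]
      by_cases h1 : rp < r
      · simp only [if_pos h1]
        refine (tendsto_const_nhds).congr' ?_
        have h2 : Tendsto (fun J : ℕ => (2 : ℝ) ^ J * (r - rp)) atTop atTop :=
          (tendsto_pow_atTop_atTop_of_one_lt one_lt_two).atTop_mul_const (sub_pos.2 h1)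
        filter_upwards [h2.eventually_ge_atTop 2] with J hJ
        have h3 : (r - rp) / t J = 2 ^ J * (r - rp) := by
          simp only [t, one_div, inv_pow]; field_simp
        rw [hη0 (rp + (r - rp) / t J) (by rw [h3]; linarith), sub_zero]
      · simp only [if_neg h1]
        exact tendsto_const_nhds
  refine ⟨4 * C, fun lam => ?_⟩
  refine le_of_tendsto ((hlim lam).norm.const_mul _) (Eventually.of_forall fun J => ?_)
  have hsum : mellin (S J) (p + lam * I) = ∑ j ∈ Finset.range J, ((t j : ℝ) : ℂ) ^ (l + κ) *
      mellin (fun r => g r * dilate rp (t j) Y r) (p + lam * I) := by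
    simp only [mellin, S, Finset.smul_sum]
    rw [integral_finsetSum _ fun j _ => ?_]
    · refine Finset.sum_congr rfl fun j _ => ?_
      rw [← integral_const_mul]
      congr 1; ext r; simp only [smul_eq_mul]; ring
    · exact (radialTest.mellinConvergent (hmem j) (p + lam * I)).const_smul (((t j : ℝ) : ℂ) ^ (l + κ))
  rw [hsum]
  set L := 1 + |lam|
  have hL : 0 < L := by positivity
  calc L ^ (l + 1) * ‖∑ j ∈ Finset.range J, ((t j : ℝ) : ℂ) ^ (l + κ) *
        mellin (fun r => g r * dilate rp (t j) Y r) (p + lam * I)‖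
      ≤ L ^ (l + 1) * ∑ j ∈ Finset.range J, C * (t j ^ (l + 1) / (1 + t j * |lam|) ^ k) := by
        gcongr
        refine (norm_sum_le _ _).trans (Finset.sum_le_sum fun j _ => ?_)
        have h1 := hdec (t j) (ht j) (ht1 j) lam
        have hpos : 0 < (1 + t j * |lam|) ^ k := by have := ht j; positivity
        rw [norm_mul, norm_cpow_eq_rpow_re_of_pos (ht j), Real.rpow_add (ht j), Real.rpow_one, mul_div_assoc',
          le_div_iff₀ hpos]
        simp only [add_re, ofReal_re, hκ, add_zero]
        have h2 : 0 ≤ t j ^ l := (Real.rpow_pos_of_pos (ht j) l).le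
        nlinarith [mul_le_mul_of_nonneg_left h1 h2]
    _ = C * ∑ j ∈ Finset.range J, L ^ (l + 1) * (t j ^ (l + 1) / (1 + t j * |lam|) ^ k) := by
        rw [← Finset.mul_sum, ← Finset.mul_sum]; ring
    _ ≤ C * ∑ j ∈ Finset.range J, t j * L / (1 + t j * |lam|) ^ 2 := by
        gcongr with j _
        exact dyadic_term_le hl hk (ht j) (ht1 j) lam
    _ ≤ C * 4 := by
        gcongr
        exact sum_dyadic_le lam J
    _ = 4 * C := mul_comm _ _

variable {rp d l p e : ℝ} {κ : ℂ}

lemma integral_Ioi_shift (rp : ℝ) (F : ℝ → ℂ) : ∫ x in Ioi (0 : ℝ), F x = ∫ r in Ioi rp, F (r - rp) := by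
  rw [← integral_indicator measurableSet_Ioi, ← integral_indicator measurableSet_Ioi,
    ← integral_sub_right_eq_self _ rp]
  refine integral_congr_ae (ae_of_all _ fun r => ?_)
  simp only [indicator, mem_Ioi, sub_pos]

lemma horizonForm_eq_shift (rp d : ℝ) (κ : ℂ) (l : ℝ) (N : ℕ) (φ : ℝ → ℂ) :
    horizonForm rp d κ l N φ = ∫ r in Ioi rp, ((r : ℂ) - rp) ^ (l + κ) *
      (((r : ℂ) - rp + d) ^ (l - κ) * iteratedDeriv N φ r) := by
  rw [horizonForm, integral_Ioi_shift rp]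
  simp only [add_sub_cancel, ofReal_sub]

/-- The functional `horizonForm` is bounded in the norm dual to the space of order `1/2 - s - δ`. -/
theorem exists_bound_horizonForm (hd : 0 < d) (hrd : 0 ≤ rp - d) (hκ : κ.re = 0) (hl : 0 ≤ l) {s δ : ℝ}
    {N : ℕ} (hN : (N : ℝ) = l + s) (he : 0 ≤ e) (hδ : 0 < δ) (hp : 2 * l - N + 1 < p) :
    ∃ C : ℝ≥0, ∀ φ ∈ radialTest (Ioi 0), ENNReal.ofReal (‖horizonForm rp d κ l N φ‖ ^ 2) ≤
      C * 𝓜²(φ, e, -(-s + 1 / 2 - δ), p) := by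
  have hrp : 0 < rp := by linarith
  set σ := p + N with hσ
  set g := cutPow rp d (rp - d / 2) (l - κ)
  have hg : ContDiff ℝ ∞ g := contDiff_cutPow (by linarith) _
  set Gf : ℝ → ℂ := fun r => stepUp (rp + 1) (rp + 2) r *
    (((r : ℂ) - rp) ^ (l + κ) * ((r : ℂ) - (rp - d : ℝ)) ^ (l - κ))
  have hGf : IsFarPower rp (rp - d) (l + κ) (l - κ) Gf :=
    isFarPower_stepUp (by linarith) (by linarith) (by linarith) (by linarith) _ _
  have hc : ((l + κ) + (l - κ) : ℂ).re + (1 - σ) < 0 := by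
    simp; linarith
  set G : ℝ → ℂ := fun r => nearPower rp (l + κ) g r + Gf r
  have hG : ∀ r, rp < r → G r = ((r : ℂ) - rp) ^ (l + κ) * ((r : ℂ) - rp + d) ^ (l - κ) := fun r hr => by
    simp only [G, Gf, g, nearPower, indicator, mem_Ioi, if_pos hr]
    rw [cutPow_of_ge (by linarith) (by linarith), show (r : ℂ) - (rp - d : ℝ) = r - rp + d by push_cast; ring]
    ring
  have hG0 : ∀ r, r ∉ Ioi rp → G r = 0 := fun r hr => by
    have hr' : r ≤ rp := not_lt.1 hr
    simp only [G, Gf, nearPower, indicator_of_notMem hr]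
    rw [stepUp_of_le (by linarith) (by linarith)]
    ring
  have hconv : ∀ lam : ℝ, HasMellin G ((1 - σ : ℝ) + lam * I)
      (mellin (nearPower rp (l + κ) g) ((1 - σ : ℝ) + lam * I) + mellin Gf ((1 - σ : ℝ) + lam * I)) :=
    fun lam => hasMellin_add (nearPower_convergent hrp hl hκ hg _)
      (hGf.mellinConvergent (by simpa using! hc))
  obtain ⟨C₁, h₁⟩ := nearPower_decay hrp hl hκ hg (1 - σ)
  obtain ⟨K, hK⟩ := exists_nat_ge (l + 1)
  obtain ⟨C₂, hC₂, h₂⟩ := IsFarPower.mellin_decay K hGf hc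
  have hdec : ∀ lam : ℝ, ‖mellin G ((1 - σ : ℝ) + lam * I)‖ ≤ (C₁ + C₂) * (1 + |lam|) ^ (-(l + 1)) := fun lam => by
    have hL : 1 ≤ 1 + |lam| := by linarith [abs_nonneg lam]
    have hL0 : 0 < 1 + |lam| := by positivity
    rw [(hconv lam).2, Real.rpow_neg hL0.le, ← div_eq_mul_inv, le_div_iff₀ (by positivity), mul_comm]
    refine (mul_le_mul_of_nonneg_left (norm_add_le _ _) (by positivity)).trans ?_
    rw [mul_add]
    refine add_le_add (h₁ lam) (le_trans ?_ (h₂ lam))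
    gcongr
    rw [← Real.rpow_natCast]
    exact Real.rpow_le_rpow_of_exponent_le hL hK
  obtain ⟨C, hC⟩ := exists_bound_of_mellin_le (σ := σ) (G := G) (N := N) (k := -s + 1 / 2 - δ) he
    (by have := (hconv 0).1; simpa [MellinConvergent] using! this) hdec (by rw [hN]; linarith)
  refine ⟨C, fun φ hφ => ?_⟩
  have h := hC φ hφ
  rw [hσ, add_sub_cancel_right] at h
  convert h using 4
  rw [horizonForm_eq_shift, setIntegral_eq_of_subset_of_forall_sdiff_eq_zero measurableSet_Ioi
    (Ioi_subset_Ioi hrp.le) (f := fun r => G r * iteratedDeriv N φ r)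
    fun r hr => by rw [hG0 r hr.2, zero_mul]]
  exact setIntegral_congr_fun measurableSet_Ioi fun r hr => by rw [hG r hr, mul_assoc]

open Polynomial in
/-- A polynomial density is bounded in a norm of high enough weight, near infinity. -/
theorem exists_bound_polynomial {A B : ℝ} (hA : 0 < A) (hAB : A < B) (rp k : ℝ) (P : ℂ[X]) (he : 0 ≤ e)
    (hp : P.natDegree + 1 < p) : ∃ C : ℝ≥0, ∀ φ ∈ radialTest (Ioi 0),
      ENNReal.ofReal (‖∫ r in Ioi (0 : ℝ), stepUp A B r * P.eval ((r : ℂ) - rp) * φ r‖ ^ 2) ≤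
        C * 𝓜²(φ, e, -k, p) := by
  set Gj : ℕ → ℝ → ℂ := fun j r => stepUp A B r * ((r : ℂ) - rp) ^ j
  have hGj : ∀ j : ℕ, IsFarPower rp 0 j 0 (Gj j) := fun j =>
    ⟨(contDiff_stepUp A B).mul ((ofRealCLM.contDiff.sub contDiff_const).pow j),
      ⟨A, hA, fun r hr => by simp only [Gj]; rw [stepUp_of_le hAB hr, zero_mul]⟩, by
        filter_upwards [eventually_ge_atTop B] with r hr
        simp only [Gj]
        rw [stepUp_of_ge hAB hr, cpow_natCast, cpow_zero, one_mul, mul_one]⟩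
  have hc : ∀ j ∈ Finset.range (P.natDegree + 1), ((j : ℂ) + 0).re + (1 - p) < 0 := fun j hj => by
    have : (j : ℝ) ≤ P.natDegree := by exact_mod_cast Nat.lt_succ_iff.1 (Finset.mem_range.1 hj)
    simp; linarith
  obtain ⟨K, hK⟩ := exists_nat_gt (k + 1 / 2)
  choose! D hD0 hD using fun j hj => IsFarPower.mellin_decay K (hGj j) (hc j hj)
  set G : ℝ → ℂ := fun r => stepUp A B r * P.eval ((r : ℂ) - rp)
  have hG : G = fun r => ∑ j ∈ Finset.range (P.natDegree + 1), P.coeff j • Gj j r := by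
    ext r
    simp only [G, Gj, eval_eq_sum_range, Finset.mul_sum, smul_eq_mul]
    exact Finset.sum_congr rfl fun j _ => by ring
  have hconv : ∀ j ∈ Finset.range (P.natDegree + 1), ∀ lam : ℝ,
      MellinConvergent (fun r => P.coeff j • Gj j r) ((1 - p : ℝ) + lam * I) := fun j hj lam =>
    ((hGj j).mellinConvergent (by simpa using! hc j hj)).const_smul _
  have hint : ∀ lam : ℝ, MellinConvergent G ((1 - p : ℝ) + lam * I) ∧ mellin G ((1 - p : ℝ) + lam * I) =
      ∑ j ∈ Finset.range (P.natDegree + 1), P.coeff j * mellin (Gj j) ((1 - p : ℝ) + lam * I) := fun lam => by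
    rw [hG]
    simp only [MellinConvergent, mellin, Finset.smul_sum]
    refine ⟨integrable_finsetSum _ fun j hj => hconv j hj lam, ?_⟩
    rw [integral_finsetSum _ fun j hj => hconv j hj lam]
    exact Finset.sum_congr rfl fun j _ => mellin_const_smul (Gj j) _ (P.coeff j)
  have hdec : ∀ lam : ℝ, ‖mellin G ((1 - p : ℝ) + lam * I)‖ ≤
      (∑ j ∈ Finset.range (P.natDegree + 1), ‖P.coeff j‖ * D j) * (1 + |lam|) ^ (-(K : ℝ)) := fun lam => by
    have hL0 : 0 < 1 + |lam| := by positivity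
    rw [(hint lam).2, Real.rpow_neg hL0.le, Real.rpow_natCast, ← div_eq_mul_inv, le_div_iff₀ (by positivity)]
    refine (mul_le_mul_of_nonneg_right (norm_sum_le _ _) (by positivity)).trans ?_
    rw [Finset.sum_mul]
    refine Finset.sum_le_sum fun j hj => ?_
    rw [norm_mul, mul_assoc, mul_comm ‖mellin _ _‖]
    exact mul_le_mul_of_nonneg_left (hD j hj lam) (norm_nonneg _)
  obtain ⟨C, hC⟩ := exists_bound_of_mellin_le (σ := p) (G := G) (N := 0) (k := k) he
    (by have := (hint 0).1; simpa [MellinConvergent] using! this) hdec (by push_cast; linarith)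
  refine ⟨C, fun φ hφ => ?_⟩
  have h := hC φ hφ
  simpa only [iteratedDeriv_zero, Nat.cast_zero, sub_zero] using h

/-! ### Weights of the modes -/

/-- The polynomial `q` with `∂^N (x^α (x + d)^β) = x^(α - N) (x + d)^β q(x / (x + d))`. -/
def rodriguesPoly (α β : ℂ) : ℕ → Polynomial ℂ
  | 0 => 1
  | N + 1 => (Polynomial.C (α - N) + Polynomial.C β * Polynomial.X) * rodriguesPoly α β N +
      Polynomial.X * (1 - Polynomial.X) * (rodriguesPoly α β N).derivative

lemma eval_rodriguesPoly (α β : ℂ) (N : ℕ) :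
    (rodriguesPoly α β N).eval 1 = ∏ i ∈ Finset.range N, (α + β - i) := by
  induction N with
  | zero => simp [rodriguesPoly]
  | succ N ih =>
    rw [Finset.prod_range_succ, ← ih]
    simp [rodriguesPoly]
    ring

/-- The density of `horizonForm` to the right of the horizon, after `N` integrations by parts. -/
def horizonDensity (rp d : ℝ) (α β : ℂ) (N : ℕ) (r : ℝ) : ℂ :=
  ((r : ℂ) - rp) ^ (α - N) * (((r : ℂ) - (rp - d : ℝ)) ^ β *
    (rodriguesPoly α β N).eval (((r : ℂ) - rp) / ((r : ℂ) - (rp - d : ℝ))))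

lemma hasDerivAt_horizonDensity (hd : 0 < d) (α β : ℂ) (N : ℕ) {r : ℝ} (hr : rp < r) :
    HasDerivAt (horizonDensity rp d α β N) (horizonDensity rp d α β (N + 1) r) r := by
  have h2 : rp - d < r := by linarith
  have hx : (r : ℂ) - rp ≠ 0 := sub_ne_zero.2 (ofReal_inj.not.2 hr.ne')
  have hy : (r : ℂ) - (rp - d : ℝ) ≠ 0 := sub_ne_zero.2 (ofReal_inj.not.2 h2.ne')
  have hid : ∀ c : ℝ, HasDerivAt (fun r : ℝ => (r : ℂ) - c) 1 r := fun c =>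
    ((hasDerivAt_id r).ofReal_comp).sub_const _
  have hy' := (hid rp).fun_div (hid (rp - d)) hy
  have hq := HasDerivAt.comp (h₂ := fun z => (rodriguesPoly α β N).eval z) r
    ((rodriguesPoly α β N).hasDerivAt _) hy'
  have h3 := (hasDerivAt_cpow_sub hr (α - N)).fun_mul ((hasDerivAt_cpow_sub h2 β).fun_mul hq)
  refine HasDerivAt.congr_deriv (f := horizonDensity rp d α β N) h3 ?_
  have e1 : ((r : ℂ) - rp) ^ (α - N) = ((r : ℂ) - rp) ^ (α - N - 1) * ((r : ℂ) - rp) := by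
    rw [← cpow_add_one_eq hx, sub_add_cancel]
  have e2 : ((r : ℂ) - (rp - d : ℝ)) ^ β = ((r : ℂ) - (rp - d : ℝ)) ^ (β - 1) * ((r : ℂ) - (rp - d : ℝ)) := by
    rw [← cpow_add_one_eq hy, sub_add_cancel]
  have e3 : α - ((N + 1 : ℕ) : ℂ) = α - N - 1 := by push_cast; ring
  simp only [horizonDensity, rodriguesPoly, Function.comp_apply, Polynomial.eval_add,
    Polynomial.eval_mul, Polynomial.eval_sub, Polynomial.eval_C, Polynomial.eval_X, Polynomial.eval_one, e1, e3]
  have e4 : (r : ℂ) - (rp - d : ℝ) = r - rp + d := by push_cast; ring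
  rw [e2]
  generalize ((r : ℂ) - rp) ^ (α - N - 1) = E₁
  generalize ((r : ℂ) - (rp - d : ℝ)) ^ (β - 1) = E₂
  generalize (rodriguesPoly α β N).eval _ = q₀
  generalize (rodriguesPoly α β N).derivative.eval _ = q₁
  generalize (r : ℂ) - rp = X at *
  generalize (r : ℂ) - (rp - d : ℝ) = Y at *
  field_simp
  ring

lemma tendsto_horizonDensity (N : ℕ) :
    Tendsto (fun r : ℝ => horizonDensity rp d (l + κ) (l - κ) N r / ((r ^ (2 * l - N) : ℝ) : ℂ)) atTop
      (𝓝 (∏ i ∈ Finset.range N, (2 * l - i : ℂ))) := by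
  have h1 := (tendsto_cpow_shift rp (l + κ - N)).mul (tendsto_cpow_shift (rp - d) (l - κ))
  have h2 : Tendsto (fun r : ℝ => ((r : ℂ) - rp) / ((r : ℂ) - (rp - d : ℝ))) atTop (𝓝 (1 / 1)) := by
    have h3 := (tendsto_cpow_shift rp 1).div (tendsto_cpow_shift (rp - d) 1) one_ne_zero
    refine h3.congr' ?_
    filter_upwards [eventually_gt_atTop 0] with r hr
    have : (r : ℂ) ≠ 0 := ofReal_ne_zero.2 hr.ne'
    simp only [cpow_one, Pi.div_apply]
    rw [div_div_div_cancel_right₀ this]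
  have h3 := h1.mul (((rodriguesPoly (l + κ) (l - κ) N).continuous.tendsto _).comp h2)
  rw [div_one, eval_rodriguesPoly, mul_one, one_mul] at h3
  have e1 : ∏ i ∈ Finset.range N, ((l : ℂ) + κ + (l - κ) - i) = ∏ i ∈ Finset.range N, (2 * l - i : ℂ) :=
    Finset.prod_congr rfl fun i _ => by ring
  rw [e1] at h3
  refine h3.congr' ?_
  filter_upwards [eventually_gt_atTop 0] with r hr
  have hr0 : (r : ℂ) ≠ 0 := ofReal_ne_zero.2 hr.ne'
  have e2 : ((r ^ (2 * l - N) : ℝ) : ℂ) = (r : ℂ) ^ (l + κ - N) * (r : ℂ) ^ (l - κ) := by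
    rw [← cpow_add _ _ hr0, ofReal_cpow hr.le]
    congr 1
    push_cast; ring
  rw [e2, horizonDensity, Function.comp_apply, div_mul_div_comm]
  ring

lemma continuousOn_horizonDensity (hd : 0 < d) (α β : ℂ) (N : ℕ) :
    ContinuousOn (horizonDensity rp d α β N) (Ioi rp) := fun _ hr =>
  (hasDerivAt_horizonDensity hd α β N hr).continuousAt.continuousWithinAt

lemma horizonForm_eq_integral (hd : 0 < d) (N : ℕ) {φ : ℝ → ℂ} (hφ : φ ∈ radialTest (Ioi rp)) :
    horizonForm rp d κ l N φ = (-1) ^ N * ∫ r in Ioi rp, horizonDensity rp d (l + κ) (l - κ) N r * φ r := by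
  have h1 : ∀ k j : ℕ, ∫ r in Ioi rp, horizonDensity rp d (l + κ) (l - κ) j r * iteratedDeriv k φ r =
      (-1) ^ k * ∫ r in Ioi rp, horizonDensity rp d (l + κ) (l - κ) (j + k) r * φ r := by
    intro k
    induction k with
    | zero => intro j; simp
    | succ k ih =>
      intro j
      have hm := radialTest.iteratedDeriv hφ k
      obtain ⟨a, b, ha, -, hab, h0⟩ := radialTest.exists_Icc_Ioi hm
      have hsm : ContDiff ℝ ∞ (iteratedDeriv k φ) := hm.1
      have hib : ∀ {f g : ℝ → ℂ}, ContinuousOn f (Ioi rp) → g ∈ radialTest (Ioi rp) →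
          IntegrableOn (fun r => f r * g r) (Ioi rp) := fun {f g} hf hg => by
        obtain ⟨a, b, ha, -, hab, h0⟩ := radialTest.exists_Icc_Ioi hg
        have h1 : IntegrableOn (fun r => f r * g r) (Icc a b) :=
          ((hf.mono fun r hr => ha.trans_le hr.1).mul hg.1.continuous.continuousOn).integrableOn_compact
            isCompact_Icc
        exact h1.of_forall_sdiff_eq_zero measurableSet_Ioi fun r hr => by rw [h0 r hr.2, mul_zero]
      have hz : ∀ᶠ r in 𝓝[>] rp, horizonDensity rp d (l + κ) (l - κ) j r * iteratedDeriv k φ r = 0 := by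
        filter_upwards [Ioo_mem_nhdsGT ha] with r hr
        rw [h0 r fun h => not_lt.2 h.1 hr.2, mul_zero]
      have hz' : ∀ᶠ r in atTop, horizonDensity rp d (l + κ) (l - κ) j r * iteratedDeriv k φ r = 0 := by
        filter_upwards [eventually_gt_atTop b] with r hr
        rw [h0 r fun h => not_lt.2 h.2 hr, mul_zero]
      have hc := fun i => continuousOn_horizonDensity (rp := rp) hd (l + κ) (l - κ) i
      rw [iteratedDeriv_succ, integral_Ioi_mul_deriv_eq_deriv_mul (a' := 0) (b' := 0)
        (u' := horizonDensity rp d (l + κ) (l - κ) (j + 1))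
        (fun r hr => hasDerivAt_horizonDensity hd _ _ j hr) (fun r _ => hasDerivAt_of_contDiff hsm r)
        (hib (hc j) (radialTest.deriv hm)) (hib (hc (j + 1)) hm)
        (tendsto_const_nhds.congr' (hz.mono fun r hr => hr.symm))
        (tendsto_const_nhds.congr' (hz'.mono fun r hr => hr.symm)), ih (j + 1), pow_succ,
        show j + 1 + k = j + (k + 1) by ring]
      ring
  have h2 := h1 N 0
  rw [zero_add] at h2
  rw [← h2, horizonForm_eq_shift]
  refine setIntegral_congr_fun measurableSet_Ioi fun r _ => ?_
  simp only [horizonDensity, rodriguesPoly, Polynomial.eval_one, Nat.cast_zero, sub_zero, mul_one]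
  rw [mul_assoc, show (r : ℂ) - (rp - d : ℝ) = r - rp + d by push_cast; ring]

/-- `horizonForm` is bounded only in norms of sufficient weight. -/
theorem horizonForm_weight (hd : 0 < d) (hrp : 0 ≤ rp) {N B : ℕ} (hB : 2 * l = N + B)
    {k : ℝ} (he : 0 ≤ e) {C : ℝ≥0} {c : ℂ} (hc : c ≠ 0)
    (hV : ∀ φ ∈ radialTest (Ioi 0), ENNReal.ofReal (‖c * horizonForm rp d κ l N φ‖ ^ 2) ≤ C * 𝓜²(φ, e, k, p)) :
    2 * l - N + 1 < p := by
  have h0 : c * ∏ i ∈ Finset.range N, (2 * l - i : ℂ) ≠ 0 := by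
    refine mul_ne_zero hc (Finset.prod_ne_zero_iff.2 fun i hi => ?_)
    have h1 : (i : ℝ) < N := by exact_mod_cast Finset.mem_range.1 hi
    have h2 : 2 * l - i ≠ 0 := by
      rw [hB]
      have : (0 : ℝ) ≤ B := B.cast_nonneg
      linarith
    exact_mod_cast ofReal_ne_zero.2 h2
  refine growth_lt_weight (R := rp) he (h := fun r => c * horizonDensity rp d (l + κ) (l - κ) N r) h0
    (continuousOn_const.mul (continuousOn_horizonDensity hd _ _ N)) ?_ (k := k) (C := C) fun φ hφ => ?_
  · simp_rw [mul_div_assoc]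
    exact (tendsto_horizonDensity N).const_mul c
  · refine le_trans (le_of_eq ?_) (hV φ (radialTest.mono (Ioi_subset_Ioi hrp) hφ))
    rw [horizonForm_eq_integral hd N hφ, norm_mul, norm_mul, norm_pow, norm_neg, norm_one, one_pow, one_mul,
      ← norm_mul, ← integral_const_mul]
    simp_rw [mul_assoc]

open Polynomial in
/-- A polynomial density is bounded only in norms of sufficient weight. -/
theorem polynomial_weight {R k : ℝ} {P : ℂ[X]} (hP : P ≠ 0) (he : 0 ≤ e) {C : ℝ≥0}
    (hV : ∀ φ ∈ radialTest (Ioi R), ENNReal.ofReal (‖∫ r in Ioi R, P.eval ((r : ℂ) - rp) * φ r‖ ^ 2) ≤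
      C * 𝓜²(φ, e, k, p)) :
    P.natDegree + 1 < p := by
  refine growth_lt_weight he (leadingCoeff_ne_zero.2 hP) (contDiff_eval P rp).continuous.continuousOn ?_ hV
  have h1 : Tendsto (fun r : ℝ => ((r : ℂ) - rp)⁻¹) atTop (𝓝 0) := by
    have := (continuous_ofReal.tendsto 0).comp
      (tendsto_inv_atTop_zero.comp (tendsto_atTop_add_const_right atTop (-rp) tendsto_id))
    refine (ofReal_zero ▸ this).congr fun r => ?_
    simp [sub_eq_add_neg]
  have h2 := ((P.reverse.continuous.tendsto 0).comp h1).mul (tendsto_cpow_shift rp P.natDegree)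
  rw [mul_one, ← coeff_zero_eq_eval_zero, coeff_zero_reverse] at h2
  refine h2.congr' ?_
  filter_upwards [eventually_gt_atTop rp] with r hr
  have := invertibleOfNonzero (sub_ne_zero.2 (ofReal_inj.not.2 hr.ne'))
  have h3 := eval₂_reverse_mul_pow (RingHom.id ℂ) ((r : ℂ) - rp) P
  rw [eval₂_id, eval₂_id, invOf_eq_inv] at h3
  simp only [Function.comp_apply, cpow_natCast, Real.rpow_natCast, ofReal_pow, ← h3, mul_div_assoc]

/-! ### Terminating hypergeometric functions -/

lemma isOpen_hypergeometricDomain : IsOpen {z : ℂ | 1 - z ∈ slitPlane} :=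
  isOpen_slitPlane.preimage (by fun_prop)

lemma olverF_eq {a b c : ℂ} {g : ℂ → ℂ} (hg : IsOlverF a b c g) {z : ℂ} (hz : 1 - z ∈ slitPlane) :
    olverF a b c z = g z := by
  have hex : ∃ g, IsOlverF a b c g := ⟨g, hg⟩
  have hF : olverF a b c z = hex.choose z := by rw [olverF, dif_pos hex]
  rw [hF]
  have hopen := isOpen_hypergeometricDomain
  have hconn : IsPreconnected {z : ℂ | 1 - z ∈ slitPlane} := by
    have h1 : IsPreconnected slitPlane := 
      (starConvex_one_slitPlane.isPathConnected one_mem_slitPlane).isConnected.isPreconnected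
    have h2 := h1.image (fun w : ℂ => 1 - w) (by fun_prop)
    convert h2 using 1
    ext w
    constructor
    · exact fun hw => ⟨1 - w, hw, by simp⟩
    · rintro ⟨v, hv, rfl⟩
      simpa using hv
  refine (hex.choose_spec.1.analyticOnNhd hopen).eqOn_of_preconnected_of_eventuallyEq
    (hg.1.analyticOnNhd hopen) hconn (z₀ := 0) (by simp) ?_ hz
  filter_upwards [Metric.ball_mem_nhds (0 : ℂ) one_pos] with w hw
  rw [mem_ball_zero_iff] at hw
  rw [hex.choose_spec.2 w hw, hg.2 w hw]

open Polynomial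

/-- The polynomial `𝐅(-N, b, c, -x / d)` in `x`. -/
def hyperPoly (d : ℝ) (N : ℕ) (b c : ℂ) : ℂ[X] := ∑ k ∈ Finset.range (N + 1),
  monomial k ((ascPochhammer ℂ k).eval (-(N : ℂ)) * (ascPochhammer ℂ k).eval b / Gamma (c + k) *
    ((-(d : ℂ)⁻¹) ^ k / (k.factorial : ℂ)))

variable {d : ℝ} {N : ℕ} {κ l s b c : ℂ}

lemma coeff_hyperPoly (k : ℕ) : (hyperPoly d N b c).coeff k =
    (ascPochhammer ℂ k).eval (-(N : ℂ)) * (ascPochhammer ℂ k).eval b / Gamma (c + k) *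
    ((-(d : ℂ)⁻¹) ^ k / (k.factorial : ℂ)) := by
  simp only [hyperPoly, finsetSum_coeff, coeff_monomial, Finset.sum_ite_eq', Finset.mem_range]
  split_ifs with h
  · rfl
  · rw [ascPochhammer_eval_neg_coe_nat_of_lt (by omega)]
    simp

lemma olverF_neg_natCast (hd : 0 < d) {x : ℝ} (hx : -d < x) :
    olverF (-(N : ℂ)) b c ((-x / d : ℝ) : ℂ) = (hyperPoly d N b c).eval (x : ℂ) := by
  have hF : IsOlverF (-(N : ℂ)) b c fun z => ∑ k ∈ Finset.range (N + 1),
      (ascPochhammer ℂ k).eval (-(N : ℂ)) * (ascPochhammer ℂ k).eval b / Gamma (c + k) *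
        (z ^ k / (k.factorial : ℂ)) := by
    refine ⟨(Differentiable.fun_sum fun k _ => by fun_prop).differentiableOn, fun z _ => ?_⟩
    refine (tsum_eq_sum fun k hk => ?_).symm
    rw [Finset.mem_range] at hk
    rw [ascPochhammer_eval_neg_coe_nat_of_lt (by omega)]
    simp
  have hz : 1 - ((-x / d : ℝ) : ℂ) ∈ slitPlane := by
    rw [← ofReal_one, ← ofReal_sub, ofReal_mem_slitPlane]
    have : -x / d < 1 := by rw [div_lt_one hd]; linarith
    linarith
  rw [olverF_eq hF hz, hyperPoly, eval_finsetSum]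
  refine Finset.sum_congr rfl fun k _ => ?_
  rw [eval_monomial, show ((-x / d : ℝ) : ℂ) = -(d : ℂ)⁻¹ * x by push_cast; ring, mul_pow]
  ring

lemma polyT_hyperPoly (hd : d ≠ 0) (hN : (N : ℂ) = l + s) (hc : ∀ k : ℕ, 1 - s + κ + k ≠ 0) :
    polyT d κ l s (hyperPoly d N (1 + l - s) (1 - s + κ)) = 0 := by
  ext k
  have hd' : (d : ℂ) ≠ 0 := ofReal_ne_zero.2 hd
  have hf : ((k.factorial : ℕ) : ℂ) ≠ 0 := Nat.cast_ne_zero.2 k.factorial_ne_zero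
  have hk : (k : ℂ) + 1 ≠ 0 := by exact_mod_cast k.succ_ne_zero
  have h1 := Gamma_add_one _ (hc k)
  have h2 : Gamma (1 - s + κ + k) ≠ 0 := Gamma_ne_zero fun m hm => hc (k + m) (by
    push_cast; linear_combination hm)
  have h0 := hc k
  rw [coeff_polyT, coeff_hyperPoly, coeff_hyperPoly, coeff_zero, ascPochhammer_succ_eval,
    ascPochhammer_succ_eval, Nat.cast_succ, ← add_assoc, h1, Nat.factorial_succ, pow_succ, ← hN]
  push_cast
  have e1 : (k : ℂ) + 1 - s + κ = 1 - s + κ + k := by ring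
  have e2 : (k : ℂ) + l - s + 1 = 1 + l - s + k := by ring
  rw [e1, e2]
  field_simp
  ring

lemma hyperPoly_ne_zero (hc : Gamma c ≠ 0) : hyperPoly d N b c ≠ 0 := fun h => by
  have h1 := coeff_hyperPoly (d := d) (N := N) (b := b) (c := c) 0
  rw [h] at h1
  simp at h1
  exact hc h1.symm

lemma derivative_polyT (P : ℂ[X]) :
    derivative (polyT d κ l s P) = polyT d κ l (s - 1) (derivative P) := by
  ext k
  simp only [coeff_derivative, coeff_polyT]
  push_cast; ring

lemma polyT_mul_pow (k : ℕ) (G : ℂ[X]) : polyT d 0 l k ((X * (X + C (d : ℂ))) ^ k * G) =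
    (X * (X + C (d : ℂ))) ^ k * polyT d 0 l (-k) G := by
  set W : ℂ[X] := (X * (X + C (d : ℂ))) ^ k
  have h1 : X * (X + C (d : ℂ)) * derivative W = C (k : ℂ) * (2 * X + C (d : ℂ)) * W := by
    simp only [W]
    rcases k with _ | k
    · simp
    · rw [derivative_pow]
      simp only [derivative_mul, derivative_add, derivative_X, derivative_C, Nat.add_sub_cancel, C_eq_natCast]
      ring
  have h2 := congrArg derivative h1
  refine Polynomial.funext fun x => ?_
  have e1 := congrArg (eval x) h1
  have e2 := congrArg (eval x) h2
  simp only [derivative_mul, derivative_add, derivative_X, derivative_C, derivative_ofNat, eval_add, eval_mul,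
    eval_X, eval_C, eval_one, eval_zero, eval_ofNat] at e1 e2
  simp only [eval_polyT, derivative_mul, derivative_add, eval_add, eval_mul]
  linear_combination (-G.eval x) * e2 + (-2 * (derivative G).eval x) * e1

open Polynomial

/-! ### The radial factors in terms of polynomials -/

section
variable {M a l m : ℝ} {n : ℤ} {A B : ℕ}

lemma spin_sub_iKappa_ne (hd : gap M a ≠ 0) (h : ¬Even n ∨ a * m ≠ 0) (i : ℤ) :
    (spin n : ℂ) - iKappa M a m ≠ i := fun hi => by
  have hre := congrArg re hi
  have him := congrArg im hi
  simp only [iKappa, sub_re, sub_im, ofReal_re, ofReal_im, intCast_re, intCast_im, mul_re, mul_im, I_re, I_im] at hre him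
  have h1 : 2 * a * m / gap M a = 0 := by linarith
  rw [div_eq_zero_iff, or_iff_left hd] at h1
  refine h.elim (fun hn => hn ⟨i, ?_⟩) fun h => h (by linarith)
  have : (n : ℝ) = i + i := by rw [spin] at hre; linarith
  exact_mod_cast this

lemma iKappa_neg (M a m : ℝ) : iKappa M a (-m) = -iKappa M a m := by
  simp only [iKappa]; push_cast; ring

lemma iKappa_eq_zero (h : a * m = 0) : iKappa M a m = 0 := by
  simp [iKappa, mul_assoc, h]

lemma spin_eq_natCast (hn : Even n) (h0 : 0 ≤ n) : spin n = ((n / 2).toNat : ℕ) := by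
  obtain ⟨i, rfl⟩ := hn
  have h1 : (i + i) / 2 = i := by omega
  have h2 : ((i.toNat : ℤ) : ℝ) = i := by rw [Int.toNat_of_nonneg (by omega)]
  rw [h1, spin, ← Int.cast_natCast, h2]
  push_cast; ring

lemma spin_eq_neg_natCast (hn : Even n) (h0 : n < 0) : spin n = -((-(n / 2)).toNat : ℕ) := by
  obtain ⟨i, rfl⟩ := hn
  have h1 : -((i + i) / 2) = -i := by omega
  have h2 : (((-i).toNat : ℤ) : ℝ) = -i := by rw [Int.toNat_of_nonneg (by omega)]; push_cast; rfl
  rw [h1, spin, ← Int.cast_natCast, h2]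
  push_cast; ring

lemma olverF_zVar (hd : 0 < gap M a) {r : ℝ} (hr : rMinus M a < r) (N : ℕ) (b c : ℂ) :
    olverF (-(N : ℂ)) b c (zVar M a r) = (hyperPoly (gap M a) N b c).eval ((r : ℂ) - rPlus M a) := by
  have h1 : -gap M a < r - rPlus M a := by rw [gap]; linarith
  have := olverF_neg_natCast (N := N) (b := b) (c := c) hd h1
  rw [neg_sub] at this
  rw [zVar, this, ofReal_sub]

lemma natCast_add_ne_zero (k j : ℕ) : (1 + k : ℂ) + j ≠ 0 := by
  exact_mod_cast (by omega : 1 + k + j ≠ 0)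

/-- `Δ^k` times a hypergeometric polynomial. -/
def weightedHyperPoly (d : ℝ) (k N : ℕ) (b c : ℂ) : ℂ[X] :=
  C (((d : ℂ)⁻¹) ^ (2 * k)) * ((X * (X + C (d : ℂ))) ^ k * hyperPoly d N b c)

lemma weightedHyperPoly_ne_zero {d : ℝ} (hd : d ≠ 0) (k N : ℕ) (b : ℂ) {c : ℂ} (hc : Gamma c ≠ 0) :
    weightedHyperPoly d k N b c ≠ 0 :=
  mul_ne_zero (C_ne_zero.2 (pow_ne_zero _ (inv_ne_zero (ofReal_ne_zero.2 hd))))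
    (mul_ne_zero (pow_ne_zero _ (mul_ne_zero X_ne_zero (X_add_C_ne_zero _))) (hyperPoly_ne_zero hc))

lemma polyT_weightedHyperPoly {d : ℝ} (hd : d ≠ 0) {k N : ℕ} {l : ℂ} (hN : (N : ℂ) = l - k) :
    polyT d 0 l k (weightedHyperPoly d k N (1 + l + k) (1 + k)) = 0 := by
  have h := polyT_hyperPoly (κ := 0) (s := -k) hd (by rw [hN]; ring : (N : ℂ) = l + -k)
    fun j => by simpa using natCast_add_ne_zero k j
  rw [add_zero, sub_neg_eq_add, sub_neg_eq_add] at h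
  rw [weightedHyperPoly, ← smul_eq_C_mul, polyT_smul, polyT_mul_pow, h, mul_zero, smul_zero]

lemma eval_weightedHyperPoly (hd : 0 < gap M a) {r : ℝ} (hr : rMinus M a < r) (k N : ℕ) (b c : ℂ) :
    (((r - rPlus M a) / gap M a : ℝ) : ℂ) ^ k * (((r - rMinus M a) / gap M a : ℝ) : ℂ) ^ k *
      olverF (-(N : ℂ)) b c (zVar M a r) =
      (weightedHyperPoly (gap M a) k N b c).eval ((r : ℂ) - rPlus M a) := by
  rw [olverF_zVar hd hr]
  have e1 : (r : ℂ) - rPlus M a + gap M a = r - rMinus M a := by rw [gap]; push_cast; ring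
  simp only [weightedHyperPoly, eval_mul, eval_pow, eval_X, eval_add, eval_C, e1]
  push_cast
  rw [div_pow, div_pow, pow_mul, mul_pow, inv_pow, inv_pow]
  ring

/-- The radial factor of `u_{l,m}` is a polynomial solution of the radial equation. -/
theorem exists_uRadial_eq (hd : 0 < gap M a) (hA : (A : ℝ) = l + spin n) (hB : (B : ℝ) = l - spin n) :
    ∃ U : ℂ[X], U ≠ 0 ∧ polyT (gap M a) (iKappa M a m) l (spin n) U = 0 ∧
      ∀ r, rMinus M a < r → uRadial M a n l m r = U.eval ((r : ℂ) - rPlus M a) := by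
  have hA' : (A : ℂ) = l + spin n := by exact_mod_cast congrArg ofReal hA
  have hB' : (B : ℂ) = l - spin n := by exact_mod_cast congrArg ofReal hB
  have hneg : -(l : ℂ) - spin n = -(A : ℂ) := by rw [hA']; ring
  have hU : (∀ k : ℕ, 1 - (spin n : ℂ) + iKappa M a m + k ≠ 0) → ∃ U : ℂ[X], U ≠ 0 ∧
      polyT (gap M a) (iKappa M a m) l (spin n) U = 0 ∧ ∀ r, rMinus M a < r →
        olverF (-(A : ℂ)) (1 + l - spin n) (1 - spin n + iKappa M a m) (zVar M a r) =
          U.eval ((r : ℂ) - rPlus M a) := fun hc =>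
    ⟨_, hyperPoly_ne_zero (Gamma_ne_zero fun k hk => hc k (by rw [hk]; ring)), polyT_hyperPoly hd.ne' hA' hc,
      fun r hr => olverF_zVar hd hr A _ _⟩
  by_cases h1 : ¬Even n ∨ a * m ≠ 0
  · obtain ⟨U, hU0, hUT, hUr⟩ := hU fun k hk => spin_sub_iKappa_ne hd.ne' h1 (k + 1)
      (by push_cast; linear_combination -hk)
    refine ⟨U, hU0, hUT, fun r hr => ?_⟩
    simp only [uRadial, if_pos h1, hneg, hUr r hr]
  · have h2 := h1
    simp only [not_or, not_not] at h2
    by_cases h3 : n < 0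
    · have hs := spin_eq_neg_natCast h2.1 h3
      obtain ⟨U, hU0, hUT, hUr⟩ := hU fun k hk => by
        rw [iKappa_eq_zero h2.2, hs] at hk
        push_cast at hk
        rw [sub_neg_eq_add, add_zero] at hk
        exact natCast_add_ne_zero _ _ hk
      refine ⟨U, hU0, hUT, fun r hr => ?_⟩
      rw [← hUr r hr, iKappa_eq_zero h2.2, add_zero]
      simp only [uRadial, if_neg h1, if_pos h3, hneg]
    · have hs := spin_eq_natCast h2.1 (not_lt.1 h3)
      set k := (n / 2).toNat
      have hs' : (spin n : ℂ) = k := by rw [hs]; simp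
      have hG : Gamma (1 + (k : ℂ)) ≠ 0 := Gamma_ne_zero fun j hj => natCast_add_ne_zero k j (by rw [hj]; ring)
      refine ⟨weightedHyperPoly (gap M a) k B (1 + l + k) (1 + k), weightedHyperPoly_ne_zero hd.ne' _ _ _ hG,
        ?_, fun r hr => ?_⟩
      · rw [iKappa_eq_zero h2.2, hs']
        exact polyT_weightedHyperPoly hd.ne' (by rw [hB', hs'])
      · rw [← eval_weightedHyperPoly hd hr]
        have e1 : -(l : ℂ) + k = -(B : ℂ) := by rw [hB', hs']; ring
        simp only [uRadial, if_neg h1, if_neg h3, hs', e1]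
        rfl

end

/-! ### Integration by parts with polynomials -/

section
variable {rp d : ℝ} {J : Set ℝ} {φ : ℝ → ℂ}

lemma integrableOn_polynomial_mul (Q : ℂ[X]) (hφ : φ ∈ radialTest J) :
    IntegrableOn (fun x : ℝ => Q.eval (x : ℂ) * φ (rp + x)) (Ioi 0) := by
  obtain ⟨b, hb⟩ := radialTest.exists_eq_zero_of_le hφ
  have := integrableOn_cpow_mul_of_eq_zero (α := 0) (by simp) (h := fun x : ℝ => Q.eval (x : ℂ) * φ (rp + x))
    ((Q.continuous.comp continuous_ofReal).mul (hφ.1.continuous.comp (by fun_prop))).continuousOn (b := b - rp)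
    fun x hx => by rw [hb _ (by linarith), mul_zero]
  simpa using this

lemma integral_polynomial_mul_deriv (Q : ℂ[X]) (hφ : φ ∈ radialTest J) :
    ∫ x in Ioi (0 : ℝ), Q.eval (x : ℂ) * deriv φ (rp + x) =
      -(Q.eval 0 * φ rp) - ∫ x in Ioi (0 : ℝ), (derivative Q).eval (x : ℂ) * φ (rp + x) := by
  obtain ⟨b, hb⟩ := radialTest.exists_eq_zero_of_le hφ
  have hQ : ∀ x : ℝ, HasDerivAt (fun x : ℝ => Q.eval (x : ℂ)) ((derivative Q).eval (x : ℂ)) x := fun x => by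
    simpa using hasDerivAt_eval Q 0 x
  have hφ' : ∀ x : ℝ, HasDerivAt (fun x : ℝ => φ (rp + x)) (deriv φ (rp + x)) x := fun x =>
    (hasDerivAt_of_contDiff hφ.1 (rp + x)).comp_const_add rp x
  rw [integral_Ioi_mul_deriv_eq_deriv_mul (a' := Q.eval 0 * φ rp) (b' := 0) (fun x _ => hQ x)
    (fun x _ => hφ' x) (integrableOn_polynomial_mul Q (radialTest.deriv hφ))
    (integrableOn_polynomial_mul (derivative Q) hφ)]
  · ring
  · have h := ((hQ 0).continuousAt.mul (hφ' 0).continuousAt).tendsto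
    simp only [Pi.mul_apply, ofReal_zero, add_zero] at h
    exact h.mono_left nhdsWithin_le_nhds
  · refine tendsto_const_nhds.congr' ?_
    filter_upwards [eventually_ge_atTop (b - rp)] with x hx
    rw [Pi.mul_apply, hb _ (by linarith), mul_zero]

lemma integral_polynomial_mul_iteratedDeriv (hφ : φ ∈ radialTest J) (N : ℕ) : ∀ Q : ℂ[X],
    ∫ x in Ioi (0 : ℝ), Q.eval (x : ℂ) * iteratedDeriv N φ (rp + x) =
      (-1) ^ N * ((∫ x in Ioi (0 : ℝ), (derivative^[N] Q).eval (x : ℂ) * φ (rp + x)) +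
        ∑ j ∈ Finset.range N, (-1) ^ j * ((derivative^[N - 1 - j] Q).eval 0 * iteratedDeriv j φ rp)) := by
  induction N with
  | zero => intro Q; simp
  | succ N ih =>
    intro Q
    rw [iteratedDeriv_succ, integral_polynomial_mul_deriv Q (radialTest.iteratedDeriv hφ N), ih,
      Finset.sum_range_succ, Function.iterate_succ_apply]
    have h1 : ∀ j ∈ Finset.range N, (-1 : ℂ) ^ j * ((derivative^[N + 1 - 1 - j] Q).eval 0 * iteratedDeriv j φ rp) =
        (-1) ^ j * ((derivative^[N - 1 - j] (derivative Q)).eval 0 * iteratedDeriv j φ rp) := fun j hj => by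
      rw [← Function.iterate_succ_apply, show (N - 1 - j).succ = N + 1 - 1 - j by
        have := Finset.mem_range.1 hj; omega]
    rw [Finset.sum_congr rfl h1, show N + 1 - 1 - N = 0 by omega, Function.iterate_zero_apply, pow_succ]
    have h2 : (-1 : ℂ) ^ N * (-1) ^ N = 1 := by rw [← mul_pow]; norm_num
    linear_combination (Q.eval 0 * iteratedDeriv N φ rp) * h2

/-- `(x (x + d))^l` -/
def deltaPow (d : ℝ) (L : ℕ) : ℂ[X] := (X * (X + C (d : ℂ))) ^ L

lemma coeff_deltaPow_add (d : ℝ) (L i : ℕ) : (deltaPow d L).coeff (L + i) = (d : ℂ) ^ (L - i) * L.choose i := by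
  rw [deltaPow, mul_pow, add_comm L i, coeff_X_pow_mul, coeff_X_add_C_pow]

lemma coeff_deltaPow_of_lt (d : ℝ) {L i : ℕ} (h : i < L) : (deltaPow d L).coeff i = 0 := by
  rw [deltaPow, mul_pow, coeff_X_pow_mul', if_neg (by omega)]

lemma eval_zero_iterate_derivative (Q : ℂ[X]) (i : ℕ) :
    (derivative^[i] Q).eval 0 = i.factorial * Q.coeff i := by
  rw [← coeff_zero_eq_eval_zero, coeff_iterate_derivative, zero_add, Nat.descFactorial_self, nsmul_eq_mul]

lemma polyT_iterate_derivative {κ l s : ℂ} (P : ℂ[X]) (k : ℕ) :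
    polyT d κ l (s - k) (derivative^[k] P) = derivative^[k] (polyT d κ l s P) := by
  induction k with
  | zero => simp
  | succ k ih =>
    rw [Function.iterate_succ_apply', Function.iterate_succ_apply', ← ih, derivative_polyT]
    push_cast
    ring_nf

lemma polyT_deltaPow (d : ℝ) (L k : ℕ) : polyT d 0 L (L - k) (derivative^[k] (deltaPow d L)) = 0 := by
  have h : polyT d 0 L L (deltaPow d L) = 0 := by
    have := polyT_mul_pow (d := d) (l := L) L 1
    rw [mul_one] at this
    rw [deltaPow, this]
    simp [polyT]
  rw [polyT_iterate_derivative, h, iterate_derivative_zero]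

lemma iterate_derivative_deltaPow_ne_zero (d : ℝ) {L k : ℕ} (hk : k ≤ 2 * L) :
    derivative^[k] (deltaPow d L) ≠ 0 := fun h => by
  have h1 := coeff_iterate_derivative (p := deltaPow d L) (k := k) (2 * L - k)
  rw [h, Nat.sub_add_cancel hk, coeff_zero, two_mul, coeff_deltaPow_add] at h1
  have h2 : (L + L).descFactorial k ≠ 0 := by rw [Ne, Nat.descFactorial_eq_zero_iff_lt]; omega
  simp at h1
  exact h2 (by exact_mod_cast h1.symm)

lemma horizonForm_zero_eq (d : ℝ) (L N : ℕ) (hφ : φ ∈ radialTest J) :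
    (-1) ^ N * horizonForm rp d 0 L N φ =
      (∫ r in Ioi rp, (derivative^[N] (deltaPow d L)).eval ((r : ℂ) - rp) * φ r) +
        ∑ j ∈ Finset.range N, (-1) ^ j * ((N - 1 - j).factorial * (deltaPow d L).coeff (N - 1 - j) *
          iteratedDeriv j φ rp) := by
  have h1 := integral_polynomial_mul_iteratedDeriv (rp := rp) hφ N (deltaPow d L)
  have h2 : horizonForm rp d 0 L N φ =
      ∫ x in Ioi (0 : ℝ), (deltaPow d L).eval (x : ℂ) * iteratedDeriv N φ (rp + x) := by
    rw [horizonForm]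
    congr 1; ext x
    simp only [deltaPow, eval_pow, eval_mul, eval_X, eval_add, eval_C, ofReal_natCast, add_zero, sub_zero,
      cpow_natCast, mul_pow, mul_assoc]
  rw [h2, h1, ← mul_assoc, ← mul_pow, neg_one_mul, neg_neg, one_pow, one_mul, integral_Ioi_shift rp]
  simp only [eval_zero_iterate_derivative, add_sub_cancel, ofReal_sub]

end

/-! ### The dual radial factors for vanishing `κ` -/

variable {M a l m : ℝ} {n : ℤ} {A B L : ℕ}

theorem exists_uStarRadial_eq_of_neg (hd : 0 < gap M a) (hn : Even n) (h0 : n < 0) (ham : a * m = 0)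
    (hA : (A : ℝ) = L + spin n) (hB : (B : ℝ) = L - spin n) :
    ∃ C : ℂ, C ≠ 0 ∧ ∀ φ ∈ radialTest (Ioi 0),
      uStarRadial M a n L m φ = C * horizonForm (rPlus M a) (gap M a) 0 L A φ := by
  have hs := spin_eq_neg_natCast hn h0
  set k := (-(n / 2)).toNat with hk
  have hs' : (spin n : ℂ) = -k := by rw [hs]; simp
  rw [hs] at hA hB
  have hA' : (A : ℂ) = L - k := by exact_mod_cast congrArg ofReal (hA.trans (by ring : (L : ℝ) + -k = L - k))
  have hAL : A + k = L := by
    have : (A : ℝ) + k = L := by linarith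
    exact_mod_cast this
  have hBL : B = L + k := by
    have : (B : ℝ) = L + k := by linarith
    exact_mod_cast this
  have hG : Gamma (1 + (k : ℂ)) ≠ 0 := Gamma_ne_zero fun j hj => natCast_add_ne_zero k j (by rw [hj]; ring)
  set P := weightedHyperPoly (gap M a) k A (1 + L + k) (1 + k)
  have hP := polyT_weightedHyperPoly (N := A) (k := k) hd.ne' hA'
  have hQ := polyT_deltaPow (gap M a) L A
  rw [show (L : ℂ) - A = k by rw [hA']; ring] at hQ
  have hPQ := eq_smul_of_polyT_eq_zero (N := B) (B := A) (by rw [hBL]; push_cast; ring) hA' hP hQ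
    (iterate_derivative_deltaPow_ne_zero _ (by omega))
  set c := P.coeff B / (Polynomial.derivative^[A] (deltaPow (gap M a) L)).coeff B
  have hc : c ≠ 0 := fun hc => weightedHyperPoly_ne_zero hd.ne' k A (1 + L + k) hG (by
    rw [hPQ, hc, zero_smul])
  refine ⟨c * (-1) ^ A, mul_ne_zero hc (pow_ne_zero _ (by norm_num)), fun φ hφ => ?_⟩
  rw [mul_assoc, horizonForm_zero_eq _ _ _ hφ, Finset.sum_eq_zero fun j hj => ?_, add_zero, ← integral_const_mul]
  · simp only [uStarRadial, hn, ham, h0, not_true, ne_eq, or_self, if_false, if_true, hs']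
    refine setIntegral_congr_fun measurableSet_Ioi fun r hr => ?_
    have hr' : rMinus M a < r := by have : rPlus M a < r := hr; rw [gap] at hd; linarith
    have e1 : -((L : ℝ) : ℂ) - -(k : ℂ) = -(A : ℂ) := by rw [hA']; push_cast; ring
    rw [e1, sub_neg_eq_add, sub_neg_eq_add, ofReal_natCast, eval_weightedHyperPoly hd hr', hPQ,
      Polynomial.eval_smul, smul_eq_mul, mul_assoc]
  · rw [coeff_deltaPow_of_lt _ (by have := Finset.mem_range.1 hj; omega)]
    ring

theorem exists_uStarRadial_eq_of_nonneg (hd : 0 < gap M a) (hn : Even n) (h0 : 0 ≤ n) (ham : a * m = 0)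
    (hA : (A : ℝ) = L + spin n) (hB : (B : ℝ) = L - spin n) :
    ∃ C : ℂ, C ≠ 0 ∧ ∀ φ ∈ radialTest (Ioi 0),
      uStarRadial M a n L m φ = C * horizonForm (rPlus M a) (gap M a) 0 L A φ := by
  have hs := spin_eq_natCast hn h0
  set k := (n / 2).toNat with hk
  have hs' : (spin n : ℂ) = k := by rw [hs]; simp
  rw [hs] at hA hB
  have hAL : A = L + k := by exact_mod_cast hA
  have hBL : B + k = L := by
    have : (B : ℝ) + k = L := by linarith
    exact_mod_cast this
  have hA' : (A : ℂ) = L + k := by exact_mod_cast congrArg Nat.cast hAL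
  have hB' : (B : ℂ) = L - k := by rw [← hBL]; push_cast; ring
  set d := gap M a
  have hdC : (d : ℂ) ≠ 0 := ofReal_ne_zero.2 hd.ne'
  have hf : ∀ i : ℕ, ((i.factorial : ℕ) : ℂ) ≠ 0 := fun i => Nat.cast_ne_zero.2 i.factorial_ne_zero
  have hG : Gamma (1 + (k : ℂ)) = k.factorial := by rw [add_comm, Gamma_nat_eq_factorial]
  set G := hyperPoly d B (1 + L + k) (1 + k) with hGdef
  have hG0 : G ≠ 0 := hyperPoly_ne_zero (by rw [hG]; exact hf k)
  have hGT : polyT d 0 L (-k) G = 0 := by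
    have h := polyT_hyperPoly (N := B) (κ := 0) (l := L) (s := -k) hd.ne' (by rw [hB']; ring)
      fun j => by simpa using natCast_add_ne_zero k j
    rw [add_zero, sub_neg_eq_add, sub_neg_eq_add] at h
    exact h
  have hQ := polyT_deltaPow d L A
  rw [show (L : ℂ) - A = -k by rw [hA']; ring] at hQ
  have hQG := eq_smul_of_polyT_eq_zero (N := B) (B := A) (by rw [hB']; ring) (by rw [hA']; ring) hQ hGT hG0
  set c := (Polynomial.derivative^[A] (deltaPow d L)).coeff B / G.coeff B
  have hc : c = A.factorial * (d ^ B * (L.factorial / B.factorial)) := by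
    have h1 := congrArg (Polynomial.eval 0) hQG
    rw [eval_zero_iterate_derivative, Polynomial.eval_smul, ← Polynomial.coeff_zero_eq_eval_zero,
      hGdef, coeff_hyperPoly, hAL, coeff_deltaPow_add, Nat.cast_choose ℂ (by omega : k ≤ L),
      show L - k = B by omega] at h1
    simp only [ascPochhammer_zero, Polynomial.eval_one, mul_one, Nat.cast_zero, add_zero, hG, pow_zero,
      Nat.factorial_zero, Nat.cast_one, div_one, smul_eq_mul] at h1
    have h2 := hf k
    have h3 := hf B
    rw [hAL]
    field_simp at h1 ⊢
    rw [← h1]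
  have hD : (L.factorial : ℂ) * (d : ℂ) ^ L ≠ 0 := mul_ne_zero (hf L) (pow_ne_zero _ hdC)
  refine ⟨(-1) ^ A / (L.factorial * (d : ℂ) ^ L), div_ne_zero (pow_ne_zero _ (by norm_num)) hD, fun φ hφ => ?_⟩
  rw [div_mul_eq_mul_div, horizonForm_zero_eq _ _ _ hφ, add_div, Finset.sum_div]
  simp only [uStarRadial, hn, ham, not_lt.2 h0, not_true, ne_eq, or_self, if_false, hs', ← hk]
  have hfl : ⌊(L : ℝ) + spin n⌋₊ = A := by rw [hs, ← hA, Nat.floor_natCast]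
  have hfl' : ⌊(L : ℝ) - spin n⌋₊ = B := by rw [hs, ← hB, Nat.floor_natCast]
  congr 1
  · have h1 : (∫ r in Ioi (rPlus M a), (Polynomial.derivative^[A] (deltaPow d L)).eval ((r : ℂ) - rPlus M a) * φ r) =
        c * ∫ r in Ioi (rPlus M a), olverF (-((L : ℝ) : ℂ) + k) (1 + ((L : ℝ) : ℂ) + k) (1 + k) (zVar M a r) * φ r := by
      rw [← integral_const_mul]
      refine setIntegral_congr_fun measurableSet_Ioi fun r hr => ?_
      have hr' : rMinus M a < r := by have : rPlus M a < r := hr; simp only [d, gap] at hd; linarith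
      have e1 : -((L : ℝ) : ℂ) + k = -(B : ℂ) := by rw [hB']; push_cast; ring
      rw [e1, ofReal_natCast, olverF_zVar hd hr', hQG, Polynomial.eval_smul, smul_eq_mul, mul_assoc]
    rw [h1, mul_div_right_comm, hc, hfl, hfl', hs, Real.rpow_neg hd.le, Real.rpow_natCast]
    congr 1
    push_cast
    rw [← hBL, pow_add]
    have := hf (B + k)
    have := hf B
    field_simp
  · rw [← Finset.sum_subset (Finset.range_subset_range.2 (by omega : k ≤ A)) fun j hj hjk => ?_]
    · refine Finset.sum_congr rfl fun j hj => ?_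
      have hjk := Finset.mem_range.1 hj
      obtain ⟨i, hi⟩ : ∃ i, k = i + 1 + j := ⟨k - 1 - j, by omega⟩
      have e1 : (L : ℝ) + spin n - 1 - j = (L + i : ℕ) := by rw [hs, hi]; push_cast; ring
      have e2 : (L : ℝ) - spin n + 1 + j = (B + 1 + j : ℕ) := by rw [hs, ← hBL, hi]; push_cast; ring
      have e3 : -spin n + 1 + j = -(i : ℝ) := by rw [hs, hi]; push_cast; ring
      have e4 : k - 1 - j = i := by omega
      have e5 : A - 1 - j = L + i := by omega
      rw [e1, e2, e3, e4, e5, Nat.floor_natCast, Nat.floor_natCast, coeff_deltaPow_add,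
        Nat.cast_choose ℂ (by omega : i ≤ L), show L - i = B + 1 + j by omega, Real.rpow_neg hd.le,
        Real.rpow_natCast]
      push_cast
      have e6 : (d : ℂ) ^ L = d ^ (B + 1 + j) * d ^ i := by rw [← pow_add]; congr 1; omega
      rw [e6]
      have := hf L
      have := hf i
      have := hf (B + 1 + j)
      field_simp
    · rw [coeff_deltaPow_of_lt _ (by
        have := Finset.mem_range.1 hj
        have := Finset.mem_range.not.1 hjk
        omega)]
      ring

/-! ### Homogeneous distributions -/

/-- Smooth functions that vanish for large arguments. -/
structure IsRightTest (ψ : ℝ → ℂ) : Prop where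
  smooth : ContDiff ℝ ∞ ψ
  zero : ∃ b, ∀ x, b ≤ x → ψ x = 0

variable {ψ χ φ h : ℝ → ℂ} {α β : ℂ} {k k' : ℕ}

lemma IsRightTest.deriv (hψ : IsRightTest ψ) : IsRightTest (deriv ψ) := by
  obtain ⟨b, hb⟩ := hψ.zero
  exact ⟨contDiff_deriv hψ.smooth, b + 1, fun x hx =>
    deriv_eq_zero_of_isOpen isOpen_Ioi (fun y hy => hb y (le_of_lt hy)) ((lt_add_one b).trans_le hx)⟩

lemma IsRightTest.iteratedDeriv (hψ : IsRightTest ψ) (k : ℕ) : IsRightTest (iteratedDeriv k ψ) := by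
  induction k with
  | zero => simpa
  | succ k ih => rw [iteratedDeriv_succ]; exact ih.deriv

lemma IsRightTest.smooth_mul (hψ : IsRightTest ψ) (hh : ContDiff ℝ ∞ h) :
    IsRightTest fun x => h x * ψ x :=
  ⟨hh.mul hψ.smooth, hψ.zero.imp fun b hb x hx => by rw [hb x hx, mul_zero]⟩

lemma IsRightTest.add (hψ : IsRightTest ψ) (hχ : IsRightTest χ) : IsRightTest fun x => ψ x + χ x := by
  obtain ⟨b, hb⟩ := hψ.zero
  obtain ⟨c, hc⟩ := hχ.zero
  exact ⟨hψ.smooth.add hχ.smooth, max b c, fun x hx => by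
    rw [hb x ((le_max_left _ _).trans hx), hc x ((le_max_right _ _).trans hx), add_zero]⟩

lemma IsRightTest.integrable (hψ : IsRightTest ψ) (hα : -1 < α.re) :
    IntegrableOn (fun x : ℝ => (x : ℂ) ^ α * ψ x) (Ioi 0) := by
  obtain ⟨b, hb⟩ := hψ.zero
  exact integrableOn_cpow_mul_of_eq_zero hα hψ.smooth.continuous.continuousOn hb

lemma IsRightTest.integral_cpow_mul_deriv (hψ : IsRightTest ψ) (hβ : -1 < β.re) :
    ∫ x in Ioi (0 : ℝ), (x : ℂ) ^ (β + 1) * _root_.deriv ψ x =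
      -(β + 1) * ∫ x in Ioi (0 : ℝ), (x : ℂ) ^ β * ψ x := by
  obtain ⟨b, hb⟩ := hψ.zero
  have hβ' : 0 < (β + 1).re := by simp; linarith
  have i1 := hψ.integrable hβ
  have i2 := hψ.deriv.integrable (α := β + 1) (by linarith)
  have h0 := integral_Ioi_deriv_eq_zero (F := fun x : ℝ => (x : ℂ) ^ (β + 1) * ψ x)
    (F' := fun x : ℝ => (β + 1) * ((x : ℂ) ^ β * ψ x) + (x : ℂ) ^ (β + 1) * _root_.deriv ψ x) (b := b)
    (fun x hx => by
      have := (hasDerivAt_cpow_sub (c := 0) hx (β + 1)).fun_mul (hasDerivAt_of_contDiff hψ.smooth x)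
      simp only [ofReal_zero, sub_zero, add_sub_cancel_right] at this
      exact this.congr_deriv (by ring))
    ((i1.const_mul _).add i2) (tendsto_cpow_mul_nhdsGT hβ' hψ.smooth.continuous.continuousWithinAt)
    fun x hx => by rw [hb x hx, mul_zero]
  rw [integral_add (i1.const_mul _) i2, integral_const_mul] at h0
  linear_combination h0

/-- The distribution `x_+^α`, regularised by `k` integrations by parts. -/
def xPlusPowReg (k : ℕ) (α : ℂ) (ψ : ℝ → ℂ) : ℂ :=
  (-1) ^ k / (∏ i ∈ Finset.range k, (α + 1 + i)) * ∫ x : ℝ in Ioi 0, (x : ℂ) ^ (α + k) * iteratedDeriv k ψ x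

lemma xPlusPowReg_succ (hψ : IsRightTest ψ) (hα : -1 < (α + k).re) :
    xPlusPowReg (k + 1) α ψ = xPlusPowReg k α ψ := by
  have h1 : α + 1 + k ≠ 0 := fun h => by
    have := congrArg re h
    simp at this hα
    linarith
  have h2 := (hψ.iteratedDeriv k).integral_cpow_mul_deriv hα
  rw [xPlusPowReg, xPlusPowReg, iteratedDeriv_succ, Finset.prod_range_succ,
    show α + ((k + 1 : ℕ) : ℂ) = α + k + 1 by push_cast; ring, h2,
    show α + k + 1 = α + 1 + k by ring, pow_succ]
  generalize (∏ i ∈ Finset.range k, (α + 1 + i : ℂ)) = P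
  generalize ∫ x in Ioi (0 : ℝ), (x : ℂ) ^ (α + k) * iteratedDeriv k ψ x = S
  generalize α + 1 + k = c at h1
  rw [div_mul_eq_mul_div, div_mul_eq_mul_div, ← mul_div_mul_right ((-1) ^ k * S) P h1]
  ring

lemma xPlusPowReg_eq (hψ : IsRightTest ψ) (hk : -1 < (α + k).re) (hk' : -1 < (α + k').re) :
    xPlusPowReg k α ψ = xPlusPowReg k' α ψ := by
  have h1 : ∀ (k j : ℕ), -1 < (α + k).re → xPlusPowReg (k + j) α ψ = xPlusPowReg k α ψ := fun k j hk => by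
    induction j with
    | zero => rfl
    | succ j ih =>
      rw [← ih, ← add_assoc]
      refine xPlusPowReg_succ hψ ?_
      simp at hk ⊢
      have := (Nat.cast_nonneg j : (0 : ℝ) ≤ j)
      linarith
  rw [← h1 k k' hk, ← h1 k' k hk', add_comm]

lemma xPlusPowReg_deriv (hβ : β ≠ 0) (ψ : ℝ → ℂ) (k : ℕ) :
    xPlusPowReg k β (deriv ψ) = -β * xPlusPowReg (k + 1) (β - 1) ψ := by
  have h1 : ∏ i ∈ Finset.range (k + 1), (β - 1 + 1 + i) = β * ∏ i ∈ Finset.range k, (β + 1 + i) := by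
    rw [Finset.prod_range_succ', mul_comm]
    congr 1
    · simp
    · exact Finset.prod_congr rfl fun i _ => by push_cast; ring
  rw [xPlusPowReg, xPlusPowReg, h1, iteratedDeriv_succ', show β - 1 + ((k + 1 : ℕ) : ℂ) = β + k by push_cast; ring,
    mul_comm β, div_mul_eq_div_div, pow_succ]
  field_simp

lemma xPlusPowReg_const_mul (c : ℂ) (ψ : ℝ → ℂ) :
    xPlusPowReg k α (fun x => c * ψ x) = c * xPlusPowReg k α ψ := by
  have : ∀ x, iteratedDeriv k (fun x => c * ψ x) x = c * iteratedDeriv k ψ x := fun x => by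
    exact iteratedDeriv_const_smul_field c ψ
  simp only [xPlusPowReg, this, mul_left_comm _ c, integral_const_mul]

lemma xPlusPowReg_add (hψ : IsRightTest ψ) (hχ : IsRightTest χ) (hα : -1 < (α + k).re) :
    xPlusPowReg k α (fun x => ψ x + χ x) = xPlusPowReg k α ψ + xPlusPowReg k α χ := by
  have : ∀ x, iteratedDeriv k (fun x => ψ x + χ x) x = iteratedDeriv k ψ x + iteratedDeriv k χ x := fun x =>
    iteratedDeriv_fun_add ((hψ.smooth.of_le (by exact_mod_cast le_top)).contDiffAt)
      ((hχ.smooth.of_le (by exact_mod_cast le_top)).contDiffAt)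
  simp only [xPlusPowReg, this, mul_add]
  rw [integral_add ((hψ.iteratedDeriv k).integrable hα) ((hχ.iteratedDeriv k).integrable hα), mul_add]

lemma xPlusPowReg_congr (h : EqOn ψ χ (Ioi 0)) : xPlusPowReg k α ψ = xPlusPowReg k α χ := by
  rw [xPlusPowReg, xPlusPowReg]
  congr 1
  refine setIntegral_congr_fun measurableSet_Ioi fun x hx => ?_
  have : ψ =ᶠ[𝓝 x] χ := h.eventuallyEq_of_mem (Ioi_mem_nhds hx)
  simp only [this.iteratedDeriv_eq k]

lemma contDiff_id_ofReal : ContDiff ℝ ∞ fun x : ℝ => (x : ℂ) := ofRealCLM.contDiff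

/-- Homogeneity of `x_+^β`. -/
lemma xPlusPowReg_euler (k : ℕ) : ∀ {β : ℂ} {ψ : ℝ → ℂ}, IsRightTest ψ → -1 < (β + k).re →
    (∀ i : ℕ, β + 1 + i ≠ 0) →
    xPlusPowReg k β (fun x => x * deriv ψ x) = -(β + 1) * xPlusPowReg k β ψ := by
  induction k with
  | zero =>
    intro β ψ hψ hβ _
    have h1 := hψ.integral_cpow_mul_deriv (β := β) (by simpa using hβ)
    simp only [xPlusPowReg, pow_zero, Finset.range_zero, Finset.prod_empty, div_one, one_mul, Nat.cast_zero,
      add_zero, iteratedDeriv_zero]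
    rw [← h1]
    refine setIntegral_congr_fun measurableSet_Ioi fun x hx => ?_
    have hx0 : (x : ℂ) ≠ 0 := ofReal_ne_zero.2 (ne_of_gt hx)
    rw [cpow_add_one_eq hx0, mul_assoc]
  | succ k ih =>
    intro β ψ hψ hβ hi
    have hβ' : -1 < (β + 1 + k).re := by simp at hβ ⊢; linarith
    have h1 : β + 1 ≠ 0 := by simpa using hi 0
    have hd := hψ.deriv
    have e1 : deriv (fun x : ℝ => (x : ℂ) * deriv ψ x) = fun x => deriv ψ x + x * deriv (deriv ψ) x := by
      ext x
      refine (((hasDerivAt_id x).ofReal_comp).fun_mul (hasDerivAt_of_contDiff hd.smooth x)).deriv.trans ?_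
      simp
    have h2 := xPlusPowReg_deriv h1 (fun x : ℝ => (x : ℂ) * deriv ψ x) k
    have h3 := xPlusPowReg_deriv h1 ψ k
    have h4 := ih hd hβ' fun i => by have := hi (i + 1); push_cast at this; convert this using 1; ring
    rw [e1, xPlusPowReg_add hd (hd.deriv.smooth_mul contDiff_id_ofReal) hβ', h4] at h2
    rw [add_sub_cancel_right] at h2 h3
    refine mul_left_cancel₀ h1 ?_
    linear_combination h2 + (β + 1) * h3

/-- Moving a derivative from the test function to the product of `x_+^β` with a smooth function. -/
lemma xPlusPowReg_mul_deriv (hh : ContDiff ℝ ∞ h) (hφ : IsRightTest φ) (hk : -1 < (β + k).re)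
    (hβ : ∀ i : ℕ, β + i ≠ 0) : xPlusPowReg k β (fun x => h x * deriv φ x) =
      -xPlusPowReg (k + 1) (β - 1) (fun x => (β * h x + x * deriv h x) * φ x) := by
  have h0 : β ≠ 0 := by simpa using hβ 0
  have hψ : IsRightTest fun x => deriv h x * φ x := hφ.smooth_mul (contDiff_deriv hh)
  have hχ : IsRightTest fun x => h x * deriv φ x := hφ.deriv.smooth_mul hh
  have e1 : deriv (fun x : ℝ => (β * h x + x * deriv h x) * φ x) = fun x =>
      ((β + 1) * (deriv h x * φ x) + x * deriv (fun x => deriv h x * φ x) x) + β * (h x * deriv φ x) := by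
    ext x
    have d1 := hasDerivAt_of_contDiff hh x
    have d2 := hasDerivAt_of_contDiff (contDiff_deriv hh) x
    have d3 := hasDerivAt_of_contDiff hφ.smooth x
    have d4 : deriv (fun x => deriv h x * φ x) x = _ := (d2.fun_mul d3).deriv
    rw [d4]
    refine (((d1.const_mul β).fun_add (((hasDerivAt_id x).ofReal_comp).fun_mul d2)).fun_mul d3).deriv.trans ?_
    simp only [id, ofReal_one]
    ring
  have h1 := xPlusPowReg_deriv h0 (fun x : ℝ => (β * h x + x * deriv h x) * φ x) k
  have hψ' := hψ.deriv.smooth_mul contDiff_id_ofReal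
  have h2 := xPlusPowReg_euler k hψ hk fun i => by
    have := hβ (i + 1); push_cast at this; convert this using 1; ring
  rw [e1, xPlusPowReg_add ((hψ.smooth_mul contDiff_const).add hψ') (hχ.smooth_mul contDiff_const) hk,
    xPlusPowReg_add (hψ.smooth_mul contDiff_const) hψ' hk, xPlusPowReg_const_mul, xPlusPowReg_const_mul, h2] at h1
  refine mul_left_cancel₀ h0 ?_
  linear_combination h1

/-- The smooth factor of the `j`-th derivative of `x^α h`. -/
def eulerIterate (α : ℂ) (h : ℝ → ℂ) : ℕ → ℝ → ℂ
  | 0 => h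
  | j + 1 => fun x => (α - j) * eulerIterate α h j x + x * deriv (eulerIterate α h j) x

lemma contDiff_eulerIterate (hh : ContDiff ℝ ∞ h) (α : ℂ) (j : ℕ) : ContDiff ℝ ∞ (eulerIterate α h j) := by
  induction j with
  | zero => exact hh
  | succ j ih => exact (contDiff_const.mul ih).add (contDiff_id_ofReal.mul (contDiff_deriv ih))

lemma xPlusPowReg_iteratedDeriv (hh : ContDiff ℝ ∞ h) (hφ : IsRightTest φ) (hα : -1 < α.re)
    (hint : ∀ i : ℤ, α ≠ i) (j : ℕ) :
    xPlusPowReg 0 α (fun x => h x * iteratedDeriv j φ x) =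
      (-1) ^ j * xPlusPowReg j (α - j) (fun x => eulerIterate α h j x * φ x) := by
  induction j generalizing φ with
  | zero => simp [eulerIterate]
  | succ j ih =>
    rw [iteratedDeriv_succ', ih hφ.deriv, xPlusPowReg_mul_deriv (contDiff_eulerIterate hh α j) hφ
      (by simpa using hα) (fun i hi => hint (j - i) (by push_cast; linear_combination hi)), pow_succ,
      show α - ((j + 1 : ℕ) : ℂ) = α - j - 1 by push_cast; ring]
    simp only [eulerIterate]
    ring

/-! ### The hypergeometric function as an iterated derivative -/

variable {α β : ℂ}

/-- The factor of `z^(α - j)` in the `j`-th derivative of `z^α (1 - z)^β`. -/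
def hyperIterate (α β : ℂ) : ℕ → ℂ → ℂ
  | 0 => fun z => (1 - z) ^ β
  | j + 1 => fun z => (α - j) * hyperIterate α β j z + z * deriv (hyperIterate α β j) z

lemma hasDerivAt_one_sub_cpow (β : ℂ) {z : ℂ} (hz : 1 - z ∈ slitPlane) :
    HasDerivAt (fun z : ℂ => (1 - z) ^ β) (-β * (1 - z) ^ (β - 1)) z :=
  (((hasDerivAt_id z).const_sub 1).cpow_const hz).congr_deriv (by simp)

lemma differentiableOn_hyperIterate (α β : ℂ) (j : ℕ) :
    DifferentiableOn ℂ (hyperIterate α β j) {z | 1 - z ∈ slitPlane} := by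
  induction j with
  | zero => exact fun z hz => (hasDerivAt_one_sub_cpow β hz).differentiableAt.differentiableWithinAt
  | succ j ih =>
    exact (ih.const_mul _).add (differentiableOn_id.mul (ih.deriv isOpen_hypergeometricDomain))

lemma contDiffAt_hyperIterate (α β : ℂ) (j : ℕ) {k : ℕ∞ω} :
    ContDiffAt ℂ k (hyperIterate α β j) 0 :=
  ((differentiableOn_hyperIterate α β j).analyticAt
    (isOpen_hypergeometricDomain.mem_nhds (by simp))).contDiffAt

lemma iteratedDeriv_one_sub_cpow (β : ℂ) (k : ℕ) : ∀ z : ℂ, 1 - z ∈ slitPlane →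
    iteratedDeriv k (fun z : ℂ => (1 - z) ^ β) z = (ascPochhammer ℂ k).eval (-β) * (1 - z) ^ (β - k) := by
  induction k with
  | zero => simp
  | succ k ih =>
    intro z hz
    have h1 : iteratedDeriv k (fun z : ℂ => (1 - z) ^ β) =ᶠ[𝓝 z]
        fun z => (ascPochhammer ℂ k).eval (-β) * (1 - z) ^ (β - k) := by
      filter_upwards [isOpen_hypergeometricDomain.mem_nhds hz] with w hw using ih w hw
    rw [iteratedDeriv_succ, h1.deriv_eq, ((hasDerivAt_one_sub_cpow (β - k) hz).const_mul _).deriv,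
      ascPochhammer_succ_eval, sub_sub]
    push_cast
    ring

lemma iteratedDeriv_hyperIterate (α β : ℂ) (j k : ℕ) : iteratedDeriv k (hyperIterate α β j) 0 =
    (∏ i ∈ Finset.range j, (α - i + k)) * (ascPochhammer ℂ k).eval (-β) := by
  induction j with
  | zero => rw [hyperIterate, iteratedDeriv_one_sub_cpow β k 0 (by simp)]; simp
  | succ j ih =>
    have h1 : ContDiffAt ℂ k (hyperIterate α β j) 0 := contDiffAt_hyperIterate α β j
    have h2 : ContDiffAt ℂ k (deriv (hyperIterate α β j)) 0 :=
      ((differentiableOn_hyperIterate α β j).deriv isOpen_hypergeometricDomain |>.analyticAt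
        (isOpen_hypergeometricDomain.mem_nhds (by simp))).contDiffAt
    have h3 : iteratedDeriv k (fun z => z * deriv (hyperIterate α β j) z) 0 =
        k * iteratedDeriv k (hyperIterate α β j) 0 := by
      rw [iteratedDeriv_fun_mul contDiffAt_fun_id h2]
      simp only [iteratedDeriv_fun_id_zero, mul_ite, mul_one, mul_zero, ite_mul, zero_mul, Finset.sum_ite_eq',
        Finset.mem_range]
      rcases k with _ | k
      · simp
      · rw [if_pos (by omega), Nat.choose_one_right, Nat.add_sub_cancel, ← iteratedDeriv_succ']
    rw [hyperIterate, iteratedDeriv_fun_add (contDiffAt_const.mul h1) (contDiffAt_fun_id.mul h2), h3,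
      iteratedDeriv_const_mul_field, ih, Finset.prod_range_succ]
    ring

lemma prod_mul_Gamma {α : ℂ} (hα : ∀ i : ℤ, α ≠ i) (k j : ℕ) :
    (∏ i ∈ Finset.range j, (α - i + k)) * Gamma (α - j + 1 + k) = Gamma (α + 1 + k) := by
  induction j with
  | zero => simp
  | succ j ih =>
    have h1 : α - j + k ≠ 0 := fun h => hα (j - k) (by push_cast; linear_combination h)
    rw [← ih, Finset.prod_range_succ, show α - j + 1 + k = α - j + k + 1 by ring, Gamma_add_one _ h1,
      show α - ((j + 1 : ℕ) : ℂ) + 1 + k = α - j + k by push_cast; ring]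
    ring

lemma isOlverF_hyperIterate (hα : ∀ i : ℤ, α ≠ i) (β : ℂ) (N : ℕ) :
    IsOlverF (-β) (1 + α) (α - N + 1) fun z => hyperIterate α β N z / Gamma (1 + α) := by
  refine ⟨(differentiableOn_hyperIterate α β N).div_const _, fun z hz => ?_⟩
  have hball : DifferentiableOn ℂ (hyperIterate α β N) (Metric.ball 0 1) :=
    (differentiableOn_hyperIterate α β N).mono fun w hw => by
      have : ‖-w‖ < 1 := by simpa using hw
      simpa [sub_eq_add_neg] using mem_slitPlane_of_norm_lt_one this
  have h1 := (hasSum_taylorSeries_on_ball hball (z := z) (by simpa using hz)).div_const (Gamma (1 + α))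
  refine h1.tsum_eq.symm.trans ?_
  refine tsum_congr fun k => ?_
  have hα1 : ∀ j : ℕ, 1 + α ≠ -j := fun j h => hα (-j - 1) (by push_cast; linear_combination h)
  have hG : Gamma (α - N + 1 + k) ≠ 0 := Gamma_ne_zero fun j h =>
    hα (N - 1 - k - j) (by push_cast; linear_combination h)
  rw [iteratedDeriv_hyperIterate, ← Gamma_add_nat_div_Gamma_eq _ hα1, show 1 + α + k = α + 1 + k by ring,
    ← prod_mul_Gamma hα k N, smul_eq_mul, smul_eq_mul, sub_zero]
  field_simp

lemma eulerIterate_eq_hyperIterate {h : ℝ → ℂ} {d x₀ : ℝ} {D : ℂ} (hd : 0 < d) (hx₀ : -d < x₀)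
    (h0 : ∀ x, x₀ < x → h x = D * (1 - ((-x / d : ℝ) : ℂ)) ^ β) (j : ℕ) :
    ∀ x, x₀ < x → eulerIterate α h j x = D * hyperIterate α β j ((-x / d : ℝ) : ℂ) := by
  induction j with
  | zero => exact h0
  | succ j ih =>
    intro x hx
    have h1 : eulerIterate α h j =ᶠ[𝓝 x] fun x => D * hyperIterate α β j ((-x / d : ℝ) : ℂ) := by
      filter_upwards [Ioi_mem_nhds hx] with y hy using ih y hy
    have hz : 1 - ((-x / d : ℝ) : ℂ) ∈ slitPlane := by
      rw [← ofReal_one, ← ofReal_sub, ofReal_mem_slitPlane, neg_div, sub_neg_eq_add]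
      have : -1 < x / d := by rw [lt_div_iff₀ hd]; linarith
      linarith
    have h2 := ((differentiableOn_hyperIterate α β j).differentiableAt
      (isOpen_hypergeometricDomain.mem_nhds hz)).hasDerivAt
    have h3 : HasDerivAt (fun x : ℝ => ((-x / d : ℝ) : ℂ)) ((-1 / d : ℝ) : ℂ) x :=
      (((hasDerivAt_id x).neg).div_const d).ofReal_comp
    have h4 := (h2.comp x h3).const_mul D
    simp only [eulerIterate, h1.deriv_eq, ih x hx, hyperIterate]
    have h5 : deriv (fun x : ℝ => D * hyperIterate α β j ((-x / d : ℝ) : ℂ)) x = _ := h4.deriv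
    rw [h5]
    have hd' : (d : ℂ) ≠ 0 := ofReal_ne_zero.2 hd.ne'
    push_cast
    ring

lemma radialTest.isRightTest {J : Set ℝ} {φ : ℝ → ℂ} (hφ : φ ∈ radialTest J) (rp : ℝ) :
    IsRightTest fun x => φ (rp + x) := by
  obtain ⟨b, hb⟩ := radialTest.exists_eq_zero_of_le hφ
  exact ⟨hφ.1.comp (contDiff_const.add contDiff_id), b - rp, fun x hx => hb _ (by linarith)⟩

lemma horizonForm_eq_xPlusPowReg {rp d l : ℝ} {κ : ℂ} (hd : 0 < d) (hκ : κ.re = 0) (hl : 0 ≤ l)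
    (hint : ∀ i : ℤ, (l : ℂ) + κ ≠ i) (N k : ℕ) (hk : -1 < l - N + k) {J : Set ℝ} {φ : ℝ → ℂ}
    (hφ : φ ∈ radialTest J) : horizonForm rp d κ l N φ =
      (-1) ^ N * (d : ℂ) ^ (l - κ) * Gamma (1 + (l + κ)) * xPlusPowReg k (l + κ - N) (fun x =>
        olverF (-(l - κ)) (1 + (l + κ)) (l + κ - N + 1) ((-x / d : ℝ) : ℂ) * φ (rp + x)) := by
  set H : ℝ → ℂ := fun x => stepUp (-2 * d / 3) (-d / 3) x * ((x : ℂ) - ((-d : ℝ) : ℂ)) ^ (l - κ) with hH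
  have hHs : ContDiff ℝ ∞ H := contDiff_stepUp_mul (by linarith) (by linarith) (contDiffOn_cpow (-d) _)
  have hψ := radialTest.isRightTest hφ rp
  have hG : Gamma (1 + (l + κ)) ≠ 0 := Gamma_ne_zero fun j h =>
    hint (-j - 1) (by push_cast; linear_combination h)
  have hH1 : ∀ x, -d / 3 < x → H x = (d : ℂ) ^ (l - κ) * (1 - ((-x / d : ℝ) : ℂ)) ^ (l - κ) := fun x hx => by
    have h1 : (0 : ℝ) ≤ 1 - -x / d := by
      rw [neg_div, sub_neg_eq_add]
      have : -1 ≤ x / d := by rw [le_div_iff₀ hd]; linarith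
      linarith
    rw [hH]
    beta_reduce
    rw [stepUp_of_ge (by linarith) hx.le, one_mul, ← ofReal_one, ← ofReal_sub, ← ofReal_sub,
      ← mul_cpow_ofReal_nonneg hd.le h1, ← ofReal_mul]
    congr 2
    field_simp
    ring
  have h1 : horizonForm rp d κ l N φ =
      xPlusPowReg 0 (l + κ) fun x => H x * iteratedDeriv N (fun x => φ (rp + x)) x := by
    simp only [horizonForm, xPlusPowReg, pow_zero, Finset.range_zero, Finset.prod_empty, div_one, one_mul,
      Nat.cast_zero, add_zero, iteratedDeriv_zero]
    refine setIntegral_congr_fun measurableSet_Ioi fun x (hx : 0 < x) => ?_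
    have h2 : iteratedDeriv N (fun x => φ (rp + x)) x = iteratedDeriv N φ (rp + x) := by
      rw [iteratedDeriv_comp_const_add]
    simp only [hH, h2, stepUp_of_ge (show -2 * d / 3 < -d / 3 by linarith) (show -d / 3 ≤ x by linarith), one_mul,
      ofReal_neg, sub_neg_eq_add]
  have h3 : -1 < (l + κ - N + k).re := by simp [hκ]; linarith
  have h4 : -1 < (l + κ - N + N).re := by simp [hκ]; linarith
  have h5 : EqOn (fun x => eulerIterate (l + κ) H N x * φ (rp + x)) (fun x =>
      ((d : ℂ) ^ (l - κ) * Gamma (1 + (l + κ))) *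
        (olverF (-(l - κ)) (1 + (l + κ)) (l + κ - N + 1) ((-x / d : ℝ) : ℂ) * φ (rp + x))) (Ioi 0) := by
    intro x (hx : 0 < x)
    have hz : 1 - ((-x / d : ℝ) : ℂ) ∈ slitPlane := by
      rw [← ofReal_one, ← ofReal_sub, ofReal_mem_slitPlane, neg_div, sub_neg_eq_add]
      positivity
    simp only [eulerIterate_eq_hyperIterate hd (by linarith : -d < -d / 3) hH1 N x (by linarith),
      olverF_eq (isOlverF_hyperIterate hint (l - κ) N) hz]
    field_simp
  rw [h1, xPlusPowReg_iteratedDeriv hHs hψ (by simp [hκ]; linarith) hint,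
    xPlusPowReg_eq (hψ.smooth_mul (contDiff_eulerIterate hHs _ _)) h4 h3, xPlusPowReg_congr h5,
    xPlusPowReg_const_mul]
  ring

variable {M a m l : ℝ} {n : ℤ} {A B : ℕ}

lemma exists_uStarRadial_eq (hd : 0 < gap M a) (hA : (A : ℝ) = l + spin n) (hB : (B : ℝ) = l - spin n) :
    ∃ C : ℂ, C ≠ 0 ∧ ∀ φ ∈ radialTest (Ioi 0), uStarRadial M a n l m φ =
      C * horizonForm (rPlus M a) (gap M a) (-iKappa M a m) l A φ := by
  by_cases h : ¬Even n ∨ a * m ≠ 0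
  · have hl : 0 ≤ l := by
      have : (0 : ℝ) ≤ (A : ℝ) + B := by positivity
      linarith
    have hs : (spin n : ℂ) = A - l := by rw [← ofReal_natCast, hA]; push_cast; ring
    have hne : ∀ i : ℤ, (l : ℂ) + -iKappa M a m ≠ i := fun i hi => by
      have h1 : (B : ℂ) = l - spin n := by rw [← ofReal_natCast, hB]; push_cast; ring
      exact spin_sub_iKappa_ne hd.ne' h (i - B) (by push_cast; rw [h1]; linear_combination hi)
    have hre : (-iKappa M a m).re = 0 := by simp [iKappa]
    have hG : Gamma (1 + (l + -iKappa M a m)) ≠ 0 := Gamma_ne_zero fun j h =>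
      hne (-j - 1) (by push_cast; linear_combination h)
    have hd' : (gap M a : ℂ) ≠ 0 := ofReal_ne_zero.2 hd.ne'
    set K : ℂ := (-1) ^ A * (gap M a : ℂ) ^ ((l : ℂ) - -iKappa M a m) * Gamma (1 + (l + -iKappa M a m)) with hK
    have hK0 : K ≠ 0 := mul_ne_zero (mul_ne_zero (by simp) (by simp [cpow_eq_zero_iff, hd'])) hG
    · refine ⟨(gap M a : ℂ) ^ ((spin n : ℂ) + iKappa M a m) / K, ?_, fun φ hφ => ?_⟩
      · exact div_ne_zero (by simp [cpow_eq_zero_iff, hd']) hK0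
      · rw [horizonForm_eq_xPlusPowReg hd hre hl hne A ⌈|(-(spin n : ℂ) - iKappa M a m).re|⌉₊ ?_ hφ, ← hK,
          ← mul_assoc, div_mul_cancel₀ _ hK0, uStarRadial, if_pos h]
        · congr 1
          rw [show (l : ℂ) + -iKappa M a m - A = -(spin n : ℂ) - iKappa M a m by rw [hs]; ring]
          have hx : ∀ x : ℝ, zVar M a (rPlus M a + x) = ((-x / gap M a : ℝ) : ℂ) := fun x => by
            rw [zVar]; congr 2; ring
          simp only [hx, xPlusPow, xPlusPowReg]
          congr! 7
          all_goals ring_nf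
        · have h1 := Nat.le_ceil |(-(spin n : ℂ) - iKappa M a m).re|
          have h2 := neg_abs_le ((-(spin n : ℂ) - iKappa M a m).re)
          have h3 : (-(spin n : ℂ) - iKappa M a m).re = -spin n := by simp [iKappa]
          rw [h3] at h1 h2 ⊢
          linarith
  · push Not at h
    obtain ⟨hn, ham⟩ := h
    have hAB : (A : ℤ) - B = n := by
      have : (A : ℝ) - B = n := by rw [hA, hB, spin]; ring
      exact_mod_cast this
    obtain ⟨i, rfl⟩ := hn
    obtain ⟨L, hL⟩ : ∃ L : ℕ, (L : ℤ) = B + i := ⟨(B + i).toNat, by omega⟩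
    have hl : l = L := by
      have h1 : (L : ℝ) = B + i := by exact_mod_cast hL
      rw [h1, hB, spin]; push_cast; ring
    subst hl
    rw [iKappa_eq_zero ham, neg_zero]
    rcases lt_or_ge (i + i) 0 with h0 | h0
    · exact exists_uStarRadial_eq_of_neg hd ⟨i, rfl⟩ h0 ham hA hB
    · exact exists_uStarRadial_eq_of_nonneg hd ⟨i, rfl⟩ h0 ham hA hB

/-! ## The Teukolsky operator on modes -/

section
variable {n : ℤ} {l m M a : ℝ} {J : Set ℝ} {f : SpherePair}

lemma continuous_rot {g : ℂ → ℂ} (hg : ContDiff ℝ ∞ g) : Continuous (rot g) :=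
  (hg.continuous_fderiv (by simp)).clm_apply (by fun_prop)

lemma IsSmoothSection.rot_bounded {g : SpherePair} (hg : IsSmoothSection n g) :
    ∃ C, ∀ ζ, ‖rot g.1 ζ‖ ≤ C := by
  obtain ⟨C₁, h₁⟩ := (isCompact_closedBall (0 : ℂ) 1).exists_bound_of_continuousOn
    (continuous_rot hg.smooth_fst).continuousOn
  obtain ⟨C₂, h₂⟩ := (isCompact_closedBall (0 : ℂ) 1).exists_bound_of_continuousOn
    (continuous_rot hg.smooth_snd).continuousOn
  obtain ⟨D, hD⟩ := hg.bounded
  refine ⟨max C₁ (C₂ + |(n : ℝ)| * D), fun ζ => ?_⟩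
  rcases le_or_gt ‖ζ‖ 1 with hζ | hζ
  · exact (h₁ ζ (by simpa using hζ)).trans (le_max_left _ _)
  · have h0 : ζ ≠ 0 := norm_pos_iff.1 (one_pos.trans hζ)
    have e : ∀ t : ℝ, exp ((n : ℂ) * (t * I)) * g.2 (exp ((-t : ℝ) * I) * ζ⁻¹) =
        transition n ζ * g.1 (exp (t * I) * ζ) := fun t => by
      have h3 := hg.glue (exp (t * I) * ζ) (mul_ne_zero (exp_ne_zero _) h0)
      rw [mul_inv, ← exp_neg, ← neg_mul, ← ofReal_neg] at h3
      rw [h3, transition, norm_mul, norm_exp_ofReal_mul_I, one_mul, mul_div_assoc, mul_zpow, ← transition,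
        ← exp_int_mul, ← mul_assoc, ← mul_assoc, ← exp_add]
      push_cast
      simp
    have h4 := (hasDerivAt_rotate hg.smooth_snd ζ⁻¹ (-(0 : ℝ))).scomp (0 : ℝ) (hasDerivAt_neg (0 : ℝ))
    have h5 : HasDerivAt (fun t : ℝ => (n : ℂ) * ((t : ℂ) * I)) ((n : ℂ) * (1 * I)) 0 :=
      (((hasDerivAt_id (0 : ℝ)).ofReal_comp.mul_const I).const_mul (n : ℂ))
    have h6 := (h5.cexp.fun_mul h4).unique
      (((hasDerivAt_rotate hg.smooth_fst ζ 0).const_mul (transition n ζ)).congr_of_eventuallyEq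
        (Eventually.of_forall e))
    have h7 := e 0
    simp only [neg_zero, ofReal_zero, zero_mul, mul_zero, exp_zero, one_mul, Function.comp_apply, neg_smul, one_smul] at h6 h7
    have h8 : rot g.1 ζ = (transition n ζ)⁻¹ * (n * I * (transition n ζ * g.1 ζ) - rot g.2 ζ⁻¹) := by
      have : transition n ζ ≠ 0 := norm_ne_zero_iff.1 (by rw [norm_transition n h0]; exact one_ne_zero)
      rw [← h7, eq_inv_mul_iff_mul_eq₀ this, ← h6]
      ring
    rw [h8, norm_mul, norm_inv, norm_transition n h0, inv_one, one_mul]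
    refine (norm_sub_le _ _).trans (le_trans ?_ (le_max_right _ _))
    have h9 := h₂ ζ⁻¹ (by rw [mem_closedBall_zero_iff, norm_inv]; exact inv_le_one_of_one_le₀ hζ.le)
    rw [norm_mul, norm_mul, norm_mul, norm_transition n h0, norm_I, one_mul, mul_one, norm_intCast]
    have := mul_le_mul_of_nonneg_left (hD ζ) (abs_nonneg (n : ℝ))
    linarith

lemma IsSmoothSection.integrable_rot_mul_conj {n' : ℤ} {g h : SpherePair} (hg : IsSmoothSection n g)
    (hh : IsSmoothSection n' h) :
    Integrable fun ζ => rot g.1 ζ * conj (h.1 ζ) * ((4 / (1 + ‖ζ‖ ^ 2) ^ 2 : ℝ) : ℂ) := by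
  obtain ⟨C, hC⟩ := hg.rot_bounded
  obtain ⟨D, hD⟩ := hh.bounded
  refine integrable_area (C := C * D)
    ((continuous_rot hg.smooth_fst).mul (continuous_conj.comp hh.smooth_fst.continuous)) fun ζ => ?_
  rw [norm_mul, RCLike.norm_conj]
  exact mul_le_mul (hC ζ) (hD ζ) (norm_nonneg _) ((norm_nonneg _).trans (hC ζ))

lemma IsSpinHarmonic.sphereInner_rot {f g : SpherePair} (hf : IsSpinHarmonic n l m f)
    (hg : IsSmoothSection n g) :
    sphereInner (rot g.1) f.1 = I * ((m + spin n : ℝ) : ℂ) * sphereInner g.1 f.1 := by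
  obtain ⟨C, hC⟩ := hg.rot_bounded
  obtain ⟨D, hD⟩ := hg.bounded
  obtain ⟨E, hE⟩ := hf.isSmoothSection.bounded
  have hcont : ∀ {k : ℂ → ℂ}, Continuous k → ∀ t : ℝ,
      Continuous fun ζ => k (exp (t * I) * ζ) * conj (f.1 ζ) := fun hk t =>
    (hk.comp (continuous_const.mul continuous_id)).mul
      (continuous_conj.comp hf.isSmoothSection.smooth_fst.continuous)
  have hbd : ∀ {k : ℂ → ℂ} {C : ℝ}, (∀ ζ, ‖k ζ‖ ≤ C) → ∀ (t : ℝ) ζ,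
      ‖k (exp (t * I) * ζ) * conj (f.1 ζ)‖ ≤ C * E := fun hk t ζ => by
    rw [norm_mul, RCLike.norm_conj]
    exact mul_le_mul (hk _) (hE ζ) (norm_nonneg _) ((norm_nonneg _).trans (hk 0))
  have h1 : HasDerivAt (fun t : ℝ => sphereInner (fun ζ => g.1 (exp (t * I) * ζ)) f.1)
      (sphereInner (fun ζ => rot g.1 (exp ((0 : ℝ) * I) * ζ)) f.1) 0 :=
    (hasDerivAt_integral_of_dominated_loc_of_deriv_le (𝕜 := ℝ)
      (F := fun t ζ => g.1 (exp (t * I) * ζ) * conj (f.1 ζ) * ((4 / (1 + ‖ζ‖ ^ 2) ^ 2 : ℝ) : ℂ))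
      (F' := fun t ζ => rot g.1 (exp (t * I) * ζ) * conj (f.1 ζ) * ((4 / (1 + ‖ζ‖ ^ 2) ^ 2 : ℝ) : ℂ))
      (bound := fun ζ => C * E * (4 / (1 + ‖ζ‖ ^ 2) ^ 2)) univ_mem
      (Eventually.of_forall fun t =>
        (integrable_area (hcont hg.smooth_fst.continuous t) (hbd hD t)).aestronglyMeasurable)
      (integrable_area (hcont hg.smooth_fst.continuous 0) (hbd hD 0))
      (integrable_area (hcont (continuous_rot hg.smooth_fst) 0) (hbd hC 0)).aestronglyMeasurable
      (Eventually.of_forall fun ζ t _ => by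
        rw [norm_mul, norm_real, Real.norm_of_nonneg (by positivity)]
        exact mul_le_mul_of_nonneg_right (hbd hC t ζ) (by positivity))
      (integrable_area_weight.const_mul _)
      (Eventually.of_forall fun ζ t _ =>
        ((hasDerivAt_rotate hg.smooth_fst ζ t).mul_const _).mul_const _)).2
  have h2 : ∀ t : ℝ, sphereInner (fun ζ => g.1 (exp (t * I) * ζ)) f.1 =
      exp (((m + spin n : ℝ) : ℂ) * ((t : ℂ) * I)) * sphereInner g.1 f.1 := fun t => by
    rw [sphereInner, ← areaIntegral_rotate _ (-t)]
    have e : ∀ ζ, g.1 (exp (t * I) * (exp ((-t : ℝ) * I) * ζ)) * conj (f.1 (exp ((-t : ℝ) * I) * ζ)) =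
        exp (((m + spin n : ℝ) : ℂ) * ((t : ℂ) * I)) * g.1 ζ * conj (f.1 ζ) := fun ζ => by
      rw [hf.rotate, map_mul, ← exp_conj, ← mul_assoc (exp (t * I)), ← exp_add]
      simp only [map_mul, conj_ofReal, conj_I]
      push_cast
      rw [show (t : ℂ) * I + -t * I = 0 by ring, exp_zero, one_mul,
        show ((m : ℂ) + spin n) * -(t : ℂ) * -I = (m + spin n) * (t * I) by ring]
      ring
    simp only [e]
    exact sphereInner_const_mul _ g.1 f.1
  have h3 : HasDerivAt (fun t : ℝ => ((m + spin n : ℝ) : ℂ) * ((t : ℂ) * I))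
      (((m + spin n : ℝ) : ℂ) * (1 * I)) 0 :=
    (((hasDerivAt_id (0 : ℝ)).ofReal_comp.mul_const I).const_mul _)
  rw [funext h2] at h1
  have h4 := h1.unique (h3.cexp.mul_const (sphereInner g.1 f.1))
  simp only [ofReal_zero, zero_mul, mul_zero, exp_zero, one_mul] at h4
  rw [h4]
  ring

lemma gap_pos (ha : |a| < M) : 0 < gap M a := by
  have h0 : a ^ 2 < M ^ 2 := sq_lt_sq' (abs_lt.1 ha).1 (abs_lt.1 ha).2
  have : 0 < √(M ^ 2 - a ^ 2) := Real.sqrt_pos.2 (by linarith)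
  rw [gap, rPlus, rMinus]; linarith

lemma rMinus_nonneg (ha : |a| < M) : 0 ≤ rMinus M a := by
  rw [rMinus, sub_nonneg, Real.sqrt_le_left ((abs_nonneg a).trans ha.le)]
  nlinarith [sq_nonneg a]

/-- The coefficients of the Teukolsky operator in terms of the position of the horizon. -/
lemma radOp_eq_teukolsky (ha : |a| < M) (n : ℤ) (l m : ℝ) (φ : ℝ → ℂ) (r : ℝ) :
    -((r ^ 2 - 2 * M * r + a ^ 2 : ℝ) : ℂ) * deriv (deriv φ) r +
      ((2 * (r - M) * (spin n - 1) : ℝ) : ℂ) * deriv φ r - 2 * a * (I * m * deriv φ r) +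
      eigenvalue n l * φ r + spin n * φ r =
    radOp (rPlus M a) (gap M a) (iKappa M a m) l (spin n) φ r := by
  have h0 : a ^ 2 ≤ M ^ 2 := sq_le_sq' (abs_lt.1 ha).1.le (abs_lt.1 ha).2.le
  have h1 : r ^ 2 - 2 * M * r + a ^ 2 = (r - rPlus M a) * (r - rPlus M a + gap M a) := by
    have := Real.sq_sqrt (sub_nonneg.2 h0)
    rw [gap, rPlus, rMinus]
    linear_combination this
  have h2 : 2 * (r - M) = 2 * (r - rPlus M a) + gap M a := by rw [gap, rPlus, rMinus]; ring
  have h3 : (gap M a : ℂ) * iKappa M a m = 2 * a * m * I := by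
    have : (gap M a : ℂ) ≠ 0 := ofReal_ne_zero.2 (gap_pos ha).ne'
    rw [iKappa]; push_cast; field_simp
  rw [h1, h2, radOp, h3, eigenvalue]
  push_cast
  ring

lemma teukolskyChart_mul (ha : |a| < M) {σ : ℂ} {g : ℂ → ℂ} (hg : ContDiff ℝ ∞ g)
    (h1 : ∀ ζ, spinLaplacian n g ζ = (eigenvalue n l : ℂ) * g ζ)
    (h2 : ∀ ζ, phiDeriv σ n g ζ = I * (m : ℂ) * g ζ) {φ : ℝ → ℂ} (hφ : ContDiff ℝ ∞ φ) :
    teukolskyChart M a n σ (fun p => φ p.1 * g p.2) =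
      fun p => radOp (rPlus M a) (gap M a) (iKappa M a m) l (spin n) φ p.1 * g p.2 := by
  have hd : ∀ {φ : ℝ → ℂ}, ContDiff ℝ ∞ φ → radialDeriv (fun p => φ p.1 * g p.2) =
      fun p => deriv φ p.1 * g p.2 := fun hφ => funext fun p =>
    ((hasDerivAt_of_contDiff hφ p.1).mul_const (g p.2)).deriv
  have hs : ∀ (c : ℂ) ζ, spinLaplacian n (fun z => c * g z) ζ = c * spinLaplacian n g ζ := fun c ζ => by
    simpa using spinLaplacian_sum n {()} (fun _ => c) (G := fun _ => g) (fun _ _ => hg) ζ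
  have hr : ∀ (c : ℂ) ζ, rot (fun z => c * g z) ζ = c * rot g ζ := fun c ζ => by
    simpa using rot_sum {()} (fun _ => c) (G := fun _ => g) (fun _ _ => hg) ζ
  have hp : ∀ (c : ℂ) ζ, phiDeriv σ n (fun z => c * g z) ζ = c * phiDeriv σ n g ζ := fun c ζ => by
    rw [phiDeriv, phiDeriv, hr]; ring
  funext p
  rw [teukolskyChart, hd hφ, hd (contDiff_deriv hφ)]
  simp only [hs, hp, h1, h2, ← radOp_eq_teukolsky ha]
  ring

lemma teukolsky_tensor (ha : |a| < M) (hf : IsSpinHarmonic n l m f) {φ : ℝ → ℂ}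
    (hφ : ContDiff ℝ ∞ φ) : teukolsky M a n (tensor φ f) =
      tensor (radOp (rPlus M a) (gap M a) (iKappa M a m) l (spin n) φ) f :=
  Prod.ext (teukolskyChart_mul ha hf.isSmoothSection.smooth_fst hf.eigen_fst hf.phi_fst hφ)
    (teukolskyChart_mul ha hf.isSmoothSection.smooth_snd hf.eigen_snd hf.phi_snd hφ)

lemma modeCoeff_teukolsky (ha : |a| < M) (hf : IsSpinHarmonic n l m f) {w : SpacePair}
    (hw : w ∈ testSections n J) : modeCoeff (teukolsky M a n w) f =
      radOp (rPlus M a) (gap M a) (iKappa M a m) l (spin n) (modeCoeff w f) := by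
  have hw1 := radialDerivPair_mem hw
  have hw2 := radialDerivPair_mem hw1
  have hL := laplacianPair_mem hw
  have hfs := hf.isSmoothSection
  have hd : ∀ {w : SpacePair}, w ∈ testSections n J → deriv (modeCoeff w f) = modeCoeff (radialDerivPair w) f :=
    fun hw => funext fun r => (hasDerivAt_modeCoeff hw hfs r).deriv
  funext r
  have s1 := testSections.section hw1 r
  set b : ℂ := ((2 * (r - M) * (spin n - 1) : ℝ) : ℂ) + 2 * a * (I * spin n)
  set c : ℂ := -((r ^ 2 - 2 * M * r + a ^ 2 : ℝ) : ℂ)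
  have hv : c • radialDerivPair (radialDerivPair w) + (b • radialDerivPair w + (laplacianPair n w +
      (spin n : ℂ) • w)) ∈ testSections n J :=
    add_mem (Submodule.smul_mem _ _ hw2) (add_mem (Submodule.smul_mem _ _ hw1)
      (add_mem hL (Submodule.smul_mem _ _ hw)))
  have e : ∀ ζ, (teukolsky M a n w).1 (r, ζ) = (c • radialDerivPair (radialDerivPair w) +
      (b • radialDerivPair w + (laplacianPair n w + (spin n : ℂ) • w))).1 (r, ζ) +
        -(2 * a) * rot (fun ζ => (radialDerivPair w).1 (r, ζ)) ζ := fun ζ => by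
    simp only [teukolsky, teukolskyChart, phiDeriv, Prod.fst_add, Prod.smul_fst, Pi.add_apply, Pi.smul_apply,
      smul_eq_mul, radialDerivPair, laplacianPair, b, c]
    ring
  have h1 : modeCoeff (teukolsky M a n w) f r = modeCoeff (c • radialDerivPair (radialDerivPair w) +
      (b • radialDerivPair w + (laplacianPair n w + (spin n : ℂ) • w))) f r +
        -(2 * a) * sphereInner (rot fun ζ => (radialDerivPair w).1 (r, ζ)) f.1 := by
    rw [← sphereInner_const_mul]
    simp only [modeCoeff, e, sphereInner, areaIntegral, add_mul]
    exact integral_add ((testSections.section hv r).integrable_mul_conj hfs)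
      (((s1.integrable_rot_mul_conj hfs).const_mul (-(2 * a : ℂ))).congr
        (Eventually.of_forall fun ζ => by simp only [mul_assoc]))
  rw [h1, modeCoeff_add (Submodule.smul_mem _ _ hw2) (add_mem (Submodule.smul_mem _ _ hw1)
      (add_mem hL (Submodule.smul_mem _ _ hw))) hfs, modeCoeff_add (Submodule.smul_mem _ _ hw1)
      (add_mem hL (Submodule.smul_mem _ _ hw)) hfs, modeCoeff_add hL (Submodule.smul_mem _ _ hw) hfs,
    modeCoeff_smul, modeCoeff_smul, modeCoeff_smul, modeCoeff_laplacianPair hw hf, hf.sphereInner_rot s1,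
    ← radOp_eq_teukolsky ha, hd hw, hd hw1]
  change _ + -(2 * (a : ℂ)) * (I * _ * modeCoeff (radialDerivPair w) f r) = _
  simp only [b, c]
  push_cast
  ring

end

/-! ## The kernel of the adjoint -/

section
variable {n : ℤ} {l m M a ε q k : ℝ} {J : Set ℝ} {rp d : ℝ} {κ : ℂ} {N A B : ℕ} {f : SpherePair}

lemma linearIndependent_of_exists {ι X : Type*} {u : ι → X → ℂ}
    (h : ∀ p, ∃ x, u p x ≠ 0 ∧ ∀ p', p' ≠ p → u p' x = 0) : LinearIndependent ℂ u := by
  refine linearIndependent_iff'.2 fun s g hg i hi => ?_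
  obtain ⟨x, hx, hx'⟩ := h i
  have := congrFun hg x
  simp only [Finset.sum_apply, Pi.smul_apply, smul_eq_mul, Pi.zero_apply] at this
  rw [Finset.sum_eq_single_of_mem i hi fun j _ hj => by rw [hx' j hj, mul_zero]] at this
  exact (mul_eq_zero.1 this).resolve_right hx

lemma mem_span_of_hasSum {ι ι' X : Type*} [Finite ι] {u : ι → X → ℂ} {g : ι → ι'} (hg : Function.Injective g)
    {Φ : X → ℂ} {F : ι' → X → ℂ} (hF : ∀ x, HasSum (fun i => F i x) (Φ x))
    (h0 : ∀ i, i ∉ range g → F i = 0) (h : ∀ p, ∃ c : ℂ, F (g p) = c • u p) :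
    Φ ∈ Submodule.span ℂ (range u) := by
  have := Fintype.ofFinite ι
  choose c hc using h
  have : Φ = ∑ p, c p • u p := funext fun x => by
    have h1 := (hg.hasSum_iff fun i hi => by rw [h0 i hi, Pi.zero_apply]).2 (hF x)
    rw [h1.unique (hasSum_fintype _), Finset.sum_apply]
    exact Finset.sum_congr rfl fun p _ => congrFun (hc p) x
  rw [this]
  exact Submodule.sum_mem _ fun p _ => Submodule.smul_mem _ _ (Submodule.subset_span (mem_range_self p))

lemma radialTest.conj {φ : ℝ → ℂ} (h : φ ∈ radialTest J) : (fun r => conj (φ r)) ∈ radialTest J := by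
  obtain ⟨h1, K, hK, hKJ, h2⟩ := h
  exact ⟨contDiff_conj.comp h1, K, hK, hKJ, fun r hr => by simp [h2 r hr]⟩

lemma iteratedDeriv_conj (φ : ℝ → ℂ) (k : ℕ) :
    iteratedDeriv k (fun r => conj (φ r)) = fun r => conj (iteratedDeriv k φ r) := by
  induction k with
  | zero => simp
  | succ k ih =>
    rw [iteratedDeriv_succ, ih, iteratedDeriv_succ]
    exact deriv.star' (f := iteratedDeriv k φ)

lemma horizonForm_conj (hd : 0 < d) (hκ : κ.re = 0) (φ : ℝ → ℂ) :
    horizonForm rp d (-κ) l N (fun r => conj (φ r)) = conj (horizonForm rp d κ l N φ) := by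
  have h1 : conj κ = -κ := Complex.ext (by simp [hκ]) (by simp)
  have h2 : ∀ {x : ℝ} (β : ℂ), 0 < x → conj ((x : ℂ) ^ β) = (x : ℂ) ^ conj β := fun {x} β hx => by
    rw [cpow_conj _ _ (by rw [arg_ofReal_of_nonneg hx.le]; exact Real.pi_pos.ne), conj_ofReal]
  rw [horizonForm, horizonForm, ← integral_conj]
  refine setIntegral_congr_fun measurableSet_Ioi fun x (hx : 0 < x) => ?_
  simp only [iteratedDeriv_conj, map_mul]
  rw [h2 _ hx, ← ofReal_add, h2 _ (by positivity), map_add, map_sub, h1, conj_ofReal]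

lemma exists_horizonForm_ne_zero (hd : 0 < d) (hrp : 0 ≤ rp) (κ : ℂ) (hB : 2 * l = N + B) :
    ∃ φ : radialTest (Ioi 0), horizonForm rp d κ l N φ ≠ 0 := by
  by_contra! h
  refine lt_irrefl (2 * l - N + 1) (horizonForm_weight (κ := κ) hd hrp hB (k := 0) le_rfl (C := 0) (c := 1) one_ne_zero
    fun φ hφ => ?_)
  rw [h ⟨φ, hφ⟩]
  simp

lemma iKappa_re (M a m : ℝ) : (iKappa M a m).re = 0 := by simp [iKappa]

lemma rPlus_nonneg (ha : |a| < M) : 0 ≤ rPlus M a := by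
  have := gap_pos ha
  have := rMinus_nonneg ha
  rw [gap] at *
  linarith

lemma exists_uStarModeConj_eq (ha : |a| < M) (hf : IsSpinHarmonic n l m f) (hA : (A : ℝ) = l + spin n)
    (hB : (B : ℝ) = l - spin n) : ∃ C : ℂ, C ≠ 0 ∧ ∀ w : testSections n (Ioi 0),
      uStarModeConj M a n l m f w = C * horizonForm (rPlus M a) (gap M a) (iKappa M a m) l A (modeCoeff w f) := by
  obtain ⟨C, hC0, hC⟩ := exists_uStarRadial_eq (m := m) (gap_pos ha) hA hB
  refine ⟨conj C, by simpa using hC0, fun w => ?_⟩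
  have h1 : (fun r => areaIntegral fun ζ => f.1 ζ * conj ((w : SpacePair).1 (r, ζ))) =
      fun r => conj (modeCoeff w f r) := funext fun r => by
    simp only [modeCoeff, sphereInner, areaIntegral]
    rw [← integral_conj]
    simp only [map_mul, conj_conj, conj_ofReal, mul_comm (f.1 _)]
  rw [uStarModeConj, h1, hC _ (radialTest.conj (modeCoeff_mem w.2 hf.isSmoothSection)),
    horizonForm_conj (gap_pos ha) (iKappa_re M a m), map_mul, conj_conj]

/-- The kernel of the adjoint as a vector space. -/
def adjointKernelSubmodule (M a : ℝ) (n : ℤ) (ε k q : ℝ) : Submodule ℂ (TestForm n (Ioi 0)) where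
  carrier := adjointKernel M a n ε k q
  add_mem' := fun ⟨⟨h1, h2⟩, h3⟩ ⟨⟨h1', h2'⟩, h3'⟩ => ⟨⟨h1.add h1', fun w hw => by
    rw [Pi.add_apply, h2 w hw, h2' w hw, add_zero]⟩, fun w w' h => by
    rw [Pi.add_apply, h3 w w' h, h3' w w' h, add_zero]⟩
  zero_mem' := ⟨⟨memHb_zero _ _, fun _ _ => rfl⟩, fun _ _ _ => rfl⟩
  smul_mem' := fun c _ ⟨⟨h1, h2⟩, h3⟩ => ⟨⟨h1.smul c, fun w hw => by
    rw [Pi.smul_apply, h2 w hw, smul_zero]⟩, fun w w' h => by rw [Pi.smul_apply, h3 w w' h, smul_zero]⟩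

lemma uStarModeConj_mem_adjointKernel (ha : |a| < M) (hε : 0 < ε) (hm : IsMode n l m)
    (hf : IsSpinHarmonic n l m f) {δ : ℝ} (hδ : 0 < δ) (hl : l < 1 / 2 + spin n + q) :
    uStarModeConj M a n l m f ∈ adjointKernelSubmodule M a n ε (-spin n + 1 / 2 - δ) (-q) := by
  obtain ⟨A, B, i, hA, hB, -⟩ := hm.exists_nat
  obtain ⟨C, -, hC⟩ := exists_uStarModeConj_eq ha hf hA hB
  have hd := gap_pos ha
  have hκ := iKappa_re M a m
  set L := (horizonLM (Ioi 0) (rPlus M a) hd hκ hm.nonneg A).comp (coeffTest hf.isSmoothSection)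
  have e : uStarModeConj M a n l m f = C • (L : TestForm n (Ioi 0)) := funext hC
  rw [e]
  refine Submodule.smul_mem _ C ⟨⟨?_, fun w hw => ?_⟩, fun w w' h => ?_⟩
  · obtain ⟨D, hD⟩ := exists_bound_horizonForm (p := 3 - (-q + 3 / 2)) hd
      (by rw [gap, sub_sub_cancel]; exact rMinus_nonneg ha) hκ hm.nonneg hA hm.eigenvalue_nonneg hδ
      (by rw [hA]; linarith)
    exact memHb_of_mode hm hf L.isLinear fun w => hD _ (modeCoeff_mem w.2 hf.isSmoothSection)
  · have h1 := modeCoeff_mem hw hf.isSmoothSection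
    obtain ⟨-, K, hK, hKJ, h2⟩ := radialTest.iteratedDeriv h1 A
    change horizonForm _ _ _ _ _ _ = 0
    rw [horizonForm, setIntegral_congr_fun measurableSet_Ioi (g := fun _ => 0), integral_zero]
    intro x (hx : 0 < x)
    have h3 : iteratedDeriv A (modeCoeff w f) (rPlus M a + x) = 0 := h2 _ fun h => by
      have : rPlus M a + x < rPlus M a - ε := (hKJ h).1
      linarith
    exact mul_eq_zero_of_right _ (mul_eq_zero_of_right _ h3)
  · change horizonForm _ _ _ _ _ (modeCoeff w' f) = 0
    rw [h, modeCoeff_teukolsky ha hf w.2]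
    exact horizonForm_radOp hd hκ hm.nonneg (by exact_mod_cast congrArg ofReal hA)
      (modeCoeff_mem w.2 hf.isSmoothSection)

lemma adjointKernel_modePart (ha : |a| < M) (hε : 0 < ε) (hε' : rMinus M a < rPlus M a - ε)
    {Φ : TestForm n (Ioi 0)} (hΦ : Φ ∈ adjointKernel M a n ε k (-q)) (hm : IsMode n l m)
    (hf : IsSpinHarmonic n l m f) : ∃ c : ℂ, (c ≠ 0 → l < 1 / 2 + spin n + q) ∧
      ∀ w, Φ (modePart hf.isSmoothSection w) = c * uStarModeConj M a n l m f w := by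
  obtain ⟨⟨⟨hlin, D, hD⟩, hsupp⟩, hT⟩ := hΦ
  obtain ⟨A, B, i, hA, hB, -⟩ := hm.exists_nat
  obtain ⟨C, hC0, hC⟩ := exists_uStarModeConj_eq ha hf hA hB
  have hd := gap_pos ha
  have hκ := iKappa_re M a m
  have hrp : rPlus M a - gap M a = rMinus M a := by rw [gap, sub_sub_cancel]
  obtain ⟨c, hc⟩ := exists_eq_smul_horizonLM (R := rPlus M a - ε) (s := spin n) hd hκ hm.nonneg
    (by exact_mod_cast congrArg ofReal hA) (by rw [hrp]; exact rMinus_nonneg ha) (by rwa [hrp])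
    (by linarith) ((IsLinearMap.mk' Φ hlin).comp (tensorTest (Ioi 0) hf.isSmoothSection))
    (fun φ => hT (tensorTest _ hf.isSmoothSection φ) _ (teukolsky_tensor ha hf φ.2.1).symm)
    (fun φ hφ => hsupp _ (tensor_mem hφ hf.isSmoothSection))
  have hc' : ∀ φ : radialTest (Ioi 0), Φ (tensorTest _ hf.isSmoothSection φ) =
      c * horizonForm (rPlus M a) (gap M a) (iKappa M a m) l A φ := fun φ => LinearMap.congr_fun hc φ
  refine ⟨c / C, fun h => ?_, fun w => ?_⟩
  · have hc0 : c ≠ 0 := fun h0 => h (by rw [h0, zero_div])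
    have := horizonForm_weight (B := B) (C := D) (k := -k) (p := 3 - (-q + 3 / 2)) hd (rPlus_nonneg ha)
      (by rw [hA, hB]; ring) hm.eigenvalue_nonneg hc0 fun φ hφ => by
        rw [← hc' ⟨φ, hφ⟩, ← hbNormSq_tensor hm hf (-k) _ ⟨φ, hφ⟩]
        exact hD _
    rw [hA] at this
    linarith
  · rw [hC, ← mul_assoc, div_mul_cancel₀ _ hC0]
    exact hc' (coeffTest hf.isSmoothSection w)

lemma modesBelow_injective (n : ℤ) (b : ℝ) :
    Function.Injective fun p : ModesBelow n b => (⟨p.1, p.2.1⟩ : Modes n) := by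
  rintro ⟨x, hx⟩ ⟨y, hy⟩ h
  simpa using h

theorem adjointKernel_eq_span (ha : |a| < M) (hε : 0 < ε) (hε' : rMinus M a < rPlus M a - ε)
    {f : ℝ → ℝ → SpherePair} (hf : ∀ l m, IsMode n l m → IsSpinHarmonic n l m (f l m)) {δ : ℝ} (hδ : 0 < δ) :
    adjointKernel M a n ε (-spin n + 1 / 2 - δ) (-q) =
      (Submodule.span ℂ (range fun p : ModesBelow n (1 / 2 + spin n + q) =>
        uStarModeConj M a n p.1.1 p.1.2 (f p.1.1 p.1.2)) : Set (TestForm n (Ioi 0))) := by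
  refine Subset.antisymm (fun Φ hΦ => ?_) ?_
  · have := finite_modesBelow n (1 / 2 + spin n + q)
    have hfm : ∀ p : Modes n, IsSpinHarmonic n p.1.1 p.1.2 (f p.1.1 p.1.2) := fun p => hf _ _ p.2
    choose c hc hcΦ using fun p : Modes n => adjointKernel_modePart ha hε hε' hΦ p.2 (hfm p)
    refine mem_span_of_hasSum (ι' := Modes n) (modesBelow_injective n _) (hΦ.1.1.hasSum hfm) (fun p hp => ?_)
      fun p => ⟨c ⟨p.1, p.2.1⟩, funext fun w => hcΦ _ w⟩
    have h0 : c p = 0 := by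
      by_contra h
      exact hp ⟨⟨p.1, p.2, hc p h⟩, rfl⟩
    funext w
    rw [hcΦ, h0, zero_mul, Pi.zero_apply]
  · refine Submodule.span_le (p := adjointKernelSubmodule M a n ε (-spin n + 1 / 2 - δ) (-q)).2 ?_
    rintro _ ⟨p, rfl⟩
    exact uStarModeConj_mem_adjointKernel ha hε p.2.1 (hf _ _ p.2.1) hδ p.2.2

theorem linearIndependent_uStarModeConj (ha : |a| < M) {b : ℝ} {f : ℝ → ℝ → SpherePair}
    (hf : ∀ l m, IsMode n l m → IsSpinHarmonic n l m (f l m)) : LinearIndependent ℂ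
      fun p : ModesBelow n b => uStarModeConj M a n p.1.1 p.1.2 (f p.1.1 p.1.2) := by
  refine linearIndependent_of_exists fun p => ?_
  have hfp := hf _ _ p.2.1
  obtain ⟨A, B, i, hA, hB, -⟩ := p.2.1.exists_nat
  obtain ⟨C, hC0, hC⟩ := exists_uStarModeConj_eq ha hfp hA hB
  obtain ⟨φ, hφ⟩ := exists_horizonForm_ne_zero (B := B) (gap_pos ha) (rPlus_nonneg ha) (iKappa M a p.1.2)
    (show 2 * p.1.1 = A + B by rw [hA, hB]; ring)
  refine ⟨tensorTest _ hfp.isSmoothSection φ, ?_, fun p' hp' => ?_⟩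
  · have h1 := congrArg Subtype.val (coeffTest_tensorTest_self hfp φ)
    change modeCoeff (tensorTest _ hfp.isSmoothSection φ) _ = _ at h1
    rw [hC, h1]
    exact mul_ne_zero hC0 hφ
  · obtain ⟨A', B', i', hA', hB', -⟩ := p'.2.1.exists_nat
    obtain ⟨C', -, hC'⟩ := exists_uStarModeConj_eq ha (hf _ _ p'.2.1) hA' hB'
    have h1 := congrArg Subtype.val (coeffTest_tensorTest_of_ne (hf _ _ p'.2.1) hfp p'.2.1.nonneg p.2.1.nonneg
      (fun h => hp' (Subtype.ext h)) φ)
    change modeCoeff (tensorTest _ hfp.isSmoothSection φ) _ = _ at h1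
    rw [hC', h1]
    have := horizonForm_smul (rp := rPlus M a) (d := gap M a) (κ := iKappa M a p'.1.2) (l := p'.1.1) (N := A') 0 0
    rw [zero_smul, zero_mul] at this
    exact mul_eq_zero_of_right _ this

end

/-! ## The kernel -/

section
variable {n : ℤ} {l m M a ε q k : ℝ} {J : Set ℝ} {N A B : ℕ} {f : SpherePair}

/-- Multiplication of radial test functions by a smooth function. -/
def mulTest (J : Set ℝ) {c : ℝ → ℂ} (hc : ContDiffOn ℝ ∞ c (Ioi 0)) : radialTest J →ₗ[ℂ] radialTest J where
  toFun φ := ⟨fun r => c r * (φ : ℝ → ℂ) r, radialTest.mul isOpen_Ioi hc inter_subset_right φ.2⟩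
  map_add' _ _ := Subtype.ext (funext fun _ => mul_add _ _ _)
  map_smul' _ _ := Subtype.ext (funext fun _ => mul_left_comm _ _ _)

lemma contDiffOn_sq : ContDiffOn ℝ ∞ (fun r : ℝ => (r : ℂ) ^ 2) (Ioi 0) :=
  (ofRealCLM.contDiff.pow 2).contDiffOn

lemma contDiffOn_inv_sq : ContDiffOn ℝ ∞ (fun r : ℝ => ((r : ℂ) ^ 2)⁻¹) (Ioi 0) :=
  contDiffOn_sq.inv fun _ hr => pow_ne_zero 2 (ofReal_ne_zero.2 (ne_of_gt hr))

lemma sq_mul_inv_sq_mul {φ : ℝ → ℂ} (hφ : φ ∈ radialTest J) (r : ℝ) :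
    (r : ℂ) ^ 2 * (((r : ℂ) ^ 2)⁻¹ * φ r) = φ r := by
  rcases eq_or_ne r 0 with rfl | hr
  · obtain ⟨-, K, -, hKJ, h⟩ := hφ
    rw [h 0 fun h0 => lt_irrefl (0 : ℝ) (hKJ h0).2]
    simp
  · rw [mul_inv_cancel_left₀ (pow_ne_zero 2 (ofReal_ne_zero.2 hr))]

lemma mellin_inv_sq_mul (φ : ℝ → ℂ) (s : ℂ) :
    mellin (fun r => ((r : ℂ) ^ 2)⁻¹ * φ r) s = mellin φ (s - 2) := by
  rw [mellin_eq, mellin_eq]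
  refine setIntegral_congr_fun measurableSet_Ioi fun r (hr : 0 < r) => ?_
  have h0 : (r : ℂ) ≠ 0 := ofReal_ne_zero.2 hr.ne'
  rw [show s - 2 - 1 = s - 1 - 2 by ring, cpow_sub (s - 1) 2 h0, cpow_ofNat]
  ring

lemma rSq_tensor {φ : ℝ → ℂ} (hφ : φ ∈ radialTest J) (g : SpherePair) :
    rSq (tensor (fun r => ((r : ℂ) ^ 2)⁻¹ * φ r) g) = tensor φ g := by
  refine Prod.ext (funext fun p => ?_) (funext fun p => ?_) <;>
  · simp only [rSq, tensor]
    rw [← mul_assoc, sq_mul_inv_sq_mul hφ]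

lemma exists_uMode_eq (ha : |a| < M) (hε' : rMinus M a < rPlus M a - ε) (hf : IsSmoothSection (-n) (conjPair f))
    (hA : (A : ℝ) = l + spin n) (hB : (B : ℝ) = l - spin n) : ∃ U : Polynomial ℂ, U ≠ 0 ∧
      polyT (gap M a) (iKappa M a m) l (spin n) U = 0 ∧ ∀ η, uMode M a n ε l m f η =
        polyLM (rPlus M a - ε) (rPlus M a) U (mulTest _ contDiffOn_sq (coeffTest hf η)) := by
  obtain ⟨U, hU0, hU, hr⟩ := exists_uRadial_eq (m := m) (gap_pos ha) hA hB
  refine ⟨U, hU0, hU, fun η => setIntegral_congr_fun measurableSet_Ioi fun r hR => ?_⟩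
  have e : areaIntegral (fun ζ => f.1 ζ * (η : SpacePair).1 (r, ζ)) = modeCoeff η (conjPair f) r := by
    simp only [modeCoeff, sphereInner, conjPair, conj_conj, mul_comm (f.1 _)]
  change _ = U.eval _ * ((r : ℂ) ^ 2 * modeCoeff η (conjPair f) r)
  simp only [e, hr r (hε'.trans hR)]
  ring

lemma MemExtendible.add {R : ℝ} {Φ Φ' : TestForm n (Ioi R)} (h : MemExtendible n k q R Φ)
    (h' : MemExtendible n k q R Φ') : MemExtendible n k q R (Φ + Φ') := by
  obtain ⟨Ψ, h1, ⟨c, hc, h2⟩, h3⟩ := h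
  obtain ⟨Ψ', h1', ⟨c', hc', h2'⟩, h3'⟩ := h'
  refine ⟨Ψ + Ψ', h1.add h1', ⟨min c c', lt_min hc hc', fun w hw => ?_⟩, fun w w' hw => ?_⟩
  · rw [Pi.add_apply, h2 w (testSections_mono n (Iio_subset_Iio (min_le_left _ _)) hw),
      h2' w (testSections_mono n (Iio_subset_Iio (min_le_right _ _)) hw), add_zero]
  · rw [Pi.add_apply, Pi.add_apply, h3 w w' hw, h3' w w' hw]

lemma MemExtendible.smul {R : ℝ} {Φ : TestForm n (Ioi R)} (h : MemExtendible n k q R Φ) (b : ℂ) :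
    MemExtendible n k q R (b • Φ) := by
  obtain ⟨Ψ, h1, ⟨c, hc, h2⟩, h3⟩ := h
  exact ⟨b • Ψ, h1.smul b, ⟨c, hc, fun w hw => by rw [Pi.smul_apply, h2 w hw, smul_zero]⟩,
    fun w w' hw => by rw [Pi.smul_apply, Pi.smul_apply, h3 w w' hw]⟩

/-- The kernel as a vector space. -/
def kernelSubmodule (M a : ℝ) (n : ℤ) (ε k q : ℝ) :
    Submodule ℂ (TestForm (-n) (Ioi (rPlus M a - ε))) where
  carrier := kernel M a n ε k q
  add_mem' := fun ⟨h1, h3⟩ ⟨h1', h3'⟩ => ⟨h1.add h1', fun η ψ h => by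
    rw [Pi.add_apply, h3 η ψ h, h3' η ψ h, add_zero]⟩
  zero_mem' := ⟨⟨0, memHb_zero _ _, ⟨1, one_pos, fun _ _ => rfl⟩, fun _ _ _ => rfl⟩, fun _ _ _ => rfl⟩
  smul_mem' := fun c _ ⟨h1, h3⟩ => ⟨h1.smul c, fun η ψ h => by rw [Pi.smul_apply, h3 η ψ h, smul_zero]⟩

lemma spin_neg_ofReal (n : ℤ) : (spin (-n) : ℂ) = -(spin n : ℂ) := by rw [spin_neg, ofReal_neg]

lemma uMode_mem_kernel (ha : |a| < M) (hε' : rMinus M a < rPlus M a - ε)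
    (hm : IsMode n l m) (hf : IsSpinHarmonic n l m f) (hl : l < -(3 / 2) - spin n - q) :
    uMode M a n ε l m f ∈ kernelSubmodule M a n ε (spin n + 1 / 2) q := by
  obtain ⟨A, B, i, hA, hB, -⟩ := hm.exists_nat
  have hg := hf.conj
  have hgs := hg.isSmoothSection
  obtain ⟨U, hU0, hU, huU⟩ := exists_uMode_eq (ε := ε) (m := m) ha hε' hgs hA hB
  have hR : 0 < rPlus M a - ε := (rMinus_nonneg ha).trans_lt hε'
  set R := rPlus M a - ε with hRdef
  set P : Polynomial ℂ := U * (Polynomial.X + Polynomial.C (rPlus M a : ℂ)) ^ 2 with hP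
  have hPr : ∀ r : ℝ, P.eval ((r : ℂ) - rPlus M a) = U.eval ((r : ℂ) - rPlus M a) * (r : ℂ) ^ 2 := fun r => by
    simp [hP]
  have hdeg : P.natDegree ≤ A + 2 := by
    refine Polynomial.natDegree_mul_le.trans ?_
    rw [natDegree_of_polyT_eq_zero (N := A) (B := B) (by exact_mod_cast congrArg ofReal hA)
      (by exact_mod_cast congrArg ofReal hB) hU hU0]
    gcongr
    refine (Polynomial.natDegree_pow_le).trans ?_
    rw [Polynomial.natDegree_X_add_C]
  have hRm : R / 2 < R := by linarith
  obtain ⟨D, hD⟩ := exists_bound_polynomial (half_pos hR) hRm (rPlus M a) (spin n + 1 / 2) P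
    (isMode_neg hm).eigenvalue_nonneg (p := 3 - (q + 3 / 2)) (by
      have : (P.natDegree : ℝ) ≤ A + 2 := by exact_mod_cast hdeg
      linarith)
  set L := densityLM 0 ((contDiff_stepUp (R / 2) R).mul (contDiff_eval P (rPlus M a)))
  refine ⟨⟨L.comp (coeffTest hgs), ?_, ⟨R / 2, half_pos hR, fun w hw => ?_⟩, fun w w' hw => ?_⟩, fun η ψ h => ?_⟩
  · exact memHb_of_mode (isMode_neg hm) hg (L.comp (coeffTest hgs)).isLinear
      fun w => hD _ (modeCoeff_mem w.2 hgs)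
  · obtain ⟨-, K, -, hKJ, h0⟩ := modeCoeff_mem hw hgs
    refine (setIntegral_congr_fun (g := fun _ => 0) measurableSet_Ioi fun r hr => ?_).trans (integral_zero _ _)
    change stepUp (R / 2) R r * _ * modeCoeff w (conjPair f) r = 0
    rcases le_or_gt (R / 2) r with h | h
    · rw [h0 r fun hK => not_lt.2 h (hKJ hK).1, mul_zero]
    · rw [stepUp_of_le hRm h.le, zero_mul, zero_mul]
  · obtain ⟨-, K, -, hKJ, h0⟩ := modeCoeff_mem w.2 hgs
    rw [huU]
    have h1 : ∫ r in Ioi (0 : ℝ), stepUp (R / 2) R r * P.eval ((r : ℂ) - rPlus M a) * modeCoeff w (conjPair f) r =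
        ∫ r in Ioi R, stepUp (R / 2) R r * P.eval ((r : ℂ) - rPlus M a) * modeCoeff w (conjPair f) r := by
      refine (setIntegral_eq_of_subset_of_forall_sdiff_eq_zero measurableSet_Ioi (Ioi_subset_Ioi hR.le)
        fun r hr => ?_)
      rw [h0 r fun hK => hr.2 (hKJ hK).1, mul_zero]
    rw [show (⇑(L.comp (coeffTest hgs)) : TestForm (-n) (Ioi 0)) w' = ∫ r in Ioi (0 : ℝ), stepUp (R / 2) R r *
      P.eval ((r : ℂ) - rPlus M a) * modeCoeff (w' : SpacePair) (conjPair f) r from rfl, ← hw, h1]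
    refine setIntegral_congr_fun measurableSet_Ioi fun r (hr : R < r) => ?_
    change _ * ((r : ℂ) ^ 2 * modeCoeff w (conjPair f) r) = _
    rw [stepUp_of_ge hRm hr.le, hPr]
    ring
  · have hη : rSq (η : SpacePair) ∈ testSections (-n) (Ioi R) :=
      radialMul_mem isOpen_Ioi contDiffOn_sq inter_subset_right η.2
    have hc := modeCoeff_mem hη hgs
    have e : mulTest _ contDiffOn_sq (coeffTest hgs ψ) =
        ⟨radOp (rPlus M a) (gap M a) (-iKappa M a m) l (-spin n) (modeCoeff (rSq η) (conjPair f)),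
          radOp_mem hc⟩ := by
      have h1 := modeCoeff_teukolsky ha hg hη
      rw [iKappa_neg, spin_neg_ofReal, ← h] at h1
      exact Subtype.ext ((funext fun r => (modeCoeff_radialMul (fun r => (r : ℂ) ^ 2) _ _ r).symm).trans h1)
    have h1 := polyLM_radOp (R := R) (rp := rPlus M a) (d := gap M a) (κ := iKappa M a m) (l := l) (s := spin n) U
      ⟨_, hc⟩
    rw [huU, e, h1, hU]
    simp [polyLM, densityLM]

lemma kernel_modePart (ha : |a| < M) (hε : 0 < ε) (hε' : rMinus M a < rPlus M a - ε)
    {u : TestForm (-n) (Ioi (rPlus M a - ε))} (hu : u ∈ kernel M a n ε (spin n + 1 / 2) q) (hm : IsMode n l m)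
    (hf : IsSpinHarmonic n l m f) : ∃ c : ℂ, (c ≠ 0 → l < -(3 / 2) - spin n - q) ∧
      ∀ w, u (modePart hf.conj.isSmoothSection w) = c * uMode M a n ε l m f w := by
  obtain ⟨⟨Ψ, ⟨hlin, D, hD⟩, -, huΨ⟩, hT⟩ := hu
  obtain ⟨A, B, i, hA, hB, -⟩ := hm.exists_nat
  have hg := hf.conj
  have hgs := hg.isSmoothSection
  obtain ⟨U, hU0, hU, huU⟩ := exists_uMode_eq (ε := ε) (m := m) ha hε' hgs hA hB
  have hR : 0 < rPlus M a - ε := (rMinus_nonneg ha).trans_lt hε'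
  have hrp : rPlus M a - gap M a = rMinus M a := by rw [gap, sub_sub_cancel]
  set V : radialTest (Ioi (rPlus M a - ε)) →ₗ[ℂ] ℂ := (IsLinearMap.mk' Ψ hlin).comp ((Submodule.inclusion
    (testSections_le (-n) (Ioi (rPlus M a - ε)))).comp ((tensorTest (Ioi (rPlus M a - ε)) hgs).comp (mulTest _ contDiffOn_inv_sq)))
  have hV : ∀ φ, V φ = u (tensorTest (Ioi (rPlus M a - ε)) hgs (mulTest _ contDiffOn_inv_sq φ)) := fun φ =>
    (huΨ _ _ rfl).symm
  have hVb : ∀ φ : radialTest (Ioi (rPlus M a - ε)), ENNReal.ofReal (‖V φ‖ ^ 2) ≤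
      D * 𝓜²((φ : ℝ → ℂ), eigenvalue (-n) l, -(spin n + 1 / 2), (-1 / 2 - q : ℝ)) := fun φ => by
    refine (hD _).trans (le_of_eq ?_)
    have h1 := hbNormSq_tensor (isMode_neg hm) hg (-(spin n + 1 / 2)) (3 - (q + 3 / 2))
      (mulTest _ contDiffOn_inv_sq φ)
    refine congrArg _ (h1.trans (lintegral_congr fun lam => ?_))
    have h2 := mellin_inv_sq_mul φ ((3 - (q + 3 / 2) : ℝ) + lam * I)
    rw [show ((3 - (q + 3 / 2) : ℝ) : ℂ) + lam * I - 2 = (-1 / 2 - q : ℝ) + lam * I by push_cast; ring] at h2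
    rw [← h2]
    rfl
  obtain ⟨c, hc⟩ := exists_eq_smul_polyLM (d := gap M a) hR.le (by rwa [hrp]) (by linarith)
    (iKappa_re M a m) hm.nonneg hA hB (isMode_neg hm).eigenvalue_nonneg V hVb (fun φ => by
      rw [hV]
      refine hT (tensorTest _ hgs (mulTest _ contDiffOn_inv_sq φ)) _ ?_
      have h1 := teukolsky_tensor ha hg φ.2.1
      rw [iKappa_neg, spin_neg_ofReal] at h1
      refine (rSq_tensor (radOp_mem φ.2) (conjPair f)).trans (h1.symm.trans ?_)
      exact congrArg _ (rSq_tensor φ.2 (conjPair f)).symm) hU hU0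
  refine ⟨c, fun h => ?_, fun w => ?_⟩
  · have h1 := natDegree_of_polyT_eq_zero (d := gap M a) (κ := iKappa M a m) (l := l) (s := spin n) (N := A) (B := B)
      (U := c • U)
      (by exact_mod_cast congrArg ofReal hA) (by exact_mod_cast congrArg ofReal hB)
      (by rw [polyT_smul, hU, smul_zero]) (smul_ne_zero h hU0)
    have h2 := polynomial_weight (rp := rPlus M a) (R := rPlus M a - ε) (smul_ne_zero h hU0)
      (isMode_neg hm).eigenvalue_nonneg fun φ hφ => by
        have h3 := hVb ⟨φ, hφ⟩
        rw [hc, ← polyLM_smul] at h3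
        exact h3
    rw [h1, hA] at h2
    linarith
  · rw [huU]
    have h1 := LinearMap.congr_fun hc (mulTest _ contDiffOn_sq (coeffTest hgs w))
    rw [hV, LinearMap.smul_apply, smul_eq_mul] at h1
    rw [← h1]
    refine congrArg u (congrArg (tensorTest (Ioi (rPlus M a - ε)) hgs) (Subtype.ext (funext fun r => ?_)))
    change modeCoeff w (conjPair f) r = ((r : ℂ) ^ 2)⁻¹ * ((r : ℂ) ^ 2 * modeCoeff w (conjPair f) r)
    rw [mul_left_comm, sq_mul_inv_sq_mul (modeCoeff_mem w.2 hgs)]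

theorem kernel_eq_span (ha : |a| < M) (hε : 0 < ε) (hε' : rMinus M a < rPlus M a - ε)
    {f : ℝ → ℝ → SpherePair} (hf : ∀ l m, IsMode n l m → IsSpinHarmonic n l m (f l m)) :
    kernel M a n ε (spin n + 1 / 2) q =
      (Submodule.span ℂ (range fun p : ModesBelow n (-(3 / 2) - spin n - q) =>
        uMode M a n ε p.1.1 p.1.2 (f p.1.1 p.1.2)) : Set (TestForm (-n) (Ioi (rPlus M a - ε)))) := by
  refine Subset.antisymm (fun u hu => ?_) ?_
  · have := finite_modesBelow n (-(3 / 2) - spin n - q)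
    have hm : ∀ p : Modes (-n), IsMode n p.1.1 (-p.1.2) := fun p => by simpa using isMode_neg p.2
    have hfm : ∀ p : Modes (-n), IsSpinHarmonic (-n) p.1.1 p.1.2 (conjPair (f p.1.1 (-p.1.2))) := fun p => by
      simpa using (hf _ _ (hm p)).conj
    choose c hc hcu using fun p : Modes (-n) => kernel_modePart ha hε hε' hu (hm p) (hf _ _ (hm p))
    have hsum : ∀ w, HasSum (fun p => u (modePart (hfm p).isSmoothSection w)) (u w) := fun w => by
      obtain ⟨⟨Ψ, hΨ, -, huΨ⟩, -⟩ := hu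
      rw [huΨ w (Submodule.inclusion (testSections_le _ _) w) rfl]
      refine (hΨ.hasSum hfm _).congr_fun fun p => ?_
      exact huΨ _ _ rfl
    refine mem_span_of_hasSum (ι' := Modes (-n)) (g := fun p => ⟨(p.1.1, -p.1.2), isMode_neg p.2.1⟩)
      (fun p p' h => ?_) hsum (fun p hp => ?_) fun p => ⟨c ⟨(p.1.1, -p.1.2), isMode_neg p.2.1⟩, ?_⟩
    · have h1 := Subtype.ext_iff.1 h
      simp only [Prod.mk.injEq, neg_inj] at h1
      exact Subtype.ext (Prod.ext h1.1 h1.2)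
    · have h0 : c p = 0 := by
        by_contra h
        exact hp ⟨⟨(p.1.1, -p.1.2), hm p, hc p h⟩, Subtype.ext (Prod.ext rfl (neg_neg _))⟩
      funext w
      rw [hcu, h0, zero_mul, Pi.zero_apply]
    · funext w
      rw [hcu, Pi.smul_apply, smul_eq_mul, neg_neg]
  · refine Submodule.span_le (p := kernelSubmodule M a n ε (spin n + 1 / 2) q).2 ?_
    rintro _ ⟨p, rfl⟩
    exact uMode_mem_kernel ha hε' p.2.1 (hf _ _ p.2.1) p.2.2

theorem linearIndependent_uMode (ha : |a| < M) (hε' : rMinus M a < rPlus M a - ε) {b : ℝ}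
    {f : ℝ → ℝ → SpherePair} (hf : ∀ l m, IsMode n l m → IsSpinHarmonic n l m (f l m)) :
    LinearIndependent ℂ fun p : ModesBelow n b => uMode M a n ε p.1.1 p.1.2 (f p.1.1 p.1.2) := by
  refine linearIndependent_of_exists fun p => ?_
  have hg := (hf _ _ p.2.1).conj
  obtain ⟨A, B, i, hA, hB, -⟩ := p.2.1.exists_nat
  obtain ⟨U, hU0, -, huU⟩ := exists_uMode_eq (ε := ε) (m := p.1.2) ha hε' hg.isSmoothSection hA hB
  have hR : 0 < rPlus M a - ε := (rMinus_nonneg ha).trans_lt hε'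
  obtain ⟨φ, hφ⟩ : ∃ φ, polyLM (rPlus M a - ε) (rPlus M a) U φ ≠ 0 := by
    by_contra! h
    exact hU0 (eq_zero_of_polyLM_eq_zero (rp := rPlus M a) hR.le (LinearMap.ext h))
  refine ⟨tensorTest _ hg.isSmoothSection (mulTest _ contDiffOn_inv_sq φ), ?_, fun p' hp' => ?_⟩
  · rw [huU, coeffTest_tensorTest_self hg]
    convert hφ
    exact Subtype.ext (funext fun r => sq_mul_inv_sq_mul φ.2 r)
  · obtain ⟨A', B', i', hA', hB', -⟩ := p'.2.1.exists_nat
    have hg' := (hf _ _ p'.2.1).conj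
    obtain ⟨U', -, -, huU'⟩ := exists_uMode_eq (ε := ε) (m := p'.1.2) ha hε' hg'.isSmoothSection hA' hB'
    rw [huU', coeffTest_tensorTest_of_ne hg' hg p'.2.1.nonneg p.2.1.nonneg, map_zero, map_zero]
    intro h
    simp only [Prod.mk.injEq, neg_inj] at h
    exact hp' (Subtype.ext (Prod.ext h.1 h.2))

end

end KerrTeukolsky

end

theorem mainTheorem8 (M a ε q : ℝ) (n : ℤ) (ha : |a| < M) (hε : 0 < ε)
    (hε' : KerrTeukolsky.rMinus M a < KerrTeukolsky.rPlus M a - ε) :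
    (∃ f : ℝ → ℝ → KerrTeukolsky.SpherePair,
      ∀ l m, KerrTeukolsky.IsMode n l m → KerrTeukolsky.IsSpinHarmonic n l m (f l m)) ∧
    ∀ f : ℝ → ℝ → KerrTeukolsky.SpherePair,
      (∀ l m, KerrTeukolsky.IsMode n l m → KerrTeukolsky.IsSpinHarmonic n l m (f l m)) →
      (KerrTeukolsky.kernel M a n ε (KerrTeukolsky.spin n + 1 / 2) q =
          (Submodule.span ℂ (Set.range
            (fun p : KerrTeukolsky.ModesBelow n (-(3 / 2) - KerrTeukolsky.spin n - q) =>
              KerrTeukolsky.uMode M a n ε p.1.1 p.1.2 (f p.1.1 p.1.2))) : Set _) ∧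
        LinearIndependent ℂ
          (fun p : KerrTeukolsky.ModesBelow n (-(3 / 2) - KerrTeukolsky.spin n - q) =>
            KerrTeukolsky.uMode M a n ε p.1.1 p.1.2 (f p.1.1 p.1.2))) ∧
      ((∀ δ : ℝ, 0 < δ →
          KerrTeukolsky.adjointKernel M a n ε (-KerrTeukolsky.spin n + 1 / 2 - δ) (-q) =
            (Submodule.span ℂ (Set.range
              (fun p : KerrTeukolsky.ModesBelow n (1 / 2 + KerrTeukolsky.spin n + q) =>
                KerrTeukolsky.uStarModeConj M a n p.1.1 p.1.2 (f p.1.1 p.1.2))) : Set _)) ∧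
        LinearIndependent ℂ
          (fun p : KerrTeukolsky.ModesBelow n (1 / 2 + KerrTeukolsky.spin n + q) =>
            KerrTeukolsky.uStarModeConj M a n p.1.1 p.1.2 (f p.1.1 p.1.2))) := by
  refine ⟨?_, fun f hf => ⟨⟨KerrTeukolsky.kernel_eq_span ha hε hε' hf,
    KerrTeukolsky.linearIndependent_uMode ha hε' hf⟩,
    fun δ hδ => KerrTeukolsky.adjointKernel_eq_span ha hε hε' hf hδ,
    KerrTeukolsky.linearIndependent_uStarModeConj ha hf⟩⟩
  choose! f hf using fun (l m : ℝ) (h : KerrTeukolsky.IsMode n l m) => KerrTeukolsky.exists_isSpinHarmonic h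
  exact ⟨f, hf⟩
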